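/- **Conventions.** All objects are smooth. For multivector fields $X,Y$ of tensor degrees $r,s$ on a manifold, $i(X)$ is contraction with $i(X\wedge Y)=i(Y)\,i(X)$, $[X,Y]$ is the Schouten bracket, normalized by $[X,Y\wedge Z]=[X,Y]\wedge Z+(-1)^{(r-1)s}\,Y\wedge[X,Z]$, $[Y,X]=-(-1)^{(r-1)(s-1)}[X,Y]$ and by being the Lie bracket on vector fields, and $L_X=d\,i(X)-(-1)^r i(X)\,d$. An exact multisymplectic manifold is a finite-dimensional manifold without boundary with an $n$-form $\theta$ such that $\omega=-d\theta$ is non-degenerate on tangent vectors, and a vector field $\Sigma$ with $i(\Sigma)\omega=-\theta$. On it, an $(n-r)$-form $f$, $r\ge 1$, is Hamiltonian with Hamiltonian $r$-vector field $X_f$ if $i(X_f)\omega=df$ (forms of negative degree are $0$); it is a Poisson form if, in addition, $i(Y)\omega=0$ implies $i(Y)f=0$ for all multivector fields $Y$. An $r$-vector field $X$ is exact Hamiltonian if $L_X\theta=0$; then $J(X)=(-1)^{r-1}i(X)\theta$. For Poisson forms $f,g$ with Hamiltonian multivector fields $X_f,X_g$ of degrees $r,s$, put $$\{f,g\}=-L_{X_f}g+(-1)^{(r-1)(s-1)}L_{X_g}f-(-1)^{(r-1)s}L_{X_f\wedge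 X_g}\theta .$$ **Proposition.** (A) Let $f,g,h$ be Poisson forms on an exact multisymplectic manifold, with Hamiltonian multivector fields $X_f,X_g,X_h$ of degrees $r,s,t\ge1$. Then: 1. $\{f,g\}$ does not depend on the choice of $X_f$ and $X_g$. 2. $[X_g,X_f]$ is a Hamiltonian $(r+s-1)$-vector field of $\{f,g\}$. 3. $\{f,g\}$ is a Poisson form. 4. $\{f,g\}=-(-1)^{(r-1)(s-1)}\{g,f\}$. 5. $(-1)^{(r-1)(t-1)}\{f,\{g,h\}\}+(-1)^{(s-1)(r-1)}\{g,\{h,f\}\}+(-1)^{(t-1)(s-1)}\{h,\{f,g\}\}=0$. 6. If $X,Y$ are exact Hamiltonian multivector fields of degrees $r,s\ge1$, then $J(X),J(Y)$ are Poisson forms with Hamiltonian multivector fields $X,Y$, $[Y,X]$ is exact Hamiltonian, and $\{J(X),J(Y)\}=J([Y,X])$. (B) Let $\pi:\mathcal E\to\mathcal M$ be a fibre bundle or, more generally, a fibred manifold (its charts being fibred over charts of $\mathcal M$), with $\mathcal M,\mathcal E$ Hausdorff, $\sigma$-compact, and $n=\dim\mathcal M\ge1$. The extended multiphase space $\mathcal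 P$, the bundle over $\mathcal E$ of the $n$-forms on $\mathcal E$ that vanish on any two vertical vectors, is with its tautological $n$-form $\theta$ and its Euler vector field $\Sigma$ an exact multisymplectic manifold, so that (A) applies. In coordinates $(x^\mu,q^i,p_i^\mu,p)$, $\theta=p_i^\mu\,dq^i\wedge d^nx_\mu+p\,d^nx$. 7. Let $\tilde{\mathcal P}=V^*\mathcal E\otimes\Lambda^{n-1}T^*\mathcal M$ be the ordinary multiphase space, with coordinates $(x^\mu,q^i,p_i^\mu)$ and projection $\mathcal P\to\tilde{\mathcal P}$ forgetting $p$. Fix any connection on $\tilde{\mathcal P}\to\mathcal M$ (for instance one induced by connections in $\mathcal E$ and $T\mathcal M$). Let $d^V$ be the part of $d$ that raises the vertical degree by one and keeps the horizontal degree, $\theta^V=p_i^\mu\,Dq^i\wedge d^nx_\mu$ with $Dq^i$ the vertical part of $dq^i$, and $\omega^V=-d^V\theta^V$. Let $\tilde f,\tilde g$ be horizontal forms on $\tilde{\mathcal P}$ (vanishing on vectors vertical over $\mathcal M$) of degrees $n-r$, $n-s$, $1\le r,s\le n$, with multivector fields $\tilde X_{\tilde f},\tilde X_{\tilde g}$ of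 degrees $r,s$ satisfying $i(\tilde X_{\tilde f})\omega^V=d^V\tilde f$ and $i(\tilde X_{\tilde g})\omega^V=d^V\tilde g$. Then $\tilde h=(-1)^r\,i(\tilde X_{\tilde f})\,i(\tilde X_{\tilde g})\,\omega^V$ is again horizontal and satisfies $i(\tilde W)\omega^V=d^V\tilde h$ for some $(r+s-1)$-vector field $\tilde W$; the pull-backs $f,g$ of $\tilde f,\tilde g$ to $\mathcal P$ are Poisson forms (with Hamiltonian multivector fields of degrees $r,s$); and the pull-back of $\tilde h$ to $\mathcal P$ is $\{f,g\}$. -/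

import Mathlib

open Set Filter
open scoped Manifold ContDiff Topology

set_option maxSynthPendingDepth 3

noncomputable section

namespace Multisymplectic

/-! ### Pointwise algebra

A multivector is an element of the exterior algebra `ExteriorAlgebra ℝ V`; a covector of mixed
degree is a family of alternating forms, one for each degree, which is the same thing as a linear
functional on the exterior algebra. -/

theorem continuous_alternating_aux {V : Type*} [AddCommGroup V] [Module ℝ V] [TopologicalSpace V]
    [IsTopologicalAddGroup V] [ContinuousSMul ℝ V] [T2Space V] [FiniteDimensional ℝ V] {k : ℕ}
    (a : V [⋀^Fin k]→ₗ[ℝ] ℝ) : Continuous (fun v : Fin k → V => a v) := by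
  classical
  set b := Module.finBasis ℝ V
  have h : (fun v : Fin k → V => a v) = fun v =>
      ∑ i : Fin k → Fin (Module.finrank ℝ V), (∏ j, b.repr (v j) (i j)) * a (fun j => b (i j)) := by
    funext v
    conv_lhs => rw [show v = fun j => ∑ l, b.repr (v j) l • b l from
      funext fun j => (b.sum_repr (v j)).symm]
    rw [← AlternatingMap.coe_multilinearMap, MultilinearMap.map_sum]
    refine Finset.sum_congr rfl fun i _ => ?_
    rw [MultilinearMap.map_smul_univ, smul_eq_mul]
  rw [h]
  refine continuous_finsetSum _ fun i _ => (continuous_finsetProd _ fun j _ => ?_).mul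
    continuous_const
  have : Continuous (b.coord (i j)) := LinearMap.continuous_of_finiteDimensional _
  exact this.comp (continuous_apply j)

section Pointwise

variable {V : Type*} [AddCommGroup V] [Module ℝ V] [TopologicalSpace V]

/-- Covectors of mixed degree: a family `α k` of alternating `k`-forms. -/
abbrev Covector (V : Type*) [AddCommGroup V] [Module ℝ V] [TopologicalSpace V] : Type _ :=
  ∀ k : ℕ, V [⋀^Fin k]→L[ℝ] ℝ

/-- The linear functional `v₁ ∧ … ∧ vₖ ↦ α k (v₁, …, vₖ)` on the exterior algebra. -/
def Covector.pairing (α : Covector V) : ExteriorAlgebra ℝ V →ₗ[ℝ] ℝ :=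
  ExteriorAlgebra.liftAlternating fun k => (α k).toAlternatingMap

variable [IsTopologicalAddGroup V] [ContinuousSMul ℝ V] [T2Space V] [FiniteDimensional ℝ V]

/-- The family of alternating forms given by a linear functional on the exterior algebra. -/
def Covector.ofPairing (l : ExteriorAlgebra ℝ V →ₗ[ℝ] ℝ) : Covector V := fun k =>
  { (l.compAlternatingMap (ExteriorAlgebra.ιMulti ℝ k)) with
    cont := continuous_alternating_aux (l.compAlternatingMap (ExteriorAlgebra.ιMulti ℝ k)) }

theorem Covector.pairing_ofPairing (l : ExteriorAlgebra ℝ V →ₗ[ℝ] ℝ) :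
    (Covector.ofPairing l).pairing = l := by
  have : (fun k => ((Covector.ofPairing l) k).toAlternatingMap)
    = fun k => l.compAlternatingMap (ExteriorAlgebra.ιMulti ℝ k) := rfl
  rw [Covector.pairing, this, ExteriorAlgebra.liftAlternating_comp,
    ExteriorAlgebra.liftAlternating_ιMulti, LinearMap.comp_id]

/-- Interior product `i(X)α`, i.e. `(i(X)α)(u) = α(X ∧ u)`; thus `i(v)α = α(v, …)` for a vector
`v`, and `i(X ∧ Y) = i(Y) i(X)`. -/
def Covector.contract (X : ExteriorAlgebra ℝ V) (α : Covector V) : Covector V :=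
  Covector.ofPairing (α.pairing ∘ₗ LinearMap.mulLeft ℝ X)

/-- The derivation of the exterior algebra that extends the endomorphism `Φ` of `V`:
`v₁ ∧ … ∧ vₖ ↦ ∑ᵢ v₁ ∧ … ∧ Φ vᵢ ∧ … ∧ vₖ`, written as `u ↦ ∑ᵢ Φ eᵢ ∧ (eⁱ ⌋ u)` in a basis. -/
def insertionDerivation (Φ : V →ₗ[ℝ] V) : ExteriorAlgebra ℝ V →ₗ[ℝ] ExteriorAlgebra ℝ V :=
  ∑ i, LinearMap.mulLeft ℝ (ExteriorAlgebra.ι ℝ (Φ (Module.finBasis ℝ V i))) ∘ₗ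
    CliffordAlgebra.contractLeft ((Module.finBasis ℝ V).coord i)

/-- Insertion of an endomorphism: `(i_Φ α)(v₁, …, vₖ) = ∑ᵢ α(v₁, …, Φ vᵢ, …, vₖ)`. -/
def Covector.insert (Φ : V →ₗ[ℝ] V) (α : Covector V) : Covector V :=
  Covector.ofPairing (α.pairing ∘ₗ insertionDerivation Φ)

end Pointwise

/-! ### Local calculus on a finite-dimensional vector space -/

section Local
variable {E : Type*} [NormedAddCommGroup E] [NormedSpace ℝ E] [FiniteDimensional ℝ E]

/-- Exterior derivative of a form of mixed degree, degree by degree. -/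
def extDerivTotal (α : E → Covector E) (x : E) : Covector E
  | 0 => 0
  | k + 1 => extDeriv (fun y => α y k) x

/-- The basis `e_{i₁} ∧ … ∧ e_{iₖ}` of the exterior algebra. -/
def mvBasis (E : Type*) [NormedAddCommGroup E] [NormedSpace ℝ E] [FiniteDimensional ℝ E] :
    Module.Basis (Finset (Fin (Module.finrank ℝ E))) ℝ (ExteriorAlgebra ℝ E) :=
  (Module.finBasis ℝ E).ExteriorAlgebra

/-- Directional derivative of a multivector field (coefficientwise). -/
def mvDeriv (X : E → ExteriorAlgebra ℝ E) (x v : E) : ExteriorAlgebra ℝ E :=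
  ∑ s, fderiv ℝ (fun y => (mvBasis E).repr (X y) s) x v • mvBasis E s

/-- The coordinate expression of the Schouten bracket,
`[X, Y] = ∑ₖ ((-1)^(r-1) (eᵏ ⌋ X) ∧ ∂ₖ Y - ∂ₖ X ∧ (eᵏ ⌋ Y))` for `X` of degree `r`
(`involute` multiplies the part of degree `r - 1` by `(-1)^(r-1)`). It is the Lie bracket on vector
fields, and satisfies `[X, Y ∧ Z] = [X, Y] ∧ Z + (-1)^((r-1)s) Y ∧ [X, Z]` and
`[Y, X] = -(-1)^((r-1)(s-1)) [X, Y]`, with `s` the degree of `Y`. -/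
def schoutenLocal (X Y : E → ExteriorAlgebra ℝ E) (x : E) : ExteriorAlgebra ℝ E :=
  ∑ k, (CliffordAlgebra.involute
        (CliffordAlgebra.contractLeft ((Module.finBasis ℝ E).coord k) (X x)) *
      mvDeriv Y x (Module.finBasis ℝ E k) -
    mvDeriv X x (Module.finBasis ℝ E k) *
      CliffordAlgebra.contractLeft ((Module.finBasis ℝ E).coord k) (Y x))

end Local

/-! ### Forms and multivector fields on manifolds -/

section Manifold

variable {E : Type*} [NormedAddCommGroup E] [NormedSpace ℝ E] {H : Type*} [TopologicalSpace H]
  (I : ModelWithCorners ℝ E H) {M : Type*} [TopologicalSpace M] [ChartedSpace H M]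

instance instFiniteTangent [FiniteDimensional ℝ E] (p : M) :
    FiniteDimensional ℝ (TangentSpace I p) := inferInstanceAs (FiniteDimensional ℝ E)

instance instT2Tangent (p : M) : T2Space (TangentSpace I p) := inferInstanceAs (T2Space E)

variable (M) in
/-- Differential forms of mixed degree (without any regularity). -/
abbrev Form : Type _ := ∀ p : M, Covector (TangentSpace I p)

variable (M) in
/-- Multivector fields of mixed degree (without any regularity). -/
abbrev MVField : Type _ := ∀ p : M, ExteriorAlgebra ℝ (TangentSpace I p)

/-- The differential at `p` of the preferred chart around `p₀`. -/
def chartDeriv (p₀ p : M) : TangentSpace I p →L[ℝ] E := mfderiv I 𝓘(ℝ, E) (extChartAt I p₀) p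

/-- The differential at `y` of the inverse of the preferred chart around `p₀`. -/
def chartSymmDeriv (p₀ : M) (y : E) : E →L[ℝ] TangentSpace I ((extChartAt I p₀).symm y) :=
  mfderiv 𝓘(ℝ, E) I (extChartAt I p₀).symm y

variable {I}

/-- A form, written in the preferred chart around `p₀`. -/
def Form.inChart (α : Form I M) (p₀ : M) (y : E) : Covector E := fun k =>
  (α ((extChartAt I p₀).symm y) k).compContinuousLinearMap (chartSymmDeriv I p₀ y)

/-- A multivector field, written in the preferred chart around `p₀`. -/
def MVField.inChart (X : MVField I M) (p₀ : M) (y : E) : ExteriorAlgebra ℝ E :=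
  ExteriorAlgebra.map (chartDeriv I p₀ ((extChartAt I p₀).symm y) : _ →ₗ[ℝ] E)
    (X ((extChartAt I p₀).symm y))

/-- Smooth forms. -/
def Form.Smooth (α : Form I M) : Prop :=
  ∀ (p₀ : M) (k : ℕ), ContDiffOn ℝ ∞ (fun y => α.inChart p₀ y k) (extChartAt I p₀).target

/-- `α` is a form of degree `k` (only the zero form has a negative degree). -/
def Form.HasDegree (α : Form I M) (k : ℤ) : Prop :=
  ∀ (p : M) (j : ℕ), (j : ℤ) ≠ k → α p j = 0

/-- `X` is a multivector field of tensor degree `r`. -/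
def MVField.HasDegree (X : MVField I M) (r : ℕ) : Prop :=
  ∀ p : M, X p ∈ (⋀[ℝ]^r (TangentSpace I p) : Submodule ℝ (ExteriorAlgebra ℝ (TangentSpace I p)))

/-- The exterior derivative, computed at each point in the preferred chart around it. -/
def extD (α : Form I M) : Form I M := fun p k =>
  (extDerivTotal (α.inChart p) (extChartAt I p p) k).compContinuousLinearMap (chartDeriv I p p)

/-- A vector field as a multivector field of degree one. -/
def ofVector (v : ∀ p : M, TangentSpace I p) : MVField I M := fun p => ExteriorAlgebra.ι ℝ (v p)

/-- The exterior product of multivector fields. -/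
def wedge (X Y : MVField I M) : MVField I M := fun p => X p * Y p

variable [FiniteDimensional ℝ E]

/-- Smooth multivector fields. -/
def MVField.Smooth (X : MVField I M) : Prop :=
  ∀ (p₀ : M) (s), ContDiffOn ℝ ∞ (fun y => (mvBasis E).repr (X.inChart p₀ y) s)
    (extChartAt I p₀).target

/-- The interior product `i(X)α`. -/
def contract (X : MVField I M) (α : Form I M) : Form I M := fun p => (α p).contract (X p)

/-- The Schouten bracket, computed at each point in the preferred chart around it. -/
def schouten (X Y : MVField I M) : MVField I M := fun p =>
  ExteriorAlgebra.map ((chartDeriv I p p).inverse : E →ₗ[ℝ] TangentSpace I p)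
    (schoutenLocal (X.inChart p) (Y.inChart p) (extChartAt I p p))

/-- The Lie derivative `L_Y = d i(Y) - (-1)^r i(Y) d` along a multivector field of degree `r`. -/
def lieDeriv (r : ℕ) (Y : MVField I M) (α : Form I M) : Form I M :=
  extD (contract Y α) - (-1 : ℝ) ^ r • contract Y (extD α)

/-! ### Exact multisymplectic manifolds, Poisson forms and their bracket -/

/-- The form `ω = -dθ`. -/
def omega (θ : Form I M) : Form I M := -extD θ

/-- `θ` is an `n`-form and `S` a vector field with `i(S)ω = -θ` for `ω = -dθ`, and `ω` is
non-degenerate on vectors. -/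
structure IsExactMultisymplectic (n : ℕ) (θ : Form I M) (S : ∀ p : M, TangentSpace I p) :
    Prop where
  smooth : θ.Smooth
  degree : θ.HasDegree n
  smooth_scaling : (ofVector S).Smooth
  contract_scaling : contract (ofVector S) (omega θ) = -θ
  nondegenerate : ∀ (p : M) (v : TangentSpace I p),
    (omega θ p).contract (ExteriorAlgebra.ι ℝ v) = 0 → v = 0

/-- `f` is a Hamiltonian form (of degree `n - r`) with Hamiltonian `r`-vector field `X`:
`i(X)ω = df`. -/
structure IsHamiltonian (n : ℕ) (θ : Form I M) (r : ℕ) (X : MVField I M) (f : Form I M) :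
    Prop where
  smooth_field : X.Smooth
  degree_field : X.HasDegree r
  smooth_form : f.Smooth
  degree_form : f.HasDegree ((n : ℤ) - r)
  eq : contract X (omega θ) = extD f

/-- `f` is a Poisson form of degree `n - r`: a Hamiltonian form such that `i(Y)ω = 0` implies
`i(Y)f = 0` for all multivector fields `Y`. -/
structure IsPoisson (n : ℕ) (θ : Form I M) (r : ℕ) (f : Form I M) : Prop where
  hamiltonian : ∃ X, IsHamiltonian n θ r X f
  kernel : ∀ (k : ℕ) (Y : MVField I M), Y.Smooth → Y.HasDegree k →
    contract Y (omega θ) = 0 → contract Y f = 0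

/-- The bracket `{f, g}`, computed with Hamiltonian multivector fields `X` of `f` (degree `r`) and
`Y` of `g` (degree `s`). -/
def bracket (θ : Form I M) (r s : ℕ) (X : MVField I M) (f : Form I M) (Y : MVField I M)
    (g : Form I M) : Form I M :=
  -lieDeriv r X g + (-1 : ℝ) ^ ((r - 1) * (s - 1)) • lieDeriv s Y f
    - (-1 : ℝ) ^ ((r - 1) * s) • lieDeriv (r + s) (wedge X Y) θ

/-- `X` is an exact Hamiltonian `r`-vector field: `L_X θ = 0`. -/
structure IsExactHamiltonian (θ : Form I M) (r : ℕ) (X : MVField I M) : Prop where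
  smooth : X.Smooth
  degree : X.HasDegree r
  lieDeriv_eq : lieDeriv r X θ = 0

/-- `J(X) = (-1)^(r-1) i(X)θ` for an `r`-vector field `X`, `r ≥ 1`. -/
def momentum (θ : Form I M) (r : ℕ) (X : MVField I M) : Form I M :=
  (-1 : ℝ) ^ (r - 1) • contract X θ

end Manifold

/-! ### Fibred manifolds and their multiphase spaces -/

section Bundle

/-- `π : Y → M` is a fibred manifold whose given smooth structure on `Y` consists of fibred charts:
each chart `(x, q)` in the atlas of `Y` lies over a smooth chart `x` of `M`. (The fibre bundles and,
more generally, the submersions admit such an atlas.) -/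
def IsFibered {EM EQ : Type*} [NormedAddCommGroup EM] [NormedSpace ℝ EM]
    [NormedAddCommGroup EQ] [NormedSpace ℝ EQ]
    {M : Type*} [TopologicalSpace M] [ChartedSpace EM M]
    {Y : Type*} [TopologicalSpace Y] [ChartedSpace (EM × EQ) Y] (π : Y → M) : Prop :=
  ∀ φ ∈ atlas (EM × EQ) Y, ∃ ψ ∈ IsManifold.maximalAtlas 𝓘(ℝ, EM) ∞ M,
    ∀ y ∈ φ.source, π y ∈ ψ.source ∧ ψ (π y) = (φ y).1

variable {EM EQ : Type*} [NormedAddCommGroup EM] [NormedSpace ℝ EM]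
  [NormedAddCommGroup EQ] [NormedSpace ℝ EQ]

/-- The component `T_x M → T_x M` of a fibre preserving linear map of `T_x M × V`. -/
def baseBlock (L : EM × EQ →L[ℝ] EM × EQ) : EM →L[ℝ] EM :=
  (ContinuousLinearMap.fst ℝ EM EQ).comp (L.comp (ContinuousLinearMap.inl ℝ EM EQ))

/-- The vertical component of a fibre preserving linear map. -/
def vertBlock (L : EM × EQ →L[ℝ] EM × EQ) : EQ →L[ℝ] EQ :=
  (ContinuousLinearMap.snd ℝ EM EQ).comp (L.comp (ContinuousLinearMap.inr ℝ EM EQ))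

/-- The map `L` with the component from vertical to base directions removed; it equals `L` when `L`
preserves the vertical subspace. -/
def triangular (L : EM × EQ →L[ℝ] EM × EQ) : EM × EQ →L[ℝ] EM × EQ :=
  ((baseBlock L).comp (ContinuousLinearMap.fst ℝ EM EQ)).prod
    ((ContinuousLinearMap.snd ℝ EM EQ).comp L)

theorem triangular_apply (L : EM × EQ →L[ℝ] EM × EQ) (v : EM × EQ) :
    triangular L v = ((L (v.1, 0)).1, (L v).2) := rfl

theorem triangular_fst (L : EM × EQ →L[ℝ] EM × EQ) {v : EM × EQ} (hv : v.1 = 0) :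
    (triangular L v).1 = 0 := by
  rw [triangular_apply, hv]
  exact congrArg Prod.fst (map_zero L)

theorem triangular_eq {L : EM × EQ →L[ℝ] EM × EQ} (hL : ∀ w : EQ, (L (0, w)).1 = 0) :
    triangular L = L := by
  refine ContinuousLinearMap.ext fun v => ?_
  rw [triangular_apply]
  refine Prod.ext ?_ rfl
  have : L v = L (v.1, 0) + L (0, v.2) := by rw [← map_add]; simp
  simp [this, hL]

variable (EM EQ) in
/-- The alternating `n`-forms on `EM × EQ` that vanish on any two vertical vectors, i.e.
`p dⁿx + ∑ pᵢ^μ dqⁱ ∧ dⁿx_μ` in coordinates. -/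
def extFibre (n : ℕ) : Submodule ℝ ((EM × EQ) [⋀^Fin n]→L[ℝ] ℝ) where
  carrier := {α | ∀ (v : Fin n → EM × EQ) (i j : Fin n), i ≠ j →
    (v i).1 = 0 → (v j).1 = 0 → α v = 0}
  zero_mem' := fun v i j _ _ _ => rfl
  add_mem' := fun ha hb v i j h hi hj => by
    simp [ha v i j h hi hj, hb v i j h hi hj]
  smul_mem' := fun c a ha v i j h hi hj => by simp [ha v i j h hi hj]

/-- Pull-back of such forms along a fibre preserving linear map. -/
def extChange (n : ℕ) (L : EM × EQ →L[ℝ] EM × EQ) : extFibre EM EQ n →L[ℝ] extFibre EM EQ n :=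
  ((ContinuousAlternatingMap.compContinuousLinearMapCLM (triangular L)).comp
    (extFibre EM EQ n).subtypeL).codRestrict (extFibre EM EQ n) (fun α v i j h hi hj => by
      refine α.2 _ i j h ?_ ?_
      · exact triangular_fst L hi
      · exact triangular_fst L hj)

theorem extChange_apply (n : ℕ) (L : EM × EQ →L[ℝ] EM × EQ) (α : extFibre EM EQ n)
    (v : Fin n → EM × EQ) :
    (extChange n L α : (EM × EQ) [⋀^Fin n]→L[ℝ] ℝ) v = α.1 (fun i => triangular L (v i)) := rfl

variable (EM EQ) in
/-- Vertical covectors with values in the `m`-forms of the base: `∑ pᵢ^μ dqⁱ ⊗ dⁿx_μ` in coordinates,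
with `n = m + 1`. -/
abbrev OrdFibre (m : ℕ) : Type _ := EQ →L[ℝ] EM [⋀^Fin m]→L[ℝ] ℝ

/-- Pull-back of the latter along a fibre preserving linear map. -/
def ordChange (m : ℕ) (L : EM × EQ →L[ℝ] EM × EQ) : OrdFibre EM EQ m →L[ℝ] OrdFibre EM EQ m :=
  (ContinuousLinearMap.compL ℝ EQ _ _
      (ContinuousAlternatingMap.compContinuousLinearMapCLM (baseBlock L))).comp
    ((ContinuousLinearMap.compL ℝ EQ EQ (EM [⋀^Fin m]→L[ℝ] ℝ)).flip (vertBlock L))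

theorem ordChange_apply (m : ℕ) (L : EM × EQ →L[ℝ] EM × EQ) (β : OrdFibre EM EQ m) (w : EQ)
    (h : Fin m → EM) :
    ordChange m L β w h = β (vertBlock L w) (fun i => baseBlock L (h i)) := rfl

section Smoothness

variable {B EB : Type*} [NormedAddCommGroup EB] [NormedSpace ℝ EB] [TopologicalSpace B]
  [ChartedSpace EB B]

theorem contMDiffOn_of_coords {W : Type*} [NormedAddCommGroup W] [NormedSpace ℝ W]
    {κ : Type*} [Finite κ] (J : W →ₗ[ℝ] (κ → ℝ)) (hJ : Function.Injective J) {f : B → W}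
    {s : Set B} (hf : ∀ k, ContMDiffOn 𝓘(ℝ, EB) 𝓘(ℝ, ℝ) ∞ (fun y => J (f y) k) s) :
    ContMDiffOn 𝓘(ℝ, EB) 𝓘(ℝ, W) ∞ f s := by
  have := Fintype.ofFinite κ
  obtain ⟨R, hR⟩ := LinearMap.exists_leftInverse_of_injective J (LinearMap.ker_eq_bot.2 hJ)
  have h1 : ContMDiffOn 𝓘(ℝ, EB) 𝓘(ℝ, κ → ℝ) ∞ (fun y => J (f y)) s :=
    contMDiffOn_pi_space.2 hf
  have h2 := (LinearMap.toContinuousLinearMap R).contMDiff (n := ∞).comp_contMDiffOn h1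
  refine h2.congr fun y _ => ?_
  exact (LinearMap.congr_fun hR (f y)).symm

variable [FiniteDimensional ℝ EM] [FiniteDimensional ℝ EQ]

def altCoords {V : Type*} [NormedAddCommGroup V] [NormedSpace ℝ V] [FiniteDimensional ℝ V]
    (k : ℕ) : (V [⋀^Fin k]→L[ℝ] ℝ) →ₗ[ℝ] ((Fin k → Fin (Module.finrank ℝ V)) → ℝ) where
  toFun α := fun s => α (fun i => Module.finBasis ℝ V (s i))
  map_add' _ _ := rfl
  map_smul' _ _ := rfl

theorem altCoords_injective {V : Type*} [NormedAddCommGroup V] [NormedSpace ℝ V]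
    [FiniteDimensional ℝ V] (k : ℕ) : Function.Injective (altCoords (V := V) k) := by
  intro α β h
  have : α.toMultilinearMap = β.toMultilinearMap :=
    Module.Basis.ext_multilinear (fun _ => Module.finBasis ℝ V) fun s => congrFun h s
  exact ContinuousAlternatingMap.ext fun v => congrArg (fun a => a v) this

instance instFiniteAlternating {V : Type*} [NormedAddCommGroup V] [NormedSpace ℝ V]
    [FiniteDimensional ℝ V] (k : ℕ) : FiniteDimensional ℝ (V [⋀^Fin k]→L[ℝ] ℝ) :=
  Module.Finite.of_injective _ (altCoords_injective k)

instance instFiniteOrd (m : ℕ) : FiniteDimensional ℝ (OrdFibre EM EQ m) := inferInstance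
instance instFiniteExt (n : ℕ) : FiniteDimensional ℝ (extFibre EM EQ n) := inferInstance

theorem contMDiffOn_alternating_apply {V : Type*} [NormedAddCommGroup V] [NormedSpace ℝ V]
    {k : ℕ} (α : V [⋀^Fin k]→L[ℝ] ℝ) {v : B → Fin k → V} {s : Set B}
    (hv : ∀ i, ContMDiffOn 𝓘(ℝ, EB) 𝓘(ℝ, V) ∞ (fun y => v y i) s) :
    ContMDiffOn 𝓘(ℝ, EB) 𝓘(ℝ, ℝ) ∞ (fun y => α (v y)) s :=
  (α.toContinuousMultilinearMap.contDiff (n := ∞)).contMDiff.comp_contMDiffOn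
    (contMDiffOn_pi_space.2 hv)

theorem contMDiffOn_extChange (n : ℕ) {L : B → EM × EQ →L[ℝ] EM × EQ} {s : Set B}
    (hL : ContMDiffOn 𝓘(ℝ, EB) 𝓘(ℝ, EM × EQ →L[ℝ] EM × EQ) ∞ L s) :
    ContMDiffOn 𝓘(ℝ, EB) 𝓘(ℝ, extFibre EM EQ n →L[ℝ] extFibre EM EQ n) ∞
      (fun y => extChange n (L y)) s := by
  let b := Module.finBasis ℝ (extFibre EM EQ n)
  let J : (extFibre EM EQ n →L[ℝ] extFibre EM EQ n) →ₗ[ℝ]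
      ((Fin (Module.finrank ℝ (extFibre EM EQ n)) ×
        (Fin n → Fin (Module.finrank ℝ (EM × EQ)))) → ℝ) :=
    { toFun := fun c q => altCoords n (c (b q.1)).1 q.2
      map_add' := fun _ _ => rfl
      map_smul' := fun _ _ => rfl }
  refine contMDiffOn_of_coords J (fun c c' h => ?_) fun q => ?_
  · have : (c : extFibre EM EQ n →ₗ[ℝ] extFibre EM EQ n) = c' := b.ext fun a =>
      Subtype.ext (altCoords_injective n (funext fun t => congrFun h (a, t)))
    exact ContinuousLinearMap.coe_injective this
  · refine contMDiffOn_alternating_apply (b q.1).1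
      (v := fun y i => triangular (L y) (Module.finBasis ℝ (EM × EQ) (q.2 i))) fun i => ?_
    set u := Module.finBasis ℝ (EM × EQ) (q.2 i)
    have h1 : ContMDiffOn 𝓘(ℝ, EB) 𝓘(ℝ, EM × EQ) ∞ (fun y => L y (u.1, 0)) s :=
      hL.clm_apply contMDiffOn_const
    have h2 : ContMDiffOn 𝓘(ℝ, EB) 𝓘(ℝ, EM × EQ) ∞ (fun y => L y u) s :=
      hL.clm_apply contMDiffOn_const
    exact ((ContinuousLinearMap.fst ℝ EM EQ).contMDiff.comp_contMDiffOn h1).prodMk_space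
      ((ContinuousLinearMap.snd ℝ EM EQ).contMDiff.comp_contMDiffOn h2)

theorem contMDiffOn_ordChange (m : ℕ) {L : B → EM × EQ →L[ℝ] EM × EQ} {s : Set B}
    (hL : ContMDiffOn 𝓘(ℝ, EB) 𝓘(ℝ, EM × EQ →L[ℝ] EM × EQ) ∞ L s) :
    ContMDiffOn 𝓘(ℝ, EB) 𝓘(ℝ, OrdFibre EM EQ m →L[ℝ] OrdFibre EM EQ m) ∞
      (fun y => ordChange m (L y)) s := by
  let b := Module.finBasis ℝ (OrdFibre EM EQ m)
  let e := Module.finBasis ℝ EQ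
  let J : (OrdFibre EM EQ m →L[ℝ] OrdFibre EM EQ m) →ₗ[ℝ]
      ((Fin (Module.finrank ℝ (OrdFibre EM EQ m)) × Fin (Module.finrank ℝ EQ) ×
        (Fin m → Fin (Module.finrank ℝ EM))) → ℝ) :=
    { toFun := fun c q => altCoords m (c (b q.1) (e q.2.1)) q.2.2
      map_add' := fun _ _ => rfl
      map_smul' := fun _ _ => rfl }
  refine contMDiffOn_of_coords J (fun c c' h => ?_) fun q => ?_
  · have : (c : OrdFibre EM EQ m →ₗ[ℝ] OrdFibre EM EQ m) = c' := b.ext fun a =>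
      ContinuousLinearMap.coe_injective (e.ext fun a' =>
        altCoords_injective m (funext fun t => congrFun h (a, a', t)))
    exact ContinuousLinearMap.coe_injective this
  · have hA : ∀ u : EM × EQ, ContMDiffOn 𝓘(ℝ, EB) 𝓘(ℝ, EM × EQ) ∞ (fun y => L y u) s :=
      fun u => hL.clm_apply contMDiffOn_const
    -- expand the first argument in a basis
    have key : ∀ y, J (ordChange m (L y)) q = ∑ t, e.coord t (vertBlock (L y) (e q.2.1)) *
        b q.1 (e t) (fun i => baseBlock (L y) (Module.finBasis ℝ EM (q.2.2 i))) := by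
      intro y
      change b q.1 (vertBlock (L y) (e q.2.1)) _ = _
      conv_lhs => rw [← e.sum_repr (vertBlock (L y) (e q.2.1)), map_sum]
      rw [ContinuousAlternatingMap.sum_apply]
      refine Finset.sum_congr rfl fun t _ => ?_
      rw [map_smul]
      rfl
    refine ContMDiffOn.congr ?_ fun y _ => key y
    refine contMDiffOn_finsetSum fun t _ => ContMDiffOn.mul ?_ ?_
    · exact ((LinearMap.toContinuousLinearMap (e.coord t)).contMDiff.comp_contMDiffOn
        ((ContinuousLinearMap.snd ℝ EM EQ).contMDiff.comp_contMDiffOn (hA (0, e q.2.1))))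
    · exact contMDiffOn_alternating_apply _ fun i =>
        (ContinuousLinearMap.fst ℝ EM EQ).contMDiff.comp_contMDiffOn
          (hA (Module.finBasis ℝ EM (q.2.2 i), 0))

end Smoothness

variable {M : Type*} [TopologicalSpace M] [ChartedSpace EM M]
  {Y : Type*} [TopologicalSpace Y] [ChartedSpace (EM × EQ) Y]
  [IsManifold 𝓘(ℝ, EM × EQ) ∞ Y]

theorem tangentChange_vertical {π : Y → M} (hπ : IsFibered (EM := EM) (EQ := EQ) π)
    (i j : atlas (EM × EQ) Y) {y : Y} (hi : y ∈ i.1.source) (hj : y ∈ j.1.source) (w : EQ) :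
    ((tangentBundleCore 𝓘(ℝ, EM × EQ) Y).coordChange i j y (0, w)).1 = 0 := by
  obtain ⟨ψ, -, hψ⟩ := hπ i.1 i.2
  obtain ⟨χ, -, hχ⟩ := hπ j.1 j.2
  have hd : DifferentiableAt ℝ (j.1 ∘ i.1.symm) (i.1 y) := by
    have h := 𝓘(ℝ, EM × EQ).contDiffWithinAt_extendCoordChange' (n := ∞)
      (IsManifold.subset_maximalAtlas i.2) (IsManifold.subset_maximalAtlas j.2) hi hj
    have h' := h.differentiableWithinAt (by simp)
    simpa [differentiableWithinAt_univ] using h'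
  have hcc : (tangentBundleCore 𝓘(ℝ, EM × EQ) Y).coordChange i j y
      = fderiv ℝ (j.1 ∘ i.1.symm) (i.1 y) := by
    simp [tangentBundleCore_coordChange, fderivWithin_univ]
  rw [hcc]
  -- the first component is constant along the fibre direction
  have hline : HasDerivAt (fun t : ℝ => i.1 y + t • ((0 : EM), w)) ((0 : EM), w) 0 := by
    simpa using ((hasDerivAt_id (0 : ℝ)).smul_const ((0 : EM), w)).const_add (i.1 y)
  have hF : HasFDerivAt (j.1 ∘ i.1.symm) (fderiv ℝ (j.1 ∘ i.1.symm) (i.1 y))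
      (i.1 y + (0 : ℝ) • ((0 : EM), w)) := by simpa using hd.hasFDerivAt
  have hcomp := hF.comp_hasDerivAt (0 : ℝ) hline
  have hfst := (ContinuousLinearMap.fst ℝ EM EQ).hasFDerivAt.comp_hasDerivAt (0 : ℝ) hcomp
  have hconst : (fun t : ℝ => (ContinuousLinearMap.fst ℝ EM EQ)
      ((j.1 ∘ i.1.symm) (i.1 y + t • ((0 : EM), w)))) =ᶠ[𝓝 0] fun _ => χ (ψ.symm (i.1 y).1) := by
    have hopen : (i.1.symm ≫ₕ j.1).source ∈ 𝓝 (i.1 y + (0 : ℝ) • ((0 : EM), w)) := by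
      refine (i.1.symm ≫ₕ j.1).open_source.mem_nhds ?_
      simp [hi, hj]
    filter_upwards [hline.continuousAt.preimage_mem_nhds hopen] with t ht
    have ht' : i.1 y + t • ((0 : EM), w) ∈ i.1.target ∧
        i.1.symm (i.1 y + t • ((0 : EM), w)) ∈ j.1.source := by simpa using ht
    have h1 := hψ _ (i.1.map_target ht'.1)
    have h2 := hχ _ ht'.2
    rw [i.1.right_inv ht'.1] at h1
    have h3 : (i.1 y + t • ((0 : EM), w)).1 = (i.1 y).1 := by simp
    change (j.1 (i.1.symm (i.1 y + t • ((0 : EM), w)))).1 = _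
    rw [← h2.2, ← h3, ← h1.2, ψ.left_inv h1.1]
  exact (hfst.congr_of_eventuallyEq hconst.symm).unique (hasDerivAt_const _ _)


theorem contMDiffOn_tangentChange (i j : atlas (EM × EQ) Y) :
    ContMDiffOn 𝓘(ℝ, EM × EQ) 𝓘(ℝ, EM × EQ →L[ℝ] EM × EQ) ∞
      ((tangentBundleCore 𝓘(ℝ, EM × EQ) Y).coordChange j i) (i.1.source ∩ j.1.source) := by
  have : IsManifold 𝓘(ℝ, EM × EQ) (∞ + 1) Y := by simpa
  have h := (tangentBundleCore.isContMDiff (I := 𝓘(ℝ, EM × EQ)) (M := Y) (n := ∞)).1 j i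
  rw [inter_comm] at h
  exact h

theorem vertBlock_comp {A B C : EM × EQ →L[ℝ] EM × EQ} (hc : ∀ v, B (A v) = C v)
    (hA : ∀ w, (A (0, w)).1 = 0) (w : EQ) :
    vertBlock B (vertBlock A w) = vertBlock C w := by
  have : A (0, w) = (0, (A (0, w)).2) := Prod.ext (hA w) rfl
  change (B (0, (A (0, w)).2)).2 = (C (0, w)).2
  rw [← this, hc]

theorem baseBlock_comp {A B C : EM × EQ →L[ℝ] EM × EQ} (hc : ∀ v, B (A v) = C v)
    (hB : ∀ w, (B (0, w)).1 = 0) (h : EM) :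
    baseBlock B (baseBlock A h) = baseBlock C h := by
  change (B ((A (h, 0)).1, 0)).1 = (C (h, 0)).1
  rw [← hc]
  have : B (A (h, 0)) = B ((A (h, 0)).1, 0) + B (0, (A (h, 0)).2) := by
    rw [← map_add]; simp
  rw [this, Prod.fst_add, hB, add_zero]

variable [FiniteDimensional ℝ EM] [FiniteDimensional ℝ EQ]

/-- The vector bundle over `Y` with fibre at `y` the `(m+1)`-forms on `T_y Y` that vanish on any two
vertical vectors; the charts of `Y` trivialize it. -/
def extCore (m : ℕ) {π : Y → M} (hπ : IsFibered (EM := EM) (EQ := EQ) π) :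
    VectorBundleCore ℝ Y (extFibre EM EQ (m + 1)) (atlas (EM × EQ) Y) where
  baseSet i := i.1.source
  isOpen_baseSet i := i.1.open_source
  indexAt := achart (EM × EQ)
  mem_baseSet_at := mem_chart_source (EM × EQ)
  coordChange i j y :=
    extChange (m + 1) ((tangentBundleCore 𝓘(ℝ, EM × EQ) Y).coordChange j i y)
  coordChange_self i y hy α := by
    refine Subtype.ext (ContinuousAlternatingMap.ext fun v => ?_)
    rw [extChange_apply, triangular_eq (tangentChange_vertical hπ i i hy hy)]
    simp only [(tangentBundleCore 𝓘(ℝ, EM × EQ) Y).coordChange_self i y hy]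
  continuousOn_coordChange i j :=
    (contMDiffOn_extChange (m + 1) (contMDiffOn_tangentChange i j)).continuousOn
  coordChange_comp i j k y hy α := by
    obtain ⟨⟨hi, hj⟩, hk⟩ := hy
    refine Subtype.ext (ContinuousAlternatingMap.ext fun v => ?_)
    rw [extChange_apply, extChange_apply, extChange_apply,
      triangular_eq (tangentChange_vertical hπ k j hk hj),
      triangular_eq (tangentChange_vertical hπ j i hj hi),
      triangular_eq (tangentChange_vertical hπ k i hk hi)]
    simp only [(tangentBundleCore 𝓘(ℝ, EM × EQ) Y).coordChange_comp k j i y ⟨⟨hk, hj⟩, hi⟩]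

instance instContMDiffExtCore (m : ℕ) {π : Y → M} (hπ : IsFibered (EM := EM) (EQ := EQ) π) :
    (extCore m hπ).IsContMDiff 𝓘(ℝ, EM × EQ) ∞ where
  contMDiffOn_coordChange i j :=
    contMDiffOn_extChange (m + 1) (contMDiffOn_tangentChange i j)

/-- The vector bundle over `Y` with fibre at `y` the linear maps from the vertical tangent space
at `y` to the `m`-forms on the tangent space of `M` at `π y`. -/
def ordCore (m : ℕ) {π : Y → M} (hπ : IsFibered (EM := EM) (EQ := EQ) π) :
    VectorBundleCore ℝ Y (OrdFibre EM EQ m) (atlas (EM × EQ) Y) where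
  baseSet i := i.1.source
  isOpen_baseSet i := i.1.open_source
  indexAt := achart (EM × EQ)
  mem_baseSet_at := mem_chart_source (EM × EQ)
  coordChange i j y :=
    ordChange m ((tangentBundleCore 𝓘(ℝ, EM × EQ) Y).coordChange j i y)
  coordChange_self i y hy β := by
    refine ContinuousLinearMap.ext fun w => ContinuousAlternatingMap.ext fun h => ?_
    simp only [ordChange_apply, vertBlock, baseBlock, ContinuousLinearMap.comp_apply,
      (tangentBundleCore 𝓘(ℝ, EM × EQ) Y).coordChange_self i y hy]
    simp
  continuousOn_coordChange i j :=
    (contMDiffOn_ordChange m (contMDiffOn_tangentChange i j)).continuousOn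
  coordChange_comp i j k y hy β := by
    obtain ⟨⟨hi, hj⟩, hk⟩ := hy
    have hc := (tangentBundleCore 𝓘(ℝ, EM × EQ) Y).coordChange_comp k j i y ⟨⟨hk, hj⟩, hi⟩
    have hv := tangentChange_vertical hπ k j hk hj
    have hv' := tangentChange_vertical hπ j i hj hi
    refine ContinuousLinearMap.ext fun w => ContinuousAlternatingMap.ext fun h => ?_
    rw [ordChange_apply, ordChange_apply, ordChange_apply]
    have e1 := vertBlock_comp hc hv
    have e2 := baseBlock_comp hc hv'
    rw [e1]
    simp only [e2]

instance instContMDiffOrdCore (m : ℕ) {π : Y → M} (hπ : IsFibered (EM := EM) (EQ := EQ) π) :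
    (ordCore m hπ).IsContMDiff 𝓘(ℝ, EM × EQ) ∞ where
  contMDiffOn_coordChange i j :=
    contMDiffOn_ordChange m (contMDiffOn_tangentChange i j)

/-- The extended multiphase space: the affine dual of the first jet bundle, realized as the bundle of
`(m+1)`-forms on `Y` that vanish on any two vertical vectors, where `dim M = m + 1`. -/
abbrev ExtPhase (m : ℕ) {π : Y → M} (hπ : IsFibered (EM := EM) (EQ := EQ) π) : Type _ :=
  Bundle.TotalSpace (extFibre EM EQ (m + 1)) (extCore m hπ).Fiber

/-- The ordinary multiphase space: the quotient of the extended one by the forms pulled back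
from `M`, realized as `V*Y ⊗ ⋀ᵐ T*M`. -/
abbrev OrdPhase (m : ℕ) {π : Y → M} (hπ : IsFibered (EM := EM) (EQ := EQ) π) : Type _ :=
  Bundle.TotalSpace (OrdFibre EM EQ m) (ordCore m hπ).Fiber

variable (EM EQ) in
/-- The model of the extended multiphase space. -/
abbrev extModel (m : ℕ) := 𝓘(ℝ, EM × EQ).prod 𝓘(ℝ, extFibre EM EQ (m + 1))
variable (EM EQ) in
/-- The model of the ordinary multiphase space. -/
abbrev ordModel (m : ℕ) := 𝓘(ℝ, EM × EQ).prod 𝓘(ℝ, OrdFibre EM EQ m)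

variable (m : ℕ) {π : Y → M} (hπ : IsFibered (EM := EM) (EQ := EQ) π)

/-- The differential of the projection of the extended multiphase space to `Y`; the target is the
tangent space of `Y` in the preferred chart, in which the points of the fibre are written too. -/
def extProjDeriv (p : ExtPhase m hπ) : TangentSpace (extModel EM EQ m) p →L[ℝ] EM × EQ :=
  mfderiv (extModel EM EQ m) 𝓘(ℝ, EM × EQ) (fun q : ExtPhase m hπ => q.1) p

/-- The same for the ordinary multiphase space. -/
def ordProjDeriv (p : OrdPhase m hπ) : TangentSpace (ordModel EM EQ m) p →L[ℝ] EM × EQ :=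
  mfderiv (ordModel EM EQ m) 𝓘(ℝ, EM × EQ) (fun q : OrdPhase m hπ => q.1) p

/-- The multicanonical (tautological) form
`θ = ∑ pᵢ^μ dqⁱ ∧ dⁿx_μ + p dⁿx` of the extended multiphase space, `n = m + 1`. -/
def canonicalForm : Form (extModel EM EQ m) (ExtPhase m hπ) := fun p =>
  Pi.single (m + 1)
    ((p.2 : extFibre EM EQ (m + 1)).1.compContinuousLinearMap (extProjDeriv m hπ p))

/-- The scaling (Euler) vector field of the extended multiphase space as a vector bundle over `Y`. -/
def eulerField (p : ExtPhase m hπ) : TangentSpace (extModel EM EQ m) p :=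
  mfderiv 𝓘(ℝ, ℝ) (extModel EM EQ m)
    (fun t : ℝ => (⟨p.1, t • p.2⟩ : ExtPhase m hπ)) 1 (1 : ℝ)

/-- The part `w ↦ α(w, ·, …, ·)` of a form that is seen by the ordinary multiphase space. -/
def fibreProj (α : extFibre EM EQ (m + 1)) : OrdFibre EM EQ m :=
  (ContinuousAlternatingMap.compContinuousLinearMapCLM (ContinuousLinearMap.inl ℝ EM EQ)).comp
    (α.1.curryLeft.comp (ContinuousLinearMap.inr ℝ EM EQ))

/-- The projection of the extended to the ordinary multiphase space,
`(x, q, pᵢ^μ, p) ↦ (x, q, pᵢ^μ)`. -/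
def phaseProj (p : ExtPhase m hπ) : OrdPhase m hπ := ⟨p.1, fibreProj m p.2⟩

/-- Pull-back of forms from the ordinary to the extended multiphase space. -/
def pullback (β : Form (ordModel EM EQ m) (OrdPhase m hπ)) :
    Form (extModel EM EQ m) (ExtPhase m hπ) := fun p k =>
  (β (phaseProj m hπ p) k).compContinuousLinearMap
    (mfderiv (extModel EM EQ m) (ordModel EM EQ m) (phaseProj m hπ) p)

/-- The differential of the projection of the ordinary multiphase space to `M`. -/
def toBaseDeriv (p : OrdPhase m hπ) :
    TangentSpace (ordModel EM EQ m) p →L[ℝ] TangentSpace 𝓘(ℝ, EM) (π p.1) :=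
  mfderiv (ordModel EM EQ m) 𝓘(ℝ, EM) (fun q : OrdPhase m hπ => π q.1) p

/-- Smooth (Ehresmann) connections of the ordinary multiphase space over `M`, given by the projection
`Φ` of its tangent spaces onto the vertical subspaces. -/
structure IsConnection (Φ : ∀ p : OrdPhase m hπ,
    TangentSpace (ordModel EM EQ m) p →L[ℝ] TangentSpace (ordModel EM EQ m) p) : Prop where
  idempotent : ∀ p v, Φ p (Φ p v) = Φ p v
  vertical : ∀ p v, (∃ w, Φ p w = v) ↔ toBaseDeriv m hπ p v = 0
  smooth : ∀ p₀ : OrdPhase m hπ, ContDiffOn ℝ ∞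
    (fun y => (chartDeriv (ordModel EM EQ m) p₀ ((extChartAt (ordModel EM EQ m) p₀).symm y)).comp
      ((Φ ((extChartAt (ordModel EM EQ m) p₀).symm y)).comp
        (chartSymmDeriv (ordModel EM EQ m) p₀ y)))
    (extChartAt (ordModel EM EQ m) p₀).target

variable (Φ : ∀ p : OrdPhase m hπ,
    TangentSpace (ordModel EM EQ m) p →L[ℝ] TangentSpace (ordModel EM EQ m) p)

/-- The operator `i_Φ`; for a connection `Φ` it multiplies a form with `a` vertical legs (and any
number of horizontal ones) by `a`. -/
def insertConnection (α : Form (ordModel EM EQ m) (OrdPhase m hπ)) :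
    Form (ordModel EM EQ m) (OrdPhase m hπ) :=
  fun p => (α p).insert (Φ p : _ →ₗ[ℝ] TangentSpace (ordModel EM EQ m) p)

/-- The commutator of `i_Φ` with an operator on forms. -/
def commInsert
    (D : Form (ordModel EM EQ m) (OrdPhase m hπ) → Form (ordModel EM EQ m) (OrdPhase m hπ))
    (α : Form (ordModel EM EQ m) (OrdPhase m hπ)) : Form (ordModel EM EQ m) (OrdPhase m hπ) :=
  insertConnection m hπ Φ (D α) - D (insertConnection m hπ Φ α)

/-- The vertical exterior derivative `d^V`: the part of `d` that adds one vertical leg and no horizontal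
one. As the vertical distribution is integrable, `d` is the sum of operators that change the numbers
of (vertical, horizontal) legs by `(1, 0)`, `(0, 1)` and `(-1, 2)`, on which the commutator
with `i_Φ` acts by the factors `1`, `0` and `-1`; hence
`d^V = ([i_Φ, d] + [i_Φ, [i_Φ, d]]) / 2`. -/
def verticalD (α : Form (ordModel EM EQ m) (OrdPhase m hπ)) :
    Form (ordModel EM EQ m) (OrdPhase m hπ) :=
  (1 / 2 : ℝ) • (commInsert m hπ Φ extD α + commInsert m hπ Φ (commInsert m hπ Φ extD) α)

/-- The form `θ^V = ∑ pᵢ^μ Dqⁱ ∧ dⁿx_μ` of the ordinary multiphase space, `Dqⁱ` being the vertical part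
of `dqⁱ`: at a point `β` of the fibre,
`θ^V(v₀, …, vₘ) = ∑ᵢ (-1)ⁱ β(T Φ vᵢ)(T v₀, …, T vᵢ₋₁, T vᵢ₊₁, …, T vₘ)`, where `T` stands for the
differential of the projection to `Y` in the first slot, to `M` in the others. -/
def thetaV : Form (ordModel EM EQ m) (OrdPhase m hπ) := fun p =>
  let a : (EM × EQ) × OrdFibre EM EQ m →L[ℝ] EM × EQ := ordProjDeriv m hπ p
  let b : (EM × EQ) × OrdFibre EM EQ m →L[ℝ] EM × EQ := (ordProjDeriv m hπ p).comp (Φ p)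
  let β : OrdFibre EM EQ m := p.2
  Pi.single (M := fun k => TangentSpace (ordModel EM EQ m) p [⋀^Fin k]→L[ℝ] ℝ) (m + 1)
    (ContinuousAlternatingMap.alternatizeUncurryFin
      ((ContinuousAlternatingMap.compContinuousLinearMapCLM
        ((ContinuousLinearMap.fst ℝ EM EQ).comp a)).comp
        (β.comp ((ContinuousLinearMap.snd ℝ EM EQ).comp b))))

/-- The form `ω^V = -d^V θ^V`. -/
def omegaV : Form (ordModel EM EQ m) (OrdPhase m hπ) := -verticalD m hπ Φ (thetaV m hπ Φ)

/-- `f` is a Hamiltonian form à la Kanatchikov, of degree `m + 1 - r`, with `r`-vector field `X`: it is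
horizontal (it vanishes on vectors that are vertical over `M`) and `i(X)ω^V = d^V f`. -/
structure IsKanatchikovHamiltonian (r : ℕ) (X : MVField (ordModel EM EQ m) (OrdPhase m hπ))
    (f : Form (ordModel EM EQ m) (OrdPhase m hπ)) : Prop where
  smooth_field : X.Smooth
  degree_field : X.HasDegree r
  smooth_form : f.Smooth
  degree_form : f.HasDegree (((m + 1 : ℕ) : ℤ) - r)
  horizontal : ∀ (p : OrdPhase m hπ) (v : TangentSpace (ordModel EM EQ m) p),
    toBaseDeriv m hπ p v = 0 → (f p).contract (ExteriorAlgebra.ι ℝ v) = 0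
  eq : contract X (omegaV m hπ Φ) = verticalD m hπ Φ f

set_option synthInstance.maxHeartbeats 200000 in
/-- The bracket of Kanatchikov `(-1)^r i(X)i(Y)ω^V` of Hamiltonian forms with multivector fields `X` (of
degree `r`) and `Y`. -/
def kanatchikovBracket (r : ℕ) (X Y' : MVField (ordModel EM EQ m) (OrdPhase m hπ)) :
    Form (ordModel EM EQ m) (OrdPhase m hπ) :=
  (-1 : ℝ) ^ r • contract X (contract Y' (omegaV m hπ Φ))

end Bundle

end Multisymplectic

end

open Multisymplectic

/-!
A form is treated as a functional on the exterior algebra of the tangent space (`Covector.pairing`).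
Contraction is then `(i(X)α)(u) = α(X ∧ u)`, so the graded commutation of contractions is that of the
exterior algebra, and in charts `d` is the operator `dualD`.

Part (A) rests on one identity, `i([X, Y]) = (-1)^((r - 1)s) L_X i(Y) - i(Y) L_X` on forms. It is
verified in coordinates (`dual_schoutenLocal`). As it determines the Schouten bracket and `d` is
natural, the bracket does not depend on the chart (`schoutenLocal_comp`), and the identity holds on
manifolds (`contract_schouten`). What remains is Cartan calculus with an operator `D` of square zero
and contractions: `D_cartanBracket` says that `[Y, X]` is a Hamiltonian field of `{f, g}`,
`cartanBracket_jacobi` is the Jacobi identity, `cartanBracket_momentum` the statement on momenta.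
Exactness enters through `θ = -i(Σ)ω`: fields that annihilate `ω` annihilate `θ`. Therefore the bracket
does not depend on the Hamiltonian fields (`bracket_congr_left`) and is a Poisson form
(`IsPoisson.bracket`).

The extended multiphase space is a bundle of forms on its base, whose tautological form has the same
expression in all charts induced from the base, and `ω` has constant coefficients there
(`IsTautological.dual`, `IsTautological.omega_dual`). Non-degeneracy is then linear algebra
(`tautOmega_nondegenerate`). Also, an equation `i(X)ω = df` that can be solved at each point has a
smooth solution: a generalized inverse of a constant matrix solves it in charts, and a partition of
unity glues the solutions (`IsTautological.exists_isHamiltonian`).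

For the comparison with the ordinary multiphase space, let `Φ` be the vertical projection of the
connection. The derivation `i_Φ` of the exterior algebra counts vertical factors
(`IsBihomogeneous.insertionDerivation_eq`), and `ωᵛ` turns out to be the part with two vertical legs
of `-d` of the pull-back of the tautological form along a local section of the projection
(`omegaV_model`). The difference of the two is the product of a linear form and the volume form of
the base. Correcting the differential of the section by this linear form, along the fibre, gives a
lift `S` of tangent vectors under which `ω` is pulled back to `ωᵛ` (`exists_isPhaseLift`).

If `X` solves `i(X)ωᵛ = dᵛf`, then `S(i_Φ X) + e ∧ k` solves `i(X₀)ω = df` on the extended space, `e`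
being the vector along the fibre and `k` the horizontal multivector that is dual to the horizontal
part of `df` (`IsPhaseLift.exists_hamiltonian`). Each term of this solution has a vertical factor. So
Hamiltonian fields annihilate the pull-backs of horizontal forms, the bracket of the pull-backs
reduces to `(-1)^r i(X_f) dg` (`bracket_eq_contract`), and counting vertical legs identifies it with
the twofold contraction of `ωᵛ` (`apply_insertionDerivation_mul_eq`). Conversely a Hamiltonian field
of the bracket is restricted to local sections and pushed forward; after multiplication by `2 - i_Φ`
it solves the equation for the contraction (`IsPhaseLift.apply_mul_eq`), and a partition of unity
yields the field that is asked for (`exists_isVerticalHamiltonian`).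
-/


set_option linter.unusedSectionVars false

noncomputable section

namespace Multisymplectic

/-! ### The exterior algebra -/

section ExteriorAlgebra

variable {V : Type*} [AddCommGroup V] [Module ℝ V]

theorem exteriorPower_zero_eq : (⋀[ℝ]^0 V : Submodule ℝ (ExteriorAlgebra ℝ V)) = 1 := pow_zero _

theorem exteriorPower_succ_eq (r : ℕ) : (⋀[ℝ]^(r + 1) V : Submodule ℝ (ExteriorAlgebra ℝ V)) =
    LinearMap.range (ExteriorAlgebra.ι ℝ) * ⋀[ℝ]^r V := pow_succ' _ _

theorem ι_mul_mem_exteriorPower {r : ℕ} (v : V) {X : ExteriorAlgebra ℝ V} (hX : X ∈ ⋀[ℝ]^r V) :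
    ExteriorAlgebra.ι ℝ v * X ∈ ⋀[ℝ]^(r + 1) V := by
  rw [exteriorPower_succ_eq]
  exact Submodule.mul_mem_mul (LinearMap.mem_range_self _ v) hX

theorem mul_mem_exteriorPower {r s : ℕ} {X Y : ExteriorAlgebra ℝ V} (hX : X ∈ ⋀[ℝ]^r V)
    (hY : Y ∈ ⋀[ℝ]^s V) : X * Y ∈ ⋀[ℝ]^(r + s) V := by
  have : (⋀[ℝ]^(r + s) V : Submodule ℝ (ExteriorAlgebra ℝ V)) = ⋀[ℝ]^r V * ⋀[ℝ]^s V :=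
    pow_add _ _ _
  rw [this]
  exact Submodule.mul_mem_mul hX hY

theorem ιMulti_mem_exteriorPower {k : ℕ} (v : Fin k → V) :
    ExteriorAlgebra.ιMulti ℝ k v ∈ ⋀[ℝ]^k V := by
  rw [← ExteriorAlgebra.ιMulti_span_fixedDegree]
  exact Submodule.subset_span ⟨v, rfl⟩

theorem ι_mem_exteriorPower (v : V) : ExteriorAlgebra.ι ℝ v ∈ ⋀[ℝ]^1 V := by
  have : (⋀[ℝ]^1 V : Submodule ℝ (ExteriorAlgebra ℝ V)) = LinearMap.range (ExteriorAlgebra.ι ℝ) :=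
    pow_one _
  rw [this]; exact LinearMap.mem_range_self _ v

/-- Induction over homogeneous multivectors by left multiplication with vectors. -/
theorem exteriorPower_induction {C : ℕ → ExteriorAlgebra ℝ V → Prop}
    (hone : ∀ c : ℝ, C 0 (algebraMap ℝ _ c))
    (hmul : ∀ r v X, X ∈ ⋀[ℝ]^r V → C r X → C (r + 1) (ExteriorAlgebra.ι ℝ v * X))
    (hadd : ∀ r X Y, C r X → C r Y → C r (X + Y))
    {r : ℕ} {X : ExteriorAlgebra ℝ V} (hX : X ∈ ⋀[ℝ]^r V) : C r X := by
  induction r generalizing X with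
  | zero =>
    rw [exteriorPower_zero_eq, Submodule.mem_one] at hX
    obtain ⟨c, rfl⟩ := hX
    exact hone c
  | succ r ih =>
    rw [exteriorPower_succ_eq] at hX
    refine Submodule.mul_induction_on hX ?_ (fun X Y => hadd _ X Y)
    rintro _ ⟨v, rfl⟩ n hn
    exact hmul r v n hn (ih hn)

/-- Induction over all multivectors by left multiplication with vectors. -/
theorem exteriorAlgebra_induction {C : ExteriorAlgebra ℝ V → Prop}
    (hone : ∀ c : ℝ, C (algebraMap ℝ _ c))
    (hmul : ∀ v X, C X → C (ExteriorAlgebra.ι ℝ v * X))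
    (hadd : ∀ X Y, C X → C Y → C (X + Y)) (X : ExteriorAlgebra ℝ V) : C X := by
  have h : X ∈ (⊤ : Submodule ℝ (ExteriorAlgebra ℝ V)) := trivial
  rw [← ExteriorAlgebra.ιMulti_span] at h
  have h0 : C 0 := by simpa using hone 0
  refine Submodule.closure_induction (p := fun x _ => C x) h0 (fun x y _ _ => hadd x y) ?_ h
  rintro c _ ⟨⟨k, v⟩, rfl⟩
  have : c • ExteriorAlgebra.ιMulti ℝ k v ∈ ⋀[ℝ]^k V :=
    Submodule.smul_mem _ _ (ιMulti_mem_exteriorPower v)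
  exact exteriorPower_induction (C := fun _ X => C X) hone (fun _ v X _ h => hmul v X h)
    (fun _ => hadd) this

theorem mul_comm_exteriorPower {r s : ℕ} {X Y : ExteriorAlgebra ℝ V} (hX : X ∈ ⋀[ℝ]^r V)
    (hY : Y ∈ ⋀[ℝ]^s V) : X * Y = (-1 : ℝ) ^ (r * s) • (Y * X) := by
  have key : ∀ v : V, ExteriorAlgebra.ι ℝ v * Y = (-1 : ℝ) ^ s • (Y * ExteriorAlgebra.ι ℝ v) := by
    intro v
    refine exteriorPower_induction (C := fun s Y => ExteriorAlgebra.ι ℝ v * Y =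
      (-1 : ℝ) ^ s • (Y * ExteriorAlgebra.ι ℝ v)) (fun c => ?_) (fun r w X _ h => ?_)
      (fun r X Y h h' => ?_) hY
    · rw [pow_zero, one_smul, Algebra.commutes]
    · have hsw := ExteriorAlgebra.ι_add_mul_swap (R := ℝ) v w
      rw [← mul_assoc, eq_neg_of_add_eq_zero_left hsw, neg_mul, mul_assoc, h, mul_smul_comm,
        mul_assoc, pow_succ]
      module
    · rw [mul_add, h, h', add_mul, smul_add]
  refine exteriorPower_induction (C := fun r X => X * Y = (-1 : ℝ) ^ (r * s) • (Y * X))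
    (fun c => ?_) (fun r v X _ h => ?_) (fun r X Z h h' => ?_) hX
  · rw [zero_mul, pow_zero, one_smul, Algebra.commutes]
  · rw [mul_assoc, h, mul_smul_comm, ← mul_assoc, key, smul_mul_assoc, smul_smul, mul_assoc,
      ← pow_add, Nat.succ_mul]
  · rw [add_mul, h, h', mul_add, smul_add]

theorem exteriorPower_zero_algebraMap (c : ℝ) :
    algebraMap ℝ (ExteriorAlgebra ℝ V) c ∈ ⋀[ℝ]^0 V := by
  rw [exteriorPower_zero_eq, Submodule.mem_one]; exact ⟨c, rfl⟩

theorem map_mem_exteriorPower {W : Type*} [AddCommGroup W] [Module ℝ W] (L : V →ₗ[ℝ] W) {r : ℕ}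
    {X : ExteriorAlgebra ℝ V} (hX : X ∈ ⋀[ℝ]^r V) : ExteriorAlgebra.map L X ∈ ⋀[ℝ]^r W := by
  refine exteriorPower_induction (C := fun r X => ExteriorAlgebra.map L X ∈ ⋀[ℝ]^r W)
    (fun c => ?_) (fun r v X _ h => ?_) (fun r X Y h h' => ?_) hX
  · rw [AlgHom.commutes]; exact exteriorPower_zero_algebraMap c
  · rw [map_mul, ExteriorAlgebra.map_apply_ι]; exact ι_mul_mem_exteriorPower _ h
  · rw [map_add]; exact add_mem h h'

/-- Contraction with a covector is an antiderivation. -/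
theorem contractLeft_mul (e : Module.Dual ℝ V) {r : ℕ} {X : ExteriorAlgebra ℝ V}
    (hX : X ∈ ⋀[ℝ]^r V) (u : ExteriorAlgebra ℝ V) :
    CliffordAlgebra.contractLeft e (X * u) =
      CliffordAlgebra.contractLeft e X * u + (-1 : ℝ) ^ r • (X * CliffordAlgebra.contractLeft e u) := by
  refine exteriorPower_induction (C := fun r X => CliffordAlgebra.contractLeft e (X * u) =
      CliffordAlgebra.contractLeft e X * u +
        (-1 : ℝ) ^ r • (X * CliffordAlgebra.contractLeft e u))
    (fun c => ?_) (fun r v X _ h => ?_) (fun r X Y h h' => ?_) hX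
  · rw [CliffordAlgebra.contractLeft_algebraMap_mul, CliffordAlgebra.contractLeft_algebraMap]
    simp
  · rw [mul_assoc, ExteriorAlgebra.ι, CliffordAlgebra.contractLeft_ι_mul, h,
      CliffordAlgebra.contractLeft_ι_mul, pow_succ]
    simp only [mul_add, sub_mul, smul_mul_assoc, mul_smul_comm, mul_assoc]
    module
  · rw [add_mul, map_add, h, h', map_add, add_mul, add_mul, smul_add]; abel

theorem contractLeft_mem_exteriorPower (e : Module.Dual ℝ V) {r : ℕ} {X : ExteriorAlgebra ℝ V}
    (hX : X ∈ ⋀[ℝ]^(r + 1) V) : CliffordAlgebra.contractLeft e X ∈ ⋀[ℝ]^r V := by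
  have key : ∀ {r : ℕ} {X : ExteriorAlgebra ℝ V}, X ∈ ⋀[ℝ]^r V →
      (r = 0 ∧ CliffordAlgebra.contractLeft e X = 0) ∨
        ∃ k, r = k + 1 ∧ CliffordAlgebra.contractLeft e X ∈ ⋀[ℝ]^k V := by
    intro r X hX
    induction r generalizing X with
    | zero =>
      rw [exteriorPower_zero_eq, Submodule.mem_one] at hX
      obtain ⟨c, rfl⟩ := hX
      exact Or.inl ⟨rfl, CliffordAlgebra.contractLeft_algebraMap (Q := (0 : QuadraticForm ℝ V)) e c⟩
    | succ r ih =>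
      refine Or.inr ⟨r, rfl, ?_⟩
      rw [exteriorPower_succ_eq] at hX
      refine Submodule.mul_induction_on hX ?_ (fun X Y h h' => by rw [map_add]; exact add_mem h h')
      rintro _ ⟨v, rfl⟩ n hn
      rw [ExteriorAlgebra.ι, CliffordAlgebra.contractLeft_ι_mul]
      refine sub_mem (Submodule.smul_mem _ _ hn) ?_
      rcases ih hn with ⟨-, h⟩ | ⟨k, rfl, h⟩
      · rw [h, mul_zero]; exact zero_mem _
      · exact ι_mul_mem_exteriorPower v h
  rcases key hX with ⟨h, -⟩ | ⟨k, hk, h⟩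
  · omega
  · obtain rfl : k = r := by omega
    exact h

theorem contractLeft_exteriorPower_zero (e : Module.Dual ℝ V) {X : ExteriorAlgebra ℝ V}
    (hX : X ∈ ⋀[ℝ]^0 V) : CliffordAlgebra.contractLeft e X = 0 := by
  rw [exteriorPower_zero_eq, Submodule.mem_one] at hX
  obtain ⟨c, rfl⟩ := hX
  exact CliffordAlgebra.contractLeft_algebraMap (Q := (0 : QuadraticForm ℝ V)) e c

theorem involute_exteriorPower {r : ℕ} {X : ExteriorAlgebra ℝ V} (hX : X ∈ ⋀[ℝ]^r V) :
    CliffordAlgebra.involute X = (-1 : ℝ) ^ r • X := by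
  refine exteriorPower_induction (C := fun r X => CliffordAlgebra.involute X = (-1 : ℝ) ^ r • X)
    (fun c => ?_) (fun r v X _ h => ?_) (fun r X Y h h' => ?_) hX
  · rw [AlgHom.commutes, pow_zero, one_smul]
  · rw [map_mul, ExteriorAlgebra.ι, CliffordAlgebra.involute_ι, h, pow_succ]
    simp only [neg_mul, mul_smul_comm]
    module
  · rw [map_add, h, h', smul_add]

theorem contractLeft_ιMulti (e : Module.Dual ℝ V) {k : ℕ} (v : Fin (k + 1) → V) :
    CliffordAlgebra.contractLeft e (ExteriorAlgebra.ιMulti ℝ (k + 1) v) =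
      ∑ i : Fin (k + 1), (-1 : ℝ) ^ (i : ℕ) • e (v i) • ExteriorAlgebra.ιMulti ℝ k (i.removeNth v) := by
  induction k with
  | zero =>
    rw [ExteriorAlgebra.ιMulti_succ_apply, ExteriorAlgebra.ι, CliffordAlgebra.contractLeft_ι_mul]
    simp
  | succ k ih =>
    rw [ExteriorAlgebra.ιMulti_succ_apply, ExteriorAlgebra.ι, CliffordAlgebra.contractLeft_ι_mul,
      ih, Fin.sum_univ_succ (n := k + 1), Finset.mul_sum, sub_eq_add_neg, ← Finset.sum_neg_distrib]
    congr 1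
    · simp [Fin.removeNth_zero, Matrix.vecTail, Fin.tail, Function.comp_def]
    · refine Finset.sum_congr rfl fun i _ => ?_
      have : ExteriorAlgebra.ιMulti ℝ (k + 1) (i.succ.removeNth v) =
          ExteriorAlgebra.ι ℝ (v 0) *
            ExteriorAlgebra.ιMulti ℝ k (i.removeNth (Matrix.vecTail v)) := by
        rw [ExteriorAlgebra.ιMulti_succ_apply]
        congr 2
        funext j
        simp [Matrix.vecTail, Fin.removeNth]
      rw [this, mul_smul_comm, mul_smul_comm, Fin.val_succ, pow_succ]
      simp only [Matrix.vecTail, Function.comp_apply]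
      rw [ExteriorAlgebra.ι]
      module

theorem contractLeft_ιMulti_zero (e : Module.Dual ℝ V) (v : Fin 0 → V) :
    CliffordAlgebra.contractLeft e (ExteriorAlgebra.ιMulti ℝ 0 v) = 0 := by
  rw [ExteriorAlgebra.ιMulti_zero_apply]; exact CliffordAlgebra.contractLeft_one (Q := (0 : QuadraticForm ℝ V)) e

end ExteriorAlgebra

section Insertion

variable {V : Type*} [AddCommGroup V] [Module ℝ V] [FiniteDimensional ℝ V]

@[simp] theorem insertionDerivation_algebraMap (Φ : V →ₗ[ℝ] V) (c : ℝ) :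
    insertionDerivation Φ (algebraMap ℝ _ c) = 0 := by
  simp only [insertionDerivation, LinearMap.sum_apply, LinearMap.comp_apply]
  refine Finset.sum_eq_zero fun i _ => ?_
  rw [CliffordAlgebra.contractLeft_algebraMap, map_zero]

theorem insertionDerivation_ι_mul (Φ : V →ₗ[ℝ] V) (v : V) (u : ExteriorAlgebra ℝ V) :
    insertionDerivation Φ (ExteriorAlgebra.ι ℝ v * u) =
      ExteriorAlgebra.ι ℝ (Φ v) * u + ExteriorAlgebra.ι ℝ v * insertionDerivation Φ u := by
  have hv : ExteriorAlgebra.ι ℝ (Φ v) * u = ∑ i, (Module.finBasis ℝ V).coord i v •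
      (ExteriorAlgebra.ι ℝ (Φ (Module.finBasis ℝ V i)) * u) := by
    conv_lhs => rw [← (Module.finBasis ℝ V).sum_repr v]
    simp only [map_sum, map_smul, Finset.sum_mul, smul_mul_assoc, Module.Basis.coord_apply]
  rw [hv]
  simp only [insertionDerivation, LinearMap.sum_apply, LinearMap.comp_apply,
    LinearMap.mulLeft_apply, Finset.mul_sum, ← Finset.sum_add_distrib]
  refine Finset.sum_congr rfl fun i _ => ?_
  have := CliffordAlgebra.contractLeft_ι_mul (Q := (0 : QuadraticForm ℝ V))
    ((Module.finBasis ℝ V).coord i) v u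
  rw [ExteriorAlgebra.ι, this, mul_sub, mul_smul_comm, sub_eq_add_neg]
  congr 1
  have hsw := ExteriorAlgebra.ι_add_mul_swap (R := ℝ) v (Φ (Module.finBasis ℝ V i))
  rw [← mul_assoc, ← mul_assoc, ← neg_mul]
  congr 1
  exact (eq_neg_of_add_eq_zero_left hsw).symm

theorem insertionDerivation_mul (Φ : V →ₗ[ℝ] V) (X u : ExteriorAlgebra ℝ V) :
    insertionDerivation Φ (X * u) =
      insertionDerivation Φ X * u + X * insertionDerivation Φ u := by
  refine exteriorAlgebra_induction (C := fun X => insertionDerivation Φ (X * u) =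
      insertionDerivation Φ X * u + X * insertionDerivation Φ u) (fun c => ?_) (fun v X h => ?_)
    (fun X Y h h' => ?_) X
  · rw [insertionDerivation_algebraMap, ← Algebra.smul_def, map_smul, zero_mul, zero_add,
      Algebra.smul_def]
  · rw [mul_assoc, insertionDerivation_ι_mul, h, insertionDerivation_ι_mul]
    simp only [mul_add, add_mul, mul_assoc]; abel
  · rw [add_mul, map_add, h, h', map_add, add_mul, add_mul]; abel

theorem insertionDerivation_one (Φ : V →ₗ[ℝ] V) : insertionDerivation Φ 1 = 0 := by
  simpa using insertionDerivation_algebraMap Φ 1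

theorem insertionDerivation_mem (Φ : V →ₗ[ℝ] V) {r : ℕ} {X : ExteriorAlgebra ℝ V}
    (hX : X ∈ ⋀[ℝ]^r V) : insertionDerivation Φ X ∈ ⋀[ℝ]^r V := by
  refine exteriorPower_induction (C := fun r X => insertionDerivation Φ X ∈ ⋀[ℝ]^r V)
    (fun c => ?_) (fun r v X hX h => ?_) (fun r X Y h h' => ?_) hX
  · rw [insertionDerivation_algebraMap]; exact zero_mem _
  · rw [insertionDerivation_ι_mul]
    exact add_mem (ι_mul_mem_exteriorPower _ hX) (ι_mul_mem_exteriorPower _ h)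
  · rw [map_add]; exact add_mem h h'

/-- Insertion derivations are intertwined by linear maps that intertwine the endomorphisms. -/
theorem map_insertionDerivation {W : Type*} [AddCommGroup W] [Module ℝ W] [FiniteDimensional ℝ W]
    {Φ : V →ₗ[ℝ] V} {Ψ : W →ₗ[ℝ] W} {L : V →ₗ[ℝ] W} (h : ∀ v, L (Φ v) = Ψ (L v))
    (u : ExteriorAlgebra ℝ V) : ExteriorAlgebra.map L (insertionDerivation Φ u) =
      insertionDerivation Ψ (ExteriorAlgebra.map L u) := by
  refine exteriorAlgebra_induction (C := fun u => ExteriorAlgebra.map L (insertionDerivation Φ u) =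
      insertionDerivation Ψ (ExteriorAlgebra.map L u)) (fun c => ?_) (fun v X hX => ?_)
    (fun X Y hX hY => ?_) u
  · rw [insertionDerivation_algebraMap, AlgHom.commutes, insertionDerivation_algebraMap, map_zero]
  · rw [insertionDerivation_ι_mul, map_add, map_mul, map_mul, map_mul, hX,
      ExteriorAlgebra.map_apply_ι, ExteriorAlgebra.map_apply_ι, insertionDerivation_ι_mul, h]
  · rw [map_add, map_add, map_add, map_add, hX, hY]

end Insertion

/-! ### Covectors as functionals on the exterior algebra -/

theorem lhom_ext_ιMulti {V W : Type*} [AddCommGroup V] [Module ℝ V] [AddCommGroup W] [Module ℝ W]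
    {l l' : ExteriorAlgebra ℝ V →ₗ[ℝ] W}
    (h : ∀ k (v : Fin k → V), l (ExteriorAlgebra.ιMulti ℝ k v) =
      l' (ExteriorAlgebra.ιMulti ℝ k v)) : l = l' :=
  ExteriorAlgebra.lhom_ext fun k => AlternatingMap.ext (h k)

section Covectors

variable {V : Type*} [AddCommGroup V] [Module ℝ V] [TopologicalSpace V]

theorem Covector.pairing_ιMulti (α : Covector V) {k : ℕ} (v : Fin k → V) :
    α.pairing (ExteriorAlgebra.ιMulti ℝ k v) = α k v := by
  rw [Covector.pairing, ExteriorAlgebra.liftAlternating_apply_ιMulti]; rfl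

theorem Covector.ext_pairing {α β : Covector V} (h : ∀ u, α.pairing u = β.pairing u) : α = β := by
  funext k
  ext v
  simpa [Covector.pairing_ιMulti] using h (ExteriorAlgebra.ιMulti ℝ k v)

/-- The pairing as a linear map in the covector. -/
def Covector.pairingₗ : Covector V →ₗ[ℝ] ExteriorAlgebra ℝ V →ₗ[ℝ] ℝ where
  toFun α := α.pairing
  map_add' α β := lhom_ext_ιMulti fun k v => by
    rw [LinearMap.add_apply]; simp only [Covector.pairing_ιMulti]; rfl
  map_smul' c α := lhom_ext_ιMulti fun k v => by
    rw [LinearMap.smul_apply]; simp only [Covector.pairing_ιMulti]; rfl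

theorem Covector.pairing_add (α β : Covector V) : (α + β).pairing = α.pairing + β.pairing :=
  map_add Covector.pairingₗ α β

theorem Covector.pairing_sub (α β : Covector V) : (α - β).pairing = α.pairing - β.pairing :=
  map_sub Covector.pairingₗ α β

theorem Covector.pairing_neg (α : Covector V) : (-α).pairing = -α.pairing :=
  map_neg Covector.pairingₗ α

theorem Covector.pairing_smul (c : ℝ) (α : Covector V) : (c • α).pairing = c • α.pairing :=
  map_smul Covector.pairingₗ c α

theorem Covector.pairing_zero : (0 : Covector V).pairing = 0 :=
  map_zero Covector.pairingₗ

/-- The pairing with a form of degree `k` vanishes on multivectors of other degrees. -/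
theorem Covector.pairing_eq_zero {α : Covector V} {k : ℤ} (hα : ∀ j : ℕ, (j : ℤ) ≠ k → α j = 0)
    {j : ℕ} (hj : (j : ℤ) ≠ k) {u : ExteriorAlgebra ℝ V} (hu : u ∈ ⋀[ℝ]^j V) :
    α.pairing u = 0 := by
  rw [← ExteriorAlgebra.ιMulti_span_fixedDegree] at hu
  have : Submodule.span ℝ (Set.range (ExteriorAlgebra.ιMulti ℝ j)) ≤ LinearMap.ker α.pairing := by
    rw [Submodule.span_le]
    rintro _ ⟨v, rfl⟩
    simp [Covector.pairing_ιMulti, hα j hj]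
  exact this hu

theorem Covector.eq_zero_of_pairing {α : Covector V} {j : ℕ}
    (h : ∀ u ∈ ⋀[ℝ]^j V, α.pairing u = 0) : α j = 0 := by
  ext v
  rw [← Covector.pairing_ιMulti]
  exact h _ (ιMulti_mem_exteriorPower v)

/-- Pull-back of a covector along a continuous linear map. -/
def Covector.comap {W : Type*} [AddCommGroup W] [Module ℝ W] [TopologicalSpace W]
    (α : Covector V) (L : W →L[ℝ] V) : Covector W := fun k => (α k).compContinuousLinearMap L

theorem Covector.pairing_comap {W : Type*} [AddCommGroup W] [Module ℝ W] [TopologicalSpace W]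
    (α : Covector V) (L : W →L[ℝ] V) (u : ExteriorAlgebra ℝ W) :
    (α.comap L).pairing u = α.pairing (ExteriorAlgebra.map (L : W →ₗ[ℝ] V) u) := by
  have : (α.comap L).pairing =
      α.pairing ∘ₗ (ExteriorAlgebra.map (L : W →ₗ[ℝ] V)).toLinearMap := by
    refine lhom_ext_ιMulti fun k v => ?_
    rw [Covector.pairing_ιMulti, LinearMap.comp_apply, AlgHom.toLinearMap_apply,
      ExteriorAlgebra.map_apply_ιMulti, Covector.pairing_ιMulti]
    rfl
  rw [this]; rfl

variable [IsTopologicalAddGroup V] [ContinuousSMul ℝ V] [T2Space V] [FiniteDimensional ℝ V]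

theorem Covector.pairing_contract (X : ExteriorAlgebra ℝ V) (α : Covector V)
    (u : ExteriorAlgebra ℝ V) : (α.contract X).pairing u = α.pairing (X * u) := by
  rw [Covector.contract, Covector.pairing_ofPairing]; rfl

theorem Covector.pairing_insert (Φ : V →ₗ[ℝ] V) (α : Covector V)
    (u : ExteriorAlgebra ℝ V) : (α.insert Φ).pairing u = α.pairing (insertionDerivation Φ u) := by
  rw [Covector.insert, Covector.pairing_ofPairing]; rfl

theorem Covector.contract_eq_zero_iff (X : ExteriorAlgebra ℝ V) (α : Covector V) :
    α.contract X = 0 ↔ ∀ u, α.pairing (X * u) = 0 := by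
  constructor
  · intro h u
    rw [← Covector.pairing_contract, h, Covector.pairing_zero]; rfl
  · intro h
    refine Covector.ext_pairing fun u => ?_
    rw [Covector.pairing_contract, h, Covector.pairing_zero]; rfl

/-- Contraction with an `r`-vector lowers the degree by `r`. -/
theorem Covector.contract_of_degree {α : Covector V} {k : ℤ}
    (hα : ∀ j : ℕ, (j : ℤ) ≠ k → α j = 0) {r : ℕ} {X : ExteriorAlgebra ℝ V} (hX : X ∈ ⋀[ℝ]^r V)
    {j : ℕ} (hj : (j : ℤ) ≠ k - r) : α.contract X j = 0 := by
  refine Covector.eq_zero_of_pairing fun u hu => ?_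
  rw [Covector.pairing_contract]
  refine Covector.pairing_eq_zero hα (j := r + j) ?_ (mul_mem_exteriorPower hX hu)
  push_cast; omega

end Covectors

end Multisymplectic

end

noncomputable section

namespace Multisymplectic

/-! ### Calculus of multivector fields and forms on a vector space -/

section LocalCalculus

variable {E : Type*} [NormedAddCommGroup E] [NormedSpace ℝ E] [FiniteDimensional ℝ E]

/-- The exterior algebra of a finite-dimensional space with the norm of its coordinates in the basis
`mvBasis`; all norms being equivalent, only the differential calculus that it gives matters. -/
instance instNormedExteriorAlgebra : NormedAddCommGroup (ExteriorAlgebra ℝ E) :=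
  NormedAddCommGroup.induced (ExteriorAlgebra ℝ E) (Finset (Fin (Module.finrank ℝ E)) → ℝ)
    (mvBasis E).equivFun (mvBasis E).equivFun.injective

instance instNormedSpaceExteriorAlgebra : NormedSpace ℝ (ExteriorAlgebra ℝ E) :=
  NormedSpace.induced ℝ (ExteriorAlgebra ℝ E) (Finset (Fin (Module.finrank ℝ E)) → ℝ)
    (mvBasis E).equivFun

instance instFiniteExteriorAlgebra : FiniteDimensional ℝ (ExteriorAlgebra ℝ E) :=
  Module.Basis.finiteDimensional_of_finite (mvBasis E)

/-- Left multiplication by a multivector, as a continuous bilinear map. -/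
def mvMulL (E : Type*) [NormedAddCommGroup E] [NormedSpace ℝ E] [FiniteDimensional ℝ E] :
    ExteriorAlgebra ℝ E →L[ℝ] ExteriorAlgebra ℝ E →L[ℝ] ExteriorAlgebra ℝ E :=
  LinearMap.toContinuousLinearMap
    (LinearMap.toContinuousLinearMap.toLinearMap ∘ₗ LinearMap.mul ℝ (ExteriorAlgebra ℝ E))

@[simp] theorem mvMulL_apply (X Y : ExteriorAlgebra ℝ E) : mvMulL E X Y = X * Y := rfl

/-- The pairing of a covector as a continuous functional. -/
def Covector.toDual (α : Covector E) : ExteriorAlgebra ℝ E →L[ℝ] ℝ :=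
  LinearMap.toContinuousLinearMap α.pairing

@[simp] theorem Covector.toDual_apply (α : Covector E) (u : ExteriorAlgebra ℝ E) :
    α.toDual u = α.pairing u := rfl

theorem mvDeriv_eq {X : E → ExteriorAlgebra ℝ E} {x : E} (hX : DifferentiableAt ℝ X x) (v : E) :
    mvDeriv X x v = fderiv ℝ X x v := by
  have h : ∀ s, fderiv ℝ (fun y => (mvBasis E).repr (X y) s) x v =
      (mvBasis E).repr (fderiv ℝ X x v) s := fun s => by
    have := ((LinearMap.toContinuousLinearMap ((mvBasis E).coord s)).hasFDerivAt.comp x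
      hX.hasFDerivAt).fderiv
    change fderiv ℝ ((LinearMap.toContinuousLinearMap ((mvBasis E).coord s)) ∘ X) x v = _
    rw [this]; rfl
  rw [mvDeriv]
  simp only [h]
  exact (mvBasis E).sum_repr _

theorem contDiffOn_mv_iff {X : E → ExteriorAlgebra ℝ E} {s : Set E} {n : WithTop ℕ∞} :
    (∀ t, ContDiffOn ℝ n (fun y => (mvBasis E).repr (X y) t) s) ↔ ContDiffOn ℝ n X s := by
  constructor
  · intro h
    have : X = fun y => ∑ t, (mvBasis E).repr (X y) t • mvBasis E t :=
      funext fun y => ((mvBasis E).sum_repr _).symm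
    rw [this]
    exact ContDiffOn.sum fun t _ => (h t).smul contDiffOn_const
  · intro h t
    exact (LinearMap.toContinuousLinearMap ((mvBasis E).coord t)).contDiff.comp_contDiffOn h

theorem contDiffOn_dual_iff {W : Type*} [NormedAddCommGroup W] [NormedSpace ℝ W]
    [FiniteDimensional ℝ W] {F : Type*} [NormedAddCommGroup F] [NormedSpace ℝ F]
    {a : F → W →L[ℝ] ℝ} {s : Set F} {n : WithTop ℕ∞} :
    ContDiffOn ℝ n a s ↔ ∀ u, ContDiffOn ℝ n (fun y => a y u) s :=
  contDiffOn_clm_apply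

theorem contDiffOn_alternating_iff {F : Type*} [NormedAddCommGroup F] [NormedSpace ℝ F] {k : ℕ}
    {a : F → E [⋀^Fin k]→L[ℝ] ℝ} {s : Set F} {n : WithTop ℕ∞} :
    ContDiffOn ℝ n a s ↔ ∀ v, ContDiffOn ℝ n (fun y => a y v) s := by
  constructor
  · intro h v
    let ev : (E [⋀^Fin k]→L[ℝ] ℝ) →ₗ[ℝ] ℝ :=
      { toFun := fun a => a v, map_add' := fun _ _ => rfl, map_smul' := fun _ _ => rfl }
    exact (LinearMap.toContinuousLinearMap ev).contDiff.comp_contDiffOn h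
  · intro h
    obtain ⟨R, hR⟩ := LinearMap.exists_leftInverse_of_injective (altCoords (V := E) k)
      (LinearMap.ker_eq_bot.2 (altCoords_injective k))
    have h1 : ContDiffOn ℝ n (fun y => altCoords k (a y)) s :=
      contDiffOn_pi.2 fun t => h _
    refine ((LinearMap.toContinuousLinearMap R).contDiff.comp_contDiffOn h1).congr fun y _ => ?_
    exact (LinearMap.congr_fun hR (a y)).symm

theorem differentiableAt_alternating_iff {F : Type*} [NormedAddCommGroup F] [NormedSpace ℝ F]
    {k : ℕ} {a : F → E [⋀^Fin k]→L[ℝ] ℝ} {x : F} :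
    DifferentiableAt ℝ a x ↔ ∀ v, DifferentiableAt ℝ (fun y => a y v) x := by
  constructor
  · intro h v
    let ev : (E [⋀^Fin k]→L[ℝ] ℝ) →ₗ[ℝ] ℝ :=
      { toFun := fun a => a v, map_add' := fun _ _ => rfl, map_smul' := fun _ _ => rfl }
    exact (LinearMap.toContinuousLinearMap ev).differentiableAt.comp x h
  · intro h
    obtain ⟨R, hR⟩ := LinearMap.exists_leftInverse_of_injective (altCoords (V := E) k)
      (LinearMap.ker_eq_bot.2 (altCoords_injective k))
    have h1 : DifferentiableAt ℝ (fun y => altCoords k (a y)) x :=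
      differentiableAt_pi.2 fun t => h _
    refine ((LinearMap.toContinuousLinearMap R).differentiableAt.comp x h1).congr_of_eventuallyEq
      (Eventually.of_forall fun y => ?_)
    exact (LinearMap.congr_fun hR (a y)).symm

/-- The components of a form are smooth if and only if the functional on multivectors is. -/
theorem contDiffOn_toDual_iff {F : Type*} [NormedAddCommGroup F] [NormedSpace ℝ F]
    {α : F → Covector E} {s : Set F} {n : WithTop ℕ∞} :
    ContDiffOn ℝ n (fun y => (α y).toDual) s ↔ ∀ k, ContDiffOn ℝ n (fun y => α y k) s := by
  rw [contDiffOn_dual_iff]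
  constructor
  · intro h k
    refine contDiffOn_alternating_iff.2 fun v => ?_
    simpa [Covector.pairing_ιMulti] using h (ExteriorAlgebra.ιMulti ℝ k v)
  · intro h u
    have hu : u ∈ Submodule.span ℝ (Set.range fun x : Σ k, (Fin k → E) =>
        ExteriorAlgebra.ιMulti ℝ x.1 x.2) := by rw [ExteriorAlgebra.ιMulti_span]; trivial
    refine Submodule.span_induction (p := fun u _ => ContDiffOn ℝ n (fun y => (α y).toDual u) s)
      ?_ ?_ ?_ ?_ hu
    · rintro _ ⟨⟨k, v⟩, rfl⟩
      simpa [Covector.pairing_ιMulti] using contDiffOn_alternating_iff.1 (h k) v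
    · simpa using contDiffOn_const
    · intro u w _ _ h h'
      simpa using h.add h'
    · intro c u _ h
      simpa using contDiffOn_const.mul h

/-- The exterior derivative in terms of functionals on multivectors:
`(da)(u) = ∑ₖ (∂ₖ a)(eᵏ ⌋ u)`. -/
def dualD (a : E → ExteriorAlgebra ℝ E →L[ℝ] ℝ) (x : E) (u : ExteriorAlgebra ℝ E) : ℝ :=
  ∑ k, fderiv ℝ a x (Module.finBasis ℝ E k)
    (CliffordAlgebra.contractLeft ((Module.finBasis ℝ E).coord k) u)

theorem dualD_add_right (a : E → ExteriorAlgebra ℝ E →L[ℝ] ℝ) (x : E)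
    (u w : ExteriorAlgebra ℝ E) : dualD a x (u + w) = dualD a x u + dualD a x w := by
  simp [dualD, Finset.sum_add_distrib]

theorem dualD_smul_right (a : E → ExteriorAlgebra ℝ E →L[ℝ] ℝ) (x : E) (c : ℝ)
    (u : ExteriorAlgebra ℝ E) : dualD a x (c • u) = c * dualD a x u := by
  simp [dualD, Finset.mul_sum]

/-- The degreewise exterior derivative of Mathlib is `dualD` on functionals. -/
theorem pairing_extDerivTotal {α : E → Covector E} {x : E}
    (hα : ∀ k, DifferentiableAt ℝ (fun y => α y k) x)
    (hα' : DifferentiableAt ℝ (fun y => (α y).toDual) x) (u : ExteriorAlgebra ℝ E) :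
    (extDerivTotal α x).pairing u = dualD (fun y => (α y).toDual) x u := by
  let D : ExteriorAlgebra ℝ E →ₗ[ℝ] ℝ :=
    { toFun := dualD (fun y => (α y).toDual) x
      map_add' := dualD_add_right _ x
      map_smul' := dualD_smul_right _ x }
  have : (extDerivTotal α x).pairing = D := by
    refine lhom_ext_ιMulti fun k v => ?_
    rw [Covector.pairing_ιMulti]
    change _ = dualD _ x _
    cases k with
    | zero =>
      simp only [dualD, contractLeft_ιMulti_zero, map_zero, Finset.sum_const_zero]
      rfl
    | succ k =>
      have hc : ∀ (i : Fin (k + 1)) (w : E),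
          fderiv ℝ (fun y => (α y).toDual) x w (ExteriorAlgebra.ιMulti ℝ k (i.removeNth v)) =
            fderiv ℝ (fun y => α y k) x w (i.removeNth v) := by
        intro i w
        let ev : (E [⋀^Fin k]→L[ℝ] ℝ) →ₗ[ℝ] ℝ :=
          { toFun := fun a => a (i.removeNth v), map_add' := fun _ _ => rfl,
            map_smul' := fun _ _ => rfl }
        have h1 := ((LinearMap.toContinuousLinearMap ev).hasFDerivAt.comp x
          (hα k).hasFDerivAt)
        have h2 := hα'.hasFDerivAt.clm_apply
          (hasFDerivAt_const (ExteriorAlgebra.ιMulti ℝ k (i.removeNth v)) x)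
        have h3 : (fun y => (α y).toDual (ExteriorAlgebra.ιMulti ℝ k (i.removeNth v))) =
            (LinearMap.toContinuousLinearMap ev) ∘ fun y => α y k := by
          funext y; rw [Covector.toDual_apply, Covector.pairing_ιMulti]; rfl
        rw [h3] at h2
        have h4 := h2.unique h1
        have h5 := congrArg (fun L : E →L[ℝ] ℝ => L w) h4
        simpa [ev] using h5
      change extDeriv (fun y => α y k) x v = _
      rw [extDeriv, ContinuousAlternatingMap.alternatizeUncurryFin_apply]
      simp only [dualD, contractLeft_ιMulti, map_sum, map_smul, hc]
      rw [Finset.sum_comm]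
      refine Finset.sum_congr rfl fun i _ => ?_
      conv_lhs => rw [← (Module.finBasis ℝ E).sum_repr (v i)]
      rw [map_sum, ContinuousAlternatingMap.sum_apply, Finset.smul_sum]
      refine Finset.sum_congr rfl fun j _ => ?_
      simp [Module.Basis.coord_apply]
  rw [this]; rfl

/-- The interior product in terms of functionals on multivectors. -/
def dualContract (X : E → ExteriorAlgebra ℝ E) (a : E → ExteriorAlgebra ℝ E →L[ℝ] ℝ) (y : E) :
    ExteriorAlgebra ℝ E →L[ℝ] ℝ := (a y).comp (mvMulL E (X y))

theorem dualContract_apply (X : E → ExteriorAlgebra ℝ E) (a : E → ExteriorAlgebra ℝ E →L[ℝ] ℝ)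
    (y : E) (u : ExteriorAlgebra ℝ E) : dualContract X a y u = a y (X y * u) := rfl

theorem hasFDerivAt_mvMulL {X : E → ExteriorAlgebra ℝ E} {x : E} (hX : DifferentiableAt ℝ X x) :
    HasFDerivAt (fun y => mvMulL E (X y)) ((mvMulL E).comp (fderiv ℝ X x)) x :=
  (mvMulL E).hasFDerivAt.comp x hX.hasFDerivAt

theorem differentiableAt_dualContract {X : E → ExteriorAlgebra ℝ E}
    {a : E → ExteriorAlgebra ℝ E →L[ℝ] ℝ} {x : E} (hX : DifferentiableAt ℝ X x)
    (ha : DifferentiableAt ℝ a x) : DifferentiableAt ℝ (dualContract X a) x :=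
  (ha.hasFDerivAt.clm_comp (hasFDerivAt_mvMulL hX)).differentiableAt

theorem contDiffOn_dualContract {X : E → ExteriorAlgebra ℝ E}
    {a : E → ExteriorAlgebra ℝ E →L[ℝ] ℝ} {s : Set E} {n : WithTop ℕ∞} (hX : ContDiffOn ℝ n X s)
    (ha : ContDiffOn ℝ n a s) : ContDiffOn ℝ n (dualContract X a) s :=
  ha.clm_comp ((mvMulL E).contDiff.comp_contDiffOn hX)

theorem fderiv_dualContract {X : E → ExteriorAlgebra ℝ E}
    {a : E → ExteriorAlgebra ℝ E →L[ℝ] ℝ} {x : E} (hX : DifferentiableAt ℝ X x)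
    (ha : DifferentiableAt ℝ a x) (w : E) (u : ExteriorAlgebra ℝ E) :
    fderiv ℝ (dualContract X a) x w u =
      fderiv ℝ a x w (X x * u) + a x (fderiv ℝ X x w * u) := by
  have h := (ha.hasFDerivAt.clm_comp (hasFDerivAt_mvMulL hX)).fderiv
  change fderiv ℝ (fun y => (a y).comp (mvMulL E (X y))) x w u = _
  rw [h]
  simp [add_comm]

theorem fderiv_mem_exteriorPower {X : E → ExteriorAlgebra ℝ E} {x : E} {r : ℕ}
    (hX : DifferentiableAt ℝ X x) (hr : ∀ᶠ y in 𝓝 x, X y ∈ ⋀[ℝ]^r E) (w : E) :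
    fderiv ℝ X x w ∈ ⋀[ℝ]^r E := by
  -- the projection to the complement of the subspace annihilates `X`
  obtain ⟨q, hq⟩ := (⋀[ℝ]^r E : Submodule ℝ (ExteriorAlgebra ℝ E)).exists_isCompl
  let p := Submodule.projectionOnto q _ hq.symm
  have h1 := (LinearMap.toContinuousLinearMap p).hasFDerivAt.comp x hX.hasFDerivAt
  have h2 : (LinearMap.toContinuousLinearMap p) ∘ X =ᶠ[𝓝 x] fun _ => 0 := by
    filter_upwards [hr] with y hy
    exact (Submodule.projectionOnto_apply_eq_zero_iff hq.symm).2 hy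
  have h3 := (h1.congr_of_eventuallyEq h2.symm).unique (hasFDerivAt_const _ _)
  have h4 : p (fderiv ℝ X x w) = 0 := by simpa using congrArg (fun L => L w) h3
  exact (Submodule.projectionOnto_apply_eq_zero_iff hq.symm).1 h4

/-- The interior product with the Schouten bracket is the graded commutator of a Lie derivative and
an interior product. The second derivatives do not enter, and the derivatives of the form cancel. -/
theorem dual_schoutenLocal {X Y : E → ExteriorAlgebra ℝ E} {a : E → ExteriorAlgebra ℝ E →L[ℝ] ℝ}
    {x : E} {r s : ℕ} (hr : 1 ≤ r) (hX : DifferentiableAt ℝ X x) (hY : DifferentiableAt ℝ Y x)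
    (ha : DifferentiableAt ℝ a x) (hXr : ∀ᶠ y in 𝓝 x, X y ∈ ⋀[ℝ]^r E)
    (hYs : ∀ᶠ y in 𝓝 x, Y y ∈ ⋀[ℝ]^s E) (u : ExteriorAlgebra ℝ E) :
    a x (schoutenLocal X Y x * u) =
      (-1 : ℝ) ^ ((r - 1) * s) * (dualD (dualContract X (dualContract Y a)) x u -
          (-1 : ℝ) ^ r * dualD (dualContract Y a) x (X x * u)) -
        (dualD (dualContract X a) x (Y x * u) - (-1 : ℝ) ^ r * dualD a x (X x * (Y x * u))) := by
  obtain ⟨q, rfl⟩ : ∃ q, r = q + 1 := ⟨r - 1, by omega⟩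
  simp only [schoutenLocal, dualD, Finset.sum_mul, map_sum, Finset.mul_sum,
    ← Finset.sum_sub_distrib]
  refine Finset.sum_congr rfl fun k _ => ?_
  have hYa := differentiableAt_dualContract hY ha
  set e := (Module.finBasis ℝ E).coord k
  set w := Module.finBasis ℝ E k
  simp only [fderiv_dualContract hX hYa, fderiv_dualContract hY ha, fderiv_dualContract hX ha,
    dualContract_apply, mvDeriv_eq hX, mvDeriv_eq hY]
  have dX := hXr.self_of_nhds
  have dY := hYs.self_of_nhds
  have dX' := fderiv_mem_exteriorPower hX hXr w
  have dY' := fderiv_mem_exteriorPower hY hYs w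
  have dc := contractLeft_mem_exteriorPower e dX
  rw [involute_exteriorPower dc, contractLeft_mul e dX, contractLeft_mul e dX,
    contractLeft_mul e dY]
  -- `Y` and its derivative are moved past the factors that come from `X`.
  have c1 : ∀ v, Y x * (X x * v) = (-1 : ℝ) ^ (s * q + s) • (X x * (Y x * v)) := fun v => by
    rw [← mul_assoc, mul_comm_exteriorPower dY dX, smul_mul_assoc, mul_assoc, mul_add_one]
  have c2 : ∀ v, Y x * (CliffordAlgebra.contractLeft e (X x) * v) =
      (-1 : ℝ) ^ (s * q) • (CliffordAlgebra.contractLeft e (X x) * (Y x * v)) := fun v => by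
    rw [← mul_assoc, mul_comm_exteriorPower dY dc, smul_mul_assoc, mul_assoc]
  have c3 : ∀ v, Y x * (fderiv ℝ X x w * v) =
      (-1 : ℝ) ^ (s * q + s) • (fderiv ℝ X x w * (Y x * v)) := fun v => by
    rw [← mul_assoc, mul_comm_exteriorPower dY dX', smul_mul_assoc, mul_assoc, mul_add_one]
  have c4 : ∀ v, fderiv ℝ Y x w * (CliffordAlgebra.contractLeft e (X x) * v) =
      (-1 : ℝ) ^ (s * q) • (CliffordAlgebra.contractLeft e (X x) * (fderiv ℝ Y x w * v)) :=
    fun v => by rw [← mul_assoc, mul_comm_exteriorPower dY' dc, smul_mul_assoc, mul_assoc]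
  simp only [mul_add, sub_mul, mul_smul_comm, smul_mul_assoc, c1, c2, c3, c4, map_add,
    map_sub, map_smul, smul_eq_mul, mul_assoc]
  have e2 : (-1 : ℝ) ^ ((q + 1 - 1) * s) = (-1) ^ (s * q) := by rw [Nat.add_sub_cancel, mul_comm]
  rw [e2, pow_succ, pow_add]
  -- The remaining signs depend only on the parities of `s * q`, `q` and `s`.
  rcases neg_one_pow_eq_or ℝ (s * q) with h1 | h1 <;> rcases neg_one_pow_eq_or ℝ q with h2 | h2 <;>
  rcases neg_one_pow_eq_or ℝ s with h3 | h3 <;> rw [h1, h2, h3] <;> ring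

theorem schoutenLocal_mem {X Y : E → ExteriorAlgebra ℝ E} {x : E} {r s : ℕ} (hr : 1 ≤ r)
    (hX : DifferentiableAt ℝ X x) (hY : DifferentiableAt ℝ Y x)
    (hXr : ∀ᶠ y in 𝓝 x, X y ∈ ⋀[ℝ]^r E) (hYs : ∀ᶠ y in 𝓝 x, Y y ∈ ⋀[ℝ]^s E) :
    schoutenLocal X Y x ∈ ⋀[ℝ]^(r + s - 1) E := by
  obtain ⟨q, rfl⟩ : ∃ q, r = q + 1 := ⟨r - 1, by omega⟩
  refine Submodule.sum_mem _ fun k _ => ?_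
  rw [mvDeriv_eq hX, mvDeriv_eq hY]
  have dc := contractLeft_mem_exteriorPower ((Module.finBasis ℝ E).coord k) hXr.self_of_nhds
  rw [involute_exteriorPower dc]
  have h : q + 1 + s - 1 = q + s := by omega
  rw [h]
  refine sub_mem (mul_mem_exteriorPower (Submodule.smul_mem _ _ dc)
    (fderiv_mem_exteriorPower hY hYs _)) ?_
  cases s with
  | zero =>
    rw [contractLeft_exteriorPower_zero _ hYs.self_of_nhds, mul_zero]; exact zero_mem _
  | succ s =>
    rw [show q + (s + 1) = (q + 1) + s by omega]
    exact mul_mem_exteriorPower (fderiv_mem_exteriorPower hX hXr _)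
      (contractLeft_mem_exteriorPower _ hYs.self_of_nhds)

theorem contDiffOn_schoutenLocal {X Y : E → ExteriorAlgebra ℝ E} {s : Set E} (hs : IsOpen s)
    (hX : ContDiffOn ℝ ∞ X s) (hY : ContDiffOn ℝ ∞ Y s) :
    ContDiffOn ℝ ∞ (schoutenLocal X Y) s := by
  have dX : ∀ w, ContDiffOn ℝ ∞ (fun x => fderiv ℝ X x w) s := fun w =>
    (hX.fderiv_of_isOpen hs (by simp)).clm_apply contDiffOn_const
  have dY : ∀ w, ContDiffOn ℝ ∞ (fun x => fderiv ℝ Y x w) s := fun w =>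
    (hY.fderiv_of_isOpen hs (by simp)).clm_apply contDiffOn_const
  have hmul : ∀ {A B : E → ExteriorAlgebra ℝ E}, ContDiffOn ℝ ∞ A s → ContDiffOn ℝ ∞ B s →
      ContDiffOn ℝ ∞ (fun x => A x * B x) s := fun {A B} hA hB =>
    ((mvMulL E).contDiff.comp_contDiffOn hA).clm_apply hB
  have hlin : ∀ (L : ExteriorAlgebra ℝ E →ₗ[ℝ] ExteriorAlgebra ℝ E) {A : E → ExteriorAlgebra ℝ E},
      ContDiffOn ℝ ∞ A s → ContDiffOn ℝ ∞ (fun x => L (A x)) s := fun L {A} hA =>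
    (LinearMap.toContinuousLinearMap L).contDiff.comp_contDiffOn hA
  have heq : ∀ x ∈ s, schoutenLocal X Y x = ∑ k, (CliffordAlgebra.involute
        (CliffordAlgebra.contractLeft ((Module.finBasis ℝ E).coord k) (X x)) *
      fderiv ℝ Y x (Module.finBasis ℝ E k) -
    fderiv ℝ X x (Module.finBasis ℝ E k) *
      CliffordAlgebra.contractLeft ((Module.finBasis ℝ E).coord k) (Y x)) := fun x hx => by
    have h1 := ((hX.contDiffAt (hs.mem_nhds hx)).differentiableAt (by simp))
    have h2 := ((hY.contDiffAt (hs.mem_nhds hx)).differentiableAt (by simp))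
    simp only [schoutenLocal, mvDeriv_eq h1, mvDeriv_eq h2]
  refine ContDiffOn.congr (ContDiffOn.sum fun k _ => ContDiffOn.sub (hmul ?_ (dY _))
    (hmul (dX _) ?_)) heq
  · exact hlin (CliffordAlgebra.involute.toLinearMap ∘ₗ
      CliffordAlgebra.contractLeft ((Module.finBasis ℝ E).coord k)) hX
  · exact hlin (CliffordAlgebra.contractLeft ((Module.finBasis ℝ E).coord k)) hY

end LocalCalculus

end Multisymplectic

end

noncomputable section

namespace Multisymplectic

/-! ### Naturality of the local calculus -/

section Naturality

variable {E : Type*} [NormedAddCommGroup E] [NormedSpace ℝ E] [FiniteDimensional ℝ E]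

theorem toDual_ofPairing (l : ExteriorAlgebra ℝ E →L[ℝ] ℝ) :
    (Covector.ofPairing (l : ExteriorAlgebra ℝ E →ₗ[ℝ] ℝ)).toDual = l := by
  refine ContinuousLinearMap.ext fun u => ?_
  rw [Covector.toDual_apply, Covector.pairing_ofPairing]; rfl

theorem differentiableAt_toDual_iff {F : Type*} [NormedAddCommGroup F] [NormedSpace ℝ F]
    {α : F → Covector E} {x : F} :
    DifferentiableAt ℝ (fun y => (α y).toDual) x ↔
      ∀ k, DifferentiableAt ℝ (fun y => α y k) x := by
  have hclm : DifferentiableAt ℝ (fun y => (α y).toDual) x ↔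
      ∀ u, DifferentiableAt ℝ (fun y => (α y).toDual u) x :=
    ⟨fun h u => h.clm_apply (differentiableAt_const u), fun h => by
      have : (fun y => (α y).toDual) = fun y => ∑ t, (α y).toDual (mvBasis E t) •
          LinearMap.toContinuousLinearMap ((mvBasis E).coord t) := funext fun y =>
        ContinuousLinearMap.coe_injective ((mvBasis E).ext fun t => by
          simp)
      rw [this]
      exact DifferentiableAt.fun_sum fun t _ => (h _).smul_const _⟩
  rw [hclm]
  constructor
  · intro h k
    refine differentiableAt_alternating_iff.2 fun v => ?_
    simpa [Covector.pairing_ιMulti] using h (ExteriorAlgebra.ιMulti ℝ k v)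
  · intro h u
    have hu : u ∈ Submodule.span ℝ (Set.range fun x : Σ k, (Fin k → E) =>
        ExteriorAlgebra.ιMulti ℝ x.1 x.2) := by rw [ExteriorAlgebra.ιMulti_span]; trivial
    refine Submodule.span_induction
      (p := fun u _ => DifferentiableAt ℝ (fun y => (α y).toDual u) x) ?_ ?_ ?_ ?_ hu
    · rintro _ ⟨⟨k, v⟩, rfl⟩
      simpa [Covector.pairing_ιMulti] using differentiableAt_alternating_iff.1 (h k) v
    · simp
    · intro u w _ _ h h'
      simpa using DifferentiableAt.fun_add h h'
    · intro c u _ h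
      simpa using h.const_mul c

/-- The functorial action of a linear map on multivectors, as a continuous linear map. -/
def mvMap {F : Type*} [NormedAddCommGroup F] [NormedSpace ℝ F] [FiniteDimensional ℝ F]
    (L : E →L[ℝ] F) : ExteriorAlgebra ℝ E →L[ℝ] ExteriorAlgebra ℝ F :=
  LinearMap.toContinuousLinearMap (ExteriorAlgebra.map (L : E →ₗ[ℝ] F)).toLinearMap

@[simp] theorem mvMap_apply {F : Type*} [NormedAddCommGroup F] [NormedSpace ℝ F]
    [FiniteDimensional ℝ F] (L : E →L[ℝ] F) (u : ExteriorAlgebra ℝ E) :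
    mvMap L u = ExteriorAlgebra.map (L : E →ₗ[ℝ] F) u := rfl

theorem mvMap_comp {F G : Type*} [NormedAddCommGroup F] [NormedSpace ℝ F]
    [FiniteDimensional ℝ F] [NormedAddCommGroup G] [NormedSpace ℝ G]
    [FiniteDimensional ℝ G] (K : F →L[ℝ] G) (L : E →L[ℝ] F) (u : ExteriorAlgebra ℝ E) :
    mvMap K (mvMap L u) = mvMap (K.comp L) u := by
  have := ExteriorAlgebra.map_comp_map (L : E →ₗ[ℝ] F) (K : F →ₗ[ℝ] G)
  exact congrArg (fun f => f u) this

theorem mvMap_id (u : ExteriorAlgebra ℝ E) : mvMap (ContinuousLinearMap.id ℝ E) u = u := by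
  have := ExteriorAlgebra.map_id (R := ℝ) (M := E)
  exact congrArg (fun f => f u) this

/-- The action on multivectors depends smoothly on the linear map. -/
theorem contDiff_mvMap {F : Type*} [NormedAddCommGroup F] [NormedSpace ℝ F]
    [FiniteDimensional ℝ F] {n : WithTop ℕ∞} :
    ContDiff ℝ n (fun L : E →L[ℝ] F => mvMap L) := by
  refine contDiff_clm_apply_iff.2 fun u => ?_
  refine exteriorAlgebra_induction
    (C := fun u => ContDiff ℝ n (fun L : E →L[ℝ] F => mvMap L u)) (fun c => ?_) (fun v u h => ?_)
    (fun u w h h' => ?_) u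
  · simpa using contDiff_const
  · have h1 : ContDiff ℝ n fun L : E →L[ℝ] F => ExteriorAlgebra.ι ℝ (L v) :=
      (LinearMap.toContinuousLinearMap (ExteriorAlgebra.ι ℝ : F →ₗ[ℝ] _)).contDiff.comp
        (contDiff_id.clm_apply contDiff_const)
    have h2 := ((mvMulL F).contDiff.comp h1).clm_apply h
    simpa using h2
  · simpa using h.add h'

/-- Naturality of the exterior derivative. -/
theorem dualD_comp {F : Type*} [NormedAddCommGroup F] [NormedSpace ℝ F] [FiniteDimensional ℝ F]
    {τ : E → F} {a : E → ExteriorAlgebra ℝ E →L[ℝ] ℝ}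
    {b : F → ExteriorAlgebra ℝ F →L[ℝ] ℝ} {x : E} (hτ : ContDiffAt ℝ 2 τ x)
    (hb : DifferentiableAt ℝ b (τ x))
    (hab : ∀ᶠ y in 𝓝 x, a y = (b (τ y)).comp (mvMap (fderiv ℝ τ y))) (u : ExteriorAlgebra ℝ E) :
    dualD a x u = dualD b (τ x) (mvMap (fderiv ℝ τ x) u) := by
  let β : F → Covector F := fun y => Covector.ofPairing (b y : ExteriorAlgebra ℝ F →ₗ[ℝ] ℝ)
  let α : E → Covector E := fun y => (β (τ y)).comap (fderiv ℝ τ y)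
  have hβ : (fun y => (β y).toDual) = b := funext fun y => toDual_ofPairing _
  have hα : (fun y => (α y).toDual) =ᶠ[𝓝 x] a := by
    filter_upwards [hab] with y hy
    refine ContinuousLinearMap.ext fun u => ?_
    rw [hy, Covector.toDual_apply, Covector.pairing_comap, Covector.pairing_ofPairing]
    rfl
  have hτd : DifferentiableAt ℝ τ x := hτ.differentiableAt (by simp)
  have hda : DifferentiableAt ℝ a x := by
    have h1 : ContDiffAt ℝ 1 (fderiv ℝ τ) x := hτ.fderiv_right (by norm_num)
    have h2 : DifferentiableAt ℝ (fun y => mvMap (fderiv ℝ τ y)) x :=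
      (contDiff_mvMap (n := 1)).contDiffAt.differentiableAt (by simp) |>.comp x
        (h1.differentiableAt (by simp))
    have h3 : DifferentiableAt ℝ (fun y => b (τ y)) x := hb.comp x hτd
    have := h3.hasFDerivAt.clm_comp h2.hasFDerivAt
    exact this.differentiableAt.congr_of_eventuallyEq hab
  have hdα : DifferentiableAt ℝ (fun y => (α y).toDual) x := hda.congr_of_eventuallyEq hα
  have hdα' := differentiableAt_toDual_iff.1 hdα
  have hdβ : DifferentiableAt ℝ (fun y => (β y).toDual) (τ x) := hβ ▸ hb
  have hdβ' := differentiableAt_toDual_iff.1 hdβ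
  have e1 : dualD a x u = (extDerivTotal α x).pairing u := by
    rw [pairing_extDerivTotal hdα' hdα, dualD, dualD, hα.fderiv_eq]
  have e2 : dualD b (τ x) (mvMap (fderiv ℝ τ x) u) =
      ((extDerivTotal β (τ x)).comap (fderiv ℝ τ x)).pairing u := by
    rw [Covector.pairing_comap, pairing_extDerivTotal hdβ' hdβ, hβ]; rfl
  rw [e1, e2]
  congr 1
  congr 1
  funext k
  cases k with
  | zero => rfl
  | succ k => exact extDeriv_pullback (hdβ' k) hτ (by simp)

/-- Naturality of the Schouten bracket. -/
theorem schoutenLocal_comp {τ : E → E} {X Y X' Y' : E → ExteriorAlgebra ℝ E} {x : E} {r s : ℕ}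
    (hr : 1 ≤ r) (hτ : ContDiffAt ℝ 2 τ x)
    (hX : DifferentiableAt ℝ X x) (hY : DifferentiableAt ℝ Y x)
    (hX' : DifferentiableAt ℝ X' (τ x)) (hY' : DifferentiableAt ℝ Y' (τ x))
    (hXr : ∀ᶠ y in 𝓝 x, X y ∈ ⋀[ℝ]^r E) (hYs : ∀ᶠ y in 𝓝 x, Y y ∈ ⋀[ℝ]^s E)
    (hXr' : ∀ᶠ y in 𝓝 (τ x), X' y ∈ ⋀[ℝ]^r E) (hYs' : ∀ᶠ y in 𝓝 (τ x), Y' y ∈ ⋀[ℝ]^s E)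
    (hXX : ∀ᶠ y in 𝓝 x, X' (τ y) = mvMap (fderiv ℝ τ y) (X y))
    (hYY : ∀ᶠ y in 𝓝 x, Y' (τ y) = mvMap (fderiv ℝ τ y) (Y y)) :
    schoutenLocal X' Y' (τ x) = mvMap (fderiv ℝ τ x) (schoutenLocal X Y x) := by
  refine (mvBasis E).ext_elem fun t => ?_
  -- The identity for contractions determines the bracket when it is tested against constant
  -- functionals, whose pull-backs by `τ` are natural for `d`.
  let l : ExteriorAlgebra ℝ E →L[ℝ] ℝ := LinearMap.toContinuousLinearMap ((mvBasis E).coord t)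
  let b : E → ExteriorAlgebra ℝ E →L[ℝ] ℝ := fun _ => l
  let a : E → ExteriorAlgebra ℝ E →L[ℝ] ℝ := fun y => (b (τ y)).comp (mvMap (fderiv ℝ τ y))
  have hb : ∀ y, DifferentiableAt ℝ b y := fun y => differentiableAt_const _
  have hτd : DifferentiableAt ℝ τ x := hτ.differentiableAt (by simp)
  have ha : DifferentiableAt ℝ a x := by
    have h1 : ContDiffAt ℝ 1 (fderiv ℝ τ) x := hτ.fderiv_right (by norm_num)
    have h2 : DifferentiableAt ℝ (fun y => mvMap (fderiv ℝ τ y)) x :=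
      (contDiff_mvMap (n := 1)).contDiffAt.differentiableAt (by simp) |>.comp x
        (h1.differentiableAt (by simp))
    exact ((differentiableAt_const l).hasFDerivAt.clm_comp h2.hasFDerivAt).differentiableAt
  have key := dual_schoutenLocal hr hX hY ha hXr hYs 1
  have key' := dual_schoutenLocal hr hX' hY' (hb _) hXr' hYs' 1
  have hmul : ∀ (L : E →L[ℝ] E) (u w : ExteriorAlgebra ℝ E),
      mvMap L (u * w) = mvMap L u * mvMap L w := fun L u w =>
    map_mul (ExteriorAlgebra.map (L : E →ₗ[ℝ] E)) _ _
  have d0 : ∀ᶠ y in 𝓝 x, a y = (b (τ y)).comp (mvMap (fderiv ℝ τ y)) := Eventually.of_forall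
    fun _ => rfl
  have d1 : ∀ᶠ y in 𝓝 x, dualContract X a y =
      (dualContract X' b (τ y)).comp (mvMap (fderiv ℝ τ y)) := by
    filter_upwards [hXX] with y hy
    refine ContinuousLinearMap.ext fun u => ?_
    rw [ContinuousLinearMap.comp_apply, dualContract_apply, dualContract_apply, hy, ← hmul]; rfl
  have d2 : ∀ᶠ y in 𝓝 x, dualContract Y a y =
      (dualContract Y' b (τ y)).comp (mvMap (fderiv ℝ τ y)) := by
    filter_upwards [hYY] with y hy
    refine ContinuousLinearMap.ext fun u => ?_
    rw [ContinuousLinearMap.comp_apply, dualContract_apply, dualContract_apply, hy, ← hmul]; rfl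
  have d3 : ∀ᶠ y in 𝓝 x, dualContract X (dualContract Y a) y =
      (dualContract X' (dualContract Y' b) (τ y)).comp (mvMap (fderiv ℝ τ y)) := by
    filter_upwards [hXX, d2] with y hy hd
    refine ContinuousLinearMap.ext fun u => ?_
    rw [ContinuousLinearMap.comp_apply, dualContract_apply, dualContract_apply X', hy, ← hmul, hd]
    rfl
  have hYb' := differentiableAt_dualContract hY' (hb (τ x))
  rw [dualD_comp hτ (differentiableAt_dualContract hX' hYb') d3, dualD_comp hτ hYb' d2,
    dualD_comp hτ (differentiableAt_dualContract hX' (hb _)) d1, dualD_comp hτ (hb _) d0] at key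
  have m1 : mvMap (fderiv ℝ τ x) (1 : ExteriorAlgebra ℝ E) = 1 :=
    map_one (ExteriorAlgebra.map (fderiv ℝ τ x : E →ₗ[ℝ] E))
  simp only [hmul, m1, ← hXX.self_of_nhds, ← hYY.self_of_nhds] at key
  have := key'.trans key.symm
  rw [mul_one, mul_one] at this
  exact this

/-- The exterior derivative squares to zero. -/
theorem extDerivTotal_extDerivTotal {α : E → Covector E} {x : E}
    (hα : ∀ k, ContDiffAt ℝ ∞ (fun y => α y k) x) :
    extDerivTotal (extDerivTotal α) x = 0 := by
  funext k
  match k with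
  | 0 => rfl
  | 1 =>
    change extDeriv (fun _ => (0 : E [⋀^Fin 0]→L[ℝ] ℝ)) x = 0
    ext v
    simp [extDeriv, ContinuousAlternatingMap.alternatizeUncurryFin_apply]
  | k + 2 =>
    exact extDeriv_extDeriv_apply (r := ∞) (hα k) (by simpa using ENat.LEInfty.out)

end Naturality

end Multisymplectic

end

noncomputable section

namespace Multisymplectic

/-! ### Forms and multivector fields in charts -/

theorem extDerivTotal_congr {E : Type*} [NormedAddCommGroup E] [NormedSpace ℝ E]
    {α β : E → Covector E} {x : E} (h : α =ᶠ[𝓝 x] β) : extDerivTotal α x = extDerivTotal β x := by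
  funext k
  cases k with
  | zero => rfl
  | succ k =>
    refine Filter.EventuallyEq.extDeriv_eq ?_
    filter_upwards [h] with y hy
    rw [hy]

section Charts

variable {E : Type*} [NormedAddCommGroup E] [NormedSpace ℝ E] {H : Type*} [TopologicalSpace H]
  {I : ModelWithCorners ℝ E H} {M : Type*} [TopologicalSpace M] [ChartedSpace H M]

/-- The value of a form at a point, as a covector of the model space (the tangent space at a point
is the model space, seen in the preferred chart). -/
def Form.model (α : Form I M) (p : M) : Covector E := α p

/-- The value of a multivector field at a point, as a multivector of the model space. -/
def MVField.model (X : MVField I M) (p : M) : ExteriorAlgebra ℝ E := X p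

section Change

variable [I.Boundaryless] [IsManifold I ∞ M]

theorem isManifold_one_of_infty : IsManifold I 1 M := IsManifold.of_le (n := ∞) (by simp)

theorem chartDeriv_eq {p₀ p : M} (hp : p ∈ (extChartAt I p₀).source) :
    (chartDeriv I p₀ p : E →L[ℝ] E) = tangentCoordChange I p p₀ p := by
  have : IsManifold I 1 M := isManifold_one_of_infty
  have h : MDifferentiableAt I 𝓘(ℝ, E) (extChartAt I p₀) p :=
    mdifferentiableAt_extChartAt (by simpa using hp)
  exact h.mfderiv

theorem chartSymmDeriv_eq {p₀ : M} {y : E} (hy : y ∈ (extChartAt I p₀).target) :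
    (chartSymmDeriv I p₀ y : E →L[ℝ] E) =
      tangentCoordChange I p₀ ((extChartAt I p₀).symm y) ((extChartAt I p₀).symm y) := by
  have : IsManifold I 1 M := isManifold_one_of_infty
  have h : MDifferentiableAt 𝓘(ℝ, E) I (extChartAt I p₀).symm y := by
    have := mdifferentiableWithinAt_extChartAt_symm (I := I) hy
    rwa [I.range_eq_univ, mdifferentiableWithinAt_univ] at this
  have e : extChartAt I p₀ ((extChartAt I p₀).symm y) = y := (extChartAt I p₀).right_inv hy
  rw [tangentCoordChange_def, e, I.range_eq_univ]
  refine Eq.trans h.mfderiv ?_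
  simp only [writtenInExtChartAt, extChartAt_model_space_eq_id, PartialEquiv.refl_symm,
    PartialEquiv.refl_coe, Function.comp_id, modelWithCornersSelf_coe, range_id, id_eq]
  rfl

theorem Form.inChart_eq (α : Form I M) {p₀ : M} {y : E} (hy : y ∈ (extChartAt I p₀).target) :
    α.inChart p₀ y = (α.model ((extChartAt I p₀).symm y)).comap
      (tangentCoordChange I p₀ ((extChartAt I p₀).symm y) ((extChartAt I p₀).symm y)) := by
  rw [← chartSymmDeriv_eq hy]; rfl

/-- The change of coordinates between two preferred charts. -/
theorem contDiffAt_chartChange {p₀ p₁ q : M} (h₀ : q ∈ (extChartAt I p₀).source)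
    (h₁ : q ∈ (extChartAt I p₁).source) :
    ContDiffAt ℝ ∞ (extChartAt I p₁ ∘ (extChartAt I p₀).symm) (extChartAt I p₀ q) := by
  have h := contDiffWithinAt_ext_coord_change (I := I) (n := ∞) p₁ p₀ (y := extChartAt I p₀ q) (by
    rw [PartialEquiv.trans_source'', PartialEquiv.symm_symm, PartialEquiv.symm_target]
    exact mem_image_of_mem _ ⟨h₀, h₁⟩)
  rwa [I.range_eq_univ, contDiffWithinAt_univ] at h

theorem fderiv_chartChange {p₀ p₁ q : M} :
    fderiv ℝ (extChartAt I p₁ ∘ (extChartAt I p₀).symm) (extChartAt I p₀ q) =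
      tangentCoordChange I p₀ p₁ q := by
  rw [tangentCoordChange_def, I.range_eq_univ, fderivWithin_univ]

theorem tangentCoordChange_comp_eq {p₀ p₁ p₂ q : M} (h₀ : q ∈ (extChartAt I p₀).source)
    (h₁ : q ∈ (extChartAt I p₁).source) (h₂ : q ∈ (extChartAt I p₂).source) :
    (tangentCoordChange I p₁ p₂ q).comp (tangentCoordChange I p₀ p₁ q) =
      tangentCoordChange I p₀ p₂ q :=
  have : IsManifold I 1 M := isManifold_one_of_infty
  ContinuousLinearMap.ext fun _ => tangentCoordChange_comp ⟨⟨h₀, h₁⟩, h₂⟩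

theorem tangentCoordChange_self_eq {p q : M} (h : q ∈ (extChartAt I p).source) :
    tangentCoordChange I p p q = ContinuousLinearMap.id ℝ E :=
  have : IsManifold I 1 M := isManifold_one_of_infty
  ContinuousLinearMap.ext fun _ => tangentCoordChange_self h

theorem eventually_mem_chart_source {p₀ p₁ q : M} (h₀ : q ∈ (extChartAt I p₀).source)
    (h₁ : q ∈ (extChartAt I p₁).source) : ∀ᶠ y in 𝓝 (extChartAt I p₀ q),
      y ∈ (extChartAt I p₀).target ∧ (extChartAt I p₀).symm y ∈ (extChartAt I p₁).source := by
  have ht : (extChartAt I p₀).target ∈ 𝓝 (extChartAt I p₀ q) :=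
    (isOpen_extChartAt_target p₀).mem_nhds ((extChartAt I p₀).map_source h₀)
  refine (eventually_mem_set.2 ht).and ?_
  have hc := (continuousOn_extChartAt_symm p₀).continuousAt ht
  refine hc.eventually_mem ?_
  rw [(extChartAt I p₀).left_inv h₀]
  exact (isOpen_extChartAt_source p₁).mem_nhds h₁

end Change

variable [FiniteDimensional ℝ E]

/-- A form in a preferred chart, as a field of functionals on multivectors. -/
def Form.dual (α : Form I M) (p₀ : M) (y : E) : ExteriorAlgebra ℝ E →L[ℝ] ℝ :=
  (α.inChart p₀ y).toDual

theorem Form.smooth_iff {α : Form I M} : α.Smooth ↔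
    ∀ p₀ : M, ContDiffOn ℝ ∞ (α.dual p₀) (extChartAt I p₀).target :=
  forall_congr' fun _ => contDiffOn_toDual_iff.symm

theorem MVField.smooth_iff {X : MVField I M} : X.Smooth ↔
    ∀ p₀ : M, ContDiffOn ℝ ∞ (X.inChart p₀) (extChartAt I p₀).target :=
  forall_congr' fun _ => contDiffOn_mv_iff

variable [I.Boundaryless] [IsManifold I ∞ M]

theorem MVField.inChart_eq (X : MVField I M) {p₀ : M} {y : E}
    (hy : y ∈ (extChartAt I p₀).target) : X.inChart p₀ y = mvMap
      (tangentCoordChange I ((extChartAt I p₀).symm y) p₀ ((extChartAt I p₀).symm y))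
      (X.model ((extChartAt I p₀).symm y)) := by
  rw [← chartDeriv_eq ((extChartAt I p₀).map_target hy)]; rfl

theorem MVField.inChart_source (X : MVField I M) {p₀ q : M} (hq : q ∈ (extChartAt I p₀).source) :
    X.inChart p₀ (extChartAt I p₀ q) = mvMap (tangentCoordChange I q p₀ q) (X.model q) := by
  rw [X.inChart_eq ((extChartAt I p₀).map_source hq), (extChartAt I p₀).left_inv hq]

theorem MVField.inChart_self (X : MVField I M) (q : M) :
    X.inChart q (extChartAt I q q) = X.model q := by
  rw [X.inChart_source (mem_extChartAt_source q), tangentCoordChange_self_eq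
    (mem_extChartAt_source q), mvMap_id]

theorem Form.dual_source (α : Form I M) {p₀ q : M} (hq : q ∈ (extChartAt I p₀).source)
    (u : ExteriorAlgebra ℝ E) : α.dual p₀ (extChartAt I p₀ q) u =
      (α.model q).pairing (mvMap (tangentCoordChange I p₀ q q) u) := by
  rw [Form.dual, Covector.toDual_apply, α.inChart_eq ((extChartAt I p₀).map_source hq),
    (extChartAt I p₀).left_inv hq, Covector.pairing_comap]
  rfl

theorem Form.dual_self (α : Form I M) (q : M) (u : ExteriorAlgebra ℝ E) :
    α.dual q (extChartAt I q q) u = (α.model q).pairing u := by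
  rw [α.dual_source (mem_extChartAt_source q), tangentCoordChange_self_eq
    (mem_extChartAt_source q), mvMap_id]

theorem Form.dual_change (α : Form I M) {p₀ p₁ q : M} (h₀ : q ∈ (extChartAt I p₀).source)
    (h₁ : q ∈ (extChartAt I p₁).source) : α.dual p₀ (extChartAt I p₀ q) =
      (α.dual p₁ (extChartAt I p₁ q)).comp (mvMap (tangentCoordChange I p₀ p₁ q)) := by
  refine ContinuousLinearMap.ext fun u => ?_
  rw [ContinuousLinearMap.comp_apply, α.dual_source h₀, α.dual_source h₁, mvMap_comp,
    tangentCoordChange_comp_eq h₀ h₁ (mem_extChartAt_source q)]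

theorem MVField.inChart_change (X : MVField I M) {p₀ p₁ q : M}
    (h₀ : q ∈ (extChartAt I p₀).source) (h₁ : q ∈ (extChartAt I p₁).source) :
    X.inChart p₁ (extChartAt I p₁ q) =
      mvMap (tangentCoordChange I p₀ p₁ q) (X.inChart p₀ (extChartAt I p₀ q)) := by
  rw [X.inChart_source h₀, X.inChart_source h₁, mvMap_comp,
    tangentCoordChange_comp_eq (mem_extChartAt_source q) h₀ h₁]

theorem Form.ext_dual {α β : Form I M} (h : ∀ (q : M) (u : ExteriorAlgebra ℝ E),
    α.dual q (extChartAt I q q) u = β.dual q (extChartAt I q q) u) : α = β := by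
  funext q
  have : α.model q = β.model q := Covector.ext_pairing fun u => by
    rw [← α.dual_self, h, β.dual_self]
  exact this

theorem Form.dual_add (α β : Form I M) (p₀ : M) (y : E) :
    (α + β).dual p₀ y = α.dual p₀ y + β.dual p₀ y := by
  refine ContinuousLinearMap.ext fun u => ?_
  have : (α + β).inChart p₀ y = α.inChart p₀ y + β.inChart p₀ y := rfl
  simp [Form.dual, this, Covector.pairing_add]

theorem Form.dual_smul (c : ℝ) (α : Form I M) (p₀ : M) (y : E) :
    (c • α).dual p₀ y = c • α.dual p₀ y := by
  refine ContinuousLinearMap.ext fun u => ?_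
  have : (c • α).inChart p₀ y = c • α.inChart p₀ y := rfl
  simp [Form.dual, this, Covector.pairing_smul]

theorem Form.dual_neg (α : Form I M) (p₀ : M) (y : E) :
    (-α).dual p₀ y = -α.dual p₀ y := by
  rw [← neg_one_smul ℝ α, Form.dual_smul, neg_one_smul]

theorem Form.dual_contract (X : MVField I M) (α : Form I M) {p₀ : M} {y : E}
    (hy : y ∈ (extChartAt I p₀).target) :
    (contract X α).dual p₀ y = dualContract (X.inChart p₀) (α.dual p₀) y := by
  obtain ⟨q, hq, rfl⟩ : ∃ q ∈ (extChartAt I p₀).source, extChartAt I p₀ q = y :=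
    ⟨_, (extChartAt I p₀).map_target hy, (extChartAt I p₀).right_inv hy⟩
  refine ContinuousLinearMap.ext fun u => ?_
  have hmul : ∀ (L : E →L[ℝ] E) (u w : ExteriorAlgebra ℝ E),
      mvMap L (u * w) = mvMap L u * mvMap L w := fun L u w =>
    map_mul (ExteriorAlgebra.map (L : E →ₗ[ℝ] E)) _ _
  have h : (contract X α).model q = (α.model q).contract (X.model q) := rfl
  rw [Form.dual_source _ hq, dualContract_apply, Form.dual_source _ hq, X.inChart_source hq, h,
    hmul, mvMap_comp, tangentCoordChange_comp_eq (mem_extChartAt_source q) hq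
    (mem_extChartAt_source q), tangentCoordChange_self_eq (mem_extChartAt_source q), mvMap_id,
    Covector.pairing_contract]

theorem Form.Smooth.contDiffAt {α : Form I M} (hα : α.Smooth) {p₀ : M} {y : E}
    (hy : y ∈ (extChartAt I p₀).target) : ContDiffAt ℝ ∞ (α.dual p₀) y :=
  (Form.smooth_iff.1 hα p₀).contDiffAt ((isOpen_extChartAt_target p₀).mem_nhds hy)

theorem Form.Smooth.differentiableAt {α : Form I M} (hα : α.Smooth) {p₀ : M} {y : E}
    (hy : y ∈ (extChartAt I p₀).target) : DifferentiableAt ℝ (α.dual p₀) y :=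
  (hα.contDiffAt hy).differentiableAt (by simp)

theorem Form.Smooth.contDiffAt_component {α : Form I M} (hα : α.Smooth) {p₀ : M} {y : E}
    (hy : y ∈ (extChartAt I p₀).target) (k : ℕ) :
    ContDiffAt ℝ ∞ (fun y => α.inChart p₀ y k) y :=
  (hα p₀ k).contDiffAt ((isOpen_extChartAt_target p₀).mem_nhds hy)

theorem MVField.Smooth.differentiableAt {X : MVField I M} (hX : X.Smooth) {p₀ : M} {y : E}
    (hy : y ∈ (extChartAt I p₀).target) : DifferentiableAt ℝ (X.inChart p₀) y :=
  ((MVField.smooth_iff.1 hX p₀).contDiffAt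
    ((isOpen_extChartAt_target p₀).mem_nhds hy)).differentiableAt (by simp)

theorem extD_model (α : Form I M) (q : M) :
    (extD α).model q = extDerivTotal (α.inChart q) (extChartAt I q q) := by
  have h : (chartDeriv I q q : E →L[ℝ] E) = ContinuousLinearMap.id ℝ E := by
    rw [chartDeriv_eq (mem_extChartAt_source q), tangentCoordChange_self_eq
      (mem_extChartAt_source q)]
  have hid : ∀ c : Covector E, c.comap (ContinuousLinearMap.id ℝ E) = c := fun c =>
    Covector.ext_pairing fun u => by
      rw [Covector.pairing_comap]
      exact congrArg _ (mvMap_id u)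
  have h2 : ∀ L : E →L[ℝ] E, L = ContinuousLinearMap.id ℝ E → ∀ c : Covector E, c.comap L = c :=
    fun L hL c => by rw [hL, hid]
  exact h2 _ h _

/-- The exterior derivative may be computed in any preferred chart. -/
theorem Form.dual_extD {α : Form I M} (hα : α.Smooth) {p₀ : M} {y : E}
    (hy : y ∈ (extChartAt I p₀).target) (u : ExteriorAlgebra ℝ E) :
    (extD α).dual p₀ y u = dualD (α.dual p₀) y u := by
  obtain ⟨q, hq, rfl⟩ : ∃ q ∈ (extChartAt I p₀).source, extChartAt I p₀ q = y :=
    ⟨_, (extChartAt I p₀).map_target hy, (extChartAt I p₀).right_inv hy⟩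
  have hq' := mem_extChartAt_source (I := I) q
  have ht := mem_extChartAt_target (I := I) q
  have hτ : (extChartAt I q ∘ (extChartAt I p₀).symm) (extChartAt I p₀ q) = extChartAt I q q := by
    rw [Function.comp_apply, (extChartAt I p₀).left_inv hq]
  rw [Form.dual_source _ hq, extD_model, pairing_extDerivTotal
    (fun k => (hα.contDiffAt_component ht k).differentiableAt (by simp))
    (hα.differentiableAt ht)]
  change dualD (α.dual q) _ _ = _
  rw [← fderiv_chartChange, ← hτ]
  refine (dualD_comp ((contDiffAt_chartChange hq hq').of_le (by simpa using ENat.LEInfty.out))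
    (by rw [hτ]; exact hα.differentiableAt ht) ?_ u).symm
  filter_upwards [eventually_mem_chart_source hq hq'] with z hz
  have := α.dual_change ((extChartAt I p₀).map_target hz.1) hz.2
  rw [(extChartAt I p₀).right_inv hz.1] at this
  rw [this, ← fderiv_chartChange, (extChartAt I p₀).right_inv hz.1]
  rfl

theorem Form.inChart_extD {α : Form I M} (hα : α.Smooth) {p₀ : M} {y : E}
    (hy : y ∈ (extChartAt I p₀).target) :
    (extD α).inChart p₀ y = extDerivTotal (α.inChart p₀) y := by
  refine Covector.ext_pairing fun u => ?_
  rw [pairing_extDerivTotal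
    (fun k => (hα.contDiffAt_component hy k).differentiableAt (by simp)) (hα.differentiableAt hy)]
  exact Form.dual_extD hα hy u

theorem Form.Smooth.extD {α : Form I M} (hα : α.Smooth) : (extD α).Smooth := by
  rw [Form.smooth_iff]
  intro p₀
  rw [contDiffOn_dual_iff]
  intro u
  refine ContDiffOn.congr ?_ fun y hy => Form.dual_extD hα hy u
  refine ContDiffOn.sum fun k _ => ContDiffOn.clm_apply (ContDiffOn.clm_apply ?_ contDiffOn_const)
    contDiffOn_const
  exact (Form.smooth_iff.1 hα p₀).fderiv_of_isOpen (isOpen_extChartAt_target p₀) (by simp)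

theorem Form.Smooth.contract {X : MVField I M} {α : Form I M} (hX : X.Smooth) (hα : α.Smooth) :
    (contract X α).Smooth := by
  rw [Form.smooth_iff]
  intro p₀
  exact (contDiffOn_dualContract (MVField.smooth_iff.1 hX p₀) (Form.smooth_iff.1 hα p₀)).congr
    fun y hy => Form.dual_contract X α hy

theorem Form.Smooth.add {α β : Form I M} (hα : α.Smooth) (hβ : β.Smooth) : (α + β).Smooth := by
  rw [Form.smooth_iff] at *
  exact fun p₀ => ((hα p₀).add (hβ p₀)).congr fun y _ => Form.dual_add α β p₀ y

theorem Form.Smooth.smul {α : Form I M} (hα : α.Smooth) (c : ℝ) : (c • α).Smooth := by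
  rw [Form.smooth_iff] at *
  exact fun p₀ => ((contDiffOn_const (c := c)).smul (hα p₀)).congr fun y _ => Form.dual_smul c α p₀ y

theorem Form.smooth_zero : (0 : Form I M).Smooth := fun _ _ => by
  refine (contDiffOn_const (c := 0)).congr fun y _ => ?_
  ext v; rfl

theorem extD_add {α β : Form I M} (hα : α.Smooth) (hβ : β.Smooth) :
    extD (α + β) = extD α + extD β := by
  refine Form.ext_dual fun q u => ?_
  have ht := mem_extChartAt_target (I := I) q
  have h : (α + β).dual q = fun y => α.dual q y + β.dual q y :=
    funext fun y => Form.dual_add α β q y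
  rw [Form.dual_add, add_apply, Form.dual_extD (hα.add hβ) ht,
    Form.dual_extD hα ht, Form.dual_extD hβ ht, h, dualD,
    fderiv_fun_add (hα.differentiableAt ht) (hβ.differentiableAt ht)]
  simp [dualD, Finset.sum_add_distrib]

theorem extD_smul {α : Form I M} (hα : α.Smooth) (c : ℝ) : extD (c • α) = c • extD α := by
  refine Form.ext_dual fun q u => ?_
  have ht := mem_extChartAt_target (I := I) q
  have h : (c • α).dual q = fun y => c • α.dual q y := funext fun y => Form.dual_smul c α q y
  rw [Form.dual_smul, smul_apply, Form.dual_extD (hα.smul c) ht,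
    Form.dual_extD hα ht, h, dualD, fderiv_fun_const_smul (hα.differentiableAt ht)]
  simp [dualD, Finset.mul_sum]

theorem extD_extD {α : Form I M} (hα : α.Smooth) : extD (extD α) = 0 := by
  refine Form.ext_dual fun q u => ?_
  have ht := mem_extChartAt_target (I := I) q
  have h : (extD α).inChart q =ᶠ[𝓝 (extChartAt I q q)] extDerivTotal (α.inChart q) := by
    filter_upwards [(isOpen_extChartAt_target q).mem_nhds ht] with y hy
    exact Form.inChart_extD hα hy
  have h0 : (0 : Form I M).model q = 0 := rfl
  rw [Form.dual_self, Form.dual_self, extD_model, extDerivTotal_congr h,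
    extDerivTotal_extDerivTotal (fun k => hα.contDiffAt_component ht k), h0]

end Charts

end Multisymplectic

end

noncomputable section

namespace Multisymplectic

/-! ### The Schouten bracket on a manifold -/

section Schouten

variable {E : Type*} [NormedAddCommGroup E] [NormedSpace ℝ E] [FiniteDimensional ℝ E]
  {H : Type*} [TopologicalSpace H] {I : ModelWithCorners ℝ E H} {M : Type*} [TopologicalSpace M]
  [ChartedSpace H M]

theorem contract_add (X : MVField I M) (α β : Form I M) :
    contract X (α + β) = contract X α + contract X β := by
  funext q
  refine Covector.ext_pairing fun u => ?_
  change (Covector.contract (X q) (α q + β q)).pairing u =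
    (Covector.contract (X q) (α q) + Covector.contract (X q) (β q)).pairing u
  simp only [Covector.pairing_contract, Covector.pairing_add, LinearMap.add_apply]

theorem contract_smul (X : MVField I M) (c : ℝ) (α : Form I M) :
    contract X (c • α) = c • contract X α := by
  funext q
  refine Covector.ext_pairing fun u => ?_
  change (Covector.contract (X q) (c • α q)).pairing u =
    (c • Covector.contract (X q) (α q)).pairing u
  simp only [Covector.pairing_contract, Covector.pairing_smul, LinearMap.smul_apply]

theorem contract_zero (X : MVField I M) : contract X (0 : Form I M) = 0 := by
  have := contract_smul X 0 (0 : Form I M)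
  simpa using this

theorem contract_neg (X : MVField I M) (α : Form I M) : contract X (-α) = -contract X α := by
  rw [← neg_one_smul ℝ α, contract_smul, neg_one_smul]

theorem contract_sub_left (X Y : MVField I M) (α : Form I M) :
    contract (X - Y) α = contract X α - contract Y α := by
  funext q
  refine Covector.ext_pairing fun u => ?_
  change (Covector.contract (X q - Y q) (α q)).pairing u =
    (Covector.contract (X q) (α q) - Covector.contract (Y q) (α q)).pairing u
  simp only [Covector.pairing_contract, Covector.pairing_sub, LinearMap.sub_apply, sub_mul,
    map_sub]

theorem contract_wedge (X Y : MVField I M) (α : Form I M) :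
    contract (wedge X Y) α = contract Y (contract X α) := by
  funext q
  refine Covector.ext_pairing fun u => ?_
  change (Covector.contract (X q * Y q) (α q)).pairing u =
    (Covector.contract (Y q) (Covector.contract (X q) (α q))).pairing u
  simp only [Covector.pairing_contract, mul_assoc]

/-- Interior products with homogeneous multivector fields commute in the graded sense. -/
theorem contract_comm {X Y : MVField I M} {r s : ℕ} (hX : X.HasDegree r) (hY : Y.HasDegree s)
    (α : Form I M) :
    contract X (contract Y α) = (-1 : ℝ) ^ (r * s) • contract Y (contract X α) := by
  funext q
  refine Covector.ext_pairing fun u => ?_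
  change (Covector.contract (X q) (Covector.contract (Y q) (α q))).pairing u =
    ((-1 : ℝ) ^ (r * s) • Covector.contract (Y q) (Covector.contract (X q) (α q))).pairing u
  simp only [Covector.pairing_contract, Covector.pairing_smul, LinearMap.smul_apply]
  rw [← mul_assoc, ← mul_assoc, mul_comm_exteriorPower (hY q) (hX q), smul_mul_assoc, map_smul,
    mul_comm s r]

theorem Form.HasDegree.contract {X : MVField I M} {r : ℕ} (hX : X.HasDegree r) {α : Form I M}
    {k : ℤ} (hα : α.HasDegree k) : (contract X α).HasDegree (k - r) := fun p _ hj =>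
  Covector.contract_of_degree (hα p) (hX p) hj

theorem Form.HasDegree.add {α β : Form I M} {k : ℤ} (hα : α.HasDegree k) (hβ : β.HasDegree k) :
    (α + β).HasDegree k := fun p j hj => by
  change α p j + β p j = 0
  rw [hα p j hj, hβ p j hj, add_zero]

theorem Form.HasDegree.smul {α : Form I M} {k : ℤ} (hα : α.HasDegree k) (c : ℝ) :
    (c • α).HasDegree k := fun p j hj => by
  change c • α p j = 0
  rw [hα p j hj, smul_zero]

theorem Form.HasDegree.neg {α : Form I M} {k : ℤ} (hα : α.HasDegree k) :
    (-α).HasDegree k := by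
  rw [← neg_one_smul ℝ α]; exact hα.smul _

theorem Form.HasDegree.extD {α : Form I M} {k : ℤ} (hα : α.HasDegree k) :
    (extD α).HasDegree (k + 1) := fun p j hj => by
  have h : extDerivTotal (α.inChart p) (extChartAt I p p) j = 0 := by
    cases j with
    | zero => rfl
    | succ j =>
      have hz : (fun y => α.inChart p y j) = fun _ => 0 := funext fun y => by
        have : α ((extChartAt I p).symm y) j = 0 := hα _ j (by push_cast at hj; omega)
        ext v
        change α ((extChartAt I p).symm y) j _ = 0
        rw [this]; rfl
      change extDeriv (fun y => α.inChart p y j) _ = 0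
      rw [hz]
      ext v
      simp [extDeriv, ContinuousAlternatingMap.alternatizeUncurryFin_apply]
  change (extDerivTotal (α.inChart p) (extChartAt I p p) j).compContinuousLinearMap _ = 0
  rw [h]
  rfl

theorem MVField.HasDegree.wedge {X Y : MVField I M} {r s : ℕ} (hX : X.HasDegree r)
    (hY : Y.HasDegree s) : (wedge X Y).HasDegree (r + s) := fun p =>
  mul_mem_exteriorPower (hX p) (hY p)

theorem MVField.HasDegree.inChart {X : MVField I M} {r : ℕ} (hX : X.HasDegree r) (p₀ : M) (y : E) :
    X.inChart p₀ y ∈ ⋀[ℝ]^r E := map_mem_exteriorPower _ (hX _)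

theorem MVField.HasDegree.sub {X Y : MVField I M} {r : ℕ} (hX : X.HasDegree r)
    (hY : Y.HasDegree r) : (X - Y).HasDegree r := fun p => sub_mem (hX p) (hY p)

variable [I.Boundaryless] [IsManifold I ∞ M]

theorem MVField.Smooth.sub {X Y : MVField I M} (hX : X.Smooth) (hY : Y.Smooth) :
    (X - Y).Smooth := by
  rw [MVField.smooth_iff] at *
  refine fun p₀ => ((hX p₀).sub (hY p₀)).congr fun y hy => ?_
  rw [MVField.inChart_eq _ hy, MVField.inChart_eq _ hy, MVField.inChart_eq _ hy, ← map_sub]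
  rfl

theorem MVField.Smooth.wedge {X Y : MVField I M} (hX : X.Smooth) (hY : Y.Smooth) :
    (wedge X Y).Smooth := by
  rw [MVField.smooth_iff] at *
  intro p₀
  have h := ((mvMulL E).contDiff.comp_contDiffOn (hX p₀)).clm_apply (hY p₀)
  refine h.congr fun y hy => ?_
  exact map_mul (ExteriorAlgebra.map _) _ _

theorem schouten_model (X Y : MVField I M) (q : M) : (schouten X Y).model q =
    schoutenLocal (X.inChart q) (Y.inChart q) (extChartAt I q q) := by
  have h : (chartDeriv I q q : E →L[ℝ] E) = ContinuousLinearMap.id ℝ E := by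
    rw [chartDeriv_eq (mem_extChartAt_source q), tangentCoordChange_self_eq
      (mem_extChartAt_source q)]
  have h2 : ∀ L : E →L[ℝ] E, L = ContinuousLinearMap.id ℝ E →
      ∀ u, mvMap L.inverse u = u := fun L hL u => by
    rw [hL, ContinuousLinearMap.inverse_id, mvMap_id]
  exact h2 _ h _

/-- The Schouten bracket may be computed in any preferred chart. -/
theorem schouten_inChart {X Y : MVField I M} {r s : ℕ} (hr : 1 ≤ r) (hX : X.Smooth)
    (hXr : X.HasDegree r) (hY : Y.Smooth) (hYs : Y.HasDegree s) {p₀ : M} {y : E}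
    (hy : y ∈ (extChartAt I p₀).target) :
    (schouten X Y).inChart p₀ y = schoutenLocal (X.inChart p₀) (Y.inChart p₀) y := by
  obtain ⟨q, hq, rfl⟩ : ∃ q ∈ (extChartAt I p₀).source, extChartAt I p₀ q = y :=
    ⟨_, (extChartAt I p₀).map_target hy, (extChartAt I p₀).right_inv hy⟩
  have hq' := mem_extChartAt_source (I := I) q
  have ht := mem_extChartAt_target (I := I) q
  have hτ : (extChartAt I p₀ ∘ (extChartAt I q).symm) (extChartAt I q q) = extChartAt I p₀ q := by
    rw [Function.comp_apply, (extChartAt I q).left_inv hq']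
  rw [(schouten X Y).inChart_source hq, schouten_model, ← fderiv_chartChange, ← hτ]
  have key : ∀ Z : MVField I M, ∀ᶠ z in 𝓝 (extChartAt I q q),
      Z.inChart p₀ ((extChartAt I p₀ ∘ (extChartAt I q).symm) z) =
        mvMap (fderiv ℝ (extChartAt I p₀ ∘ (extChartAt I q).symm) z) (Z.inChart q z) := by
    intro Z
    filter_upwards [eventually_mem_chart_source hq' hq] with z hz
    have := Z.inChart_change ((extChartAt I q).map_target hz.1) hz.2
    rw [(extChartAt I q).right_inv hz.1] at this
    rw [Function.comp_apply, this, ← fderiv_chartChange, (extChartAt I q).right_inv hz.1]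
  refine (schoutenLocal_comp hr
    ((contDiffAt_chartChange hq' hq).of_le (by simpa using ENat.LEInfty.out))
    (hX.differentiableAt ht) (hY.differentiableAt ht)
    (by rw [hτ]; exact hX.differentiableAt hy) (by rw [hτ]; exact hY.differentiableAt hy)
    (Eventually.of_forall (hXr.inChart q)) (Eventually.of_forall (hYs.inChart q))
    (Eventually.of_forall (hXr.inChart p₀)) (Eventually.of_forall (hYs.inChart p₀))
    (key X) (key Y)).symm

theorem schouten_smooth {X Y : MVField I M} {r s : ℕ} (hr : 1 ≤ r) (hX : X.Smooth)
    (hXr : X.HasDegree r) (hY : Y.Smooth) (hYs : Y.HasDegree s) : (schouten X Y).Smooth := by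
  rw [MVField.smooth_iff]
  intro p₀
  exact (contDiffOn_schoutenLocal (isOpen_extChartAt_target p₀) (MVField.smooth_iff.1 hX p₀)
    (MVField.smooth_iff.1 hY p₀)).congr fun y hy => schouten_inChart hr hX hXr hY hYs hy

theorem schouten_degree {X Y : MVField I M} {r s : ℕ} (hr : 1 ≤ r) (hX : X.Smooth)
    (hXr : X.HasDegree r) (hY : Y.Smooth) (hYs : Y.HasDegree s) :
    (schouten X Y).HasDegree (r + s - 1) := fun q => by
  have ht := mem_extChartAt_target (I := I) q
  have h : (schouten X Y).model q ∈ ⋀[ℝ]^(r + s - 1) E := by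
    rw [schouten_model]
    exact schoutenLocal_mem hr (hX.differentiableAt ht) (hY.differentiableAt ht)
      (Eventually.of_forall (hXr.inChart q)) (Eventually.of_forall (hYs.inChart q))
  exact h

/-- The interior product with the Schouten bracket is the graded commutator of a Lie derivative and
an interior product. -/
theorem contract_schouten {X Y : MVField I M} {r s : ℕ} (hr : 1 ≤ r) (hX : X.Smooth)
    (hXr : X.HasDegree r) (hY : Y.Smooth) (hYs : Y.HasDegree s) {α : Form I M} (hα : α.Smooth) :
    contract (schouten X Y) α = (-1 : ℝ) ^ ((r - 1) * s) •
      (extD (contract X (contract Y α)) + (-(-1 : ℝ) ^ r) • contract X (extD (contract Y α))) +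
      -(contract Y (extD (contract X α) + (-(-1 : ℝ) ^ r) • contract X (extD α))) := by
  refine Form.ext_dual fun q u => ?_
  have ht := mem_extChartAt_target (I := I) q
  have hYα := Form.Smooth.contract hY hα
  have hXα := Form.Smooth.contract hX hα
  have key := dual_schoutenLocal hr (hX.differentiableAt ht) (hY.differentiableAt ht)
    (hα.differentiableAt ht) (Eventually.of_forall (hXr.inChart q))
    (Eventually.of_forall (hYs.inChart q)) u
  have ev : ∀ (Z : MVField I M) (β : Form I M), (contract Z β).dual q =ᶠ[𝓝 (extChartAt I q q)]
      dualContract (Z.inChart q) (β.dual q) := fun Z β => by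
    filter_upwards [(isOpen_extChartAt_target q).mem_nhds ht] with y hy
    exact Form.dual_contract Z β hy
  have dcongr : ∀ {a b : E → ExteriorAlgebra ℝ E →L[ℝ] ℝ} {x : E}, a =ᶠ[𝓝 x] b →
      ∀ w, dualD a x w = dualD b x w := fun {a b x} h w => by
    rw [dualD, dualD, h.fderiv_eq]
  have e1 : ∀ w, dualD (dualContract (X.inChart q) (dualContract (Y.inChart q) (α.dual q)))
      (extChartAt I q q) w = dualD ((contract X (contract Y α)).dual q) (extChartAt I q q) w := by
    refine fun w => (dcongr ?_ w).symm
    filter_upwards [ev X (contract Y α), ev Y α] with y h1 h2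
    rw [h1]
    refine ContinuousLinearMap.ext fun w => ?_
    rw [dualContract_apply, dualContract_apply, h2]
  rw [e1, ← dcongr (ev Y α), ← dcongr (ev X α)] at key
  simp only [Form.dual_add, Form.dual_smul, Form.dual_neg, add_apply, neg_apply,
    smul_apply, Form.dual_contract _ _ ht, dualContract_apply,
    Form.dual_extD (Form.Smooth.contract hX hYα) ht,
    Form.dual_extD hYα ht, Form.dual_extD hXα ht, Form.dual_extD hα ht, smul_eq_mul]
  have hs : (schouten X Y).inChart q (extChartAt I q q) =
      schoutenLocal (X.inChart q) (Y.inChart q) (extChartAt I q q) := by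
    rw [MVField.inChart_self, schouten_model]
  rw [hs, key]
  ring

end Schouten

end Multisymplectic

end

noncomputable section

namespace Multisymplectic

/-! ### Abstract Cartan calculus -/

section Abstract

variable {V : Type*} [AddCommGroup V] [Module ℝ V]

/-- The graded commutator that defines the Lie derivative along a contraction `x` of degree
`a + 1`. -/
def cartanLie (D : V →ₗ[ℝ] V) (a : ℕ) (x : V →ₗ[ℝ] V) (v : V) : V :=
  D (x v) - (-1 : ℝ) ^ (a + 1) • x (D v)

/-- The bracket of Poisson forms in terms of the exterior derivative `D` and the contractions `x`, `y`
of degrees `a + 1`, `b + 1` with the multivector fields. -/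
def cartanBracket (D : V →ₗ[ℝ] V) (θ : V) (a b : ℕ) (x : V →ₗ[ℝ] V) (f : V) (y : V →ₗ[ℝ] V)
    (g : V) : V :=
  -cartanLie D a x g + (-1 : ℝ) ^ (a * b) • cartanLie D b y f -
    (-1 : ℝ) ^ (a * (b + 1)) • (D (y (x θ)) - (-1 : ℝ) ^ (a + 1 + (b + 1)) • y (x (D θ)))

variable {D x y z : V →ₗ[ℝ] V} {θ f g h : V} {a b c : ℕ}

/-- The derivative of the bracket is the contraction of `ω = -Dθ` with the bracket of the fields,
which enters through its contraction operator `w`. -/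
theorem D_cartanBracket (hD : ∀ v, D (D v) = 0) (hx : x (D θ) = -D f) (hy : y (D θ) = -D g)
    (hyx : ∀ v, y (x v) = (-1 : ℝ) ^ ((a + 1) * (b + 1)) • x (y v)) {w : V →ₗ[ℝ] V}
    (hw : ∀ v, w v = (-1 : ℝ) ^ (b * (a + 1)) • cartanLie D b y (x v) - x (cartanLie D b y v)) :
    w (-D θ) = D (cartanBracket D θ a b x f y g) := by
  have e1 : D (x (D θ)) = 0 := by rw [hx, map_neg, hD, neg_zero]
  have e2 : D (y (D θ)) = 0 := by rw [hy, map_neg, hD, neg_zero]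
  have hf : D f = -x (D θ) := by rw [hx, neg_neg]
  have hg : D g = -y (D θ) := by rw [hy, neg_neg]
  rcases neg_one_pow_eq_or ℝ a with ha | ha <;> rcases neg_one_pow_eq_or ℝ b with hb | hb <;>
  · simp only [hw, cartanBracket, cartanLie, hyx, map_add, map_sub, map_neg, map_smul, hD, hf, hg,
      e1, e2, pow_mul, pow_add, pow_succ, ha, hb, one_pow, mul_neg, mul_one,
      neg_neg, map_zero]
    module

/-- The graded Jacobi identity. The second derivatives of `f`, `g`, `h` cancel by themselves; the
terms with `θ` cancel because contractions with brackets commute with contractions. -/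
theorem cartanBracket_jacobi (hD : ∀ v, D (D v) = 0) (hx : x (D θ) = -D f) (hy : y (D θ) = -D g)
    (hz : z (D θ) = -D h)
    (hyx : ∀ v, y (x v) = (-1 : ℝ) ^ ((a + 1) * (b + 1)) • x (y v))
    (hzx : ∀ v, z (x v) = (-1 : ℝ) ^ ((a + 1) * (c + 1)) • x (z v))
    (hzy : ∀ v, z (y v) = (-1 : ℝ) ^ ((b + 1) * (c + 1)) • y (z v))
    {yx xz zy : V →ₗ[ℝ] V}
    (hw₁ : ∀ v, zy v = (-1 : ℝ) ^ (c * (b + 1)) • cartanLie D c z (y v) - y (cartanLie D c z v))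
    (hw₂ : ∀ v, xz v = (-1 : ℝ) ^ (a * (c + 1)) • cartanLie D a x (z v) - z (cartanLie D a x v))
    (hw₃ : ∀ v, yx v = (-1 : ℝ) ^ (b * (a + 1)) • cartanLie D b y (x v) - x (cartanLie D b y v))
    (hc : ∀ v, zy (x v) = (-1 : ℝ) ^ ((b + c + 1) * (a + 1)) • x (zy v)) :
    (-1 : ℝ) ^ (a * c) • cartanBracket D θ a (b + c) x f zy (cartanBracket D θ b c y g z h) +
      (-1 : ℝ) ^ (b * a) • cartanBracket D θ b (c + a) y g xz (cartanBracket D θ c a z h x f) +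
      (-1 : ℝ) ^ (c * b) • cartanBracket D θ c (a + b) z h yx (cartanBracket D θ a b x f y g) =
      0 := by
  have e1 : D (x (D θ)) = 0 := by rw [hx, map_neg, hD, neg_zero]
  have e2 : D (y (D θ)) = 0 := by rw [hy, map_neg, hD, neg_zero]
  have e3 : D (z (D θ)) = 0 := by rw [hz, map_neg, hD, neg_zero]
  have hf : D f = -x (D θ) := by rw [hx, neg_neg]
  have hg : D g = -y (D θ) := by rw [hy, neg_neg]
  have hh : D h = -z (D θ) := by rw [hz, neg_neg]
  -- Contractions with `[Z, Y]` and `X` commute up to sign, here on `θ` and on `Dθ`.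
  have h1 : -(-1 : ℝ) ^ (a * (b + 1)) • D (zy (x θ)) = -(-1 : ℝ) ^ (a * (b + 1)) • D _ :=
    congrArg (fun v => -(-1 : ℝ) ^ (a * (b + 1)) • D v) (hc θ)
  have h2 : (-1 : ℝ) ^ (c + b * (a + 1)) • zy (x (D θ)) = (-1 : ℝ) ^ (c + b * (a + 1)) • _ :=
    congrArg ((-1 : ℝ) ^ (c + b * (a + 1)) • ·) (hc (D θ))
  rcases neg_one_pow_eq_or ℝ a with ha | ha <;> rcases neg_one_pow_eq_or ℝ b with hb | hb <;>
  rcases neg_one_pow_eq_or ℝ c with hc' | hc' <;>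
  · simp only [hw₁, hw₂, hw₃, cartanBracket, cartanLie, hyx, hzx, hzy, map_add, map_sub, map_neg,
      map_smul, hD, hf, hg, hh, e1, e2, e3, pow_mul, pow_add, pow_succ, ha, hb, hc',
      one_pow, mul_neg, mul_one, neg_neg, map_zero] at h1 h2 ⊢
    linear_combination (norm := module) h1 + h2

/-- For exact Hamiltonian fields, whose Lie derivatives annihilate `θ`, the bracket of the momenta
is the momentum of the bracket of the fields. -/
theorem cartanBracket_momentum (hx : cartanLie D a x θ = 0)
    (hy : cartanLie D b y θ = 0)
    (hyx : ∀ v, y (x v) = (-1 : ℝ) ^ ((a + 1) * (b + 1)) • x (y v)) {w : V →ₗ[ℝ] V}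
    (hw : ∀ v, w v = (-1 : ℝ) ^ (b * (a + 1)) • cartanLie D b y (x v) - x (cartanLie D b y v)) :
    cartanBracket D θ a b x ((-1 : ℝ) ^ a • x θ) y ((-1 : ℝ) ^ b • y θ) =
      (-1 : ℝ) ^ (a + b) • w θ := by
  have e1 : D (x θ) = (-1 : ℝ) ^ (a + 1) • x (D θ) := sub_eq_zero.1 hx
  have e2 : D (y θ) = (-1 : ℝ) ^ (b + 1) • y (D θ) := sub_eq_zero.1 hy
  rcases neg_one_pow_eq_or ℝ a with ha | ha <;> rcases neg_one_pow_eq_or ℝ b with hb | hb <;>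
  · simp only [hw, cartanBracket, cartanLie, hyx, map_sub, map_smul, e1, e2,
      pow_mul, pow_add, pow_succ, ha, hb, one_pow, mul_neg, mul_one, neg_neg]
    module

end Abstract

end Multisymplectic

end

noncomputable section

namespace Multisymplectic

/-! ### Poisson forms on exact multisymplectic manifolds -/

section PoissonForms

variable {E : Type*} [NormedAddCommGroup E] [NormedSpace ℝ E] [FiniteDimensional ℝ E]
  {H : Type*} [TopologicalSpace H] {I : ModelWithCorners ℝ E H} {M : Type*} [TopologicalSpace M]
  [ChartedSpace H M] [I.Boundaryless] [IsManifold I ∞ M]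

theorem Form.Smooth.neg {α : Form I M} (hα : α.Smooth) : (-α).Smooth := by
  rw [← neg_one_smul ℝ α]; exact hα.smul _

theorem Form.Smooth.sub {α β : Form I M} (hα : α.Smooth) (hβ : β.Smooth) : (α - β).Smooth := by
  rw [sub_eq_add_neg]; exact hα.add hβ.neg

theorem extD_zero : extD (0 : Form I M) = 0 := by
  simpa using extD_smul (Form.smooth_zero (I := I) (M := M)) 0

theorem extD_neg {α : Form I M} (hα : α.Smooth) : extD (-α) = -extD α := by
  rw [← neg_one_smul ℝ α, extD_smul hα, neg_one_smul]

theorem Form.Smooth.lieDeriv {r : ℕ} {X : MVField I M} (hX : X.Smooth) {α : Form I M}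
    (hα : α.Smooth) : (lieDeriv r X α).Smooth :=
  (Form.Smooth.contract hX hα).extD.sub ((Form.Smooth.contract hX hα.extD).smul _)

theorem Form.HasDegree.sub {α β : Form I M} {k : ℤ} (hα : α.HasDegree k) (hβ : β.HasDegree k) :
    (α - β).HasDegree k := by
  rw [sub_eq_add_neg]; exact hα.add hβ.neg

theorem Form.HasDegree.lieDeriv {r : ℕ} {X : MVField I M} (hX : X.HasDegree r) {α : Form I M}
    {k : ℤ} (hα : α.HasDegree k) : (lieDeriv r X α).HasDegree (k - r + 1) := by
  have h := Form.HasDegree.contract hX hα.extD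
  rw [show k + 1 - (r : ℤ) = k - r + 1 by ring] at h
  exact (Form.HasDegree.contract hX hα).extD.sub (h.smul _)

variable (I M) in
/-- The vector space of smooth forms. -/
def smoothForms : Submodule ℝ (Form I M) where
  carrier := {α | α.Smooth}
  zero_mem' := Form.smooth_zero
  add_mem' := fun h h' => h.add h'
  smul_mem' := fun c _ h => h.smul c

/-- The exterior derivative of smooth forms as a linear map. -/
def extDₗ : smoothForms I M →ₗ[ℝ] smoothForms I M where
  toFun α := ⟨extD α.1, α.2.extD⟩
  map_add' α β := Subtype.ext (extD_add α.2 β.2)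
  map_smul' c α := Subtype.ext (extD_smul α.2 c)

/-- The interior product of smooth forms with a smooth multivector field as a linear map. -/
def contractₗ (X : MVField I M) (hX : X.Smooth) : smoothForms I M →ₗ[ℝ] smoothForms I M where
  toFun α := ⟨contract X α.1, Form.Smooth.contract hX α.2⟩
  map_add' _ _ := Subtype.ext (contract_add X _ _)
  map_smul' c _ := Subtype.ext (contract_smul X c _)

theorem extDₗ_extDₗ (α : smoothForms I M) : extDₗ (extDₗ α) = 0 := Subtype.ext (extD_extD α.2)

variable {n r s t : ℕ} {X X' Y Y' W : MVField I M} {θ f g : Form I M}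
  {S : ∀ p : M, TangentSpace I p}

theorem contractₗ_comm (hX : X.Smooth) (hXr : X.HasDegree r) (hY : Y.Smooth)
    (hYs : Y.HasDegree s) (α : smoothForms I M) :
    contractₗ Y hY (contractₗ X hX α) = (-1 : ℝ) ^ (r * s) • contractₗ X hX (contractₗ Y hY α) :=
  Subtype.ext (by rw [mul_comm]; exact contract_comm hYs hXr α.1)

theorem contractₗ_schouten {a b : ℕ} (hX : X.Smooth) (hXr : X.HasDegree (a + 1)) (hY : Y.Smooth)
    (hYs : Y.HasDegree (b + 1)) (hW : (schouten Y X).Smooth) (α : smoothForms I M) :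
    contractₗ (schouten Y X) hW α = (-1 : ℝ) ^ (b * (a + 1)) •
      cartanLie extDₗ b (contractₗ Y hY) (contractₗ X hX α) -
        contractₗ X hX (cartanLie extDₗ b (contractₗ Y hY) α) := by
  refine Subtype.ext ((contract_schouten (Nat.le_add_left 1 b) hY hYs hX hXr α.2).trans ?_)
  rw [neg_smul, neg_smul, ← sub_eq_add_neg, ← sub_eq_add_neg, ← sub_eq_add_neg]
  rfl

theorem coe_cartanBracket {a b : ℕ} (hX : X.Smooth) (hY : Y.Smooth) (hθ : θ.Smooth)
    (f g : smoothForms I M) :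
    (cartanBracket extDₗ ⟨θ, hθ⟩ a b (contractₗ X hX) f (contractₗ Y hY) g).1 =
      bracket θ (a + 1) (b + 1) X f.1 Y g.1 := by
  rw [bracket, lieDeriv.eq_1 (a + 1 + (b + 1)), contract_wedge, contract_wedge]
  rfl

/-- Cartan's formula `i([X, Y]) = (-1)^((r - 1)s) L_X i(Y) - i(Y) L_X`. -/
theorem contract_schouten_eq (hr : 1 ≤ r) (hX : X.Smooth)
    (hXr : X.HasDegree r) (hY : Y.Smooth) (hYs : Y.HasDegree s) {α : Form I M} (hα : α.Smooth) :
    contract (schouten X Y) α = (-1 : ℝ) ^ ((r - 1) * s) • lieDeriv r X (contract Y α) -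
      contract Y (lieDeriv r X α) := by
  rw [contract_schouten hr hX hXr hY hYs hα, neg_smul, neg_smul, ← sub_eq_add_neg,
    ← sub_eq_add_neg, ← sub_eq_add_neg]
  rfl

theorem lieDeriv_zero : lieDeriv r X (0 : Form I M) = 0 := by
  rw [lieDeriv, contract_zero, extD_zero, contract_zero, smul_zero, sub_zero]

/-- A field `Y` that annihilates `α` annihilates `L_X α` if `[X, Y]` annihilates `α`. -/
theorem contract_lieDeriv_eq_zero (hr : 1 ≤ r) (hX : X.Smooth)
    (hXr : X.HasDegree r) (hY : Y.Smooth) (hYs : Y.HasDegree s) {α : Form I M} (hα : α.Smooth)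
    (h : contract Y α = 0) (h' : contract (schouten X Y) α = 0) :
    contract Y (lieDeriv r X α) = 0 := by
  rw [contract_schouten_eq hr hX hXr hY hYs hα, h, lieDeriv_zero, smul_zero, zero_sub,
    neg_eq_zero] at h'
  exact h'

/-- The Lie derivative along an exterior product. -/
theorem lieDeriv_wedge :
    lieDeriv (r + s) (wedge X Y) θ =
      (-1 : ℝ) ^ s • contract Y (lieDeriv r X θ) + lieDeriv s Y (contract X θ) := by
  simp only [lieDeriv, contract_wedge, sub_eq_add_neg, contract_add, contract_neg, contract_smul,
    pow_add]
  module

theorem omega_smooth (hθ : θ.Smooth) : (omega θ).Smooth := hθ.extD.neg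

/-- Hamiltonian multivector fields preserve `ω`, as `d i(X)ω = ddf = 0` and `dω = 0`. -/
theorem IsHamiltonian.lieDeriv_omega (hX : IsHamiltonian n θ r X f) (hθ : θ.Smooth) :
    lieDeriv r X (omega θ) = 0 := by
  rw [lieDeriv, hX.eq, extD_extD hX.smooth_form, omega, extD_neg hθ.extD, extD_extD hθ,
    neg_zero, contract_zero, smul_zero, sub_zero]

theorem IsHamiltonian.contract_extD (hX : IsHamiltonian n θ r X f) :
    contract X (extD θ) = -extD f := by
  rw [← hX.eq, omega, contract_neg, neg_neg]

/-- Multivector fields that annihilate `ω` annihilate `θ = -i(Σ)ω`. -/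
theorem IsExactMultisymplectic.contract_eq_zero (hθ : IsExactMultisymplectic n θ S)
    (hX : X.HasDegree r) (h : contract X (omega θ) = 0) : contract X θ = 0 := by
  have hS : (ofVector S).HasDegree 1 := fun p => ι_mem_exteriorPower _
  have e := contract_comm hX hS (omega θ)
  rwa [hθ.contract_scaling, h, contract_zero, smul_zero, contract_neg, neg_eq_zero] at e

theorem IsExactMultisymplectic.contract_congr (hθ : IsExactMultisymplectic n θ S)
    (hX : X.HasDegree r) (hX' : X'.HasDegree r)
    (h : contract X (omega θ) = contract X' (omega θ)) : contract X θ = contract X' θ := by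
  rw [← sub_eq_zero, ← contract_sub_left] at h ⊢
  exact hθ.contract_eq_zero (hX.sub hX') h

/-- Hamiltonian multivector fields of the same form differ by a field that annihilates `ω`, so
that they contract Poisson forms equally. -/
theorem IsPoisson.contract_congr (hg : IsPoisson n θ s g) (hX : IsHamiltonian n θ r X f)
    (hX' : IsHamiltonian n θ r X' f) : contract X g = contract X' g := by
  rw [← sub_eq_zero, ← contract_sub_left]
  refine hg.kernel r _ (hX.smooth_field.sub hX'.smooth_field)
    (hX.degree_field.sub hX'.degree_field) ?_
  rw [contract_sub_left, hX.eq, hX'.eq, sub_self]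

theorem bracket_antisymm (hr : 1 ≤ r) (hs : 1 ≤ s) (hθ : θ.Smooth)
    (hX : X.Smooth) (hXr : X.HasDegree r) (hY : Y.Smooth) (hYs : Y.HasDegree s) :
    bracket θ r s X f Y g = -((-1 : ℝ) ^ ((r - 1) * (s - 1)) • bracket θ s r Y g X f) := by
  obtain ⟨a, rfl⟩ := Nat.exists_eq_add_of_le' hr
  obtain ⟨b, rfl⟩ := Nat.exists_eq_add_of_le' hs
  simp only [Nat.add_sub_cancel]
  rw [bracket, bracket, lieDeriv.eq_1 (a + 1 + (b + 1)), lieDeriv.eq_1 (b + 1 + (a + 1)),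
    contract_wedge, contract_wedge, contract_wedge, contract_wedge, contract_comm hXr hYs,
    contract_comm hXr hYs, extD_smul (Form.Smooth.contract hY (Form.Smooth.contract hX hθ))]
  simp only [Nat.add_sub_cancel]
  rcases neg_one_pow_eq_or ℝ a with ha | ha <;> rcases neg_one_pow_eq_or ℝ b with hb | hb <;>
  · simp only [pow_mul, pow_add, pow_succ, ha, hb, one_pow, mul_neg, mul_one, neg_neg]
    module

/-- The bracket does not depend on the Hamiltonian field of its first argument: the difference of
two choices annihilates `ω`, hence `θ` and `g`, and also `dg = i(Y)ω`. -/
theorem bracket_congr_left (hθ : IsExactMultisymplectic n θ S)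
    (hg : IsPoisson n θ s g) (hX : IsHamiltonian n θ r X f) (hX' : IsHamiltonian n θ r X' f)
    (hY : IsHamiltonian n θ s Y g) : bracket θ r s X f Y g = bracket θ r s X' f Y g := by
  have e1 := hg.contract_congr hX hX'
  have e2 : contract X (omega θ) = contract X' (omega θ) := hX.eq.trans hX'.eq.symm
  have e3 := hθ.contract_congr hX.degree_field hX'.degree_field e2
  have e4 : contract X (extD θ) = contract X' (extD θ) := by
    rw [hX.contract_extD, hX'.contract_extD]
  have e5 : contract X (extD g) = contract X' (extD g) := by
    rw [← hY.eq, contract_comm hX.degree_field hY.degree_field, e2,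
      contract_comm hX'.degree_field hY.degree_field]
  simp only [bracket, lieDeriv, contract_wedge, e1, e3, e4, e5]

theorem bracket_congr_right (hr : 1 ≤ r) (hs : 1 ≤ s) (hθ : IsExactMultisymplectic n θ S)
    (hf : IsPoisson n θ r f) (hX : IsHamiltonian n θ r X f)
    (hY : IsHamiltonian n θ s Y g) (hY' : IsHamiltonian n θ s Y' g) :
    bracket θ r s X f Y g = bracket θ r s X f Y' g := by
  rw [bracket_antisymm hr hs hθ.smooth hX.smooth_field hX.degree_field hY.smooth_field
    hY.degree_field, bracket_antisymm hr hs hθ.smooth hX.smooth_field hX.degree_field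
    hY'.smooth_field hY'.degree_field, bracket_congr_left hθ hf hY hY' hX]

/-- The Schouten bracket `[Y, X]` is a Hamiltonian multivector field of the bracket. -/
theorem IsHamiltonian.bracket (hr : 1 ≤ r) (hs : 1 ≤ s) (hθ : θ.Smooth) (hθn : θ.HasDegree n)
    (hX : IsHamiltonian n θ r X f) (hY : IsHamiltonian n θ s Y g) :
    IsHamiltonian n θ (r + s - 1) (schouten Y X) (bracket θ r s X f Y g) where
  smooth_field := schouten_smooth hs hY.smooth_field hY.degree_field hX.smooth_field
    hX.degree_field
  degree_field := by
    rw [add_comm]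
    exact schouten_degree hs hY.smooth_field hY.degree_field hX.smooth_field hX.degree_field
  smooth_form := ((Form.Smooth.lieDeriv hX.smooth_field hY.smooth_form).neg.add
    ((Form.Smooth.lieDeriv hY.smooth_field hX.smooth_form).smul _)).sub
      ((Form.Smooth.lieDeriv (hX.smooth_field.wedge hY.smooth_field) hθ).smul _)
  degree_form := by
    have h1 := Form.HasDegree.lieDeriv hX.degree_field hY.degree_form
    have h2 := Form.HasDegree.lieDeriv hY.degree_field hX.degree_form
    have h3 := Form.HasDegree.lieDeriv (hX.degree_field.wedge hY.degree_field) hθn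
    have e : ((n : ℤ) - (r + s - 1 : ℕ)) = n - s - r + 1 := by
      rw [Nat.cast_sub (by omega)]; push_cast; ring
    rw [e]
    rw [show (n : ℤ) - r - s + 1 = n - s - r + 1 by ring] at h2
    rw [show (n : ℤ) - (r + s : ℕ) + 1 = n - s - r + 1 by push_cast; ring] at h3
    exact (h1.neg.add (h2.smul _)).sub (h3.smul _)
  eq := by
    obtain ⟨a, rfl⟩ := Nat.exists_eq_add_of_le' hr
    obtain ⟨b, rfl⟩ := Nat.exists_eq_add_of_le' hs
    have hW := schouten_smooth hs hY.smooth_field hY.degree_field hX.smooth_field hX.degree_field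
    have := congrArg Subtype.val (D_cartanBracket (D := extDₗ) (θ := ⟨θ, hθ⟩)
      (f := ⟨f, hX.smooth_form⟩) (g := ⟨g, hY.smooth_form⟩) (a := a) (b := b)
      (x := contractₗ X hX.smooth_field) (y := contractₗ Y hY.smooth_field) extDₗ_extDₗ
      (Subtype.ext hX.contract_extD) (Subtype.ext hY.contract_extD)
      (contractₗ_comm hX.smooth_field hX.degree_field hY.smooth_field hY.degree_field)
      (contractₗ_schouten hX.smooth_field hX.degree_field hY.smooth_field hY.degree_field hW))
    refine Eq.trans this ?_
    exact congrArg extD (coe_cartanBracket _ _ _ _ _)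

/-- If `Z` annihilates `ω`, so do `[X, Z]` and `[Y, Z]`, because `X` and `Y` preserve `ω`. As
these fields annihilate `f`, `g` and `θ`, the field `Z` annihilates their Lie derivatives. -/
theorem IsPoisson.bracket (hr : 1 ≤ r) (hs : 1 ≤ s) (hθ : IsExactMultisymplectic n θ S)
    (hf : IsPoisson n θ r f) (hg : IsPoisson n θ s g)
    (hX : IsHamiltonian n θ r X f) (hY : IsHamiltonian n θ s Y g) :
    IsPoisson n θ (r + s - 1) (bracket θ r s X f Y g) where
  hamiltonian := ⟨_, hX.bracket hr hs hθ.smooth hθ.degree hY⟩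
  kernel k Z hZ hZk h := by
    have ker : ∀ {r : ℕ} {X : MVField I M} {f : Form I M}, 1 ≤ r → IsHamiltonian n θ r X f →
        contract (schouten X Z) (omega θ) = 0 := fun {r X f} hr hX => by
      rw [contract_schouten_eq hr hX.smooth_field hX.degree_field hZ hZk (omega_smooth hθ.smooth),
        h, lieDeriv_zero, hX.lieDeriv_omega hθ.smooth, contract_zero, smul_zero, sub_zero]
    have hXZ := schouten_degree hr hX.smooth_field hX.degree_field hZ hZk
    have hYZ := schouten_degree hs hY.smooth_field hY.degree_field hZ hZk
    have e1 : contract Z (lieDeriv r X g) = 0 :=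
      contract_lieDeriv_eq_zero hr hX.smooth_field hX.degree_field hZ hZk hY.smooth_form
        (hg.kernel k Z hZ hZk h) (hg.kernel _ _
          (schouten_smooth hr hX.smooth_field hX.degree_field hZ hZk) hXZ (ker hr hX))
    have e2 : contract Z (lieDeriv s Y f) = 0 :=
      contract_lieDeriv_eq_zero hs hY.smooth_field hY.degree_field hZ hZk hX.smooth_form
        (hf.kernel k Z hZ hZk h) (hf.kernel _ _
          (schouten_smooth hs hY.smooth_field hY.degree_field hZ hZk) hYZ (ker hs hY))
    have e3 : contract Z (lieDeriv r X θ) = 0 :=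
      contract_lieDeriv_eq_zero hr hX.smooth_field hX.degree_field hZ hZk hθ.smooth
        (hθ.contract_eq_zero hZk h) (hθ.contract_eq_zero hXZ (ker hr hX))
    have e4 : contract Z (lieDeriv s Y (contract X θ)) = 0 :=
      contract_lieDeriv_eq_zero hs hY.smooth_field hY.degree_field hZ hZk
        (Form.Smooth.contract hX.smooth_field hθ.smooth)
        (by rw [contract_comm hZk hX.degree_field, hθ.contract_eq_zero hZk h, contract_zero,
          smul_zero])
        (by rw [contract_comm hYZ hX.degree_field, hθ.contract_eq_zero hYZ (ker hs hY),
          contract_zero, smul_zero])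
    rw [Multisymplectic.bracket, lieDeriv_wedge, sub_eq_add_neg]
    simp only [contract_add, contract_neg, contract_smul, e1, e2, e4,
      contract_comm hZk hY.degree_field (lieDeriv r X θ), e3, contract_zero, smul_zero, neg_zero,
      add_zero]

/-- Since the bracket does not depend on the choice of Hamiltonian fields, those of the inner
brackets may be taken to be Schouten brackets, and `cartanBracket_jacobi` applies. -/
theorem bracket_jacobi {h : Form I M} {Z XY YZ ZX : MVField I M} (hr : 1 ≤ r) (hs : 1 ≤ s)
    (ht : 1 ≤ t) (hθ : IsExactMultisymplectic n θ S) (hf : IsPoisson n θ r f)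
    (hg : IsPoisson n θ s g) (hh : IsPoisson n θ t h) (hX : IsHamiltonian n θ r X f)
    (hY : IsHamiltonian n θ s Y g) (hZ : IsHamiltonian n θ t Z h)
    (hXY : IsHamiltonian n θ (r + s - 1) XY (bracket θ r s X f Y g))
    (hYZ : IsHamiltonian n θ (s + t - 1) YZ (bracket θ s t Y g Z h))
    (hZX : IsHamiltonian n θ (t + r - 1) ZX (bracket θ t r Z h X f)) :
    (-1 : ℝ) ^ ((r - 1) * (t - 1)) •
        bracket θ r (s + t - 1) X f YZ (bracket θ s t Y g Z h) +
      (-1 : ℝ) ^ ((s - 1) * (r - 1)) •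
        bracket θ s (t + r - 1) Y g ZX (bracket θ t r Z h X f) +
      (-1 : ℝ) ^ ((t - 1) * (s - 1)) •
        bracket θ t (r + s - 1) Z h XY (bracket θ r s X f Y g) = 0 := by
  have gXY := hX.bracket hr hs hθ.smooth hθ.degree hY
  have gYZ := hY.bracket hs ht hθ.smooth hθ.degree hZ
  have gZX := hZ.bracket ht hr hθ.smooth hθ.degree hX
  rw [bracket_congr_right hr (by omega) hθ hf hX hYZ gYZ,
    bracket_congr_right hs (by omega) hθ hg hY hZX gZX,
    bracket_congr_right ht (by omega) hθ hh hZ hXY gXY]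
  obtain ⟨a, rfl⟩ := Nat.exists_eq_add_of_le' hr
  obtain ⟨b, rfl⟩ := Nat.exists_eq_add_of_le' hs
  obtain ⟨c, rfl⟩ := Nat.exists_eq_add_of_le' ht
  have d1 : b + 1 + (c + 1) - 1 = b + c + 1 := by omega
  have d2 : c + 1 + (a + 1) - 1 = c + a + 1 := by omega
  have d3 : a + 1 + (b + 1) - 1 = a + b + 1 := by omega
  rw [d3] at gXY
  rw [d1] at gYZ
  rw [d2] at gZX
  have wXY := gXY.smooth_field
  have wYZ := gYZ.smooth_field
  have wZX := gZX.smooth_field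
  have := congrArg Subtype.val (cartanBracket_jacobi (D := extDₗ) (θ := ⟨θ, hθ.smooth⟩)
    (f := ⟨f, hX.smooth_form⟩) (g := ⟨g, hY.smooth_form⟩) (h := ⟨h, hZ.smooth_form⟩)
    (a := a) (b := b) (c := c)
    (x := contractₗ X hX.smooth_field) (y := contractₗ Y hY.smooth_field)
    (z := contractₗ Z hZ.smooth_field) (yx := contractₗ _ wXY)
    (xz := contractₗ _ wZX) (zy := contractₗ _ wYZ) extDₗ_extDₗ
    (Subtype.ext hX.contract_extD) (Subtype.ext hY.contract_extD) (Subtype.ext hZ.contract_extD)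
    (contractₗ_comm _ hX.degree_field _ hY.degree_field)
    (contractₗ_comm _ hX.degree_field _ hZ.degree_field)
    (contractₗ_comm _ hY.degree_field _ hZ.degree_field)
    (contractₗ_schouten _ hY.degree_field _ hZ.degree_field _)
    (contractₗ_schouten _ hZ.degree_field _ hX.degree_field _)
    (contractₗ_schouten _ hX.degree_field _ hY.degree_field _)
    (fun v => by rw [mul_comm]; exact contractₗ_comm _ hX.degree_field _ gYZ.degree_field v))
  rw [d1, d2, d3]
  refine Eq.trans ?_ this
  have c1 := coe_cartanBracket (a := b) (b := c) hY.smooth_field hZ.smooth_field hθ.smooth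
    ⟨g, hY.smooth_form⟩ ⟨h, hZ.smooth_form⟩
  have c2 := coe_cartanBracket (a := c) (b := a) hZ.smooth_field hX.smooth_field hθ.smooth
    ⟨h, hZ.smooth_form⟩ ⟨f, hX.smooth_form⟩
  have c3 := coe_cartanBracket (a := a) (b := b) hX.smooth_field hY.smooth_field hθ.smooth
    ⟨f, hX.smooth_form⟩ ⟨g, hY.smooth_form⟩
  rw [← c1, ← c2, ← c3, ← coe_cartanBracket (a := a) (b := b + c) hX.smooth_field
    wYZ hθ.smooth ⟨f, hX.smooth_form⟩,
    ← coe_cartanBracket (a := b) (b := c + a) hY.smooth_field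
    wZX hθ.smooth ⟨g, hY.smooth_form⟩,
    ← coe_cartanBracket (a := c) (b := a + b) hZ.smooth_field
    wXY hθ.smooth ⟨h, hZ.smooth_form⟩]
  rfl

theorem IsExactHamiltonian.isHamiltonian (hr : 1 ≤ r) (hθ : θ.Smooth) (hθn : θ.HasDegree n)
    (hX : IsExactHamiltonian θ r X) : IsHamiltonian n θ r X (momentum θ r X) where
  smooth_field := hX.smooth
  degree_field := hX.degree
  smooth_form := (Form.Smooth.contract hX.smooth hθ).smul _
  degree_form := (Form.HasDegree.contract hX.degree hθn).smul _
  eq := by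
    obtain ⟨a, rfl⟩ := Nat.exists_eq_add_of_le' hr
    rw [momentum, extD_smul (Form.Smooth.contract hX.smooth hθ), sub_eq_zero.1 hX.lieDeriv_eq,
      omega, contract_neg, smul_smul, ← pow_add, Odd.neg_one_pow ⟨a, by omega⟩, neg_one_smul]

theorem IsExactHamiltonian.isPoisson (hr : 1 ≤ r) (hθ : IsExactMultisymplectic n θ S)
    (hX : IsExactHamiltonian θ r X) : IsPoisson n θ r (momentum θ r X) where
  hamiltonian := ⟨X, hX.isHamiltonian hr hθ.smooth hθ.degree⟩
  kernel k Z _ hZk h := by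
    rw [momentum, contract_smul, contract_comm hZk hX.degree, hθ.contract_eq_zero hZk h,
      contract_zero, smul_zero, smul_zero]

theorem bracket_momentum (hr : 1 ≤ r) (hs : 1 ≤ s) (hθ : θ.Smooth)
    (hX : IsExactHamiltonian θ r X) (hY : IsExactHamiltonian θ s Y) :
    bracket θ r s X (momentum θ r X) Y (momentum θ s Y) =
      momentum θ (s + r - 1) (schouten Y X) := by
  have hW := schouten_smooth hs hY.smooth hY.degree hX.smooth hX.degree
  obtain ⟨a, rfl⟩ := Nat.exists_eq_add_of_le' hr
  obtain ⟨b, rfl⟩ := Nat.exists_eq_add_of_le' hs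
  have := congrArg Subtype.val (cartanBracket_momentum (D := extDₗ) (θ := ⟨θ, hθ⟩)
    (a := a) (b := b) (x := contractₗ X hX.smooth) (y := contractₗ Y hY.smooth)
    (Subtype.ext hX.lieDeriv_eq) (Subtype.ext hY.lieDeriv_eq)
    (contractₗ_comm _ hX.degree _ hY.degree)
    (contractₗ_schouten _ hX.degree _ hY.degree hW))
  rw [momentum, momentum, momentum, ← coe_cartanBracket hX.smooth hY.smooth hθ
    ⟨_, (Form.Smooth.contract hX.smooth hθ).smul _⟩
    ⟨_, (Form.Smooth.contract hY.smooth hθ).smul _⟩,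
    show b + 1 + (a + 1) - 1 - 1 = a + b by omega]
  exact this

theorem IsExactHamiltonian.schouten (hr : 1 ≤ r) (hs : 1 ≤ s) (hθ : θ.Smooth)
    (hθn : θ.HasDegree n) (hX : IsExactHamiltonian θ r X) (hY : IsExactHamiltonian θ s Y) :
    IsExactHamiltonian θ (s + r - 1) (schouten Y X) where
  smooth := schouten_smooth hs hY.smooth hY.degree hX.smooth hX.degree
  degree := schouten_degree hs hY.smooth hY.degree hX.smooth hX.degree
  lieDeriv_eq := by
    have hW := schouten_smooth hs hY.smooth hY.degree hX.smooth hX.degree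
    have h := ((hX.isHamiltonian hr hθ hθn).bracket hr hs hθ hθn
      (hY.isHamiltonian hs hθ hθn)).eq
    rw [bracket_momentum hr hs hθ hX hY, momentum, extD_smul (Form.Smooth.contract hW hθ), omega,
      contract_neg] at h
    obtain ⟨a, rfl⟩ := Nat.exists_eq_add_of_le' hr
    obtain ⟨b, rfl⟩ := Nat.exists_eq_add_of_le' hs
    rw [show b + 1 + (a + 1) - 1 - 1 = b + a by omega] at h
    rw [lieDeriv, show b + 1 + (a + 1) - 1 = b + a + 1 by omega, pow_succ, mul_neg_one, neg_smul,
      ← smul_neg, h, smul_smul, ← pow_add, Even.neg_one_pow ⟨_, rfl⟩, one_smul, sub_self]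

end PoissonForms

end Multisymplectic

end

noncomputable section

namespace Multisymplectic

/-! ### Volume forms on the exterior algebra -/

section Volume

variable {B : Type*} [AddCommGroup B] [Module ℝ B] [FiniteDimensional ℝ B]

/-- A linear functional on the exterior algebra that is concentrated in degree `j`. -/
def IsHomogeneous {V : Type*} [AddCommGroup V] [Module ℝ V] (G : ExteriorAlgebra ℝ V →ₗ[ℝ] ℝ)
    (j : ℕ) : Prop := ∀ (i : ℕ) (u : ExteriorAlgebra ℝ V), i ≠ j → u ∈ ⋀[ℝ]^i V → G u = 0

theorem exteriorPower_eq_zero {k : ℕ} (hk : Module.finrank ℝ B < k) {u : ExteriorAlgebra ℝ B}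
    (hu : u ∈ ⋀[ℝ]^k B) : u = 0 := by
  have h : (⋀[ℝ]^k B : Submodule ℝ (ExteriorAlgebra ℝ B)) = ⊥ := by
    rw [← ExteriorAlgebra.ιMulti_span_fixedDegree, Submodule.span_eq_bot]
    rintro _ ⟨v, rfl⟩
    refine AlternatingMap.map_linearDependent _ v fun hv => ?_
    have := hv.fintype_card_le_finrank
    rw [Fintype.card_fin] at this
    omega
  rw [h] at hu
  exact (Submodule.mem_bot ℝ).1 hu

theorem IsHomogeneous.eq_zero {G : ExteriorAlgebra ℝ B →ₗ[ℝ] ℝ} {j : ℕ} (hG : IsHomogeneous G j)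
    (hj : Module.finrank ℝ B < j) : G = 0 := by
  refine lhom_ext_ιMulti fun k v => ?_
  rw [LinearMap.zero_apply]
  by_cases hk : k = j
  · rw [exteriorPower_eq_zero (hk ▸ hj) (ιMulti_mem_exteriorPower v), map_zero]
  · exact hG k _ hk (ιMulti_mem_exteriorPower v)

/-- Two functionals agree if they agree on homogeneous elements. -/
theorem lhom_ext_homogeneous {V : Type*} [AddCommGroup V] [Module ℝ V]
    {G G' : ExteriorAlgebra ℝ V →ₗ[ℝ] ℝ} (h : ∀ i, ∀ u ∈ ⋀[ℝ]^i V, G u = G' u)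
    (u : ExteriorAlgebra ℝ V) : G u = G' u := by
  have : G = G' := lhom_ext_ιMulti fun k v => h k _ (ιMulti_mem_exteriorPower v)
  rw [this]

/-- Euler's identity for homogeneous multivectors. -/
theorem sum_basis_mul_contractLeft {j : ℕ} {u : ExteriorAlgebra ℝ B} (hu : u ∈ ⋀[ℝ]^j B) :
    ∑ i, ExteriorAlgebra.ι ℝ (Module.finBasis ℝ B i) *
      CliffordAlgebra.contractLeft ((Module.finBasis ℝ B).coord i) u = (j : ℝ) • u := by
  have h : ∀ w, insertionDerivation (LinearMap.id : B →ₗ[ℝ] B) w =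
      ∑ i, ExteriorAlgebra.ι ℝ (Module.finBasis ℝ B i) *
        CliffordAlgebra.contractLeft ((Module.finBasis ℝ B).coord i) w := fun w => by
    simp [insertionDerivation]
  rw [← h]
  refine exteriorPower_induction (C := fun j u =>
    insertionDerivation (LinearMap.id : B →ₗ[ℝ] B) u = (j : ℝ) • u) (fun c => ?_)
    (fun r v X _ hX => ?_) (fun r X Y hX hY => ?_) hu
  · rw [insertionDerivation_algebraMap, Nat.cast_zero, zero_smul]
  · rw [insertionDerivation_ι_mul, hX, LinearMap.id_apply, mul_smul_comm, Nat.cast_succ, add_smul,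
      one_smul, add_comm]
  · rw [map_add, hX, hY, smul_add]

/-- Poincaré duality in the exterior algebra: every functional of degree `j` is `u ↦ vol (K ∧ u)` for
some `K` of the complementary degree. -/
theorem exists_volume_eq {n : ℕ} (hn : Module.finrank ℝ B = n) {vol : ExteriorAlgebra ℝ B →ₗ[ℝ] ℝ}
    (hvol : IsHomogeneous vol n) {e : ExteriorAlgebra ℝ B} (he : e ∈ ⋀[ℝ]^n B) (hve : vol e = 1)
    {j : ℕ} : ∀ {l : ℕ} {G : ExteriorAlgebra ℝ B →ₗ[ℝ] ℝ}, IsHomogeneous G j → l + j = n →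
      ∃ K ∈ ⋀[ℝ]^l B, ∀ u, vol (K * u) = G u := by
  induction j with
  | zero =>
    intro l G hG hl
    obtain rfl : l = n := by omega
    refine ⟨G 1 • e, Submodule.smul_mem _ _ he, lhom_ext_homogeneous
      (G := vol ∘ₗ LinearMap.mulLeft ℝ (G 1 • e)) (fun i u hu => ?_)⟩
    rw [LinearMap.comp_apply, LinearMap.mulLeft_apply, smul_mul_assoc, map_smul, smul_eq_mul]
    by_cases hi : i = 0
    · subst hi
      rw [exteriorPower_zero_eq, Submodule.mem_one] at hu
      obtain ⟨c, rfl⟩ := hu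
      rw [← Algebra.commutes, ← Algebra.smul_def, map_smul, hve, Algebra.algebraMap_eq_smul_one,
        map_smul, smul_eq_mul, smul_eq_mul]
      ring
    · rw [hG i u hi hu, hvol (l + i) _ (by omega) (mul_mem_exteriorPower he hu), mul_zero]
  | succ j ih =>
    intro l G hG hl
    have h : ∀ i, ∃ K ∈ ⋀[ℝ]^(l + 1) B, ∀ u, vol (K * u) =
        (G ∘ₗ LinearMap.mulLeft ℝ (ExteriorAlgebra.ι ℝ (Module.finBasis ℝ B i))) u := fun i =>
      ih (fun k u hk hu => hG (k + 1) _ (by omega) (ι_mul_mem_exteriorPower _ hu)) (by omega)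
    choose K hK hKG using h
    -- Euler's identity for the argument of `G` suggests this candidate, `K i` being the
    -- multivectors that belong to the contractions of `G`.
    set L : ExteriorAlgebra ℝ B := ((-1 : ℝ) ^ l * (1 / (j + 1 : ℝ))) •
      ∑ i, CliffordAlgebra.contractLeft ((Module.finBasis ℝ B).coord i) (K i) with hL
    have hLm : L ∈ ⋀[ℝ]^l B := Submodule.smul_mem _ _
      (Submodule.sum_mem _ fun i _ => contractLeft_mem_exteriorPower _ (hK i))
    refine ⟨L, hLm, lhom_ext_homogeneous (G := vol ∘ₗ LinearMap.mulLeft ℝ L) (fun i u hu => ?_)⟩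
    rw [LinearMap.comp_apply, LinearMap.mulLeft_apply]
    by_cases hi : i = j + 1
    · subst hi
      have e1 := sum_basis_mul_contractLeft hu
      have e2 : ∀ i, CliffordAlgebra.contractLeft ((Module.finBasis ℝ B).coord i) (K i) * u =
          (-1 : ℝ) ^ l • (K i * CliffordAlgebra.contractLeft ((Module.finBasis ℝ B).coord i) u) := by
        intro i
        -- The degree exceeds the dimension.
        have h0 : K i * u = 0 := exteriorPower_eq_zero (k := l + 1 + (j + 1)) (by omega)
          (mul_mem_exteriorPower (hK i) hu)
        have := contractLeft_mul ((Module.finBasis ℝ B).coord i) (hK i) u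
        rw [h0, map_zero, pow_succ, mul_neg_one, neg_smul, ← sub_eq_add_neg, eq_comm,
          sub_eq_zero] at this
        exact this
      have e3 : G u = (1 / (j + 1 : ℝ)) * ∑ i, G (ExteriorAlgebra.ι ℝ (Module.finBasis ℝ B i) *
          CliffordAlgebra.contractLeft ((Module.finBasis ℝ B).coord i) u) := by
        rw [← map_sum, e1, map_smul, smul_eq_mul, Nat.cast_succ, one_div, inv_mul_cancel_left₀]
        positivity
      rw [e3, hL, smul_mul_assoc, Finset.sum_mul, map_smul, map_sum, smul_eq_mul,
        mul_comm ((-1 : ℝ) ^ l), mul_assoc, Finset.mul_sum]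
      congr 1
      refine Finset.sum_congr rfl fun i _ => ?_
      rw [e2, map_smul, hKG, smul_eq_mul, ← mul_assoc, ← pow_add, Even.neg_one_pow ⟨l, rfl⟩,
        one_mul]
      rfl
    · rw [hG i u hi hu, hvol (l + i) _ (by omega) (mul_mem_exteriorPower hLm hu)]

end Volume

/-! ### Multivectors with a given number of vertical factors -/

section Vertical

variable {V W B : Type*} [AddCommGroup V] [Module ℝ V] [AddCommGroup W] [Module ℝ W]
  [AddCommGroup B] [Module ℝ B]

theorem ι_mul_ι_mul (v w : V) (u : ExteriorAlgebra ℝ V) :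
    ExteriorAlgebra.ι ℝ v * (ExteriorAlgebra.ι ℝ w * u) =
      -(ExteriorAlgebra.ι ℝ w * (ExteriorAlgebra.ι ℝ v * u)) := by
  rw [← mul_assoc, ← mul_assoc, eq_neg_iff_add_eq_zero, ← add_mul, ExteriorAlgebra.ι_add_mul_swap,
    zero_mul]

/-- The multivectors with at least `j` factors in the subspace `K`. -/
def vertPow (K : Submodule ℝ V) : ℕ → Submodule ℝ (ExteriorAlgebra ℝ V)
  | 0 => ⊤
  | j + 1 => Submodule.span ℝ {x | ∃ w ∈ K, ∃ u ∈ vertPow K j, x = ExteriorAlgebra.ι ℝ w * u}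

variable {K : Submodule ℝ V}

theorem ι_mul_mem_vertPow_succ {w : V} (hw : w ∈ K) {j : ℕ} {u : ExteriorAlgebra ℝ V}
    (hu : u ∈ vertPow K j) : ExteriorAlgebra.ι ℝ w * u ∈ vertPow K (j + 1) :=
  Submodule.subset_span ⟨w, hw, u, hu, rfl⟩

theorem vertPow_induction {j : ℕ} {C : ExteriorAlgebra ℝ V → Prop}
    (hmul : ∀ w ∈ K, ∀ u ∈ vertPow K j, C (ExteriorAlgebra.ι ℝ w * u)) (hzero : C 0)
    (hadd : ∀ x y, C x → C y → C (x + y)) (hsmul : ∀ (a : ℝ) x, C x → C (a • x))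
    {x : ExteriorAlgebra ℝ V} (hx : x ∈ vertPow K (j + 1)) : C x := by
  refine Submodule.span_induction (fun x hx => ?_) hzero (fun x y _ _ => hadd x y)
    (fun a x _ => hsmul a x) hx
  obtain ⟨w, hw, u, hu, rfl⟩ := hx
  exact hmul w hw u hu

theorem ι_mul_mem_vertPow (v : V) {j : ℕ} {u : ExteriorAlgebra ℝ V} (hu : u ∈ vertPow K j) :
    ExteriorAlgebra.ι ℝ v * u ∈ vertPow K j := by
  induction j generalizing u with
  | zero => exact Submodule.mem_top
  | succ j ih =>
    refine vertPow_induction (C := fun u => ExteriorAlgebra.ι ℝ v * u ∈ vertPow K (j + 1))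
      (fun w hw u hu => ?_) ?_ (fun x y hx hy => ?_) (fun a x hx => ?_) hu
    · rw [ι_mul_ι_mul]
      exact neg_mem (ι_mul_mem_vertPow_succ hw (ih hu))
    · rw [mul_zero]; exact zero_mem _
    · rw [mul_add]; exact add_mem hx hy
    · rw [mul_smul_comm]; exact Submodule.smul_mem _ _ hx

theorem mul_mem_vertPow (X : ExteriorAlgebra ℝ V) {j : ℕ} {u : ExteriorAlgebra ℝ V}
    (hu : u ∈ vertPow K j) : X * u ∈ vertPow K j := by
  refine exteriorAlgebra_induction (C := fun X => X * u ∈ vertPow K j) (fun c => ?_)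
    (fun v X hX => ?_) (fun X Y hX hY => ?_) X
  · rw [← Algebra.smul_def]; exact Submodule.smul_mem _ _ hu
  · rw [mul_assoc]; exact ι_mul_mem_vertPow v hX
  · rw [add_mul]; exact add_mem hX hY

theorem vertPow_succ_le (j : ℕ) : vertPow K (j + 1) ≤ vertPow K j := fun x hx => by
  induction j generalizing x with
  | zero => exact Submodule.mem_top
  | succ j ih =>
    exact vertPow_induction (C := fun x => x ∈ vertPow K (j + 1))
      (fun w hw u hu => ι_mul_mem_vertPow_succ hw (ih u hu)) (zero_mem _)
      (fun _ _ => add_mem) (fun a _ h => Submodule.smul_mem _ a h) hx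

theorem vertPow_anti {i j : ℕ} (h : i ≤ j) : vertPow K j ≤ vertPow K i := by
  induction h with
  | refl => exact le_rfl
  | step _ ih => exact (vertPow_succ_le _).trans ih

theorem mul_mem_vertPow_one {X : ExteriorAlgebra ℝ V} (hX : X ∈ vertPow K 1) {j : ℕ}
    {u : ExteriorAlgebra ℝ V} (hu : u ∈ vertPow K j) : X * u ∈ vertPow K (j + 1) := by
  refine vertPow_induction (C := fun X => X * u ∈ vertPow K (j + 1)) (fun w hw u' _ => ?_) ?_
    (fun x y hx hy => ?_) (fun a x hx => ?_) hX
  · rw [mul_assoc]; exact ι_mul_mem_vertPow_succ hw (mul_mem_vertPow u' hu)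
  · rw [zero_mul]; exact zero_mem _
  · rw [add_mul]; exact add_mem hx hy
  · rw [smul_mul_assoc]; exact Submodule.smul_mem _ _ hx

theorem map_mem_vertPow {K' : Submodule ℝ W} {L : V →ₗ[ℝ] W} (hL : ∀ w ∈ K, L w ∈ K') {j : ℕ}
    {u : ExteriorAlgebra ℝ V} (hu : u ∈ vertPow K j) :
    ExteriorAlgebra.map L u ∈ vertPow K' j := by
  induction j generalizing u with
  | zero => exact Submodule.mem_top
  | succ j ih =>
    refine vertPow_induction (C := fun u => ExteriorAlgebra.map L u ∈ vertPow K' (j + 1))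
      (fun w hw u hu => ?_) ?_ (fun x y hx hy => ?_) (fun a x hx => ?_) hu
    · rw [map_mul, ExteriorAlgebra.map_apply_ι]
      exact ι_mul_mem_vertPow_succ (hL w hw) (ih hu)
    · rw [map_zero]; exact zero_mem _
    · rw [map_add]; exact add_mem hx hy
    · rw [map_smul]; exact Submodule.smul_mem _ _ hx

/-- Modulo multivectors with a vertical factor, vectors may be changed by vertical ones. -/
theorem sub_map_mem_vertPow_one {L : V →ₗ[ℝ] V} (hL : ∀ v, v - L v ∈ K) (u : ExteriorAlgebra ℝ V) :
    u - ExteriorAlgebra.map L u ∈ vertPow K 1 := by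
  refine exteriorAlgebra_induction (C := fun u => u - ExteriorAlgebra.map L u ∈ vertPow K 1)
    (fun c => ?_) (fun v X hX => ?_) (fun X Y hX hY => ?_) u
  · rw [AlgHom.commutes, sub_self]; exact zero_mem _
  · have : ExteriorAlgebra.ι ℝ v * X - ExteriorAlgebra.map L (ExteriorAlgebra.ι ℝ v * X) =
        ExteriorAlgebra.ι ℝ (v - L v) * X +
          ExteriorAlgebra.ι ℝ (L v) * (X - ExteriorAlgebra.map L X) := by
      rw [map_mul, ExteriorAlgebra.map_apply_ι, map_sub, sub_mul, mul_sub]; abel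
    rw [this]
    exact add_mem (ι_mul_mem_vertPow_succ (hL v) Submodule.mem_top) (ι_mul_mem_vertPow _ hX)
  · rw [map_add, add_sub_add_comm]; exact add_mem hX hY

theorem map_eq_zero_of_mem_vertPow {L : V →ₗ[ℝ] W} (hL : ∀ w ∈ K, L w = 0)
    {u : ExteriorAlgebra ℝ V} (hu : u ∈ vertPow K 1) : ExteriorAlgebra.map L u = 0 := by
  refine vertPow_induction (C := fun u => ExteriorAlgebra.map L u = 0) (fun w hw u _ => ?_)
    (map_zero _) (fun x y hx hy => ?_) (fun a x hx => ?_) hu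
  · rw [map_mul, ExteriorAlgebra.map_apply_ι, hL w hw, map_zero, zero_mul]
  · rw [map_add, hx, hy, add_zero]
  · rw [map_smul, hx, smul_zero]

/-- `Φ` is the projection onto the kernel of `b` along the image of the section `c` of `b`. -/
structure IsSplitting (Φ : V →ₗ[ℝ] V) (b : V →ₗ[ℝ] B) (c : B →ₗ[ℝ] V) : Prop where
  decomp : ∀ v, Φ v + c (b v) = v
  section_eq : ∀ h, b (c h) = h

namespace IsSplitting

variable {Φ : V →ₗ[ℝ] V} {b : V →ₗ[ℝ] B} {c : B →ₗ[ℝ] V} (h : IsSplitting Φ b c)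
include h

theorem apply_section (x : B) : Φ (c x) = 0 := by
  have := h.decomp (c x)
  rwa [h.section_eq, add_eq_right] at this

theorem apply_mem (v : V) : Φ v ∈ LinearMap.ker b := by
  have := congrArg b (h.decomp v)
  rwa [map_add, h.section_eq, add_eq_right] at this

theorem apply_of_mem {w : V} (hw : w ∈ LinearMap.ker b) : Φ w = w := by
  have := h.decomp w
  rwa [LinearMap.mem_ker.1 hw, map_zero, add_zero] at this

end IsSplitting

/-- `IsBihomogeneous b c a u` means that `u` is the exterior product of `a` vertical vectors and a
horizontal multivector, the vertical vectors being the kernel of `b` and the horizontal ones the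
image of `c`. -/
inductive IsBihomogeneous (b : V →ₗ[ℝ] B) (c : B →ₗ[ℝ] V) : ℕ → ExteriorAlgebra ℝ V → Prop
  | horizontal (u : ExteriorAlgebra ℝ B) : IsBihomogeneous b c 0 (ExteriorAlgebra.map c u)
  | vertical {a : ℕ} {w : V} {u : ExteriorAlgebra ℝ V} (hw : w ∈ LinearMap.ker b)
    (hu : IsBihomogeneous b c a u) : IsBihomogeneous b c (a + 1) (ExteriorAlgebra.ι ℝ w * u)

variable {Φ : V →ₗ[ℝ] V} {b : V →ₗ[ℝ] B} {c : B →ₗ[ℝ] V}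

theorem IsBihomogeneous.mem_vertPow {a : ℕ} {u : ExteriorAlgebra ℝ V}
    (hu : IsBihomogeneous b c a u) : u ∈ vertPow (LinearMap.ker b) a := by
  induction hu with
  | horizontal u => exact Submodule.mem_top
  | vertical hw _ ih => exact ι_mul_mem_vertPow_succ hw ih

/-- The derivation `i_Φ` counts the vertical factors. -/
theorem IsBihomogeneous.insertionDerivation_eq [FiniteDimensional ℝ V] (h : IsSplitting Φ b c)
    {a : ℕ} {u : ExteriorAlgebra ℝ V} (hu : IsBihomogeneous b c a u) :
    insertionDerivation Φ u = (a : ℝ) • u := by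
  induction hu with
  | horizontal u =>
    rw [Nat.cast_zero, zero_smul]
    refine exteriorAlgebra_induction
      (C := fun u => insertionDerivation Φ (ExteriorAlgebra.map c u) = 0) (fun r => ?_)
      (fun v X hX => ?_) (fun X Y hX hY => ?_) u
    · rw [AlgHom.commutes, insertionDerivation_algebraMap]
    · rw [map_mul, ExteriorAlgebra.map_apply_ι, insertionDerivation_ι_mul, hX, h.apply_section,
        map_zero, zero_mul, mul_zero, add_zero]
    · rw [map_add, map_add, hX, hY, add_zero]
  | vertical hw _ ih =>
    rw [insertionDerivation_ι_mul, ih, h.apply_of_mem hw, mul_smul_comm, Nat.cast_succ, add_smul,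
      one_smul, add_comm]

/-- The bihomogeneous multivectors span the exterior algebra. -/
theorem span_isBihomogeneous (h : IsSplitting Φ b c) (x : ExteriorAlgebra ℝ V) :
    x ∈ Submodule.span ℝ {u | ∃ a, IsBihomogeneous b c a u} := by
  set S := Submodule.span ℝ {u | ∃ a, IsBihomogeneous b c a u} with hS
  have hmul : ∀ w ∈ LinearMap.ker b, ∀ u ∈ S, ExteriorAlgebra.ι ℝ w * u ∈ S := by
    intro w hw u hu
    refine Submodule.span_induction (fun u hu => ?_) ?_ (fun x y _ _ hx hy => ?_)
      (fun a x _ hx => ?_) hu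
    · obtain ⟨a, ha⟩ := hu
      exact Submodule.subset_span ⟨_, ha.vertical hw⟩
    · rw [mul_zero]; exact zero_mem _
    · rw [mul_add]; exact add_mem hx hy
    · rw [mul_smul_comm]; exact Submodule.smul_mem _ _ hx
  have hhor : ∀ y a u, IsBihomogeneous b c a u → ExteriorAlgebra.ι ℝ (c y) * u ∈ S := by
    intro y a u hu
    induction hu with
    | horizontal u =>
      rw [← ExteriorAlgebra.map_apply_ι, ← map_mul]
      exact Submodule.subset_span ⟨0, IsBihomogeneous.horizontal _⟩
    | vertical hw _ ih =>
      rw [ι_mul_ι_mul]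
      exact neg_mem (hmul _ hw _ ih)
  refine exteriorAlgebra_induction (C := fun x => x ∈ S) (fun r => ?_) (fun v X hX => ?_)
    (fun X Y hX hY => add_mem hX hY) x
  · rw [← AlgHom.commutes (ExteriorAlgebra.map c)]
    exact Submodule.subset_span ⟨0, IsBihomogeneous.horizontal _⟩
  · rw [← h.decomp v, map_add, add_mul]
    refine add_mem (hmul _ (h.apply_mem v) _ hX) ?_
    refine Submodule.span_induction (fun u hu => ?_) ?_ (fun x y _ _ hx hy => ?_)
      (fun a x _ hx => ?_) hX
    · obtain ⟨a, ha⟩ := hu; exact hhor _ _ _ ha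
    · rw [mul_zero]; exact zero_mem _
    · rw [mul_add]; exact add_mem hx hy
    · rw [mul_smul_comm]; exact Submodule.smul_mem _ _ hx

theorem lhom_eq_of_isBihomogeneous (h : IsSplitting Φ b c) {N : Type*} [AddCommGroup N] [Module ℝ N]
    {G G' : ExteriorAlgebra ℝ V →ₗ[ℝ] N} (hG : ∀ a u, IsBihomogeneous b c a u → G u = G' u)
    (u : ExteriorAlgebra ℝ V) : G u = G' u := by
  refine Submodule.span_induction (p := fun u _ => G u = G' u) (fun u hu => ?_) (by simp)
    (fun x y _ _ hx hy => ?_) (fun a x _ hx => ?_) (span_isBihomogeneous h u)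
  · obtain ⟨a, ha⟩ := hu; exact hG a u ha
  · rw [map_add, map_add, hx, hy]
  · rw [map_smul, map_smul, hx]

theorem insertionDerivation_mem_vertPow {V : Type*} [AddCommGroup V] [Module ℝ V]
    [FiniteDimensional ℝ V] {Φ : V →ₗ[ℝ] V} {K : Submodule ℝ V} (h : ∀ v, Φ v ∈ K)
    (u : ExteriorAlgebra ℝ V) : insertionDerivation Φ u ∈ vertPow K 1 := by
  rw [insertionDerivation, LinearMap.sum_apply]
  exact sum_mem fun i _ => ι_mul_mem_vertPow_succ (h _) Submodule.mem_top

end Vertical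

end Multisymplectic

end

noncomputable section

namespace Multisymplectic

/-! ### Pointwise comparison of the two multiphase spaces -/

section Comparison

variable {V W B : Type*} [AddCommGroup V] [Module ℝ V] [FiniteDimensional ℝ V]
  [AddCommGroup W] [Module ℝ W] [AddCommGroup B] [Module ℝ B] [FiniteDimensional ℝ B]
  {Φ : V →ₗ[ℝ] V} {b : V →ₗ[ℝ] B} {c : B →ₗ[ℝ] V}

/-- On forms with at most one vertical leg, `i_Φ` is idempotent. -/
theorem apply_insertionDerivation_twice (h : IsSplitting Φ b c) {φ : ExteriorAlgebra ℝ V →ₗ[ℝ] ℝ}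
    (hφ : ∀ u ∈ vertPow (LinearMap.ker b) 2, φ u = 0) (u : ExteriorAlgebra ℝ V) :
    φ (insertionDerivation Φ (insertionDerivation Φ u)) = φ (insertionDerivation Φ u) := by
  refine lhom_eq_of_isBihomogeneous h
    (G := φ ∘ₗ insertionDerivation Φ ∘ₗ insertionDerivation Φ)
    (G' := φ ∘ₗ insertionDerivation Φ) (fun a u hu => ?_) u
  simp only [LinearMap.comp_apply, hu.insertionDerivation_eq h, map_smul, smul_eq_mul]
  obtain rfl | rfl | ha : a = 0 ∨ a = 1 ∨ 2 ≤ a := by omega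
  · simp
  · simp
  · rw [hφ u (vertPow_anti ha hu.mem_vertPow)]; simp

/-- If `X` solves `i(X)o = dᵛf`, so does its image under the derivation `i_Φ`, since `o` has two
vertical legs and `dᵛf` has one. -/
theorem apply_insertionDerivation_mul {o φ : ExteriorAlgebra ℝ V →ₗ[ℝ] ℝ} (h : IsSplitting Φ b c)
    (ho : ∀ u, o (insertionDerivation Φ u) = 2 * o u)
    (hφ : ∀ u ∈ vertPow (LinearMap.ker b) 2, φ u = 0) {X : ExteriorAlgebra ℝ V}
    (hX : ∀ u, o (X * u) = φ (insertionDerivation Φ u)) (u : ExteriorAlgebra ℝ V) :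
    o (insertionDerivation Φ X * u) = φ (insertionDerivation Φ u) := by
  have h1 := ho (X * u)
  rw [insertionDerivation_mul, map_add, hX, hX, apply_insertionDerivation_twice h hφ] at h1
  linarith

/-- Contraction of `o` with two Hamiltonian multivectors annihilates vertical vectors. -/
theorem apply_mul_mul_eq_zero {o φ ψ : ExteriorAlgebra ℝ V →ₗ[ℝ] ℝ} (h : IsSplitting Φ b c)
    (ho : ∀ u, o (insertionDerivation Φ u) = 2 * o u)
    (hφ : ∀ u ∈ vertPow (LinearMap.ker b) 2, φ u = 0)
    (hψ : ∀ u ∈ vertPow (LinearMap.ker b) 2, ψ u = 0) {r s : ℕ} {X Y : ExteriorAlgebra ℝ V}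
    (hXr : X ∈ ⋀[ℝ]^r V) (hYs : Y ∈ ⋀[ℝ]^s V)
    (hX : ∀ u, o (X * u) = φ (insertionDerivation Φ u))
    (hY : ∀ u, o (Y * u) = ψ (insertionDerivation Φ u)) {u : ExteriorAlgebra ℝ V}
    (hu : u ∈ vertPow (LinearMap.ker b) 1) : o (Y * (X * u)) = 0 := by
  have key : ∀ a u, IsBihomogeneous b c (a + 1) u → o (Y * (X * u)) = 0 := by
    intro a u hu
    have hcomm : ∀ {X Y : ExteriorAlgebra ℝ V}, X ∈ ⋀[ℝ]^r V → Y ∈ ⋀[ℝ]^s V →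
        o (Y * (X * u)) = (-1 : ℝ) ^ (s * r) * o (X * (Y * u)) := fun hX hY => by
      rw [← mul_assoc, mul_comm_exteriorPower hY hX, smul_mul_assoc, map_smul, mul_assoc,
        smul_eq_mul]
    have e1 := apply_insertionDerivation_mul h ho hψ hY (X * u)
    rw [← hY] at e1
    have e2 := apply_insertionDerivation_mul h ho hφ hX (Y * u)
    rw [← hX] at e2
    have e3 : o (Y * (insertionDerivation Φ X * u)) = o (Y * (X * u)) := by
      rw [hcomm (insertionDerivation_mem Φ hXr) hYs, e2, ← hcomm hXr hYs]
    -- Count vertical legs in `o (Y * (X * u))`: two in `o`, but one on account of `X`, one on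
    -- account of `Y`, and `a + 1` in `u`.
    have e4 := ho (Y * (X * u))
    rw [insertionDerivation_mul, insertionDerivation_mul, hu.insertionDerivation_eq h, mul_add,
      map_add, map_add, e1, e3, mul_smul_comm, mul_smul_comm, map_smul, smul_eq_mul] at e4
    have e5 : ((a + 1 : ℕ) : ℝ) * o (Y * (X * u)) = 0 := by linarith
    exact (mul_eq_zero.1 e5).resolve_left (by positivity)
  refine vertPow_induction (C := fun u => o (Y * (X * u)) = 0) (fun w hw u _ => ?_) (by simp)
    (fun x y hx hy => by rw [mul_add, mul_add, map_add, hx, hy, add_zero])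
    (fun a x hx => by rw [mul_smul_comm, mul_smul_comm, map_smul, hx, smul_zero]) hu
  exact lhom_eq_of_isBihomogeneous h
    (G := o ∘ₗ LinearMap.mulLeft ℝ Y ∘ₗ LinearMap.mulLeft ℝ X ∘ₗ
      LinearMap.mulLeft ℝ (ExteriorAlgebra.ι ℝ w)) (G' := 0)
    (fun a u hu => key a _ (hu.vertical hw)) u

/-- The relation between the tangent space `V` of the ordinary and the tangent space `W` of the
extended multiphase space: `q` is the differential of the projection, `e` the vector along its fibre,
`S` a right inverse of `q` that pulls `Ω` back to `o`. -/
structure IsPhaseLift (vol : ExteriorAlgebra ℝ B →ₗ[ℝ] ℝ) (o : ExteriorAlgebra ℝ V →ₗ[ℝ] ℝ)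
    (Ω : ExteriorAlgebra ℝ W →ₗ[ℝ] ℝ) (b : V →ₗ[ℝ] B) (q : W →ₗ[ℝ] V) (S : V →ₗ[ℝ] W) (e : W) :
    Prop where
  proj_lift : ∀ v, q (S v) = v
  proj_fibre : q e = 0
  decomp : ∀ w, ∃ t : ℝ, w = S (q w) + t • e
  omega_fibre : ∀ u, Ω (ExteriorAlgebra.ι ℝ e * u) = -vol (ExteriorAlgebra.map (b ∘ₗ q) u)
  omega_lift : ∀ u, Ω (ExteriorAlgebra.map S u) = o u

theorem map_map_apply {V₁ V₂ V₃ : Type*} [AddCommGroup V₁] [Module ℝ V₁] [AddCommGroup V₂]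
    [Module ℝ V₂] [AddCommGroup V₃] [Module ℝ V₃] (g : V₂ →ₗ[ℝ] V₃) (f : V₁ →ₗ[ℝ] V₂)
    (u : ExteriorAlgebra ℝ V₁) :
    ExteriorAlgebra.map g (ExteriorAlgebra.map f u) = ExteriorAlgebra.map (g ∘ₗ f) u :=
  DFunLike.congr_fun (ExteriorAlgebra.map_comp_map f g) u

theorem map_eq_self {V₁ : Type*} [AddCommGroup V₁] [Module ℝ V₁] {f : V₁ →ₗ[ℝ] V₁}
    (hf : ∀ v, f v = v) (u : ExteriorAlgebra ℝ V₁) : ExteriorAlgebra.map f u = u := by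
  have : f = LinearMap.id := LinearMap.ext hf
  rw [this, ExteriorAlgebra.map_id]
  rfl

theorem apply_mul_comm {V₁ : Type*} [AddCommGroup V₁] [Module ℝ V₁]
    (Ω : ExteriorAlgebra ℝ V₁ →ₗ[ℝ] ℝ) {r s : ℕ} {X Y : ExteriorAlgebra ℝ V₁} (hX : X ∈ ⋀[ℝ]^r V₁)
    (hY : Y ∈ ⋀[ℝ]^s V₁) (u : ExteriorAlgebra ℝ V₁) :
    Ω (X * (Y * u)) = (-1 : ℝ) ^ (r * s) * Ω (Y * (X * u)) := by
  rw [← mul_assoc, mul_comm_exteriorPower hX hY, smul_mul_assoc, map_smul, mul_assoc, smul_eq_mul]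

/-- A functional without vertical legs factors through the base. -/
theorem apply_map_section (h : IsSplitting Φ b c) {f : ExteriorAlgebra ℝ V →ₗ[ℝ] ℝ}
    (hf : ∀ u ∈ vertPow (LinearMap.ker b) 1, f u = 0) (u : ExteriorAlgebra ℝ V) :
    f (ExteriorAlgebra.map c (ExteriorAlgebra.map b u)) = f u := by
  have := hf _ (sub_map_mem_vertPow_one (L := c ∘ₗ b) (K := LinearMap.ker b) (fun v => by
    rw [LinearMap.mem_ker, map_sub, LinearMap.comp_apply, h.section_eq, sub_self]) u)
  rw [map_sub, sub_eq_zero] at this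
  rw [this, map_map_apply]

namespace IsPhaseLift

variable {vol : ExteriorAlgebra ℝ B →ₗ[ℝ] ℝ} {o φ ψ χ f : ExteriorAlgebra ℝ V →ₗ[ℝ] ℝ}
    {Ω : ExteriorAlgebra ℝ W →ₗ[ℝ] ℝ} {q : W →ₗ[ℝ] V} {S : V →ₗ[ℝ] W} {e : W}
    {n j l : ℕ} {η : ExteriorAlgebra ℝ B}

/-- Every multivector is the sum of a lift and a multiple of the vector along the fibre. -/
theorem map_decomp (hp : IsPhaseLift vol o Ω b q S e) (u : ExteriorAlgebra ℝ W) :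
    ∃ u', u = ExteriorAlgebra.map S (ExteriorAlgebra.map q u) + ExteriorAlgebra.ι ℝ e * u' := by
  refine exteriorAlgebra_induction (C := fun u => ∃ u',
    u = ExteriorAlgebra.map S (ExteriorAlgebra.map q u) + ExteriorAlgebra.ι ℝ e * u')
    (fun r => ⟨0, ?_⟩) (fun w X hX => ?_) (fun X Y hX hY => ?_) u
  · rw [AlgHom.commutes, AlgHom.commutes, mul_zero, add_zero]
  · obtain ⟨X', hX'⟩ := hX
    obtain ⟨t, ht⟩ := hp.decomp w
    refine ⟨t • X - ExteriorAlgebra.ι ℝ (S (q w)) * X', ?_⟩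
    rw [map_mul, map_mul, ExteriorAlgebra.map_apply_ι, ExteriorAlgebra.map_apply_ι, mul_sub,
      ← sub_eq_zero, ι_mul_ι_mul e]
    nth_rewrite 1 [ht]
    rw [map_add, add_mul]
    nth_rewrite 1 [hX']
    rw [map_smul, mul_smul_comm, smul_mul_assoc, mul_add]
    abel
  · obtain ⟨X', hX'⟩ := hX
    obtain ⟨Y', hY'⟩ := hY
    refine ⟨X' + Y', ?_⟩
    rw [map_add, map_add, mul_add, add_add_add_comm, ← hX', ← hY']

/-- The vector along the fibre contracts `Ω` to the volume form, up to sign. -/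
theorem omega_eq (hp : IsPhaseLift vol o Ω b q S e) (u : ExteriorAlgebra ℝ V)
    {K : ExteriorAlgebra ℝ W} : Ω (ExteriorAlgebra.ι ℝ e * (K * ExteriorAlgebra.map S u)) =
      -vol (ExteriorAlgebra.map (b ∘ₗ q) K * ExteriorAlgebra.map b u) := by
  rw [hp.omega_fibre, map_mul, map_map_apply, LinearMap.comp_assoc,
    show q ∘ₗ S = LinearMap.id from LinearMap.ext hp.proj_lift, LinearMap.comp_id]

/-- A solution `X` of `i(X)o = dᵛf` on the ordinary multiphase space yields a solution of
`i(X₀)Ω = df` on the extended one. -/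
theorem exists_hamiltonian (hp : IsPhaseLift vol o Ω b q S e) (h : IsSplitting Φ b c)
    (hn : Module.finrank ℝ B = n) (hvol : IsHomogeneous vol n) (hη : η ∈ ⋀[ℝ]^n B)
    (hvη : vol η = 1) (ho : ∀ u, o (insertionDerivation Φ u) = 2 * o u)
    (hφ : ∀ u ∈ vertPow (LinearMap.ker b) 2, φ u = 0) (hφj : IsHomogeneous φ j) (hl : l + j = n)
    {X : ExteriorAlgebra ℝ V} (hXr : X ∈ ⋀[ℝ]^(l + 1) V)
    (hX : ∀ u, o (X * u) = φ (insertionDerivation Φ u)) :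
    ∃ X₀ ∈ ⋀[ℝ]^(l + 1) W, X₀ ∈ vertPow (LinearMap.ker (b ∘ₗ q)) 1 ∧
      ExteriorAlgebra.map q X₀ = insertionDerivation Φ X ∧
      ∀ u, Ω (X₀ * u) = φ (ExteriorAlgebra.map q u) := by
  have hqS : q ∘ₗ S = LinearMap.id := LinearMap.ext hp.proj_lift
  -- The horizontal part of `df`, which `ωᵛ` does not see, is taken up by the vector `e` along
  -- the fibre.
  obtain ⟨k, hk, hkφ⟩ := exists_volume_eq hn hvol hη hvη (j := j)
    (G := -(φ ∘ₗ (ExteriorAlgebra.map c).toLinearMap))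
    (fun i u hi hu => by
      rw [LinearMap.neg_apply, LinearMap.comp_apply, neg_eq_zero]
      exact hφj i _ hi (map_mem_exteriorPower c hu)) hl
  set X₀ := ExteriorAlgebra.map S (insertionDerivation Φ X) +
    ExteriorAlgebra.ι ℝ e * ExteriorAlgebra.map (S ∘ₗ c) k with hX₀
  have hbqK : ExteriorAlgebra.map (b ∘ₗ q) (ExteriorAlgebra.map (S ∘ₗ c) k) = k := by
    rw [map_map_apply]
    exact map_eq_self (fun x => by
      simp only [LinearMap.comp_apply, hp.proj_lift, h.section_eq]) k
  have hX₀m : X₀ ∈ ⋀[ℝ]^(l + 1) W := add_mem (map_mem_exteriorPower S (insertionDerivation_mem Φ hXr))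
    (ι_mul_mem_exteriorPower e (map_mem_exteriorPower _ hk))
  have hX₀v : X₀ ∈ vertPow (LinearMap.ker (b ∘ₗ q)) 1 := by
    refine add_mem (map_mem_vertPow (K := LinearMap.ker b) (fun w hw => ?_)
      (insertionDerivation_mem_vertPow h.apply_mem X)) (ι_mul_mem_vertPow_succ ?_ Submodule.mem_top)
    · rw [LinearMap.mem_ker, LinearMap.comp_apply, hp.proj_lift]; exact hw
    · rw [LinearMap.mem_ker, LinearMap.comp_apply, hp.proj_fibre, map_zero]
  refine ⟨X₀, hX₀m, hX₀v, ?_, ?_⟩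
  · rw [hX₀, map_add, map_mul, ExteriorAlgebra.map_apply_ι, hp.proj_fibre, map_zero, zero_mul,
      add_zero, map_map_apply, hqS, ExteriorAlgebra.map_id]
    rfl
  have hS : ∀ u, Ω (X₀ * ExteriorAlgebra.map S u) = φ u := by
    refine lhom_eq_of_isBihomogeneous h (G := Ω ∘ₗ LinearMap.mulLeft ℝ X₀ ∘ₗ
      (ExteriorAlgebra.map S).toLinearMap) (G' := φ) (fun a u hu => ?_)
    change Ω (X₀ * ExteriorAlgebra.map S u) = φ u
    rw [hX₀, add_mul, map_add, ← map_mul, hp.omega_lift, mul_assoc, hp.omega_eq, hbqK,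
      apply_insertionDerivation_mul h ho hφ hX, hu.insertionDerivation_eq h, map_smul, smul_eq_mul]
    cases hu with
    | horizontal u =>
      have : ExteriorAlgebra.map b (ExteriorAlgebra.map c u) = u := by
        rw [map_map_apply]; exact map_eq_self h.section_eq u
      rw [this, hkφ, LinearMap.neg_apply, neg_neg]
      simp
    | @vertical a w u hw hu =>
      have h0 : ExteriorAlgebra.map b (ExteriorAlgebra.ι ℝ w * u) = 0 := by
        rw [map_mul, ExteriorAlgebra.map_apply_ι, LinearMap.mem_ker.1 hw, map_zero, zero_mul]
      rw [h0, mul_zero, map_zero, neg_zero, add_zero]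
      rcases Nat.eq_zero_or_pos a with rfl | ha
      · simp
      · rw [hφ _ (vertPow_anti (by omega) (hu.vertical hw).mem_vertPow), mul_zero]
  intro u
  obtain ⟨u', hu'⟩ := hp.map_decomp u
  rw [hu', mul_add, map_add, hS, apply_mul_comm Ω hX₀m (ι_mem_exteriorPower e), hp.omega_fibre,
    map_mul, map_eq_zero_of_mem_vertPow (fun w hw => hw) hX₀v, map_add, map_mul (ExteriorAlgebra.map q),
    ExteriorAlgebra.map_apply_ι, hp.proj_fibre, map_map_apply q S, hqS, ExteriorAlgebra.map_id]
  simp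

/-- Pull-backs of horizontal forms to the extended multiphase space are contractions of `Ω`. -/
theorem exists_contraction (hp : IsPhaseLift vol o Ω b q S e) (h : IsSplitting Φ b c)
    (hn : Module.finrank ℝ B = n) (hvol : IsHomogeneous vol n) (hη : η ∈ ⋀[ℝ]^n B)
    (hvη : vol η = 1) (hf : ∀ u ∈ vertPow (LinearMap.ker b) 1, f u = 0) (hfj : IsHomogeneous f j)
    (hl : l + j = n) : ∃ K ∈ ⋀[ℝ]^l W, ∀ u,
      f (ExteriorAlgebra.map q u) = Ω (ExteriorAlgebra.ι ℝ e * (K * u)) := by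
  obtain ⟨k, hk, hkf⟩ := exists_volume_eq hn hvol hη hvη (j := j)
    (G := -(f ∘ₗ (ExteriorAlgebra.map c).toLinearMap))
    (fun i u hi hu => by
      rw [LinearMap.neg_apply, LinearMap.comp_apply, neg_eq_zero]
      exact hfj i _ hi (map_mem_exteriorPower c hu)) hl
  refine ⟨ExteriorAlgebra.map (S ∘ₗ c) k, map_mem_exteriorPower _ hk, fun u => ?_⟩
  have hbqK : ExteriorAlgebra.map (b ∘ₗ q) (ExteriorAlgebra.map (S ∘ₗ c) k) = k := by
    rw [map_map_apply]
    exact map_eq_self (fun x => by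
      simp only [LinearMap.comp_apply, hp.proj_lift, h.section_eq]) k
  rw [hp.omega_fibre, map_mul, hbqK, hkf, LinearMap.neg_apply, neg_neg, ← map_map_apply b q]
  exact (apply_map_section h hf _).symm

/-- Multivectors that annihilate `Ω` annihilate the pull-backs of horizontal forms `f`, because
`f` is a contraction of `Ω`. -/
theorem apply_mul_eq_zero (hp : IsPhaseLift vol o Ω b q S e) (h : IsSplitting Φ b c)
    (hn : Module.finrank ℝ B = n) (hvol : IsHomogeneous vol n) (hη : η ∈ ⋀[ℝ]^n B)
    (hvη : vol η = 1) (hf : ∀ u ∈ vertPow (LinearMap.ker b) 1, f u = 0) (hfj : IsHomogeneous f j)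
    (hl : l + j = n) {Z : ExteriorAlgebra ℝ W} {k : ℕ} (hZk : Z ∈ ⋀[ℝ]^k W)
    (hZ : ∀ u, Ω (Z * u) = 0) (u : ExteriorAlgebra ℝ W) :
    f (ExteriorAlgebra.map q (Z * u)) = 0 := by
  obtain ⟨K, hK, hKf⟩ := hp.exists_contraction h hn hvol hη hvη hf hfj hl
  rw [hKf, ← mul_assoc, apply_mul_comm Ω (ι_mul_mem_exteriorPower e hK) hZk, hZ, mul_zero]

/-- A solution `Z` of `i(Z)Ω = dh` on the extended multiphase space yields a solution of
`i(Z')o = dᵛh` on the ordinary one. -/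
theorem apply_mul_eq (hp : IsPhaseLift vol o Ω b q S e) (h : IsSplitting Φ b c)
    (ho : ∀ u, o (insertionDerivation Φ u) = 2 * o u)
    {Z : ExteriorAlgebra ℝ W} (hZ : ∀ u, Ω (Z * u) = χ (ExteriorAlgebra.map q u))
    (u : ExteriorAlgebra ℝ V) :
    o (((2 : ℝ) • ExteriorAlgebra.map q Z - insertionDerivation Φ (ExteriorAlgebra.map q Z)) * u) =
      χ (insertionDerivation Φ u) := by
  have hqS : q ∘ₗ S = LinearMap.id := LinearMap.ext hp.proj_lift
  refine lhom_eq_of_isBihomogeneous h (G := o ∘ₗ LinearMap.mulLeft ℝ _)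
    (G' := χ ∘ₗ insertionDerivation Φ) (fun a u hu => ?_) u
  rw [LinearMap.comp_apply, LinearMap.comp_apply, LinearMap.mulLeft_apply]
  have e1 := ho (ExteriorAlgebra.map q Z * u)
  rw [insertionDerivation_mul, map_add, hu.insertionDerivation_eq h, mul_smul_comm, map_smul,
    smul_eq_mul] at e1
  -- On the left, `2 - i_Φ` turns into multiplication by the number `a` of vertical factors of
  -- `u`.
  have e2 : o (((2 : ℝ) • ExteriorAlgebra.map q Z -
      insertionDerivation Φ (ExteriorAlgebra.map q Z)) * u) =
        a * o (ExteriorAlgebra.map q Z * u) := by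
    rw [sub_mul, map_sub, smul_mul_assoc, map_smul, smul_eq_mul]; linarith
  rw [e2, hu.insertionDerivation_eq h, map_smul, smul_eq_mul]
  cases hu with
  | horizontal u => simp
  | @vertical a w u hw hu =>
    have h0 : ExteriorAlgebra.map b (ExteriorAlgebra.ι ℝ w * u) = 0 := by
      rw [map_mul, ExteriorAlgebra.map_apply_ι, LinearMap.mem_ker.1 hw, map_zero, zero_mul]
    obtain ⟨Z', hZ'⟩ := hp.map_decomp Z
    have e3 := hZ (ExteriorAlgebra.map S (ExteriorAlgebra.ι ℝ w * u))
    rw [map_map_apply q S, hqS, ExteriorAlgebra.map_id, AlgHom.id_apply] at e3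
    rw [← e3]
    nth_rewrite 2 [hZ']
    rw [add_mul, map_add, mul_assoc, hp.omega_eq, h0, mul_zero, map_zero, neg_zero, add_zero,
      ← map_mul, hp.omega_lift]

end IsPhaseLift

/-- The contraction of `dg` with the vertical part of a Hamiltonian multivector `X` of `f` is a
twofold contraction of `o`. Both sides vanish on vertical vectors. -/
theorem apply_insertionDerivation_mul_eq {o φ ψ : ExteriorAlgebra ℝ V →ₗ[ℝ] ℝ}
    (h : IsSplitting Φ b c) (ho : ∀ u, o (insertionDerivation Φ u) = 2 * o u)
    (hφ : ∀ u ∈ vertPow (LinearMap.ker b) 2, φ u = 0)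
    (hψ : ∀ u ∈ vertPow (LinearMap.ker b) 2, ψ u = 0) {r s : ℕ} {X Y : ExteriorAlgebra ℝ V}
    (hXr : X ∈ ⋀[ℝ]^r V) (hYs : Y ∈ ⋀[ℝ]^s V)
    (hX : ∀ u, o (X * u) = φ (insertionDerivation Φ u))
    (hY : ∀ u, o (Y * u) = ψ (insertionDerivation Φ u)) (u : ExteriorAlgebra ℝ V) :
    ψ (insertionDerivation Φ X * u) = o (Y * (X * u)) := by
  refine lhom_eq_of_isBihomogeneous h (G := ψ ∘ₗ LinearMap.mulLeft ℝ (insertionDerivation Φ X))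
    (G' := o ∘ₗ LinearMap.mulLeft ℝ Y ∘ₗ LinearMap.mulLeft ℝ X) (fun a u hu => ?_) u
  change ψ (insertionDerivation Φ X * u) = o (Y * (X * u))
  rcases Nat.eq_zero_or_pos a with rfl | ha
  · rw [hY, insertionDerivation_mul, hu.insertionDerivation_eq h]
    simp
  · have hu1 := vertPow_anti ha hu.mem_vertPow
    rw [hψ _ (mul_mem_vertPow_one (insertionDerivation_mem_vertPow h.apply_mem X) hu1),
      apply_mul_mul_eq_zero h ho hφ hψ hXr hYs hX hY hu1]

/-- The part with two vertical legs of a functional with at most two vertical legs. -/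
theorem apply_insertionDerivation_eq_two_mul {o τ : ExteriorAlgebra ℝ V →ₗ[ℝ] ℝ}
    (h : IsSplitting Φ b c) (hτ : ∀ u ∈ vertPow (LinearMap.ker b) 3, τ u = 0)
    (ho : ∀ u, o u = 1 / 2 * τ (insertionDerivation Φ (insertionDerivation Φ u) -
      insertionDerivation Φ u)) (u : ExteriorAlgebra ℝ V) :
    o (insertionDerivation Φ u) = 2 * o u := by
  refine lhom_eq_of_isBihomogeneous h (G := o ∘ₗ insertionDerivation Φ) (G' := (2 : ℝ) • o)
    (fun a u hu => ?_) u
  rw [LinearMap.comp_apply, LinearMap.smul_apply, smul_eq_mul, hu.insertionDerivation_eq h,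
    map_smul, smul_eq_mul, ho, hu.insertionDerivation_eq h, map_smul, hu.insertionDerivation_eq h,
    smul_smul, ← sub_smul, map_smul, smul_eq_mul]
  obtain rfl | rfl | rfl | ha : a = 0 ∨ a = 1 ∨ a = 2 ∨ 3 ≤ a := by omega
  · norm_num
  · norm_num
  · norm_num
  · rw [hτ u (vertPow_anti ha hu.mem_vertPow)]; simp

theorem contractLeft_map_eq_zero {τ : Module.Dual ℝ V} {c : B →ₗ[ℝ] V} (hτ : ∀ x, τ (c x) = 0)
    (u : ExteriorAlgebra ℝ B) :
    CliffordAlgebra.contractLeft τ (ExteriorAlgebra.map c u) = 0 := by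
  refine exteriorAlgebra_induction
    (C := fun u => CliffordAlgebra.contractLeft τ (ExteriorAlgebra.map c u) = 0)
    (fun r => ?_) (fun v X hX => ?_) (fun X Y hX hY => ?_) u
  · rw [AlgHom.commutes]
    exact contractLeft_exteriorPower_zero τ (exteriorPower_zero_algebraMap r)
  · rw [map_mul, ExteriorAlgebra.map_apply_ι, ExteriorAlgebra.ι,
      CliffordAlgebra.contractLeft_ι_mul, hτ, hX, zero_smul, mul_zero, sub_zero]
  · rw [map_add, map_add, hX, hY, add_zero]

theorem contractLeft_mem_vertPow (τ : Module.Dual ℝ V) {K : Submodule ℝ V} {j : ℕ}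
    {u : ExteriorAlgebra ℝ V} (hu : u ∈ vertPow K (j + 1)) :
    CliffordAlgebra.contractLeft τ u ∈ vertPow K j := by
  induction j generalizing u with
  | zero => exact Submodule.mem_top
  | succ j ih =>
    refine vertPow_induction (C := fun u => CliffordAlgebra.contractLeft τ u ∈ vertPow K (j + 1))
      (fun w hw u hu => ?_) ?_ (fun x y hx hy => ?_) (fun a x hx => ?_) hu
    · rw [ExteriorAlgebra.ι, CliffordAlgebra.contractLeft_ι_mul]
      exact sub_mem (Submodule.smul_mem _ _ hu) (ι_mul_mem_vertPow_succ hw (ih hu))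
    · rw [map_zero]; exact zero_mem _
    · rw [map_add]; exact add_mem hx hy
    · rw [map_smul]; exact Submodule.smul_mem _ _ hx

/-- The exterior powers of a map perturbed by a map of rank one. -/
theorem map_add_smulRight (S : V →ₗ[ℝ] W) (τ : Module.Dual ℝ V) (e : W) (u : ExteriorAlgebra ℝ V) :
    ExteriorAlgebra.map (S + τ.smulRight e) u = ExteriorAlgebra.map S u +
      ExteriorAlgebra.ι ℝ e * ExteriorAlgebra.map S (CliffordAlgebra.contractLeft τ u) := by
  refine exteriorAlgebra_induction (C := fun u => ExteriorAlgebra.map (S + τ.smulRight e) u =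
    ExteriorAlgebra.map S u +
      ExteriorAlgebra.ι ℝ e * ExteriorAlgebra.map S (CliffordAlgebra.contractLeft τ u))
    (fun r => ?_) (fun v X hX => ?_) (fun X Y hX hY => ?_) u
  · rw [AlgHom.commutes, AlgHom.commutes,
      contractLeft_exteriorPower_zero τ (exteriorPower_zero_algebraMap r), map_zero, mul_zero,
      add_zero]
  · have e1 : CliffordAlgebra.contractLeft τ (ExteriorAlgebra.ι ℝ v * X) =
        τ v • X - ExteriorAlgebra.ι ℝ v * CliffordAlgebra.contractLeft τ X :=
      CliffordAlgebra.contractLeft_ι_mul (Q := (0 : QuadraticForm ℝ V)) τ v X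
    have e2 : ∀ x : ExteriorAlgebra ℝ W,
        ExteriorAlgebra.ι ℝ e * (ExteriorAlgebra.ι ℝ e * x) = 0 := fun x => by
      rw [← mul_assoc, ExteriorAlgebra.ι_sq_zero, zero_mul]
    rw [e1, map_mul, hX, ExteriorAlgebra.map_apply_ι, LinearMap.add_apply,
      LinearMap.smulRight_apply, map_add, map_smul, map_sub, map_smul, map_mul, map_mul,
      ExteriorAlgebra.map_apply_ι, add_mul, mul_add, mul_add, smul_mul_assoc, smul_mul_assoc, e2,
      ι_mul_ι_mul (S v), mul_sub, mul_smul_comm, smul_zero]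
    abel
  · simp only [map_add, hX, hY, mul_add]; abel

/-- If `o` is the part of `τ` with two vertical legs, a right inverse `S` of `q` that pulls `Ω` back to
`τ` can be corrected along the fibre of `q` such that `Ω` is pulled back to `o`: the difference
`τ - o` has one vertical leg and as many horizontal ones as possible, hence it is the product of a
linear form and the volume form. -/
theorem exists_isPhaseLift {n : ℕ} {vol : ExteriorAlgebra ℝ B →ₗ[ℝ] ℝ} {η : ExteriorAlgebra ℝ B}
    {o τ : ExteriorAlgebra ℝ V →ₗ[ℝ] ℝ} {Ω : ExteriorAlgebra ℝ W →ₗ[ℝ] ℝ} {q : W →ₗ[ℝ] V}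
    {S : V →ₗ[ℝ] W} {e : W} (hp : IsPhaseLift vol τ Ω b q S e) (h : IsSplitting Φ b c)
    (hn : Module.finrank ℝ B = n) (hvol : IsHomogeneous vol n) (hη : η ∈ ⋀[ℝ]^n B)
    (hvη : vol η = 1) (hτ : ∀ u ∈ vertPow (LinearMap.ker b) 3, τ u = 0)
    (hτn : IsHomogeneous τ (n + 1))
    (ho : ∀ u, o u = 1 / 2 * τ (insertionDerivation Φ (insertionDerivation Φ u) -
      insertionDerivation Φ u)) : ∃ S', IsPhaseLift vol o Ω b q S' e := by
  -- The linear form with `τ - o = σ ∧ vol`.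
  let σ : Module.Dual ℝ V := τ ∘ₗ LinearMap.mulRight ℝ (ExteriorAlgebra.map c η) ∘ₗ
    ExteriorAlgebra.ι ℝ ∘ₗ Φ
  have hσ : ∀ v, σ v = τ (ExteriorAlgebra.ι ℝ (Φ v) * ExteriorAlgebra.map c η) := fun v => rfl
  have hσc : ∀ x, σ (c x) = 0 := fun x => by
    rw [hσ, h.apply_section, map_zero, zero_mul, map_zero]
  refine ⟨S + σ.smulRight e, ⟨fun v => ?_, hp.proj_fibre, fun w => ?_, hp.omega_fibre, ?_⟩⟩
  · rw [LinearMap.add_apply, LinearMap.smulRight_apply, map_add, map_smul, hp.proj_fibre,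
      smul_zero, add_zero, hp.proj_lift]
  · obtain ⟨t, ht⟩ := hp.decomp w
    refine ⟨t - σ (q w), ?_⟩
    nth_rewrite 1 [ht]
    rw [LinearMap.add_apply, LinearMap.smulRight_apply]
    module
  · refine lhom_eq_of_isBihomogeneous h
      (G := Ω ∘ₗ (ExteriorAlgebra.map (S + σ.smulRight e)).toLinearMap) (fun a u hu => ?_)
    change Ω (ExteriorAlgebra.map (S + σ.smulRight e) u) = o u
    have h1 := hp.omega_eq (CliffordAlgebra.contractLeft σ u) (K := 1)
    rw [one_mul, map_one, one_mul] at h1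
    rw [map_add_smulRight, map_add, hp.omega_lift, h1, ho, hu.insertionDerivation_eq h, map_smul,
      hu.insertionDerivation_eq h, smul_smul, ← sub_smul, map_smul, smul_eq_mul]
    cases hu with
    | horizontal u =>
      have h0 : τ (ExteriorAlgebra.map c u) = 0 := by
        have : τ ∘ₗ (ExteriorAlgebra.map c).toLinearMap = 0 :=
          IsHomogeneous.eq_zero (j := n + 1) (fun i u hi hu =>
            hτn i _ hi (map_mem_exteriorPower c hu)) (by omega)
        exact LinearMap.congr_fun this u
      rw [h0, contractLeft_map_eq_zero hσc]
      simp
    | @vertical a w u hw hu =>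
      cases hu with
      | horizontal u =>
        obtain ⟨k, hk, hku⟩ := exists_volume_eq hn hvol hη hvη (j := n) (l := 0)
          (G := τ ∘ₗ LinearMap.mulLeft ℝ (ExteriorAlgebra.ι ℝ w) ∘ₗ
            (ExteriorAlgebra.map c).toLinearMap)
          (fun i u hi hu => hτn (i + 1) _ (by omega)
            (ι_mul_mem_exteriorPower w (map_mem_exteriorPower c hu))) (by omega)
        rw [exteriorPower_zero_eq, Submodule.mem_one] at hk
        obtain ⟨κ, rfl⟩ := hk
        have hkv : ∀ u, κ * vol u = τ (ExteriorAlgebra.ι ℝ w * ExteriorAlgebra.map c u) := by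
          intro u
          have := hku u
          rw [← Algebra.smul_def, map_smul, smul_eq_mul] at this
          exact this
        have hκ : σ w = κ := by
          rw [hσ, h.apply_of_mem hw, ← hkv, hvη, mul_one]
        have e1 : CliffordAlgebra.contractLeft σ (ExteriorAlgebra.ι ℝ w * ExteriorAlgebra.map c u) =
            κ • ExteriorAlgebra.map c u := by
          have := CliffordAlgebra.contractLeft_ι_mul (Q := (0 : QuadraticForm ℝ V)) σ w
            (ExteriorAlgebra.map c u)
          rw [contractLeft_map_eq_zero hσc, mul_zero, sub_zero, hκ] at this
          exact this
        rw [e1, map_smul, map_smul, smul_eq_mul, map_map_apply,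
          map_eq_self (f := b ∘ₗ c) h.section_eq, ← hkv]
        norm_num
      | @vertical a w' u hw' hu =>
        have hu2 := (hu.vertical hw').vertical hw
        rw [map_eq_zero_of_mem_vertPow (fun w hw => hw)
          (contractLeft_mem_vertPow σ (vertPow_anti (by omega) hu2.mem_vertPow)), map_zero,
          neg_zero, add_zero]
        rcases Nat.eq_zero_or_pos a with rfl | ha
        · push_cast; ring
        · rw [hτ _ (vertPow_anti (by omega) hu2.mem_vertPow), mul_zero, mul_zero]

end Comparison

end Multisymplectic

end

noncomputable section

namespace Multisymplectic

/-! ### Maps and vector bundles in charts -/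

section Maps

variable {E : Type*} [NormedAddCommGroup E] [NormedSpace ℝ E] {H : Type*} [TopologicalSpace H]
  {I : ModelWithCorners ℝ E H} {N : Type*} [TopologicalSpace N] [ChartedSpace H N]
  [I.Boundaryless] [IsManifold I ∞ N]
  {E' : Type*} [NormedAddCommGroup E'] [NormedSpace ℝ E'] {H' : Type*} [TopologicalSpace H']
  {I' : ModelWithCorners ℝ E' H'} {P : Type*} [TopologicalSpace P] [ChartedSpace H' P]
  [I'.Boundaryless] [IsManifold I' ∞ P]

/-- The differential of a map that is given by `G` in preferred charts around `p` and `p'`. -/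
theorem hasMFDerivAt_of_charts {F : N → P} {p q : N} {p' : P} (hq : q ∈ (extChartAt I p).source)
    {G : E → E'} {L : E →L[ℝ] E'} (hG : HasFDerivAt G L (extChartAt I p q))
    (hmem : G (extChartAt I p q) ∈ (extChartAt I' p').target)
    (h : ∀ᶠ y in 𝓝 (extChartAt I p q),
      F ((extChartAt I p).symm y) = (extChartAt I' p').symm (G y)) :
    HasMFDerivAt I I' F q ((tangentCoordChange I' p' (F q) (F q)).comp
      (L.comp (tangentCoordChange I q p q)) : E →L[ℝ] E') := by
  have hqq := mem_extChartAt_source (I := I) q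
  have hFq : F q = (extChartAt I' p').symm (G (extChartAt I p q)) := by
    have := h.self_of_nhds
    rwa [(extChartAt I p).left_inv hq] at this
  have hFq' : F q ∈ (extChartAt I' p').source := hFq ▸ (extChartAt I' p').map_target hmem
  have hGq : G (extChartAt I p q) = extChartAt I' p' (F q) := by
    rw [hFq, (extChartAt I' p').right_inv hmem]
  have hsymm : ContinuousAt (extChartAt I' p').symm (G (extChartAt I p q)) :=
    (continuousOn_extChartAt_symm p').continuousAt
      ((isOpen_extChartAt_target p').mem_nhds hmem)
  refine ⟨?_, ?_⟩
  · have hc : ContinuousAt ((extChartAt I' p').symm ∘ G ∘ extChartAt I p) q :=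
      ContinuousAt.comp (f := G ∘ extChartAt I p) hsymm
        (hG.continuousAt.comp (continuousAt_extChartAt' hq))
    refine hc.congr ?_
    filter_upwards [(isOpen_extChartAt_source p).mem_nhds hq,
      (continuousAt_extChartAt' hq).eventually h] with x hx hx'
    rw [(extChartAt I p).left_inv hx] at hx'
    exact hx'.symm
  · suffices hd : HasFDerivAt (𝕜 := ℝ) (E := E) (F := E') (writtenInExtChartAt I I' q F)
        ((tangentCoordChange I' p' (F q) (F q)).comp
          (L.comp (tangentCoordChange I q p q)) : E →L[ℝ] E') (extChartAt I q q) from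
      hd.hasFDerivWithinAt
    have h1 := ((contDiffAt_chartChange hqq hq).differentiableAt (by simp)).hasFDerivAt
    have h2 := ((contDiffAt_chartChange hFq' (mem_extChartAt_source (I := I') (F q))).differentiableAt
      (by simp)).hasFDerivAt
    rw [fderiv_chartChange] at h1 h2
    have e1 : (extChartAt I p ∘ (extChartAt I q).symm) (extChartAt I q q) = extChartAt I p q := by
      rw [Function.comp_apply, (extChartAt I q).left_inv hqq]
    rw [← hGq] at h2
    rw [← e1] at hG h2
    refine (HasFDerivAt.comp (f := G ∘ extChartAt I p ∘ (extChartAt I q).symm) _ h2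
      (hG.comp _ h1)).congr_of_eventuallyEq ?_
    have hev := (contDiffAt_chartChange hqq hq).continuousAt
    rw [ContinuousAt, e1] at hev
    filter_upwards [hev.eventually h, eventually_mem_chart_source hqq hq] with y hy hy'
    simp only [writtenInExtChartAt, Function.comp_apply] at hy ⊢
    rw [← hy, (extChartAt I p).left_inv hy'.2]

end Maps

section Core

variable {B F : Type*} [NormedAddCommGroup B] [NormedSpace ℝ B] [NormedAddCommGroup F]
  [NormedSpace ℝ F] {Y : Type*} [TopologicalSpace Y] [ChartedSpace B Y]

/-- A vector bundle that is trivialized by the charts of its base. -/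
structure IsChartCore (Z : VectorBundleCore ℝ Y F (atlas B Y)) : Prop where
  indexAt : ∀ y, Z.indexAt y = achart B y
  baseSet : ∀ i, Z.baseSet i = i.1.source

variable {Z : VectorBundleCore ℝ Y F (atlas B Y)}

theorem IsChartCore.target (h : IsChartCore Z) (p : Bundle.TotalSpace F Z.Fiber) :
    (extChartAt (𝓘(ℝ, B).prod 𝓘(ℝ, F)) p).target = (extChartAt 𝓘(ℝ, B) p.1).target ×ˢ univ := by
  rw [FiberBundle.extChartAt_target]
  congr 1
  refine inter_eq_left.2 fun y hy => ?_
  have := (extChartAt 𝓘(ℝ, B) p.1).map_target hy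
  change _ ∈ Z.baseSet (Z.indexAt p.1)
  rw [h.baseSet, h.indexAt]
  simpa using this

theorem IsChartCore.mem_source (h : IsChartCore Z) (p q : Bundle.TotalSpace F Z.Fiber) :
    q ∈ (extChartAt (𝓘(ℝ, B).prod 𝓘(ℝ, F)) p).source ↔ q.1 ∈ (extChartAt 𝓘(ℝ, B) p.1).source := by
  rw [extChartAt_source, extChartAt_source, FiberBundle.chartedSpace_chartAt]
  have hb : ∀ x : Y, x ∈ Z.baseSet (Z.indexAt p.1) ↔ x ∈ (chartAt B p.1).source := by
    intro x
    rw [h.baseSet, h.indexAt]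
    rfl
  rw [OpenPartialHomeomorph.trans_source]
  simp only [OpenPartialHomeomorph.prod_source, OpenPartialHomeomorph.refl_source, mem_inter_iff,
    mem_preimage, mem_prod, mem_univ, and_true]
  have h1 : q ∈ (trivializationAt F Z.Fiber p.1).source ↔ q.1 ∈ Z.baseSet (Z.indexAt p.1) :=
    (trivializationAt F Z.Fiber p.1).mem_source
  refine ⟨fun hq => hq.2, fun hq => ⟨h1.2 ((hb _).2 hq), hq⟩⟩

theorem extChartAt_core (p q : Bundle.TotalSpace F Z.Fiber) :
    extChartAt (𝓘(ℝ, B).prod 𝓘(ℝ, F)) p q = (extChartAt 𝓘(ℝ, B) p.1 q.1,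
      Z.coordChange (Z.indexAt q.1) (Z.indexAt p.1) q.1 q.2) := by
  rw [FiberBundle.extChartAt]
  rfl

theorem IsChartCore.symm_apply (h : IsChartCore Z) (p : Bundle.TotalSpace F Z.Fiber) {y : B × F}
    (hy : y.1 ∈ (extChartAt 𝓘(ℝ, B) p.1).target) :
    (extChartAt (𝓘(ℝ, B).prod 𝓘(ℝ, F)) p).symm y = ⟨(extChartAt 𝓘(ℝ, B) p.1).symm y.1,
      Z.coordChange (Z.indexAt p.1) (Z.indexAt ((extChartAt 𝓘(ℝ, B) p.1).symm y.1))
        ((extChartAt 𝓘(ℝ, B) p.1).symm y.1) y.2⟩ := by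
  have hs := (extChartAt 𝓘(ℝ, B) p.1).map_target hy
  have hb : (extChartAt 𝓘(ℝ, B) p.1).symm y.1 ∈ Z.baseSet (Z.indexAt p.1) := by
    rw [h.baseSet, h.indexAt]
    simpa using hs
  set q : Bundle.TotalSpace F Z.Fiber := ⟨(extChartAt 𝓘(ℝ, B) p.1).symm y.1,
      Z.coordChange (Z.indexAt p.1) (Z.indexAt ((extChartAt 𝓘(ℝ, B) p.1).symm y.1))
        ((extChartAt 𝓘(ℝ, B) p.1).symm y.1) y.2⟩ with hq
  have hqs : q ∈ (extChartAt (𝓘(ℝ, B).prod 𝓘(ℝ, F)) p).source := (h.mem_source p q).2 hs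
  have hqy : extChartAt (𝓘(ℝ, B).prod 𝓘(ℝ, F)) p q = y := by
    rw [extChartAt_core]
    refine Prod.ext ((extChartAt 𝓘(ℝ, B) p.1).right_inv hy) ?_
    change Z.coordChange _ _ _ (Z.coordChange _ _ _ y.2) = y.2
    rw [Z.coordChange_comp _ _ _ _ ⟨⟨hb, Z.mem_baseSet_at _⟩, hb⟩, Z.coordChange_self _ _ hb]
  rw [← (extChartAt _ p).left_inv hqs, hqy]

/-- The differential of the bundle projection. -/
theorem IsChartCore.hasMFDerivAt_proj [IsManifold 𝓘(ℝ, B) ∞ Y] [Z.IsContMDiff 𝓘(ℝ, B) ∞]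
    (h : IsChartCore Z) (p : Bundle.TotalSpace F Z.Fiber) :
    HasMFDerivAt (𝓘(ℝ, B).prod 𝓘(ℝ, F)) 𝓘(ℝ, B) (fun q : Bundle.TotalSpace F Z.Fiber => q.1) p
      (ContinuousLinearMap.fst ℝ B F) := by
  have ht := mem_extChartAt_target (I := 𝓘(ℝ, B).prod 𝓘(ℝ, F)) p
  have hs := mem_extChartAt_source (I := 𝓘(ℝ, B).prod 𝓘(ℝ, F)) p
  have := hasMFDerivAt_of_charts (I := 𝓘(ℝ, B).prod 𝓘(ℝ, F)) (I' := 𝓘(ℝ, B))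
    (F := fun q : Bundle.TotalSpace F Z.Fiber => q.1) (p := p) (p' := p.1) hs
    (ContinuousLinearMap.fst ℝ B F).hasFDerivAt
    (by have := h.target p ▸ ht; exact this.1) (by
      filter_upwards [(isOpen_extChartAt_target p).mem_nhds ht] with y hy
      rw [h.target] at hy
      rw [h.symm_apply p hy.1]
      rfl)
  rw [tangentCoordChange_self_eq hs] at this
  have h2 : tangentCoordChange 𝓘(ℝ, B) p.1 p.1 p.1 = ContinuousLinearMap.id ℝ B :=
    tangentCoordChange_self_eq (mem_extChartAt_source (I := 𝓘(ℝ, B)) p.1)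
  have h3 : ∀ K : B →L[ℝ] B, K = ContinuousLinearMap.id ℝ B →
      K.comp ((ContinuousLinearMap.fst ℝ B F).comp (ContinuousLinearMap.id ℝ (B × F))) =
        ContinuousLinearMap.fst ℝ B F := by
    rintro K rfl
    rfl
  exact (h3 _ h2) ▸ this

/-- In the preferred charts, the changes of coordinates of the total space lie over those of the
base. -/
theorem IsChartCore.fst_tangentCoordChange [IsManifold 𝓘(ℝ, B) ∞ Y] [Z.IsContMDiff 𝓘(ℝ, B) ∞]
    (h : IsChartCore Z) {p₀ p₁ q : Bundle.TotalSpace F Z.Fiber}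
    (h₀ : q.1 ∈ (extChartAt 𝓘(ℝ, B) p₀.1).source) (h₁ : q.1 ∈ (extChartAt 𝓘(ℝ, B) p₁.1).source)
    (v : B × F) : (tangentCoordChange (𝓘(ℝ, B).prod 𝓘(ℝ, F)) p₀ p₁ q v).1 =
      tangentCoordChange 𝓘(ℝ, B) p₀.1 p₁.1 q.1 v.1 := by
  have h₀' := (h.mem_source p₀ q).2 h₀
  have h₁' := (h.mem_source p₁ q).2 h₁
  have d1 := ((contDiffAt_chartChange h₀' h₁').differentiableAt (by simp)).hasFDerivAt
  have d2 := ((contDiffAt_chartChange h₀ h₁).differentiableAt (by simp)).hasFDerivAt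
  rw [fderiv_chartChange] at d1 d2
  have e1 := (ContinuousLinearMap.fst ℝ B F).hasFDerivAt.comp _ d1
  have e2 : HasFDerivAt ((extChartAt 𝓘(ℝ, B) p₁.1 ∘ (extChartAt 𝓘(ℝ, B) p₀.1).symm) ∘
      (ContinuousLinearMap.fst ℝ B F)) _ (extChartAt (𝓘(ℝ, B).prod 𝓘(ℝ, F)) p₀ q) :=
    HasFDerivAt.comp _ (by rw [extChartAt_core]; exact d2)
      (ContinuousLinearMap.fst ℝ B F).hasFDerivAt
  have e3 := e2.congr_of_eventuallyEq (f₁ := (ContinuousLinearMap.fst ℝ B F) ∘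
    (extChartAt (𝓘(ℝ, B).prod 𝓘(ℝ, F)) p₁ ∘ (extChartAt (𝓘(ℝ, B).prod 𝓘(ℝ, F)) p₀).symm)) (by
      filter_upwards [(isOpen_extChartAt_target p₀).mem_nhds
        ((extChartAt (𝓘(ℝ, B).prod 𝓘(ℝ, F)) p₀).map_source h₀')] with y hy
      rw [h.target] at hy
      simp only [Function.comp_apply]
      rw [h.symm_apply p₀ hy.1, extChartAt_core]
      rfl)
  exact DFunLike.congr_fun (e1.unique e3) v

/-- The velocity of the curve `t ↦ t • p` in the fibres, in a preferred chart. -/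
theorem IsChartCore.mfderiv_smul [IsManifold 𝓘(ℝ, B) ∞ Y] [Z.IsContMDiff 𝓘(ℝ, B) ∞]
    (h : IsChartCore Z) {p₀ p : Bundle.TotalSpace F Z.Fiber}
    (hp : p ∈ (extChartAt (𝓘(ℝ, B).prod 𝓘(ℝ, F)) p₀).source) :
    tangentCoordChange (𝓘(ℝ, B).prod 𝓘(ℝ, F)) p p₀ p (mfderiv 𝓘(ℝ, ℝ) (𝓘(ℝ, B).prod 𝓘(ℝ, F))
      (fun t : ℝ => (⟨p.1, t • p.2⟩ : Bundle.TotalSpace F Z.Fiber)) 1 (1 : ℝ)) =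
      (0, (extChartAt (𝓘(ℝ, B).prod 𝓘(ℝ, F)) p₀ p).2) := by
  set y := extChartAt (𝓘(ℝ, B).prod 𝓘(ℝ, F)) p₀ p with hy
  have ht : y ∈ (extChartAt (𝓘(ℝ, B).prod 𝓘(ℝ, F)) p₀).target := (extChartAt _ p₀).map_source hp
  have hG : HasFDerivAt (fun t : ℝ => (y.1, t • y.2))
      ((0 : ℝ →L[ℝ] B).prod ((ContinuousLinearMap.id ℝ ℝ).smulRight y.2))
      (extChartAt 𝓘(ℝ, ℝ) (1 : ℝ) (1 : ℝ)) :=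
    (hasFDerivAt_const _ _).prodMk ((hasFDerivAt_id _).smul_const _)
  have hsymm : ∀ t : ℝ, (⟨p.1, t • p.2⟩ : Bundle.TotalSpace F Z.Fiber) =
      (extChartAt (𝓘(ℝ, B).prod 𝓘(ℝ, F)) p₀).symm (y.1, t • y.2) := by
    intro t
    have ht' := ht
    rw [h.target] at ht'
    have h1 := h.symm_apply p₀ (y := (y.1, t • y.2)) ht'.1
    have h2 := h.symm_apply p₀ (y := y) ht'.1
    rw [(extChartAt _ p₀).left_inv hp] at h2
    rw [h1, map_smul, h2]
    rfl
  have key := (hasMFDerivAt_of_charts (I := 𝓘(ℝ, ℝ)) (I' := 𝓘(ℝ, B).prod 𝓘(ℝ, F))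
    (F := fun t : ℝ => (⟨p.1, t • p.2⟩ : Bundle.TotalSpace F Z.Fiber)) (p := 1) (q := 1) (p' := p₀)
    (mem_extChartAt_source (I := 𝓘(ℝ, ℝ)) (1 : ℝ)) hG
    (by rw [h.target] at ht ⊢; exact ⟨ht.1, mem_univ _⟩)
    (Eventually.of_forall fun t => hsymm t)).mfderiv
  have hone : (⟨p.1, (1 : ℝ) • p.2⟩ : Bundle.TotalSpace F Z.Fiber) = p := by rw [one_smul]
  have h3 : ∀ q : Bundle.TotalSpace F Z.Fiber, q = p →
      tangentCoordChange (𝓘(ℝ, B).prod 𝓘(ℝ, F)) p p₀ p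
        (tangentCoordChange (𝓘(ℝ, B).prod 𝓘(ℝ, F)) p₀ q q (0, (1 : ℝ) • y.2)) = (0, y.2) := by
    rintro q rfl
    have := tangentCoordChange_comp_eq (I := 𝓘(ℝ, B).prod 𝓘(ℝ, F)) hp
      (mem_extChartAt_source (I := 𝓘(ℝ, B).prod 𝓘(ℝ, F)) q) hp
    rw [tangentCoordChange_self_eq hp] at this
    rw [one_smul]
    exact DFunLike.congr_fun this _
  rw [← h3 _ hone]
  congr 1
  refine (DFunLike.congr_fun key (1 : ℝ)).trans ?_
  have h4 : tangentCoordChange 𝓘(ℝ, ℝ) (1 : ℝ) (1 : ℝ) (1 : ℝ) = ContinuousLinearMap.id ℝ ℝ :=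
    tangentCoordChange_self_eq (mem_extChartAt_source (I := 𝓘(ℝ, ℝ)) (1 : ℝ))
  have h5 : ∀ (K : ℝ →L[ℝ] ℝ) (N : B × F →L[ℝ] B × F), K = ContinuousLinearMap.id ℝ ℝ →
      N.comp (((0 : ℝ →L[ℝ] B).prod ((ContinuousLinearMap.id ℝ ℝ).smulRight y.2)).comp K) (1 : ℝ) =
        N (0, (1 : ℝ) • y.2) := by
    rintro K N rfl
    rfl
  exact h5 _ _ h4

end Core

end Multisymplectic

end

noncomputable section

namespace Multisymplectic

/-! ### The linear models of the multiphase spaces -/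

section AltPairing

variable {V : Type*} [AddCommGroup V] [Module ℝ V] [TopologicalSpace V]
  [IsTopologicalAddGroup V] [ContinuousSMul ℝ V] [T2Space V] [FiniteDimensional ℝ V]

/-- The functional on multivectors given by a single alternating form. -/
def altPairing (k : ℕ) : (V [⋀^Fin k]→L[ℝ] ℝ) →ₗ[ℝ] ExteriorAlgebra ℝ V →ₗ[ℝ] ℝ :=
  Covector.pairingₗ ∘ₗ LinearMap.single ℝ (fun k => V [⋀^Fin k]→L[ℝ] ℝ) k

theorem altPairing_def {k : ℕ} (α : V [⋀^Fin k]→L[ℝ] ℝ) : altPairing k α =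
    Covector.pairing (V := V) (Pi.single k α) := rfl

theorem altPairing_ιMulti {k : ℕ} (α : V [⋀^Fin k]→L[ℝ] ℝ) (v : Fin k → V) :
    altPairing k α (ExteriorAlgebra.ιMulti ℝ k v) = α v := by
  rw [altPairing_def, Covector.pairing_ιMulti, Pi.single_eq_same]

theorem altPairing_ιMulti_of_ne {k j : ℕ} (h : j ≠ k) (α : V [⋀^Fin k]→L[ℝ] ℝ) (v : Fin j → V) :
    altPairing k α (ExteriorAlgebra.ιMulti ℝ j v) = 0 := by
  rw [altPairing_def, Covector.pairing_ιMulti, Pi.single_eq_of_ne h]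
  rfl

theorem isHomogeneous_altPairing {k : ℕ} (α : V [⋀^Fin k]→L[ℝ] ℝ) :
    IsHomogeneous (altPairing k α) k := fun i u hi hu =>
  Covector.pairing_eq_zero (α := Pi.single k α) (k := k)
    (fun j hj => Pi.single_eq_of_ne (by exact_mod_cast hj) _) (by exact_mod_cast hi) hu

theorem eq_zero_of_altPairing {k : ℕ} {α : V [⋀^Fin k]→L[ℝ] ℝ} (h : ∀ u, altPairing k α u = 0) :
    α = 0 := by
  ext v
  rw [← altPairing_ιMulti, h]
  rfl

theorem altPairing_comp {W : Type*} [AddCommGroup W] [Module ℝ W] [TopologicalSpace W]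
    [IsTopologicalAddGroup W] [ContinuousSMul ℝ W] [T2Space W] [FiniteDimensional ℝ W]
    {k : ℕ} (α : V [⋀^Fin k]→L[ℝ] ℝ) (L : W →L[ℝ] V) (u : ExteriorAlgebra ℝ W) :
    altPairing k (α.compContinuousLinearMap L) u =
      altPairing k α (ExteriorAlgebra.map (L : W →ₗ[ℝ] V) u) := by
  have : (Pi.single k (α.compContinuousLinearMap L) : Covector W) =
      Covector.comap (Pi.single k α : Covector V) L := by
    funext j
    by_cases h : j = k
    · subst h
      simp [Covector.comap]
    · simp only [Covector.comap, Pi.single_eq_of_ne h]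
      rfl
  rw [altPairing_def, this, Covector.pairing_comap]
  rfl

theorem altPairing_ι_mul {V : Type*} [NormedAddCommGroup V] [NormedSpace ℝ V]
    [FiniteDimensional ℝ V] {k : ℕ} (α : V [⋀^Fin (k + 1)]→L[ℝ] ℝ) (v : V)
    (u : ExteriorAlgebra ℝ V) :
    altPairing (k + 1) α (ExteriorAlgebra.ι ℝ v * u) = altPairing k (α.curryLeft v) u := by
  have : altPairing (k + 1) α ∘ₗ LinearMap.mulLeft ℝ (ExteriorAlgebra.ι ℝ v) =
      altPairing k (α.curryLeft v) := lhom_ext_ιMulti fun j w => by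
    by_cases h : j = k
    · subst h
      have e : ExteriorAlgebra.ι ℝ v * ExteriorAlgebra.ιMulti ℝ j w =
          ExteriorAlgebra.ιMulti ℝ (j + 1) (Matrix.vecCons v w) := by
        rw [ExteriorAlgebra.ιMulti_succ_apply]
        rfl
      rw [LinearMap.comp_apply, LinearMap.mulLeft_apply, e, altPairing_ιMulti, altPairing_ιMulti]
      rfl
    · rw [altPairing_ιMulti_of_ne h]
      exact isHomogeneous_altPairing α _ _ (by omega)
        (ι_mul_mem_exteriorPower v (ιMulti_mem_exteriorPower w))
  exact LinearMap.congr_fun this u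

end AltPairing

section Dual

variable {A T : Type*} [NormedAddCommGroup A] [NormedSpace ℝ A] [FiniteDimensional ℝ A]
  [NormedAddCommGroup T] [NormedSpace ℝ T] [FiniteDimensional ℝ T]

theorem fderiv_apply_eq_zero {a : A → ExteriorAlgebra ℝ T →L[ℝ] ℝ} {x : A}
    {u : ExteriorAlgebra ℝ T} (ha : DifferentiableAt ℝ a x) (h : ∀ᶠ y in 𝓝 x, a y u = 0) (w : A) :
    fderiv ℝ a x w u = 0 := by
  have h1 : HasFDerivAt (fun y => a y u) ((fderiv ℝ a x).flip u) x :=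
    (ha.hasFDerivAt.clm_apply (hasFDerivAt_const u x)).congr_fderiv (by ext; simp)
  have h2 : HasFDerivAt (fun y => a y u) (0 : A →L[ℝ] ℝ) x :=
    (hasFDerivAt_const (0 : ℝ) x).congr_of_eventuallyEq h
  exact DFunLike.congr_fun (h1.unique h2) w

/-- The exterior derivative of a form that annihilates multivectors with `j` factors in `K`
annihilates those with `j + 1` factors in `K`. -/
theorem dualD_eq_zero_of_mem_vertPow {a : A → ExteriorAlgebra ℝ A →L[ℝ] ℝ} {x : A}
    {K : Submodule ℝ A} {j : ℕ} (ha : DifferentiableAt ℝ a x)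
    (h : ∀ᶠ y in 𝓝 x, ∀ u ∈ vertPow K j, a y u = 0) {u : ExteriorAlgebra ℝ A}
    (hu : u ∈ vertPow K (j + 1)) : dualD a x u = 0 :=
  Finset.sum_eq_zero fun _ _ => fderiv_apply_eq_zero ha
    (h.mono fun _ hy => hy _ (contractLeft_mem_vertPow _ hu)) _

theorem dualD_eq_zero_of_degree {a : A → ExteriorAlgebra ℝ A →L[ℝ] ℝ} {x : A} {j : ℕ}
    (ha : DifferentiableAt ℝ a x)
    (h : ∀ᶠ y in 𝓝 x, IsHomogeneous (a y : ExteriorAlgebra ℝ A →ₗ[ℝ] ℝ) j)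
    {i : ℕ} (hi : i ≠ j + 1) {u : ExteriorAlgebra ℝ A} (hu : u ∈ ⋀[ℝ]^i A) : dualD a x u = 0 := by
  refine Finset.sum_eq_zero fun _ _ => ?_
  cases i with
  | zero => rw [contractLeft_exteriorPower_zero _ hu, map_zero]
  | succ i =>
    exact fderiv_apply_eq_zero ha
      (h.mono fun _ hy => hy _ _ (by omega) (contractLeft_mem_exteriorPower _ hu)) _

end Dual

section Model

variable {EM EQ : Type*} [NormedAddCommGroup EM] [NormedSpace ℝ EM] [FiniteDimensional ℝ EM]
  [NormedAddCommGroup EQ] [NormedSpace ℝ EQ] [FiniteDimensional ℝ EQ]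

/-- Forms vanishing on two vertical vectors, as functionals. -/
theorem altPairing_eq_zero_of_mem_vertPow {n : ℕ} (α : extFibre EM EQ n)
    {u : ExteriorAlgebra ℝ (EM × EQ)} (hu : u ∈ vertPow (LinearMap.ker (LinearMap.fst ℝ EM EQ)) 2) :
    altPairing n α.1 u = 0 := by
  refine vertPow_induction (C := fun u => altPairing n α.1 u = 0) (fun w hw u hu => ?_)
    (map_zero _) (fun x y hx hy => by rw [map_add, hx, hy, add_zero])
    (fun a x hx => by rw [map_smul, hx, smul_zero]) hu
  refine vertPow_induction (C := fun u => altPairing n α.1 (ExteriorAlgebra.ι ℝ w * u) = 0)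
    (fun w' hw' u _ => ?_) (by rw [mul_zero, map_zero])
    (fun x y hx hy => by rw [mul_add, map_add, hx, hy, add_zero])
    (fun a x hx => by rw [mul_smul_comm, map_smul, hx, smul_zero]) hu
  have : altPairing n α.1 ∘ₗ LinearMap.mulLeft ℝ (ExteriorAlgebra.ι ℝ w) ∘ₗ
      LinearMap.mulLeft ℝ (ExteriorAlgebra.ι ℝ w') = 0 := lhom_ext_ιMulti fun k v => by
    have e : ExteriorAlgebra.ι ℝ w * (ExteriorAlgebra.ι ℝ w' * ExteriorAlgebra.ιMulti ℝ k v) =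
        ExteriorAlgebra.ιMulti ℝ (k + 2) (Matrix.vecCons w (Matrix.vecCons w' v)) := by
      rw [ExteriorAlgebra.ιMulti_succ_apply, ExteriorAlgebra.ιMulti_succ_apply]
      rfl
    rw [LinearMap.comp_apply, LinearMap.comp_apply, LinearMap.mulLeft_apply,
      LinearMap.mulLeft_apply, e, LinearMap.zero_apply]
    by_cases h : k + 2 = n
    · subst h
      rw [altPairing_ιMulti]
      exact α.2 _ 0 1 (by simp) hw hw'
    · exact altPairing_ιMulti_of_ne h _ _
  exact LinearMap.congr_fun this u

end Model

section Tautological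

variable {A F : Type*} [NormedAddCommGroup A] [NormedSpace ℝ A] [FiniteDimensional ℝ A]
  [NormedAddCommGroup F] [NormedSpace ℝ F] [FiniteDimensional ℝ F] {n : ℕ}

/-- The tautological form on the product of a vector space `A` with a space `F` of forms on `A`, as a
field of functionals: at a point `(y, α)` it is the pull-back of `α`. -/
def tautDual (ρ : F →ₗ[ℝ] A [⋀^Fin n]→L[ℝ] ℝ) :
    A × F →L[ℝ] ExteriorAlgebra ℝ (A × F) →L[ℝ] ℝ :=
  LinearMap.toContinuousLinearMap (LinearMap.toContinuousLinearMap.toLinearMap ∘ₗ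
    (ExteriorAlgebra.map (LinearMap.fst ℝ A F)).toLinearMap.lcomp
      ℝ ℝ ∘ₗ altPairing n ∘ₗ ρ ∘ₗ LinearMap.snd ℝ _ _)

variable (ρ : F →ₗ[ℝ] A [⋀^Fin n]→L[ℝ] ℝ)

theorem tautDual_apply (y : A × F) (u : ExteriorAlgebra ℝ (A × F)) :
    tautDual ρ y u = altPairing n (ρ y.2) (ExteriorAlgebra.map (LinearMap.fst ℝ _ _) u) := rfl

/-- The differential of the tautological form, up to the sign; its coefficients are constant. -/
def tautOmega : ExteriorAlgebra ℝ (A × F) →ₗ[ℝ] ℝ where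
  toFun u := -dualD (tautDual ρ) 0 u
  map_add' u w := by rw [dualD_add_right, neg_add]
  map_smul' c u := by rw [dualD_smul_right, RingHom.id_apply, smul_eq_mul, mul_neg]

theorem dualD_tautDual (y : A × F) (u : ExteriorAlgebra ℝ (A × F)) :
    dualD (tautDual ρ) y u = -tautOmega ρ u := by
  change _ = - - dualD (tautDual ρ) 0 u
  rw [neg_neg]
  simp only [dualD, ContinuousLinearMap.fderiv]

theorem isHomogeneous_tautOmega : IsHomogeneous (tautOmega ρ) (n + 1) := by
  intro i u hi hu
  change -dualD _ _ _ = 0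
  rw [dualD_eq_zero_of_degree (j := n) (tautDual ρ).differentiableAt (Eventually.of_forall
    fun y i u hi hu => ?_) hi hu, neg_zero]
  exact isHomogeneous_altPairing _ _ _ hi (map_mem_exteriorPower _ hu)

theorem tautOmega_eq_zero_of_mem_vertPow {K : Submodule ℝ A} {j : ℕ}
    (h : ∀ x, ∀ u ∈ vertPow K j, altPairing n (ρ x) u = 0) {u : ExteriorAlgebra ℝ (A × F)}
    (hu : u ∈ vertPow (K.comap (LinearMap.fst ℝ A F)) (j + 1)) : tautOmega ρ u = 0 := by
  change -dualD _ _ _ = 0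
  rw [dualD_eq_zero_of_mem_vertPow (tautDual ρ).differentiableAt (Eventually.of_forall
    fun y u hu => ?_) hu, neg_zero]
  exact h _ _ (map_mem_vertPow (fun w hw => hw) hu)

/-- The insertion of a vector along the fibre. -/
theorem tautOmega_fibre (α : F) (u : ExteriorAlgebra ℝ (A × F)) :
    tautOmega ρ (ExteriorAlgebra.ι ℝ ((0 : A), α) * u) =
      -altPairing n (ρ α) (ExteriorAlgebra.map (LinearMap.fst ℝ _ _) u) := by
  change -dualD _ _ _ = _
  set e := Module.finBasis ℝ (A × F)
  have h0 : ∀ y u', tautDual ρ y (ExteriorAlgebra.ι ℝ ((0 : A), α) * u') = 0 := fun y u' => by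
    rw [tautDual_apply, map_mul, ExteriorAlgebra.map_apply_ι, LinearMap.fst_apply, map_zero,
      zero_mul, map_zero]
  have h1 : tautDual ρ ((0 : A), α) u =
      altPairing n (ρ α) (ExteriorAlgebra.map (LinearMap.fst ℝ _ _) u) := rfl
  have h2 : ∀ y (k : Fin _), tautDual ρ y (CliffordAlgebra.contractLeft (e.coord k)
      (ExteriorAlgebra.ι ℝ ((0 : A), α) * u)) = e.coord k ((0 : A), α) * tautDual ρ y u := by
    intro y k
    have : CliffordAlgebra.contractLeft (e.coord k) (ExteriorAlgebra.ι ℝ ((0 : A), α) * u) =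
        e.coord k ((0 : A), α) • u - ExteriorAlgebra.ι ℝ ((0 : A), α) *
          CliffordAlgebra.contractLeft (e.coord k) u := CliffordAlgebra.contractLeft_ι_mul _ _ _
    rw [this, map_sub, h0, map_smul, sub_zero, smul_eq_mul]
  rw [← h1]
  conv_rhs => rw [← e.sum_repr ((0 : A), α), map_sum, sum_apply]
  congr 1
  refine Finset.sum_congr rfl fun k _ => ?_
  rw [ContinuousLinearMap.fderiv, h2, map_smul, smul_apply]
  rfl

/-- Naturality with respect to linear maps. -/
theorem tautOmega_map {A' : Type*} [NormedAddCommGroup A'] [NormedSpace ℝ A']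
    [FiniteDimensional ℝ A'] (S : A' →L[ℝ] A × F) (x : A') (u : ExteriorAlgebra ℝ A') :
    tautOmega ρ (ExteriorAlgebra.map (S : A' →ₗ[ℝ] A × F) u) =
      -dualD (fun y => (tautDual ρ (S y)).comp (mvMap S)) x u := by
  rw [dualD_comp (τ := S) (b := tautDual ρ) (S.contDiff.contDiffAt) (tautDual ρ).differentiableAt
    (Eventually.of_forall fun y => by rw [ContinuousLinearMap.fderiv]), dualD_tautDual, neg_neg,
    ContinuousLinearMap.fderiv]
  rfl

/-- `ω` vanishes on multivectors tangent to the zero section, on which the tautological form is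
zero. -/
theorem tautOmega_map_inl (u : ExteriorAlgebra ℝ A) :
    tautOmega ρ (ExteriorAlgebra.map (LinearMap.inl ℝ _ _) u) = 0 := by
  have h := tautOmega_map ρ (ContinuousLinearMap.inl ℝ A F) 0 u
  have h0 : (fun y => (tautDual ρ (ContinuousLinearMap.inl ℝ A F y)).comp
      (mvMap (ContinuousLinearMap.inl ℝ A F))) = fun _ => 0 := by
    funext y
    ext u
    change altPairing n (ρ 0) _ = 0
    rw [map_zero, map_zero]
    rfl
  rw [h0] at h
  simpa [dualD] using h

theorem tautOmega_nondegenerate (hρ : Function.Injective ρ)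
    (hw : ∀ w : A, (∀ α u, altPairing n (ρ α) (ExteriorAlgebra.ι ℝ w * u) = 0) → w = 0)
    {v : A × F} (hv : ∀ u, tautOmega ρ (ExteriorAlgebra.ι ℝ v * u) = 0) : v = 0 := by
  have hsplit : v = LinearMap.inl ℝ A F v.1 + ((0 : A), v.2) :=
    Prod.ext (add_zero _).symm (zero_add _).symm
  have hid : ∀ u : ExteriorAlgebra ℝ A, ExteriorAlgebra.map (LinearMap.fst ℝ A F)
      (ExteriorAlgebra.map (LinearMap.inl ℝ A F) u) = u := fun u => by
    rw [map_map_apply, map_eq_self (fun _ => rfl)]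
  -- Multivectors of the base detect the fibre component.
  have h2 : v.2 = 0 := by
    refine hρ ((eq_zero_of_altPairing fun u => ?_).trans (map_zero ρ).symm)
    have := hv (ExteriorAlgebra.map (LinearMap.inl ℝ A F) u)
    rw [hsplit, map_add, add_mul, map_add, ← ExteriorAlgebra.map_apply_ι, ← map_mul,
      tautOmega_map_inl, zero_add, tautOmega_fibre, neg_eq_zero, hid] at this
    exact this
  -- Vectors of the fibre detect the base component.
  have h1 : v.1 = 0 := by
    refine hw _ fun α u => ?_
    have := hv (ExteriorAlgebra.ι ℝ ((0 : A), α) * ExteriorAlgebra.map (LinearMap.inl ℝ A F) u)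
    have hv' : v = LinearMap.inl ℝ A F v.1 := Prod.ext rfl h2
    rw [ι_mul_ι_mul, map_neg, neg_eq_zero, tautOmega_fibre, neg_eq_zero, hv',
      ← ExteriorAlgebra.map_apply_ι, ← map_mul, hid] at this
    exact this
  exact Prod.ext h1 h2

theorem contDiff_ι_fibre : ContDiff ℝ ∞ fun y : A × F => ExteriorAlgebra.ι ℝ ((0 : A), y.2) :=
  (LinearMap.toContinuousLinearMap (ExteriorAlgebra.ι ℝ ∘ₗ
    LinearMap.inr ℝ A F ∘ₗ LinearMap.snd ℝ A F)).contDiff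

end Tautological

section TautologicalBundle

variable {B F : Type*} [NormedAddCommGroup B] [NormedSpace ℝ B] [FiniteDimensional ℝ B]
  [NormedAddCommGroup F] [NormedSpace ℝ F] [FiniteDimensional ℝ F]
  {Y : Type*} [TopologicalSpace Y] [ChartedSpace B Y] [IsManifold 𝓘(ℝ, B) ∞ Y] {n : ℕ}

/-- `θ` is the tautological form of the bundle `Z`, whose fibre `F` consists of forms on the base (by
means of `ρ`). -/
structure IsTautological (Z : VectorBundleCore ℝ Y F (atlas B Y))
    (ρ : F →ₗ[ℝ] B [⋀^Fin n]→L[ℝ] ℝ)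
    (θ : Form (𝓘(ℝ, B).prod 𝓘(ℝ, F)) (Bundle.TotalSpace F Z.Fiber)) : Prop where
  core : IsChartCore Z
  coordChange : ∀ (i j : atlas B Y) (y : Y), y ∈ i.1.source → y ∈ j.1.source → ∀ α,
    ρ (Z.coordChange i j y α) =
      (ρ α).compContinuousLinearMap ((tangentBundleCore 𝓘(ℝ, B) Y).coordChange j i y)
  model_eq : ∀ p : Bundle.TotalSpace F Z.Fiber, θ.model p =
    Pi.single (M := fun k => (B × F) [⋀^Fin k]→L[ℝ] ℝ) n
      ((ρ p.2).compContinuousLinearMap (ContinuousLinearMap.fst ℝ B F))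

variable {Z : VectorBundleCore ℝ Y F (atlas B Y)} [Z.IsContMDiff 𝓘(ℝ, B) ∞]
  {ρ : F →ₗ[ℝ] B [⋀^Fin n]→L[ℝ] ℝ}
  {θ : Form (𝓘(ℝ, B).prod 𝓘(ℝ, F)) (Bundle.TotalSpace F Z.Fiber)}

/-- The tautological form has the same expression in all preferred charts. -/
theorem IsTautological.dual (h : IsTautological Z ρ θ) {p₀ : Bundle.TotalSpace F Z.Fiber}
    {y : B × F} (hy : y ∈ (extChartAt (𝓘(ℝ, B).prod 𝓘(ℝ, F)) p₀).target) :
    θ.dual p₀ y = tautDual ρ y := by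
  obtain ⟨q, hq, rfl⟩ : ∃ q ∈ (extChartAt (𝓘(ℝ, B).prod 𝓘(ℝ, F)) p₀).source,
      extChartAt (𝓘(ℝ, B).prod 𝓘(ℝ, F)) p₀ q = y :=
    ⟨_, (extChartAt _ p₀).map_target hy, (extChartAt _ p₀).right_inv hy⟩
  have hq' := (h.core.mem_source p₀ q).1 hq
  have hqq := mem_extChartAt_source (I := 𝓘(ℝ, B)) q.1
  refine ContinuousLinearMap.ext fun u => ?_
  have h1 := h.coordChange (achart B q.1) (achart B p₀.1) q.1 (mem_chart_source B q.1)
    (by simpa using hq') q.2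
  have h2 : tautDual ρ (extChartAt (𝓘(ℝ, B).prod 𝓘(ℝ, F)) p₀ q) u =
      altPairing n (ρ (Z.coordChange (achart B q.1) (achart B p₀.1) q.1 q.2))
        (ExteriorAlgebra.map (LinearMap.fst ℝ B F) u) := by
    rw [tautDual_apply, extChartAt_core, h.core.indexAt, h.core.indexAt]
  rw [Form.dual_source _ hq, h.model_eq, h2, h1]
  refine (altPairing_comp (ρ q.2) (ContinuousLinearMap.fst ℝ B F) _).trans
    (Eq.trans ?_ (altPairing_comp (ρ q.2) _ _).symm)
  refine congrArg (altPairing n (ρ q.2)) ?_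
  rw [mvMap_apply, map_map_apply, map_map_apply]
  exact congrArg (fun L => ExteriorAlgebra.map L u)
    (LinearMap.ext fun v => h.core.fst_tangentCoordChange hq' hqq v)

theorem IsTautological.smooth (h : IsTautological Z ρ θ) : θ.Smooth :=
  Form.smooth_iff.2 fun _ => (tautDual ρ).contDiff.contDiffOn.congr fun _ hy => h.dual hy

theorem IsTautological.degree (h : IsTautological Z ρ θ) : θ.HasDegree (n : ℤ) := by
  intro p j hj
  change θ.model p j = 0
  rw [h.model_eq]
  exact Pi.single_eq_of_ne (by exact_mod_cast hj) _

/-- In all preferred charts `ω` has the same constant coefficients. -/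
theorem IsTautological.omega_dual (h : IsTautological Z ρ θ) {p₀ : Bundle.TotalSpace F Z.Fiber}
    {y : B × F} (hy : y ∈ (extChartAt (𝓘(ℝ, B).prod 𝓘(ℝ, F)) p₀).target)
    (u : ExteriorAlgebra ℝ (B × F)) : (omega θ).dual p₀ y u = tautOmega ρ u := by
  rw [omega, Form.dual_neg, neg_apply, Form.dual_extD h.smooth hy]
  have h' : θ.dual p₀ =ᶠ[𝓝 y] tautDual ρ := by
    filter_upwards [(isOpen_extChartAt_target p₀).mem_nhds hy] with z hz using h.dual hz
  have := dualD_tautDual ρ y u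
  rw [dualD] at this
  rw [dualD, h'.fderiv_eq, this, neg_neg]

theorem IsTautological.omega_model (h : IsTautological Z ρ θ) (p : Bundle.TotalSpace F Z.Fiber)
    (u : ExteriorAlgebra ℝ (B × F)) : ((omega θ).model p).pairing u = tautOmega ρ u := by
  rw [← Form.dual_self]
  exact h.omega_dual (mem_extChartAt_target (I := 𝓘(ℝ, B).prod 𝓘(ℝ, F)) p) u

/-- In preferred charts the Euler vector field is the fibre coordinate. -/
theorem IsTautological.inChart_scaling (h : IsTautological Z ρ θ)
    {p₀ : Bundle.TotalSpace F Z.Fiber} {y : B × F}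
    (hy : y ∈ (extChartAt (𝓘(ℝ, B).prod 𝓘(ℝ, F)) p₀).target) :
    (ofVector (I := 𝓘(ℝ, B).prod 𝓘(ℝ, F)) fun p : Bundle.TotalSpace F Z.Fiber => mfderiv 𝓘(ℝ, ℝ) (𝓘(ℝ, B).prod 𝓘(ℝ, F))
      (fun t : ℝ => (⟨p.1, t • p.2⟩ : Bundle.TotalSpace F Z.Fiber)) 1 (1 : ℝ)).inChart p₀ y =
      ExteriorAlgebra.ι ℝ ((0 : B), y.2) := by
  obtain ⟨q, hq, rfl⟩ : ∃ q ∈ (extChartAt (𝓘(ℝ, B).prod 𝓘(ℝ, F)) p₀).source,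
      extChartAt (𝓘(ℝ, B).prod 𝓘(ℝ, F)) p₀ q = y :=
    ⟨_, (extChartAt _ p₀).map_target hy, (extChartAt _ p₀).right_inv hy⟩
  rw [MVField.inChart_source _ hq]
  refine (ExteriorAlgebra.map_apply_ι _ _).trans ?_
  exact congrArg (ExteriorAlgebra.ι ℝ) (h.core.mfderiv_smul hq)

/-- A bundle of forms with its tautological form is an exact multisymplectic manifold, if no
non-zero vector of the base annihilates the fibre. -/
theorem IsTautological.isExactMultisymplectic (h : IsTautological Z ρ θ)
    (hρ : Function.Injective ρ)
    (hw : ∀ w : B, (∀ α u, altPairing n (ρ α) (ExteriorAlgebra.ι ℝ w * u) = 0) → w = 0) :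
    IsExactMultisymplectic n θ fun p => mfderiv 𝓘(ℝ, ℝ) (𝓘(ℝ, B).prod 𝓘(ℝ, F))
      (fun t : ℝ => (⟨p.1, t • p.2⟩ : Bundle.TotalSpace F Z.Fiber)) 1 (1 : ℝ) where
  smooth := h.smooth
  degree := h.degree
  smooth_scaling := MVField.smooth_iff.2 fun p₀ =>
    contDiff_ι_fibre.contDiffOn.congr fun y hy => h.inChart_scaling hy
  contract_scaling := by
    refine Form.ext_dual fun q u => ?_
    have ht := mem_extChartAt_target (I := 𝓘(ℝ, B).prod 𝓘(ℝ, F)) q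
    rw [Form.dual_contract _ _ ht, dualContract_apply, h.inChart_scaling ht,
      h.omega_dual ht, tautOmega_fibre, Form.dual_neg, neg_apply, h.dual ht, tautDual_apply]
  nondegenerate p v hv := by
    refine tautOmega_nondegenerate ρ hρ hw fun u => ?_
    rw [← h.omega_model p]
    exact (Covector.contract_eq_zero_iff _ _).1 hv u

end TautologicalBundle

end Multisymplectic

end

noncomputable section

namespace Multisymplectic

/-! ### The fibres of the multiphase spaces -/

section Fibres

variable {EM EQ : Type*} [NormedAddCommGroup EM] [NormedSpace ℝ EM] [FiniteDimensional ℝ EM]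
  [NormedAddCommGroup EQ] [NormedSpace ℝ EQ] [FiniteDimensional ℝ EQ] {m : ℕ}

/-- A volume form on the base. -/
def volForm (h : Module.finrank ℝ EM = m + 1) : EM [⋀^Fin (m + 1)]→L[ℝ] ℝ :=
  { (Module.finBasisOfFinrankEq ℝ EM h).det with
    cont := continuous_alternating_aux (Module.finBasisOfFinrankEq ℝ EM h).det }

/-- The multivector dual to the volume form. -/
def volVector (h : Module.finrank ℝ EM = m + 1) : ExteriorAlgebra ℝ EM :=
  ExteriorAlgebra.ιMulti ℝ (m + 1) (Module.finBasisOfFinrankEq ℝ EM h)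

theorem volVector_mem (h : Module.finrank ℝ EM = m + 1) :
    volVector h ∈ ⋀[ℝ]^(m + 1) EM := ιMulti_mem_exteriorPower _

theorem altPairing_volForm_volVector (h : Module.finrank ℝ EM = m + 1) :
    altPairing (m + 1) (volForm h) (volVector h) = 1 :=
  (altPairing_ιMulti _ _).trans (Module.finBasisOfFinrankEq ℝ EM h).det_self

theorem eq_smul_volForm (h : Module.finrank ℝ EM = m + 1) (α : EM [⋀^Fin (m + 1)]→L[ℝ] ℝ) :
    α = α (Module.finBasisOfFinrankEq ℝ EM h) • volForm h := by
  ext v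
  exact DFunLike.congr_fun
    (AlternatingMap.eq_smul_basis_det (Module.finBasisOfFinrankEq ℝ EM h) α.toAlternatingMap) v

variable (EQ) in
/-- The pull-back of the volume form, as an element of the fibre. -/
def fibreUnit (h : Module.finrank ℝ EM = m + 1) : extFibre EM EQ (m + 1) :=
  ⟨(volForm h).compContinuousLinearMap (ContinuousLinearMap.fst ℝ EM EQ),
    fun v i _ _ hi _ => (volForm h).map_coord_zero (m := fun i => (v i).1) i hi⟩

/-- The form with the given mixed part, for the splitting of the model space. -/
def fibreSectionForm (β : OrdFibre EM EQ m) : (EM × EQ) [⋀^Fin (m + 1)]→L[ℝ] ℝ :=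
  ContinuousAlternatingMap.alternatizeUncurryFin
    ((ContinuousAlternatingMap.compContinuousLinearMapCLM (ContinuousLinearMap.fst ℝ EM EQ)).comp
      (β.comp (ContinuousLinearMap.snd ℝ EM EQ)))

theorem fibreSectionForm_apply (β : OrdFibre EM EQ m) (v : Fin (m + 1) → EM × EQ) :
    fibreSectionForm β v =
      ∑ i : Fin (m + 1), (-1 : ℝ) ^ (i : ℕ) * β (v i).2 (fun j => (i.removeNth v j).1) := by
  rw [fibreSectionForm, ContinuousAlternatingMap.alternatizeUncurryFin_apply]
  refine Finset.sum_congr rfl fun i _ => ?_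
  rw [zsmul_eq_mul]
  push_cast
  rfl

variable (EM EQ m) in
/-- A right inverse of the projection `fibreProj`, for the splitting of the model space. -/
def fibreSection : OrdFibre EM EQ m →ₗ[ℝ] extFibre EM EQ (m + 1) where
  toFun β := ⟨fibreSectionForm β, fun v i j hij hi hj => by
    rw [fibreSectionForm_apply]
    refine Finset.sum_eq_zero fun k _ => ?_
    have key : ∀ l, l ≠ k → (v l).1 = 0 → β (v k).2 (fun j => (k.removeNth v j).1) = 0 := by
      intro l hl h0
      obtain ⟨l', rfl⟩ := Fin.exists_succAbove_eq hl
      exact (β (v k).2).map_coord_zero l' h0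
    by_cases hk : i = k
    · rw [key j (by rw [← hk]; exact hij.symm) hj, mul_zero]
    · rw [key i hk hi, mul_zero]⟩
  map_add' β γ := Subtype.ext <| ContinuousAlternatingMap.ext fun v => by
    change fibreSectionForm (β + γ) v = fibreSectionForm β v + fibreSectionForm γ v
    rw [fibreSectionForm_apply, fibreSectionForm_apply, fibreSectionForm_apply,
      ← Finset.sum_add_distrib]
    exact Finset.sum_congr rfl fun i _ => mul_add _ _ _
  map_smul' c β := Subtype.ext <| ContinuousAlternatingMap.ext fun v => by
    change fibreSectionForm (c • β) v = c * fibreSectionForm β v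
    rw [fibreSectionForm_apply, fibreSectionForm_apply, Finset.mul_sum]
    exact Finset.sum_congr rfl fun i _ => mul_left_comm _ _ _

theorem fibreSection_coe (β : OrdFibre EM EQ m) :
    (fibreSection EM EQ m β).1 = fibreSectionForm β := rfl

variable (EM EQ m) in
/-- The projection `fibreProj` as a linear map. -/
def fibreProjₗ : extFibre EM EQ (m + 1) →ₗ[ℝ] OrdFibre EM EQ m where
  toFun := fibreProj m
  map_add' _ _ := rfl
  map_smul' _ _ := rfl

theorem fibreProj_apply (α : extFibre EM EQ (m + 1)) (w : EQ) (v : Fin m → EM) :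
    fibreProj m α w v = α.1 (Matrix.vecCons (0, w) fun j => (v j, 0)) := rfl

theorem fibreProj_fibreSection (β : OrdFibre EM EQ m) :
    fibreProjₗ EM EQ m (fibreSection EM EQ m β) = β := by
  refine ContinuousLinearMap.ext fun w => ContinuousAlternatingMap.ext fun v => ?_
  change fibreProj m (fibreSection EM EQ m β) w v = _
  rw [fibreProj_apply, fibreSection_coe, fibreSectionForm_apply, Fin.sum_univ_succ]
  rw [Finset.sum_eq_zero fun i _ => ?_, add_zero, Fin.val_zero, pow_zero, one_mul]
  · rfl
  · have : (Matrix.vecCons ((0, w) : EM × EQ) (fun j => (v j, (0 : EQ))) i.succ).2 = 0 := rfl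
    rw [this, map_zero]
    exact mul_zero _

theorem fibreProj_fibreUnit (h : Module.finrank ℝ EM = m + 1) :
    fibreProjₗ EM EQ m (fibreUnit EQ h) = 0 :=
  ContinuousLinearMap.ext fun w => ContinuousAlternatingMap.ext fun v =>
    (volForm h).map_coord_zero (m := fun i => (Matrix.vecCons ((0, w) : EM × EQ)
      (fun j => (v j, (0 : EQ))) i).1) 0 rfl

/-- A form of the fibre vanishes on a vertical vector `w` if its mixed part, evaluated on `w`,
does: the other arguments may be replaced by horizontal ones. -/
theorem eq_zero_of_fibreProj_apply {α : extFibre EM EQ (m + 1)} {w : EQ}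
    (h : fibreProj m α w = 0) (u : ExteriorAlgebra ℝ (EM × EQ)) :
    altPairing (m + 1) α.1 (ExteriorAlgebra.ι ℝ (0, w) * u) = 0 := by
  have hP : ∀ v : EM × EQ, v - ((LinearMap.inl ℝ EM EQ) ∘ₗ LinearMap.fst ℝ EM EQ) v ∈
      LinearMap.ker (LinearMap.fst ℝ EM EQ) := fun v => by simp
  have hw : ((0, w) : EM × EQ) ∈ LinearMap.ker (LinearMap.fst ℝ EM EQ) := by simp
  have h1 := altPairing_eq_zero_of_mem_vertPow α
    (ι_mul_mem_vertPow_succ hw (sub_map_mem_vertPow_one hP u))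
  rw [mul_sub, map_sub, sub_eq_zero] at h1
  have h2 : altPairing m (fibreProj m α w) (ExteriorAlgebra.map (LinearMap.fst ℝ EM EQ) u) =
      altPairing m ((α.1.curryLeft (0, w)).compContinuousLinearMap
        (ContinuousLinearMap.inl ℝ EM EQ)) (ExteriorAlgebra.map (LinearMap.fst ℝ EM EQ) u) := rfl
  rw [altPairing_comp] at h2
  rw [h1, altPairing_ι_mul, ← map_map_apply]
  refine h2.symm.trans ?_
  rw [h, map_zero]
  rfl

/-- Forms in the kernel of `fibreProj` are pulled back from the base. -/
theorem altPairing_eq_zero_of_fibreProj {γ : extFibre EM EQ (m + 1)} (h : fibreProjₗ EM EQ m γ = 0)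
    {u : ExteriorAlgebra ℝ (EM × EQ)} (hu : u ∈ vertPow (LinearMap.ker (LinearMap.fst ℝ EM EQ)) 1) :
    altPairing (m + 1) γ.1 u = 0 := by
  refine vertPow_induction (C := fun u => altPairing (m + 1) γ.1 u = 0) (fun w hw u _ => ?_)
    (map_zero _) (fun x y hx hy => by rw [map_add, hx, hy, add_zero])
    (fun a x hx => by rw [map_smul, hx, smul_zero]) hu
  have hw' : w = (0, w.2) := Prod.ext hw rfl
  rw [hw']
  exact eq_zero_of_fibreProj_apply (DFunLike.congr_fun h w.2) u

/-- A form of the fibre is determined by its mixed part up to a multiple of the volume form of the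
base. -/
theorem exists_fibre_decomp (h : Module.finrank ℝ EM = m + 1) (α : extFibre EM EQ (m + 1)) :
    ∃ t : ℝ, α = fibreSection EM EQ m (fibreProjₗ EM EQ m α) + t • fibreUnit EQ h := by
  set γ := α - fibreSection EM EQ m (fibreProjₗ EM EQ m α) with hγ
  have h0 : fibreProjₗ EM EQ m γ = 0 := by rw [hγ, map_sub, fibreProj_fibreSection, sub_self]
  have hP : ∀ v : EM × EQ, v - ((LinearMap.inl ℝ EM EQ) ∘ₗ LinearMap.fst ℝ EM EQ) v ∈
      LinearMap.ker (LinearMap.fst ℝ EM EQ) := fun v => by simp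
  set t := γ.1.compContinuousLinearMap (ContinuousLinearMap.inl ℝ EM EQ)
    (Module.finBasisOfFinrankEq ℝ EM h) with ht
  have h2 := eq_smul_volForm h (γ.1.compContinuousLinearMap (ContinuousLinearMap.inl ℝ EM EQ))
  have h3 : γ = t • fibreUnit EQ h := by
    refine Subtype.ext (sub_eq_zero.1 (eq_zero_of_altPairing (k := m + 1) fun u => ?_))
    have h4 := altPairing_eq_zero_of_fibreProj h0 (sub_map_mem_vertPow_one hP u)
    rw [map_sub, sub_eq_zero, ← map_map_apply] at h4
    have h5 : altPairing (m + 1) (t • fibreUnit EQ h : extFibre EM EQ (m + 1)).1 u =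
        altPairing (m + 1) (t • volForm h) (ExteriorAlgebra.map (LinearMap.fst ℝ EM EQ) u) := by
      exact altPairing_comp (t • volForm h) (ContinuousLinearMap.fst ℝ EM EQ) u
    rw [map_sub, LinearMap.sub_apply, h5, ht, ← h2, h4, altPairing_comp]
    exact sub_self _
  exact ⟨t, by rw [← h3, hγ]; abel⟩

/-- A vector that annihilates all forms of the fibre is zero. -/
theorem eq_zero_of_curryLeft (h : Module.finrank ℝ EM = m + 1) {w : EM × EQ}
    (hw : ∀ (α : extFibre EM EQ (m + 1)) (u : ExteriorAlgebra ℝ (EM × EQ)),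
      altPairing (m + 1) α.1 (ExteriorAlgebra.ι ℝ w * u) = 0) : w = 0 := by
  -- the volume form detects the base component
  have h1 : w.1 = 0 := by
    by_contra hne
    obtain ⟨l, hl⟩ : ∃ l : EM →L[ℝ] ℝ, l w.1 ≠ 0 := by
      obtain ⟨l, hl⟩ := SeparatingDual.exists_ne_zero (R := ℝ) hne
      exact ⟨l, hl⟩
    let lf : EM [⋀^Fin 1]→L[ℝ] ℝ := ContinuousAlternatingMap.ofSubsingleton ℝ EM ℝ (0 : Fin 1) l
    obtain ⟨K, hK, hKl⟩ := exists_volume_eq h (isHomogeneous_altPairing (volForm h))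
      (volVector_mem h) (altPairing_volForm_volVector h) (isHomogeneous_altPairing lf) (l := m) rfl
    have e1 := hKl (ExteriorAlgebra.ι ℝ w.1)
    rw [mul_comm_exteriorPower hK (ι_mem_exteriorPower w.1), map_smul] at e1
    have e2 := hw (fibreUnit EQ h) (ExteriorAlgebra.map (LinearMap.inl ℝ EM EQ) K)
    have e3 : altPairing (m + 1) (fibreUnit EQ h).1
        (ExteriorAlgebra.ι ℝ w * ExteriorAlgebra.map (LinearMap.inl ℝ EM EQ) K) =
        altPairing (m + 1) (volForm h) (ExteriorAlgebra.ι ℝ w.1 * K) := by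
      refine (altPairing_comp (volForm h) (ContinuousLinearMap.fst ℝ EM EQ) _).trans ?_
      rw [map_mul, ExteriorAlgebra.map_apply_ι, map_map_apply,
        map_eq_self (f := ((ContinuousLinearMap.fst ℝ EM EQ : EM × EQ →L[ℝ] EM) :
          EM × EQ →ₗ[ℝ] EM) ∘ₗ LinearMap.inl ℝ EM EQ) (fun v => rfl)]
      rfl
    rw [← e3, e2, smul_zero] at e1
    have e4 : altPairing 1 lf (ExteriorAlgebra.ι ℝ w.1) = l w.1 := by
      have : ExteriorAlgebra.ι ℝ w.1 = ExteriorAlgebra.ιMulti ℝ 1 (fun _ : Fin 1 => w.1) := by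
        simp
      rw [this, altPairing_ιMulti]
      rfl
    exact hl (e4.symm.trans e1.symm)
  -- the mixed forms detect the vertical component
  have h2 : w.2 = 0 := by
    by_contra hne
    obtain ⟨l, hl⟩ : ∃ l : EQ →L[ℝ] ℝ, l w.2 ≠ 0 := by
      obtain ⟨l, hl⟩ := SeparatingDual.exists_ne_zero (R := ℝ) hne
      exact ⟨l, hl⟩
    let b := Module.finBasisOfFinrankEq ℝ EM h
    let β : OrdFibre EM EQ m := l.smulRight ((volForm h).curryLeft (b 0))
    have e0 : β w.2 (fun i => b i.succ) = l w.2 * volForm h (Matrix.vecCons (b 0) fun i => b i.succ) :=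
      rfl
    have e1 : Matrix.vecCons (b 0) (fun i : Fin m => b i.succ) = b := by
      funext i
      refine Fin.cases rfl (fun i => rfl) i
    have e2 : volForm h b = 1 := b.det_self
    rw [e1, e2, mul_one] at e0
    have hw' : w = (0, w.2) := Prod.ext h1 rfl
    have e3 := hw (fibreSection EM EQ m β)
      (ExteriorAlgebra.ιMulti ℝ m fun i => ((b i.succ, 0) : EM × EQ))
    rw [altPairing_ι_mul, altPairing_ιMulti, hw'] at e3
    have e4 : fibreProjₗ EM EQ m (fibreSection EM EQ m β) w.2 (fun i => b i.succ) = 0 := e3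
    rw [fibreProj_fibreSection, e0] at e4
    exact hl e4
  exact Prod.ext h1 h2

end Fibres

end Multisymplectic

end

noncomputable section

namespace Multisymplectic

/-! ### The multiphase spaces in charts -/

section Phase

variable {EM EQ : Type*} [NormedAddCommGroup EM] [NormedSpace ℝ EM] [FiniteDimensional ℝ EM]
  [NormedAddCommGroup EQ] [NormedSpace ℝ EQ] [FiniteDimensional ℝ EQ]

theorem extChange_coe {n : ℕ} {L : EM × EQ →L[ℝ] EM × EQ} (hL : ∀ w : EQ, (L (0, w)).1 = 0)
    (α : extFibre EM EQ n) : (extChange n L α).1 = α.1.compContinuousLinearMap L := by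
  refine ContinuousAlternatingMap.ext fun v => ?_
  rw [extChange_apply, triangular_eq hL]
  rfl

variable {m : ℕ}
variable {M : Type*} [TopologicalSpace M] [ChartedSpace EM M]
  {Y : Type*} [TopologicalSpace Y] [ChartedSpace (EM × EQ) Y]
  [IsManifold 𝓘(ℝ, EM × EQ) ∞ Y] {π : Y → M} {hπ : IsFibered (EM := EM) (EQ := EQ) π}

theorem isChartCore_extCore : IsChartCore (extCore m hπ) := ⟨fun _ => rfl, fun _ => rfl⟩

theorem isChartCore_ordCore : IsChartCore (ordCore m hπ) := ⟨fun _ => rfl, fun _ => rfl⟩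

theorem extProjDeriv_eq (p : ExtPhase m hπ) : extProjDeriv m hπ p =
    ContinuousLinearMap.fst ℝ (EM × EQ) (extFibre EM EQ (m + 1)) :=
  (isChartCore_extCore.hasMFDerivAt_proj p).mfderiv

theorem ordProjDeriv_eq (p : OrdPhase m hπ) : ordProjDeriv m hπ p =
    ContinuousLinearMap.fst ℝ (EM × EQ) (OrdFibre EM EQ m) :=
  (isChartCore_ordCore.hasMFDerivAt_proj p).mfderiv

theorem isTautological_canonicalForm :
    IsTautological (extCore m hπ) (extFibre EM EQ (m + 1)).subtype (canonicalForm m hπ) where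
  core := isChartCore_extCore
  coordChange i j _ hi hj α := extChange_coe (tangentChange_vertical hπ j i hj hi) α
  model_eq p := by
    rw [← extProjDeriv_eq p]
    rfl

/-- The extended multiphase space is an exact multisymplectic manifold. -/
theorem isExactMultisymplectic_canonicalForm (h : Module.finrank ℝ EM = m + 1) :
    IsExactMultisymplectic (m + 1) (canonicalForm m hπ) (eulerField m hπ) :=
  isTautological_canonicalForm.isExactMultisymplectic Subtype.val_injective
    fun _ hw => eq_zero_of_curryLeft h hw

end Phase

end Multisymplectic

end

noncomputable section

namespace Multisymplectic

/-! ### Bundle maps and pull-backs -/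

section BundleMap

variable {B F G : Type*} [NormedAddCommGroup B] [NormedSpace ℝ B] [FiniteDimensional ℝ B]
  [NormedAddCommGroup F] [NormedSpace ℝ F] [FiniteDimensional ℝ F]
  [NormedAddCommGroup G] [NormedSpace ℝ G] [FiniteDimensional ℝ G]
  {Y : Type*} [TopologicalSpace Y] [ChartedSpace B Y] [IsManifold 𝓘(ℝ, B) ∞ Y]

/-- A linear map of the fibres that is compatible with the changes of coordinates. -/
structure IsCoreHom (Z : VectorBundleCore ℝ Y F (atlas B Y)) (Z' : VectorBundleCore ℝ Y G (atlas B Y))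
    (L : F →L[ℝ] G) : Prop where
  core : IsChartCore Z
  core' : IsChartCore Z'
  coordChange : ∀ (i j : atlas B Y) (y : Y), y ∈ i.1.source → y ∈ j.1.source → ∀ α,
    Z'.coordChange i j y (L α) = L (Z.coordChange i j y α)

/-- The map of total spaces. -/
def bundleMap (Z : VectorBundleCore ℝ Y F (atlas B Y)) (Z' : VectorBundleCore ℝ Y G (atlas B Y))
    (L : F →L[ℝ] G) (p : Bundle.TotalSpace F Z.Fiber) : Bundle.TotalSpace G Z'.Fiber :=
  ⟨p.1, L p.2⟩

variable (B) in
/-- The expression of a bundle map in charts. -/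
def modelMap (L : F →L[ℝ] G) : B × F →L[ℝ] B × G := (ContinuousLinearMap.id ℝ B).prodMap L

/-- Pull-back of forms along a bundle map. -/
def Form.bundlePullback {Z : VectorBundleCore ℝ Y F (atlas B Y)}
    {Z' : VectorBundleCore ℝ Y G (atlas B Y)} (L : F →L[ℝ] G)
    (β : Form (𝓘(ℝ, B).prod 𝓘(ℝ, G)) (Bundle.TotalSpace G Z'.Fiber)) :
    Form (𝓘(ℝ, B).prod 𝓘(ℝ, F)) (Bundle.TotalSpace F Z.Fiber) := fun p k =>
  (β (bundleMap Z Z' L p) k).compContinuousLinearMap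
    (mfderiv (𝓘(ℝ, B).prod 𝓘(ℝ, F)) (𝓘(ℝ, B).prod 𝓘(ℝ, G)) (bundleMap Z Z' L) p)

variable {Z : VectorBundleCore ℝ Y F (atlas B Y)} {Z' : VectorBundleCore ℝ Y G (atlas B Y)}
  {L : F →L[ℝ] G}

theorem IsCoreHom.modelMap_mem (h : IsCoreHom Z Z' L) {p : Bundle.TotalSpace F Z.Fiber} {y : B × F}
    (hy : y ∈ (extChartAt (𝓘(ℝ, B).prod 𝓘(ℝ, F)) p).target) :
    modelMap B L y ∈ (extChartAt (𝓘(ℝ, B).prod 𝓘(ℝ, G)) (bundleMap Z Z' L p)).target := by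
  rw [h.core.target] at hy
  rw [h.core'.target]
  exact ⟨hy.1, mem_univ _⟩

theorem IsCoreHom.map_symm (h : IsCoreHom Z Z' L) {p : Bundle.TotalSpace F Z.Fiber} {y : B × F}
    (hy : y ∈ (extChartAt (𝓘(ℝ, B).prod 𝓘(ℝ, F)) p).target) :
    bundleMap Z Z' L ((extChartAt (𝓘(ℝ, B).prod 𝓘(ℝ, F)) p).symm y) =
      (extChartAt (𝓘(ℝ, B).prod 𝓘(ℝ, G)) (bundleMap Z Z' L p)).symm (modelMap B L y) := by
  rw [h.core.target] at hy
  have hs := (extChartAt 𝓘(ℝ, B) p.1).map_target hy.1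
  have h1 := h.core.symm_apply p hy.1
  have h2 := h.core'.symm_apply (bundleMap Z Z' L p) (y := modelMap B L y) hy.1
  rw [h1, h2]
  have h3 := h.coordChange (achart B p.1) (achart B ((extChartAt 𝓘(ℝ, B) p.1).symm y.1))
    ((extChartAt 𝓘(ℝ, B) p.1).symm y.1) (by simpa using hs) (mem_chart_source B _) y.2
  rw [h.core.indexAt, h.core.indexAt, h.core'.indexAt, h.core'.indexAt]
  exact congrArg (fun v => (⟨(extChartAt 𝓘(ℝ, B) p.1).symm y.1, v⟩ :
    Bundle.TotalSpace G Z'.Fiber)) h3.symm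

theorem IsCoreHom.chart_map (h : IsCoreHom Z Z' L) {p q : Bundle.TotalSpace F Z.Fiber}
    (hq : q ∈ (extChartAt (𝓘(ℝ, B).prod 𝓘(ℝ, F)) p).source) :
    extChartAt (𝓘(ℝ, B).prod 𝓘(ℝ, G)) (bundleMap Z Z' L p) (bundleMap Z Z' L q) =
      modelMap B L (extChartAt (𝓘(ℝ, B).prod 𝓘(ℝ, F)) p q) := by
  have ht := (extChartAt (𝓘(ℝ, B).prod 𝓘(ℝ, F)) p).map_source hq
  have h1 := h.map_symm ht
  rw [(extChartAt _ p).left_inv hq] at h1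
  rw [h1, (extChartAt _ (bundleMap Z Z' L p)).right_inv (h.modelMap_mem ht)]

theorem IsCoreHom.map_mem_source (h : IsCoreHom Z Z' L) {p q : Bundle.TotalSpace F Z.Fiber}
    (hq : q ∈ (extChartAt (𝓘(ℝ, B).prod 𝓘(ℝ, F)) p).source) : bundleMap Z Z' L q ∈
      (extChartAt (𝓘(ℝ, B).prod 𝓘(ℝ, G)) (bundleMap Z Z' L p)).source :=
  (h.core'.mem_source (bundleMap Z Z' L p) (bundleMap Z Z' L q)).2 ((h.core.mem_source p q).1 hq)

variable [Z.IsContMDiff 𝓘(ℝ, B) ∞] [Z'.IsContMDiff 𝓘(ℝ, B) ∞]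

/-- The changes of coordinates of the total spaces are intertwined by the bundle map. -/
theorem IsCoreHom.tangentCoordChange_comp (h : IsCoreHom Z Z' L)
    {p₀ p₁ q : Bundle.TotalSpace F Z.Fiber}
    (h₀ : q ∈ (extChartAt (𝓘(ℝ, B).prod 𝓘(ℝ, F)) p₀).source)
    (h₁ : q ∈ (extChartAt (𝓘(ℝ, B).prod 𝓘(ℝ, F)) p₁).source) :
    (modelMap B L).comp (tangentCoordChange (𝓘(ℝ, B).prod 𝓘(ℝ, F)) p₀ p₁ q) =
      (tangentCoordChange (𝓘(ℝ, B).prod 𝓘(ℝ, G)) (bundleMap Z Z' L p₀) (bundleMap Z Z' L p₁)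
        (bundleMap Z Z' L q)).comp (modelMap B L) := by
  have d1 := ((contDiffAt_chartChange h₀ h₁).differentiableAt (by simp)).hasFDerivAt
  have d2 := ((contDiffAt_chartChange (h.map_mem_source h₀) (h.map_mem_source h₁)).differentiableAt
    (by simp)).hasFDerivAt
  rw [fderiv_chartChange] at d1 d2
  rw [h.chart_map h₀] at d2
  have e1 := (modelMap B L).hasFDerivAt.comp _ d1
  have e2 := d2.comp _ (modelMap B L).hasFDerivAt
  refine e1.unique (e2.congr_of_eventuallyEq ?_)
  filter_upwards [eventually_mem_chart_source h₀ h₁] with y hy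
  simp only [Function.comp_apply]
  rw [← h.map_symm hy.1, h.chart_map hy.2]

/-- In the preferred charts, the differential of a bundle map is the linear map of the models. -/
theorem IsCoreHom.mfderiv_eq (h : IsCoreHom Z Z' L) (p : Bundle.TotalSpace F Z.Fiber) :
    mfderiv (𝓘(ℝ, B).prod 𝓘(ℝ, F)) (𝓘(ℝ, B).prod 𝓘(ℝ, G)) (bundleMap Z Z' L) p =
      modelMap B L := by
  have hs := mem_extChartAt_source (I := 𝓘(ℝ, B).prod 𝓘(ℝ, F)) p
  have hs' := mem_extChartAt_source (I := 𝓘(ℝ, B).prod 𝓘(ℝ, G)) (bundleMap Z Z' L p)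
  have ht := mem_extChartAt_target (I := 𝓘(ℝ, B).prod 𝓘(ℝ, F)) p
  have key := (hasMFDerivAt_of_charts (I := 𝓘(ℝ, B).prod 𝓘(ℝ, F)) (I' := 𝓘(ℝ, B).prod 𝓘(ℝ, G))
    (F := bundleMap Z Z' L) hs (modelMap B L).hasFDerivAt (h.modelMap_mem ht)
    (by filter_upwards [(isOpen_extChartAt_target p).mem_nhds ht] with y hy using h.map_symm hy)).mfderiv
  refine key.trans ?_
  rw [tangentCoordChange_self_eq hs, tangentCoordChange_self_eq hs']
  rfl

theorem IsCoreHom.pullback_model (h : IsCoreHom Z Z' L)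
    (β : Form (𝓘(ℝ, B).prod 𝓘(ℝ, G)) (Bundle.TotalSpace G Z'.Fiber))
    (p : Bundle.TotalSpace F Z.Fiber) (u : ExteriorAlgebra ℝ (B × F)) :
    ((β.bundlePullback (Z := Z) L).model p).pairing u =
      (β.model (bundleMap Z Z' L p)).pairing (mvMap (modelMap B L) u) := by
  have : (β.bundlePullback (Z := Z) L).model p =
      (β.model (bundleMap Z Z' L p)).comap (modelMap B L) := by
    rw [← h.mfderiv_eq p]
    rfl
  rw [this, Covector.pairing_comap]
  rfl

theorem IsCoreHom.pullback_dual (h : IsCoreHom Z Z' L)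
    (β : Form (𝓘(ℝ, B).prod 𝓘(ℝ, G)) (Bundle.TotalSpace G Z'.Fiber))
    {p₀ : Bundle.TotalSpace F Z.Fiber} {y : B × F}
    (hy : y ∈ (extChartAt (𝓘(ℝ, B).prod 𝓘(ℝ, F)) p₀).target) :
    (β.bundlePullback (Z := Z) L).dual p₀ y =
      (β.dual (bundleMap Z Z' L p₀) (modelMap B L y)).comp (mvMap (modelMap B L)) := by
  obtain ⟨q, hq, rfl⟩ : ∃ q ∈ (extChartAt (𝓘(ℝ, B).prod 𝓘(ℝ, F)) p₀).source,
      extChartAt (𝓘(ℝ, B).prod 𝓘(ℝ, F)) p₀ q = y :=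
    ⟨_, (extChartAt _ p₀).map_target hy, (extChartAt _ p₀).right_inv hy⟩
  refine ContinuousLinearMap.ext fun u => ?_
  rw [Form.dual_source _ hq, h.pullback_model, ContinuousLinearMap.comp_apply, ← h.chart_map hq,
    Form.dual_source _ (h.map_mem_source hq), mvMap_comp, mvMap_comp,
    h.tangentCoordChange_comp hq (mem_extChartAt_source (I := 𝓘(ℝ, B).prod 𝓘(ℝ, F)) q)]

theorem Form.Smooth.bundlePullback (h : IsCoreHom Z Z' L)
    {β : Form (𝓘(ℝ, B).prod 𝓘(ℝ, G)) (Bundle.TotalSpace G Z'.Fiber)} (hβ : β.Smooth) :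
    (β.bundlePullback (Z := Z) L).Smooth := by
  rw [Form.smooth_iff]
  intro p₀
  refine ContDiffOn.congr ?_ fun y hy => h.pullback_dual β hy
  exact ((Form.smooth_iff.1 hβ _).comp (modelMap B L).contDiff.contDiffOn
    fun y hy => h.modelMap_mem hy).clm_comp contDiffOn_const

theorem Form.HasDegree.bundlePullback
    {β : Form (𝓘(ℝ, B).prod 𝓘(ℝ, G)) (Bundle.TotalSpace G Z'.Fiber)} {k : ℤ} (hβ : β.HasDegree k) :
    (β.bundlePullback (Z := Z) L).HasDegree k := by
  intro p j hj
  have : ∀ a, a = 0 → ContinuousAlternatingMap.compContinuousLinearMap a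
      (mfderiv (𝓘(ℝ, B).prod 𝓘(ℝ, F)) (𝓘(ℝ, B).prod 𝓘(ℝ, G)) (bundleMap Z Z' L) p) =
      (0 : TangentSpace (𝓘(ℝ, B).prod 𝓘(ℝ, F)) p [⋀^Fin j]→L[ℝ] ℝ) := by
    rintro a rfl
    rfl
  exact this _ (hβ (bundleMap Z Z' L p) j hj)

/-- The exterior derivative commutes with pull-backs. -/
theorem extD_bundlePullback (h : IsCoreHom Z Z' L)
    {β : Form (𝓘(ℝ, B).prod 𝓘(ℝ, G)) (Bundle.TotalSpace G Z'.Fiber)} (hβ : β.Smooth) :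
    extD (β.bundlePullback (Z := Z) L) = (extD β).bundlePullback L := by
  refine Form.ext_dual fun p u => ?_
  have ht := mem_extChartAt_target (I := 𝓘(ℝ, B).prod 𝓘(ℝ, F)) p
  rw [Form.dual_extD (hβ.bundlePullback h) ht, h.pullback_dual _ ht, ContinuousLinearMap.comp_apply,
    Form.dual_extD hβ (h.modelMap_mem ht)]
  have := dualD_comp (τ := modelMap B L) (modelMap B L).contDiff.contDiffAt
    (hβ.differentiableAt (h.modelMap_mem ht))
    (a := (β.bundlePullback (Z := Z) L).dual p) (by
      filter_upwards [(isOpen_extChartAt_target p).mem_nhds ht] with y hy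
      rw [h.pullback_dual _ hy, ContinuousLinearMap.fderiv]) u
  rw [this, ContinuousLinearMap.fderiv]

end BundleMap

end Multisymplectic

end

noncomputable section

namespace Multisymplectic

/-! ### Gluing of multivector fields -/

section Glue

variable {B F : Type*} [NormedAddCommGroup B] [NormedSpace ℝ B] [FiniteDimensional ℝ B]
  [NormedAddCommGroup F] [NormedSpace ℝ F] [FiniteDimensional ℝ F]
  {Y : Type*} [TopologicalSpace Y] [T2Space Y] [SigmaCompactSpace Y] [ChartedSpace B Y]
  [IsManifold 𝓘(ℝ, B) ∞ Y] {Z : VectorBundleCore ℝ Y F (atlas B Y)} [Z.IsContMDiff 𝓘(ℝ, B) ∞]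

/-- A pointwise convex condition on multivector fields on a vector bundle that has smooth solutions in
the charts has a smooth solution. -/
theorem IsChartCore.exists_smooth (h : IsChartCore Z)
    {C : Bundle.TotalSpace F Z.Fiber → Set (ExteriorAlgebra ℝ (B × F))}
    (hC : ∀ q, Convex ℝ (C q))
    (X : Bundle.TotalSpace F Z.Fiber → B × F → ExteriorAlgebra ℝ (B × F))
    (hX : ∀ p, ContDiffOn ℝ ∞ (X p) (extChartAt (𝓘(ℝ, B).prod 𝓘(ℝ, F)) p).target)
    (hXC : ∀ p q, q ∈ (extChartAt (𝓘(ℝ, B).prod 𝓘(ℝ, F)) p).source →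
      mvMap (tangentCoordChange (𝓘(ℝ, B).prod 𝓘(ℝ, F)) p q q)
        (X p (extChartAt (𝓘(ℝ, B).prod 𝓘(ℝ, F)) p q)) ∈ C q) :
    ∃ W : MVField (𝓘(ℝ, B).prod 𝓘(ℝ, F)) (Bundle.TotalSpace F Z.Fiber),
      W.Smooth ∧ ∀ q, W.model q ∈ C q := by
  obtain ⟨f, hf⟩ := SmoothPartitionOfUnity.exists_isSubordinate_chartAt_source (M := Y) 𝓘(ℝ, B)
  -- the points of the zero section serve as centres of the charts
  let c : Y → Bundle.TotalSpace F Z.Fiber := fun i => ⟨i, (0 : F)⟩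
  have hsrc : ∀ (i : Y) (q : Bundle.TotalSpace F Z.Fiber), q.1 ∈ tsupport (f i) →
      q ∈ (extChartAt (𝓘(ℝ, B).prod 𝓘(ℝ, F)) (c i)).source := fun i q hq => by
    refine (h.mem_source (c i) q).2 ?_
    simpa using hf i hq
  let x : Y → Bundle.TotalSpace F Z.Fiber → ExteriorAlgebra ℝ (B × F) := fun i q =>
    mvMap (tangentCoordChange (𝓘(ℝ, B).prod 𝓘(ℝ, F)) (c i) q q)
      (X (c i) (extChartAt (𝓘(ℝ, B).prod 𝓘(ℝ, F)) (c i) q))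
  let W : MVField (𝓘(ℝ, B).prod 𝓘(ℝ, F)) (Bundle.TotalSpace F Z.Fiber) := fun q =>
    (∑ᶠ i, f i q.1 • x i q : ExteriorAlgebra ℝ (B × F))
  have hW : ∀ q, W.model q = ∑ᶠ i, f i q.1 • x i q := fun q => rfl
  refine ⟨W, ?_, fun q => ?_⟩
  · refine MVField.smooth_iff.2 fun p₀ y hy => ContDiffAt.contDiffWithinAt ?_
    set q := (extChartAt (𝓘(ℝ, B).prod 𝓘(ℝ, F)) p₀).symm y with hq
    have hqs : q ∈ (extChartAt (𝓘(ℝ, B).prod 𝓘(ℝ, F)) p₀).source :=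
      (extChartAt _ p₀).map_target hy
    have hyq : extChartAt (𝓘(ℝ, B).prod 𝓘(ℝ, F)) p₀ q = y := (extChartAt _ p₀).right_inv hy
    obtain ⟨t, ht, hfin⟩ := f.locallyFinite q.1
    -- the summands in the chart
    let τ : Y → B × F → ExteriorAlgebra ℝ (B × F) := fun i z =>
      f i ((extChartAt 𝓘(ℝ, B) p₀.1).symm z.1) •
        mvMap (fderiv ℝ (extChartAt (𝓘(ℝ, B).prod 𝓘(ℝ, F)) p₀ ∘
          (extChartAt (𝓘(ℝ, B).prod 𝓘(ℝ, F)) (c i)).symm)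
          ((extChartAt (𝓘(ℝ, B).prod 𝓘(ℝ, F)) (c i) ∘
            (extChartAt (𝓘(ℝ, B).prod 𝓘(ℝ, F)) p₀).symm) z))
        (X (c i) ((extChartAt (𝓘(ℝ, B).prod 𝓘(ℝ, F)) (c i) ∘
            (extChartAt (𝓘(ℝ, B).prod 𝓘(ℝ, F)) p₀).symm) z))
    have hproj : ∀ z ∈ (extChartAt (𝓘(ℝ, B).prod 𝓘(ℝ, F)) p₀).target,
        ((extChartAt (𝓘(ℝ, B).prod 𝓘(ℝ, F)) p₀).symm z).1 =
          (extChartAt 𝓘(ℝ, B) p₀.1).symm z.1 := fun z hz => by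
      rw [h.target] at hz
      rw [h.symm_apply p₀ hz.1]
    have hcont : ContinuousAt (fun z : B × F => (extChartAt 𝓘(ℝ, B) p₀.1).symm z.1) y := by
      have hy' := hy
      rw [h.target] at hy'
      exact ((continuousOn_extChartAt_symm p₀.1).continuousAt
        ((isOpen_extChartAt_target p₀.1).mem_nhds hy'.1)).comp continuousAt_fst
    have hqy : (extChartAt 𝓘(ℝ, B) p₀.1).symm y.1 = q.1 := (hproj y hy).symm
    have hτ : ∀ i, ContDiffAt ℝ ∞ (τ i) y := fun i => by
      by_cases hi : q.1 ∈ tsupport (f i)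
      · have hqi := hsrc i q hi
        have c1 : ContDiffAt ℝ ∞ (extChartAt (𝓘(ℝ, B).prod 𝓘(ℝ, F)) (c i) ∘
            (extChartAt (𝓘(ℝ, B).prod 𝓘(ℝ, F)) p₀).symm) y := hyq ▸ contDiffAt_chartChange hqs hqi
        have e1 : (extChartAt (𝓘(ℝ, B).prod 𝓘(ℝ, F)) (c i) ∘
            (extChartAt (𝓘(ℝ, B).prod 𝓘(ℝ, F)) p₀).symm) y =
            extChartAt (𝓘(ℝ, B).prod 𝓘(ℝ, F)) (c i) q := rfl
        have c2 : ContDiffAt ℝ ∞ (fderiv ℝ (extChartAt (𝓘(ℝ, B).prod 𝓘(ℝ, F)) p₀ ∘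
            (extChartAt (𝓘(ℝ, B).prod 𝓘(ℝ, F)) (c i)).symm))
            (extChartAt (𝓘(ℝ, B).prod 𝓘(ℝ, F)) (c i) q) :=
          (contDiffAt_chartChange hqi hqs).fderiv_right (by simp)
        have c3 : ContDiffAt ℝ ∞ (X (c i)) (extChartAt (𝓘(ℝ, B).prod 𝓘(ℝ, F)) (c i) q) :=
          (hX (c i)).contDiffAt ((isOpen_extChartAt_target (c i)).mem_nhds
            ((extChartAt _ (c i)).map_source hqi))
        have c4 : ContDiffAt ℝ ∞
            (fun z : B × F => f i ((extChartAt 𝓘(ℝ, B) p₀.1).symm z.1)) y := by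
          have hy' := hy
          rw [h.target] at hy'
          have c5 : ContMDiffAt 𝓘(ℝ, B) 𝓘(ℝ, ℝ) ∞
              (f i ∘ (extChartAt 𝓘(ℝ, B) p₀.1).symm) y.1 :=
            (f i).contMDiff.contMDiffAt.comp _
              ((contMDiffOn_extChartAt_symm p₀.1).contMDiffAt
                ((isOpen_extChartAt_target p₀.1).mem_nhds hy'.1))
          exact ContDiffAt.comp (g := f i ∘ (extChartAt 𝓘(ℝ, B) p₀.1).symm) y
            c5.contDiffAt contDiffAt_fst
        rw [← e1] at c2 c3
        exact c4.smul (((contDiff_mvMap.contDiffAt.comp y (c2.comp y c1))).clm_apply (c3.comp y c1))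
      -- Outside the support the summand vanishes near `y`.
      · refine (contDiffAt_const (c := 0)).congr_of_eventuallyEq ?_
        have hn : (tsupport (f i))ᶜ ∈ 𝓝 ((extChartAt 𝓘(ℝ, B) p₀.1).symm y.1) := by
          rw [hqy]
          exact (isClosed_tsupport _).isOpen_compl.mem_nhds hi
        filter_upwards [hcont hn] with z hz
        have : f i ((extChartAt 𝓘(ℝ, B) p₀.1).symm z.1) = 0 := image_eq_zero_of_notMem_tsupport hz
        simp only [τ, this, zero_smul]
    -- Near `y` only finitely many summands are different from zero.
    refine (ContDiffAt.sum fun i (_ : i ∈ hfin.toFinset) => hτ i).congr_of_eventuallyEq ?_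
    have ht' : t ∈ 𝓝 ((extChartAt 𝓘(ℝ, B) p₀.1).symm y.1) := by rwa [hqy]
    filter_upwards [(isOpen_extChartAt_target p₀).mem_nhds hy, hcont ht'] with z hz hzt
    have hzt' : (extChartAt 𝓘(ℝ, B) p₀.1).symm z.1 ∈ t := hzt
    set q' := (extChartAt (𝓘(ℝ, B).prod 𝓘(ℝ, F)) p₀).symm z with hq'
    have hqs' : q' ∈ (extChartAt (𝓘(ℝ, B).prod 𝓘(ℝ, F)) p₀).source :=
      (extChartAt _ p₀).map_target hz
    have hzq : extChartAt (𝓘(ℝ, B).prod 𝓘(ℝ, F)) p₀ q' = z := (extChartAt _ p₀).right_inv hz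
    have hsupp : (Function.support fun i => f i q'.1 • x i q') ⊆ hfin.toFinset := by
      intro i hi
      rw [Finite.coe_toFinset]
      refine ⟨q'.1, fun h0 => hi ?_, by rw [hproj z hz]; exact hzt'⟩
      simp only [h0, zero_smul]
    rw [← hzq, MVField.inChart_source _ hqs', hW, finsum_eq_sum_of_support_subset _ hsupp, map_sum]
    refine Finset.sum_congr rfl fun i _ => ?_
    by_cases hi : q'.1 ∈ tsupport (f i)
    · have hqi := hsrc i q' hi
      simp only [x, map_smul]
      rw [mvMap_comp, tangentCoordChange_comp_eq hqi
        (mem_extChartAt_source (I := 𝓘(ℝ, B).prod 𝓘(ℝ, F)) q') hqs', hzq, ← hproj z hz,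
        Function.comp_apply, ← hq', fderiv_chartChange]
    · have h0 : f i q'.1 = 0 := image_eq_zero_of_notMem_tsupport hi
      rw [h0, zero_smul, map_zero, hzq, ← hproj z hz, h0, zero_smul]
  -- Convexity carries the pointwise property over to the sum.
  · rw [hW]
    refine (hC q).finsum_mem (fun i => f.nonneg i _) (f.sum_eq_one (mem_univ _)) fun i hi => ?_
    exact hXC (c i) q (hsrc i q (subset_tsupport _ hi))

end Glue

end Multisymplectic

end

noncomputable section

namespace Multisymplectic

/-! ### Existence of Hamiltonian multivector fields -/

theorem exists_generalized_inverse {V W : Type*} [AddCommGroup V] [Module ℝ V] [AddCommGroup W]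
    [Module ℝ W] (A : V →ₗ[ℝ] W) : ∃ R : W →ₗ[ℝ] V, ∀ v, A (R (A v)) = A v := by
  obtain ⟨g, hg⟩ := A.rangeRestrict.exists_rightInverse_of_surjective A.range_rangeRestrict
  obtain ⟨R, hR⟩ := g.exists_extend
  refine ⟨R, fun v => ?_⟩
  have h1 : R (A v) = g (A.rangeRestrict v) :=
    LinearMap.congr_fun hR (A.rangeRestrict v)
  rw [h1]
  exact congrArg Subtype.val (LinearMap.congr_fun hg (A.rangeRestrict v))

section Hamiltonian

variable {B F : Type*} [NormedAddCommGroup B] [NormedSpace ℝ B] [FiniteDimensional ℝ B]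
  [NormedAddCommGroup F] [NormedSpace ℝ F] [FiniteDimensional ℝ F]
  {Y : Type*} [TopologicalSpace Y] [ChartedSpace B Y] [IsManifold 𝓘(ℝ, B) ∞ Y] {n : ℕ}
  {Z : VectorBundleCore ℝ Y F (atlas B Y)} [Z.IsContMDiff 𝓘(ℝ, B) ∞]
  {ρ : F →ₗ[ℝ] B [⋀^Fin n]→L[ℝ] ℝ}
  {θ : Form (𝓘(ℝ, B).prod 𝓘(ℝ, F)) (Bundle.TotalSpace F Z.Fiber)}

/-- The changes of coordinates preserve `ω`. -/
theorem IsTautological.tautOmega_map_tangentCoordChange (h : IsTautological Z ρ θ)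
    {p q : Bundle.TotalSpace F Z.Fiber}
    (hq : q ∈ (extChartAt (𝓘(ℝ, B).prod 𝓘(ℝ, F)) p).source) (u : ExteriorAlgebra ℝ (B × F)) :
    tautOmega ρ (mvMap (tangentCoordChange (𝓘(ℝ, B).prod 𝓘(ℝ, F)) p q q) u) = tautOmega ρ u := by
  rw [← h.omega_model q, ← Form.dual_source _ hq, h.omega_dual ((extChartAt _ p).map_source hq)]

theorem mvMap_mul {V W : Type*} [NormedAddCommGroup V] [NormedSpace ℝ V] [FiniteDimensional ℝ V]
    [NormedAddCommGroup W] [NormedSpace ℝ W] [FiniteDimensional ℝ W] (L : V →L[ℝ] W)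
    (u w : ExteriorAlgebra ℝ V) : mvMap L (u * w) = mvMap L u * mvMap L w :=
  map_mul (ExteriorAlgebra.map (L : V →ₗ[ℝ] W)) u w

theorem mvMap_tangentCoordChange_symm {E : Type*} [NormedAddCommGroup E] [NormedSpace ℝ E]
    [FiniteDimensional ℝ E] {H : Type*} [TopologicalSpace H] {I : ModelWithCorners ℝ E H}
    {N : Type*} [TopologicalSpace N] [ChartedSpace H N] [I.Boundaryless] [IsManifold I ∞ N]
    {p p' q : N} (hp : q ∈ (extChartAt I p).source) (hp' : q ∈ (extChartAt I p').source)
    (u : ExteriorAlgebra ℝ E) :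
    mvMap (tangentCoordChange I p p' q) (mvMap (tangentCoordChange I p' p q) u) = u := by
  rw [mvMap_comp, tangentCoordChange_comp_eq hp' hp hp', tangentCoordChange_self_eq hp', mvMap_id]

theorem mvMap_mem {V W : Type*} [NormedAddCommGroup V] [NormedSpace ℝ V] [FiniteDimensional ℝ V]
    [NormedAddCommGroup W] [NormedSpace ℝ W] [FiniteDimensional ℝ W] (L : V →L[ℝ] W) {r : ℕ}
    {u : ExteriorAlgebra ℝ V} (hu : u ∈ ⋀[ℝ]^r V) : mvMap L u ∈ ⋀[ℝ]^r W :=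
  map_mem_exteriorPower _ hu

/-- If the equation `i(X)ω = df` can be solved at each point, it has a smooth solution: in the charts it
is a linear system with constant coefficients. -/
theorem IsTautological.exists_isHamiltonian [T2Space Y] [SigmaCompactSpace Y]
    (h : IsTautological Z ρ θ) {r : ℕ}
    {f : Form (𝓘(ℝ, B).prod 𝓘(ℝ, F)) (Bundle.TotalSpace F Z.Fiber)} (hf : f.Smooth)
    (hfd : f.HasDegree ((n : ℤ) - r))
    (hpt : ∀ q, ∃ X ∈ ⋀[ℝ]^r (B × F), ∀ u,
      tautOmega ρ (X * u) = ((extD f).model q).pairing u) :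
    ∃ X, IsHamiltonian n θ r X f := by
  let A : (⋀[ℝ]^r (B × F) : Submodule ℝ (ExteriorAlgebra ℝ (B × F))) →ₗ[ℝ]
      ExteriorAlgebra ℝ (B × F) →L[ℝ] ℝ :=
    LinearMap.toContinuousLinearMap.toLinearMap ∘ₗ (tautOmega ρ).compRight ℝ ∘ₗ
      LinearMap.mul ℝ (ExteriorAlgebra ℝ (B × F)) ∘ₗ Submodule.subtype _
  have hA : ∀ X u, A X u = tautOmega ρ (X.1 * u) := fun X u => rfl
  -- The same `R` serves for all points of a chart, as the coefficients of `ω` are constant.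
  obtain ⟨R, hR⟩ := exists_generalized_inverse A
  let R' : (ExteriorAlgebra ℝ (B × F) →L[ℝ] ℝ) →L[ℝ] ExteriorAlgebra ℝ (B × F) :=
    LinearMap.toContinuousLinearMap (Submodule.subtype _ ∘ₗ R)
  have hR' : ∀ a, R' a = (R a).1 := fun _ => rfl
  obtain ⟨W, hW, hWC⟩ := h.core.exists_smooth
    (C := fun q => {X | X ∈ ⋀[ℝ]^r (B × F) ∧ ∀ u,
      tautOmega ρ (X * u) = ((extD f).model q).pairing u})
    (fun q x hx y hy a b _ _ hab => ⟨add_mem (Submodule.smul_mem _ _ hx.1)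
      (Submodule.smul_mem _ _ hy.1), fun u => by
        rw [add_mul, smul_mul_assoc, smul_mul_assoc, map_add, map_smul, map_smul, hx.2, hy.2,
          ← add_smul, hab, one_smul]⟩)
    (fun p y => R' ((extD f).dual p y))
    (fun p => R'.contDiff.comp_contDiffOn (Form.smooth_iff.1 hf.extD p)) (fun p q hq => by
      have hqq := mem_extChartAt_source (I := 𝓘(ℝ, B).prod 𝓘(ℝ, F)) q
      obtain ⟨X, hX, hXu⟩ := hpt q
      set K := tangentCoordChange (𝓘(ℝ, B).prod 𝓘(ℝ, F)) p q q with hK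
      set K' := tangentCoordChange (𝓘(ℝ, B).prod 𝓘(ℝ, F)) q p q with hK'
      have ha : (extD f).dual p (extChartAt (𝓘(ℝ, B).prod 𝓘(ℝ, F)) p q) =
          A ⟨mvMap K' X, mvMap_mem _ hX⟩ := by
        refine ContinuousLinearMap.ext fun u => ?_
        rw [hA, Form.dual_source _ hq, ← hXu, ← h.tautOmega_map_tangentCoordChange hq
          (mvMap K' X * u), mvMap_mul, mvMap_tangentCoordChange_symm hq hqq]
      refine ⟨?_, fun u => ?_⟩
      · exact mvMap_mem _ (R _).2
      · have hu : u = mvMap K (mvMap K' u) := (mvMap_tangentCoordChange_symm hq hqq u).symm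
        rw [hu, ← mvMap_mul, h.tautOmega_map_tangentCoordChange hq, ← Form.dual_source _ hq, hR',
          ← hA, ha, hR])
  refine ⟨W, hW, fun q => (hWC q).1, hf, hfd, ?_⟩
  funext q
  refine Covector.ext_pairing fun u => ?_
  refine (Covector.pairing_contract _ _ _).trans ?_
  exact (h.omega_model q _).trans ((hWC q).2 u)

end Hamiltonian

end Multisymplectic

end

noncomputable section

namespace Multisymplectic

/-! ### Insertion of endomorphism fields -/

/-- Forms vanishing on two vertical vectors do not distinguish between `u` and the insertion of the
vertical projection into `u`, once `u` has a vertical factor. -/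
theorem apply_insertionDerivation_eq_self {V : Type*} [AddCommGroup V] [Module ℝ V]
    [FiniteDimensional ℝ V] {Φ : V →ₗ[ℝ] V} {K : Submodule ℝ V} (h : ∀ v, Φ v ∈ K)
    (h' : ∀ v ∈ K, Φ v = v) {a : ExteriorAlgebra ℝ V →ₗ[ℝ] ℝ} (ha : ∀ u ∈ vertPow K 2, a u = 0)
    {u : ExteriorAlgebra ℝ V} (hu : u ∈ vertPow K 1) : a (insertionDerivation Φ u) = a u := by
  refine vertPow_induction (C := fun u => a (insertionDerivation Φ u) = a u) (fun w hw u _ => ?_)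
    (by rw [map_zero]) (fun x y hx hy => by rw [map_add, map_add, map_add, hx, hy])
    (fun c x hx => by rw [map_smul, map_smul, map_smul, hx]) hu
  rw [insertionDerivation_ι_mul, h' w hw, map_add,
    ha _ (ι_mul_mem_vertPow_succ hw (insertionDerivation_mem_vertPow h u)), add_zero]

section Insert

variable {E : Type*} [NormedAddCommGroup E] [NormedSpace ℝ E] [FiniteDimensional ℝ E]

theorem contDiff_insertionDerivation (u : ExteriorAlgebra ℝ E) :
    ContDiff ℝ ∞ fun Φ : E →L[ℝ] E => insertionDerivation (Φ : E →ₗ[ℝ] E) u := by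
  have : (fun Φ : E →L[ℝ] E => insertionDerivation (Φ : E →ₗ[ℝ] E) u) = fun Φ => ∑ i,
      mvMulL E (LinearMap.toContinuousLinearMap (ExteriorAlgebra.ι ℝ (M := E))
        (Φ (Module.finBasis ℝ E i)))
        (CliffordAlgebra.contractLeft ((Module.finBasis ℝ E).coord i) u) := by
    funext Φ
    rw [insertionDerivation, LinearMap.sum_apply]
    rfl
  rw [this]
  refine ContDiff.sum fun i _ => ContDiff.clm_apply ((mvMulL E).contDiff.comp
    ((LinearMap.toContinuousLinearMap (ExteriorAlgebra.ι ℝ (M := E))).contDiff.comp ?_)) contDiff_const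
  exact contDiff_id.clm_apply contDiff_const

variable {H : Type*} [TopologicalSpace H] {I : ModelWithCorners ℝ E H} {N : Type*}
  [TopologicalSpace N] [ChartedSpace H N] [I.Boundaryless] [IsManifold I ∞ N]

/-- An endomorphism field in a preferred chart. -/
def endInChart (Φ : ∀ p : N, TangentSpace I p →L[ℝ] TangentSpace I p) (p₀ : N) (y : E) :
    E →L[ℝ] E :=
  (chartDeriv I p₀ ((extChartAt I p₀).symm y)).comp
    ((Φ ((extChartAt I p₀).symm y)).comp (chartSymmDeriv I p₀ y))

/-- The value of an endomorphism field, as an endomorphism of the model space. -/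
def endModel (Φ : ∀ p : N, TangentSpace I p →L[ℝ] TangentSpace I p) (p : N) : E →L[ℝ] E := Φ p

/-- The operator `i_Φ` on forms. -/
def insertField (Φ : ∀ p : N, TangentSpace I p →L[ℝ] TangentSpace I p) (α : Form I N) :
    Form I N :=
  fun p => (α p).insert (Φ p : _ →ₗ[ℝ] TangentSpace I p)

/-- The vertical exterior derivative `([i_Φ, d] + [i_Φ, [i_Φ, d]]) / 2`. -/
def vertD (Φ : ∀ p : N, TangentSpace I p →L[ℝ] TangentSpace I p) (α : Form I N) : Form I N :=
  (1 / 2 : ℝ) • ((insertField Φ (extD α) - extD (insertField Φ α)) +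
    (insertField Φ (insertField Φ (extD α) - extD (insertField Φ α)) -
      (insertField Φ (extD (insertField Φ α)) - extD (insertField Φ (insertField Φ α)))))

variable {Φ : ∀ p : N, TangentSpace I p →L[ℝ] TangentSpace I p}

theorem endInChart_source {p₀ q : N} (hq : q ∈ (extChartAt I p₀).source) :
    endInChart Φ p₀ (extChartAt I p₀ q) = (tangentCoordChange I q p₀ q).comp
      ((endModel Φ q).comp (tangentCoordChange I p₀ q q)) := by
  have h1 := chartDeriv_eq (I := I)
    ((extChartAt I p₀).map_target ((extChartAt I p₀).map_source hq))
  have h2 := chartSymmDeriv_eq (I := I) ((extChartAt I p₀).map_source hq)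
  have h3 : ∀ (q' : N) (L K : E →L[ℝ] E), q' = q → L = tangentCoordChange I q' p₀ q' →
      K = tangentCoordChange I p₀ q' q' → L.comp ((endModel Φ q').comp K) =
        (tangentCoordChange I q p₀ q).comp ((endModel Φ q).comp (tangentCoordChange I p₀ q q)) := by
    rintro q' L K rfl rfl rfl
    rfl
  exact h3 _ _ _ ((extChartAt I p₀).left_inv hq) h1 h2

theorem insertField_model (α : Form I N) (q : N) (u : ExteriorAlgebra ℝ E) :
    ((insertField Φ α).model q).pairing u =
      (α.model q).pairing (insertionDerivation (endModel Φ q : E →ₗ[ℝ] E) u) :=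
  Covector.pairing_insert _ _ _

theorem mvMap_insertionDerivation_endInChart {p₀ q : N} (hq : q ∈ (extChartAt I p₀).source)
    (u : ExteriorAlgebra ℝ E) :
    mvMap (tangentCoordChange I p₀ q q)
        (insertionDerivation (endInChart Φ p₀ (extChartAt I p₀ q) : E →ₗ[ℝ] E) u) =
      insertionDerivation (endModel Φ q : E →ₗ[ℝ] E) (mvMap (tangentCoordChange I p₀ q q) u) := by
  refine map_insertionDerivation (fun v => ?_) u
  have hqq := mem_extChartAt_source (I := I) q
  have := tangentCoordChange_comp_eq hqq hq hqq
  rw [tangentCoordChange_self_eq hqq] at this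
  rw [endInChart_source hq]
  exact DFunLike.congr_fun this (endModel Φ q (tangentCoordChange I p₀ q q v))

theorem insertField_dual (α : Form I N) {p₀ : N} {y : E} (hy : y ∈ (extChartAt I p₀).target)
    (u : ExteriorAlgebra ℝ E) : (insertField Φ α).dual p₀ y u =
      α.dual p₀ y (insertionDerivation (endInChart Φ p₀ y : E →ₗ[ℝ] E) u) := by
  obtain ⟨q, hq, rfl⟩ : ∃ q ∈ (extChartAt I p₀).source, extChartAt I p₀ q = y :=
    ⟨_, (extChartAt I p₀).map_target hy, (extChartAt I p₀).right_inv hy⟩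
  rw [Form.dual_source _ hq, Form.dual_source _ hq, insertField_model,
    mvMap_insertionDerivation_endInChart hq]

theorem Form.Smooth.insertField {α : Form I N} (hα : α.Smooth)
    (hΦ : ∀ p₀, ContDiffOn ℝ ∞ (endInChart Φ p₀) (extChartAt I p₀).target) :
    (insertField Φ α).Smooth := by
  rw [Form.smooth_iff]
  intro p₀
  rw [contDiffOn_dual_iff]
  intro u
  refine ContDiffOn.congr ?_ fun y hy => insertField_dual α hy u
  exact (Form.smooth_iff.1 hα p₀).clm_apply
    ((contDiff_insertionDerivation u).comp_contDiffOn (hΦ p₀))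

theorem form_ext_model {α β : Form I N}
    (h : ∀ q u, (α.model q).pairing u = (β.model q).pairing u) : α = β :=
  funext fun q => Covector.ext_pairing fun u => h q u

theorem insertField_zero : insertField Φ (0 : Form I N) = 0 := form_ext_model fun q u => by
  rw [insertField_model]
  have : (0 : Form I N).model q = 0 := rfl
  rw [this, Covector.pairing_zero]
  rfl

theorem insertField_sub (α β : Form I N) :
    insertField Φ (α - β) = insertField Φ α - insertField Φ β := form_ext_model fun q u => by
  have h1 : ∀ α β : Form I N, (α - β).model q = α.model q - β.model q := fun _ _ => rfl
  rw [insertField_model, h1, h1, Covector.pairing_sub, Covector.pairing_sub, LinearMap.sub_apply,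
    LinearMap.sub_apply, insertField_model, insertField_model]

/-- The vertical derivative of a horizontal form. -/
theorem vertD_of_insertField_eq_zero {α : Form I N} (h : insertField Φ α = 0)
    (h2 : insertField Φ (insertField Φ (extD α)) = insertField Φ (extD α)) :
    vertD Φ α = insertField Φ (extD α) := by
  rw [vertD, h, extD_zero, insertField_zero, extD_zero, sub_zero, sub_zero, sub_zero, h2,
    ← two_smul ℝ, smul_smul]
  norm_num

/-- The vertical derivative of a form with one vertical leg. -/
theorem vertD_of_insertField_eq_self {α : Form I N} (h : insertField Φ α = α) :
    vertD Φ α = (1 / 2 : ℝ) • (insertField Φ (insertField Φ (extD α)) - insertField Φ (extD α)) := by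
  rw [vertD, h, h, insertField_sub]
  congr 1
  abel

end Insert

end Multisymplectic

end

noncomputable section

namespace Multisymplectic

/-! ### Phase bundles and connections -/

section Splitting

variable {V B : Type*} [AddCommGroup V] [Module ℝ V] [FiniteDimensional ℝ V]
  [AddCommGroup B] [Module ℝ B] {Φ : V →ₗ[ℝ] V} {b : V →ₗ[ℝ] B} {c : B →ₗ[ℝ] V}

/-- The operator `a (a - 1)`, where `a` is the number of vertical factors. -/
theorem insertionDerivation_twice_sub_mem (h : IsSplitting Φ b c) (u : ExteriorAlgebra ℝ V) :
    insertionDerivation Φ (insertionDerivation Φ u) - insertionDerivation Φ u ∈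
      vertPow (LinearMap.ker b) 2 := by
  have := lhom_eq_of_isBihomogeneous h (G := (vertPow (LinearMap.ker b) 2).mkQ ∘ₗ
    (insertionDerivation Φ ∘ₗ insertionDerivation Φ - insertionDerivation Φ)) (G' := 0)
    (fun a u hu => ?_) u
  · exact (Submodule.Quotient.mk_eq_zero _).1 this
  · refine (Submodule.Quotient.mk_eq_zero _).2 ?_
    rw [LinearMap.sub_apply, LinearMap.comp_apply, hu.insertionDerivation_eq h, map_smul,
      hu.insertionDerivation_eq h, smul_smul, ← sub_smul]
    obtain rfl | rfl | ha : a = 0 ∨ a = 1 ∨ 2 ≤ a := by omega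
    · simp
    · simp
    · exact Submodule.smul_mem _ _ (vertPow_anti ha hu.mem_vertPow)

theorem apply_eq_zero_of_contract {V : Type*} [AddCommGroup V] [Module ℝ V] {K : Submodule ℝ V}
    {f : ExteriorAlgebra ℝ V →ₗ[ℝ] ℝ} (hf : ∀ w ∈ K, ∀ u, f (ExteriorAlgebra.ι ℝ w * u) = 0)
    {u : ExteriorAlgebra ℝ V} (hu : u ∈ vertPow K 1) : f u = 0 :=
  vertPow_induction (C := fun u => f u = 0) (fun w hw u _ => hf w hw u) (map_zero _)
    (fun x y hx hy => by rw [map_add, hx, hy, add_zero])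
    (fun a x hx => by rw [map_smul, hx, smul_zero]) hu

end Splitting

section PhaseBundle

variable {A B F G : Type*} [NormedAddCommGroup A] [NormedSpace ℝ A] [FiniteDimensional ℝ A]
  [NormedAddCommGroup B] [NormedSpace ℝ B] [FiniteDimensional ℝ B]
  [NormedAddCommGroup F] [NormedSpace ℝ F] [FiniteDimensional ℝ F]
  [NormedAddCommGroup G] [NormedSpace ℝ G] [FiniteDimensional ℝ G]
  {Y : Type*} [TopologicalSpace Y] [ChartedSpace B Y] [IsManifold 𝓘(ℝ, B) ∞ Y] {n : ℕ}
  {Z : VectorBundleCore ℝ Y F (atlas B Y)} {Z' : VectorBundleCore ℝ Y G (atlas B Y)}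
  [Z.IsContMDiff 𝓘(ℝ, B) ∞] [Z'.IsContMDiff 𝓘(ℝ, B) ∞]
  {ρ : F →ₗ[ℝ] B [⋀^Fin n]→L[ℝ] ℝ}
  {θ : Form (𝓘(ℝ, B).prod 𝓘(ℝ, F)) (Bundle.TotalSpace F Z.Fiber)}
  {P : F →L[ℝ] G} {s : G →L[ℝ] F} {b₀ : B →L[ℝ] A} {vol : ExteriorAlgebra ℝ A →ₗ[ℝ] ℝ} {ε : F}

/-- A bundle `Z` of `n`-forms over a fibred manifold with `n`-dimensional base, with the projection `P`
to the quotient bundle `Z'` by the multiples `ε` of the volume form of the base. In the charts, `b₀` is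
the differential of the projection to the base and `s` a section of `P`. -/
structure IsPhaseBundle (Z : VectorBundleCore ℝ Y F (atlas B Y))
    (Z' : VectorBundleCore ℝ Y G (atlas B Y)) (ρ : F →ₗ[ℝ] B [⋀^Fin n]→L[ℝ] ℝ)
    (θ : Form (𝓘(ℝ, B).prod 𝓘(ℝ, F)) (Bundle.TotalSpace F Z.Fiber))
    (P : F →L[ℝ] G) (s : G →L[ℝ] F) (b₀ : B →L[ℝ] A) (vol : ExteriorAlgebra ℝ A →ₗ[ℝ] ℝ) (ε : F) :
    Prop where
  taut : IsTautological Z ρ θ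
  hom : IsCoreHom Z Z' P
  proj_section : ∀ x, P (s x) = x
  two : ∀ x, ∀ u ∈ vertPow (LinearMap.ker (b₀ : B →ₗ[ℝ] A)) 2, altPairing n (ρ x) u = 0
  one : ∀ x, P x = 0 → ∀ u ∈ vertPow (LinearMap.ker (b₀ : B →ₗ[ℝ] A)) 1, altPairing n (ρ x) u = 0
  proj_unit : P ε = 0
  unit : ∀ u, altPairing n (ρ ε) u = vol (ExteriorAlgebra.map (b₀ : B →ₗ[ℝ] A) u)
  decomp : ∀ x, ∃ t : ℝ, x = s (P x) + t • ε
  surj : ∃ c₀ : A →ₗ[ℝ] B, ∀ a, b₀ (c₀ a) = a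
  vertical : ∀ (i j : atlas B Y) (y : Y), y ∈ i.1.source → y ∈ j.1.source → ∀ v, b₀ v = 0 →
    b₀ ((tangentBundleCore 𝓘(ℝ, B) Y).coordChange i j y v) = 0
  finrank_eq : Module.finrank ℝ A = n
  vol_degree : IsHomogeneous vol n
  vol_ne : ∃ η ∈ ⋀[ℝ]^n A, vol η = 1

/-- A field of projections onto the vertical subspaces of the total space, the kernels of `b₀`. -/
structure IsVerticalProjection (b₀ : B →L[ℝ] A)
    (Φ : ∀ p : Bundle.TotalSpace G Z'.Fiber, TangentSpace (𝓘(ℝ, B).prod 𝓘(ℝ, G)) p →L[ℝ]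
      TangentSpace (𝓘(ℝ, B).prod 𝓘(ℝ, G)) p) : Prop where
  idempotent : ∀ p v, endModel Φ p (endModel Φ p v) = endModel Φ p v
  vertical : ∀ p v, (∃ w, endModel Φ p w = v) ↔ b₀ v.1 = 0
  smooth : ∀ p₀, ContDiffOn ℝ ∞ (endInChart Φ p₀)
    (extChartAt (𝓘(ℝ, B).prod 𝓘(ℝ, G)) p₀).target

variable (G) in
/-- The differential of the projection of the total space to the base, in charts. -/
def baseMap (b₀ : B →L[ℝ] A) : B × G →ₗ[ℝ] A := (b₀ : B →ₗ[ℝ] A) ∘ₗ LinearMap.fst ℝ B G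

theorem mem_ker_baseMap {v : B × G} : v ∈ LinearMap.ker (baseMap G b₀) ↔ b₀ v.1 = 0 := Iff.rfl

variable {Φ : ∀ p : Bundle.TotalSpace G Z'.Fiber, TangentSpace (𝓘(ℝ, B).prod 𝓘(ℝ, G)) p →L[ℝ]
      TangentSpace (𝓘(ℝ, B).prod 𝓘(ℝ, G)) p}
  {θV f g : Form (𝓘(ℝ, B).prod 𝓘(ℝ, G)) (Bundle.TotalSpace G Z'.Fiber)}

namespace IsVerticalProjection

theorem apply_mem (hΦ : IsVerticalProjection b₀ Φ) (p : Bundle.TotalSpace G Z'.Fiber) (v : B × G) :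
    endModel Φ p v ∈ LinearMap.ker (baseMap G b₀) :=
  mem_ker_baseMap.2 ((hΦ.vertical p _).1 ⟨v, rfl⟩)

theorem apply_of_mem (hΦ : IsVerticalProjection b₀ Φ) (p : Bundle.TotalSpace G Z'.Fiber)
    {v : B × G} (hv : v ∈ LinearMap.ker (baseMap G b₀)) : endModel Φ p v = v := by
  obtain ⟨w, rfl⟩ := (hΦ.vertical p v).2 (mem_ker_baseMap.1 hv)
  exact hΦ.idempotent p w

/-- The vertical projection and a right inverse of the differential of the projection to the base
split the tangent space. -/
theorem exists_isSplitting (hΦ : IsVerticalProjection b₀ Φ)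
    (hb : ∃ c₀ : A →ₗ[ℝ] B, ∀ a, b₀ (c₀ a) = a) (p : Bundle.TotalSpace G Z'.Fiber) :
    ∃ c, IsSplitting (endModel Φ p : B × G →ₗ[ℝ] B × G) (baseMap G b₀) c := by
  obtain ⟨c₀, hc₀⟩ := hb
  refine ⟨(LinearMap.id - (endModel Φ p : B × G →ₗ[ℝ] B × G)) ∘ₗ LinearMap.inl ℝ B G ∘ₗ c₀,
    fun v => ?_, fun a => ?_⟩
  · have h1 := hΦ.apply_of_mem p (v := v - (c₀ (b₀ v.1), 0)) (by
      rw [mem_ker_baseMap, Prod.fst_sub, map_sub, hc₀, sub_self])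
    rw [map_sub] at h1
    change endModel Φ p v + ((c₀ (b₀ v.1), 0) - endModel Φ p (c₀ (b₀ v.1), 0)) = v
    rw [add_sub_left_comm, h1, add_sub_cancel]
  · change baseMap G b₀ ((c₀ a, 0) - endModel Φ p (c₀ a, 0)) = a
    rw [map_sub, LinearMap.mem_ker.1 (hΦ.apply_mem p _), sub_zero]
    exact hc₀ a

end IsVerticalProjection

namespace IsPhaseBundle

variable (h : IsPhaseBundle Z Z' ρ θ P s b₀ vol ε)
include h

theorem tangentCoordChange_mem {p₀ p₁ q : Bundle.TotalSpace G Z'.Fiber}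
    (h₀ : q ∈ (extChartAt (𝓘(ℝ, B).prod 𝓘(ℝ, G)) p₀).source)
    (h₁ : q ∈ (extChartAt (𝓘(ℝ, B).prod 𝓘(ℝ, G)) p₁).source) {v : B × G}
    (hv : v ∈ LinearMap.ker (baseMap G b₀)) :
    tangentCoordChange (𝓘(ℝ, B).prod 𝓘(ℝ, G)) p₀ p₁ q v ∈ LinearMap.ker (baseMap G b₀) := by
  have h₀' := (h.hom.core'.mem_source p₀ q).1 h₀
  have h₁' := (h.hom.core'.mem_source p₁ q).1 h₁
  rw [mem_ker_baseMap, h.hom.core'.fst_tangentCoordChange h₀' h₁']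
  exact h.vertical _ _ _ (by simpa using h₀') (by simpa using h₁') _ hv

theorem endInChart_mem (hΦ : IsVerticalProjection b₀ Φ) {p₀ : Bundle.TotalSpace G Z'.Fiber}
    {y : B × G} (hy : y ∈ (extChartAt (𝓘(ℝ, B).prod 𝓘(ℝ, G)) p₀).target) (v : B × G) :
    endInChart Φ p₀ y v ∈ LinearMap.ker (baseMap G b₀) := by
  obtain ⟨q, hq, rfl⟩ : ∃ q ∈ (extChartAt (𝓘(ℝ, B).prod 𝓘(ℝ, G)) p₀).source,
      extChartAt (𝓘(ℝ, B).prod 𝓘(ℝ, G)) p₀ q = y :=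
    ⟨_, (extChartAt _ p₀).map_target hy, (extChartAt _ p₀).right_inv hy⟩
  have hqq := mem_extChartAt_source (I := 𝓘(ℝ, B).prod 𝓘(ℝ, G)) q
  rw [endInChart_source hq]
  exact h.tangentCoordChange_mem hqq hq (hΦ.apply_mem q _)

theorem endInChart_of_mem (hΦ : IsVerticalProjection b₀ Φ) {p₀ : Bundle.TotalSpace G Z'.Fiber}
    {y : B × G} (hy : y ∈ (extChartAt (𝓘(ℝ, B).prod 𝓘(ℝ, G)) p₀).target) {v : B × G}
    (hv : v ∈ LinearMap.ker (baseMap G b₀)) : endInChart Φ p₀ y v = v := by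
  obtain ⟨q, hq, rfl⟩ : ∃ q ∈ (extChartAt (𝓘(ℝ, B).prod 𝓘(ℝ, G)) p₀).source,
      extChartAt (𝓘(ℝ, B).prod 𝓘(ℝ, G)) p₀ q = y :=
    ⟨_, (extChartAt _ p₀).map_target hy, (extChartAt _ p₀).right_inv hy⟩
  have hqq := mem_extChartAt_source (I := 𝓘(ℝ, B).prod 𝓘(ℝ, G)) q
  have e := tangentCoordChange_comp_eq hq hqq hq
  rw [tangentCoordChange_self_eq hq] at e
  rw [endInChart_source hq, ContinuousLinearMap.comp_apply, ContinuousLinearMap.comp_apply,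
    hΦ.apply_of_mem q (h.tangentCoordChange_mem hq hqq hv)]
  exact DFunLike.congr_fun e v

theorem tautDual_eq_zero (y : B × G) {u : ExteriorAlgebra ℝ (B × G)}
    (hu : u ∈ vertPow (LinearMap.ker (baseMap G b₀)) 2) :
    tautDual (ρ ∘ₗ (s : G →ₗ[ℝ] F)) y u = 0 := by
  rw [tautDual_apply]
  exact h.two _ _ (map_mem_vertPow (fun w hw => hw) hu)

theorem tautOmega_section_eq_zero {u : ExteriorAlgebra ℝ (B × G)}
    (hu : u ∈ vertPow (LinearMap.ker (baseMap G b₀)) 3) :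
    tautOmega (ρ ∘ₗ (s : G →ₗ[ℝ] F)) u = 0 :=
  tautOmega_eq_zero_of_mem_vertPow (ρ ∘ₗ (s : G →ₗ[ℝ] F)) (K := LinearMap.ker (b₀ : B →ₗ[ℝ] A))
    (j := 2) (fun x => h.two (s x)) hu

/-- The tangent spaces of the two phase bundles are related as described by `IsPhaseLift`. -/
theorem isPhaseLift_section : IsPhaseLift vol (tautOmega (ρ ∘ₗ (s : G →ₗ[ℝ] F))) (tautOmega ρ)
    (baseMap G b₀) (modelMap B P : B × F →ₗ[ℝ] B × G) (modelMap B s : B × G →ₗ[ℝ] B × F) (0, ε) where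
  proj_lift v := Prod.ext rfl (h.proj_section v.2)
  proj_fibre := Prod.ext rfl h.proj_unit
  decomp w := by
    obtain ⟨t, ht⟩ := h.decomp w.2
    refine ⟨t, Prod.ext ?_ ?_⟩
    · change w.1 = w.1 + t • (0 : B)
      rw [smul_zero, add_zero]
    · exact ht
  omega_fibre u := by
    rw [tautOmega_fibre, h.unit, map_map_apply]
    rfl
  omega_lift u := by
    rw [tautOmega_map ρ (modelMap B s) 0 u]
    have : (fun y => (tautDual ρ (modelMap B s y)).comp (mvMap (modelMap B s))) =
        tautDual (ρ ∘ₗ (s : G →ₗ[ℝ] F)) := by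
      funext y
      refine ContinuousLinearMap.ext fun u => ?_
      rw [ContinuousLinearMap.comp_apply, tautDual_apply, tautDual_apply, mvMap_apply,
        map_map_apply]
      rfl
    rw [this, dualD_tautDual, neg_neg]

/-- The expression of `θᵛ` in charts. -/
theorem thetaV_dual (hΦ : IsVerticalProjection b₀ Φ)
    (hθV : ∀ q u, (θV.model q).pairing u = altPairing n (ρ (s q.2)) (ExteriorAlgebra.map
      (LinearMap.fst ℝ B G) (insertionDerivation (endModel Φ q : B × G →ₗ[ℝ] B × G) u)))
    {p₀ : Bundle.TotalSpace G Z'.Fiber} {y : B × G}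
    (hy : y ∈ (extChartAt (𝓘(ℝ, B).prod 𝓘(ℝ, G)) p₀).target) (u : ExteriorAlgebra ℝ (B × G)) :
    θV.dual p₀ y u = tautDual (ρ ∘ₗ (s : G →ₗ[ℝ] F)) y
      (insertionDerivation (endInChart Φ p₀ y : B × G →ₗ[ℝ] B × G) u) := by
  have hD := insertionDerivation_mem_vertPow (h.endInChart_mem hΦ hy) u
  obtain ⟨q, hq, rfl⟩ : ∃ q ∈ (extChartAt (𝓘(ℝ, B).prod 𝓘(ℝ, G)) p₀).source,
      extChartAt (𝓘(ℝ, B).prod 𝓘(ℝ, G)) p₀ q = y :=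
    ⟨_, (extChartAt _ p₀).map_target hy, (extChartAt _ p₀).right_inv hy⟩
  have hq' := (h.hom.core'.mem_source p₀ q).1 hq
  have hqq := mem_extChartAt_source (I := 𝓘(ℝ, B)) q.1
  set w := insertionDerivation
    (endInChart Φ p₀ (extChartAt (𝓘(ℝ, B).prod 𝓘(ℝ, G)) p₀ q) : B × G →ₗ[ℝ] B × G) u with hw
  have hm : q.1 ∈ (achart B q.1).1.source := mem_chart_source B q.1
  have hm' : q.1 ∈ (achart B p₀.1).1.source := by simpa using hq'
  set x := Z.coordChange (achart B q.1) (achart B p₀.1) q.1 (s q.2) with hx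
  set x' := s (extChartAt (𝓘(ℝ, B).prod 𝓘(ℝ, G)) p₀ q).2 with hx'
  -- the changes of coordinates commute with the section up to multiples of the volume form
  have hP : P (x - x') = 0 := by
    have e : P x = (extChartAt (𝓘(ℝ, B).prod 𝓘(ℝ, G)) p₀ q).2 := by
      rw [hx, ← h.hom.coordChange _ _ _ hm hm', extChartAt_core, h.hom.core'.indexAt,
        h.hom.core'.indexAt]
      exact congrArg (Z'.coordChange (achart B q.1) (achart B p₀.1) q.1) (h.proj_section q.2)
    rw [map_sub, hx', h.proj_section, e, sub_self]
  have h1 := h.one _ hP _ (map_mem_vertPow (L := LinearMap.fst ℝ B G) (fun w hw => hw) hD)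
  rw [map_sub, map_sub, LinearMap.sub_apply, sub_eq_zero] at h1
  rw [Form.dual_source _ hq, hθV, tautDual_apply]
  refine Eq.trans ?_ h1
  rw [hx, h.taut.coordChange _ _ _ hm hm', altPairing_comp,
    ← mvMap_insertionDerivation_endInChart hq, ← hw]
  refine congrArg (altPairing n (ρ (s q.2))) ?_
  rw [mvMap_apply, map_map_apply, map_map_apply]
  exact congrArg (fun L => ExteriorAlgebra.map L w)
    (LinearMap.ext fun v => h.hom.core'.fst_tangentCoordChange hq' hqq v)

theorem thetaV_smooth (hΦ : IsVerticalProjection b₀ Φ)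
    (hθV : ∀ q u, (θV.model q).pairing u = altPairing n (ρ (s q.2)) (ExteriorAlgebra.map
      (LinearMap.fst ℝ B G) (insertionDerivation (endModel Φ q : B × G →ₗ[ℝ] B × G) u))) :
    θV.Smooth := by
  rw [Form.smooth_iff]
  intro p₀
  rw [contDiffOn_dual_iff]
  intro u
  refine ContDiffOn.congr ?_ fun y hy => h.thetaV_dual hΦ hθV hy u
  exact (tautDual (ρ ∘ₗ (s : G →ₗ[ℝ] F))).contDiff.contDiffOn.clm_apply
    ((contDiff_insertionDerivation u).comp_contDiffOn (hΦ.smooth p₀))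

theorem insertField_thetaV (hΦ : IsVerticalProjection b₀ Φ)
    (hθV : ∀ q u, (θV.model q).pairing u = altPairing n (ρ (s q.2)) (ExteriorAlgebra.map
      (LinearMap.fst ℝ B G) (insertionDerivation (endModel Φ q : B × G →ₗ[ℝ] B × G) u))) :
    insertField Φ θV = θV := form_ext_model fun q u => by
  obtain ⟨c, hc⟩ := hΦ.exists_isSplitting h.surj q
  rw [insertField_model, hθV, hθV]
  exact apply_insertionDerivation_twice hc
    (φ := altPairing n (ρ (s q.2)) ∘ₗ (ExteriorAlgebra.map (LinearMap.fst ℝ B G)).toLinearMap)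
    (fun u hu => h.two _ _ (map_mem_vertPow (fun w hw => hw) hu)) u

/-- Up to terms with one vertical leg, `dθᵛ` is the differential of the tautological form. -/
theorem extD_thetaV (hΦ : IsVerticalProjection b₀ Φ)
    (hθV : ∀ q u, (θV.model q).pairing u = altPairing n (ρ (s q.2)) (ExteriorAlgebra.map
      (LinearMap.fst ℝ B G) (insertionDerivation (endModel Φ q : B × G →ₗ[ℝ] B × G) u)))
    (q : Bundle.TotalSpace G Z'.Fiber) {u : ExteriorAlgebra ℝ (B × G)}
    (hu : u ∈ vertPow (LinearMap.ker (baseMap G b₀)) 2) :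
    ((extD θV).model q).pairing u = -tautOmega (ρ ∘ₗ (s : G →ₗ[ℝ] F)) u := by
  have ht := mem_extChartAt_target (I := 𝓘(ℝ, B).prod 𝓘(ℝ, G)) q
  have hd := (h.thetaV_smooth hΦ hθV).differentiableAt ht
  have hd' := (tautDual (ρ ∘ₗ (s : G →ₗ[ℝ] F))).differentiableAt
    (x := extChartAt (𝓘(ℝ, B).prod 𝓘(ℝ, G)) q q)
  have h1 := dualD_eq_zero_of_mem_vertPow (a := fun y => θV.dual q y -
      tautDual (ρ ∘ₗ (s : G →ₗ[ℝ] F)) y) (hd.sub hd')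
    (K := LinearMap.ker (baseMap G b₀)) (j := 1) (by
      filter_upwards [(isOpen_extChartAt_target q).mem_nhds ht] with y hy u hu
      have := apply_insertionDerivation_eq_self (h.endInChart_mem hΦ hy)
        (fun v hv => h.endInChart_of_mem hΦ hy hv)
        (a := (tautDual (ρ ∘ₗ (s : G →ₗ[ℝ] F)) y : ExteriorAlgebra ℝ (B × G) →ₗ[ℝ] ℝ))
        (fun u hu => h.tautDual_eq_zero y hu) hu
      rw [sub_apply, h.thetaV_dual hΦ hθV hy, sub_eq_zero]
      exact this) hu
  rw [← Form.dual_self, Form.dual_extD (h.thetaV_smooth hΦ hθV) ht, ← dualD_tautDual _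
    (extChartAt (𝓘(ℝ, B).prod 𝓘(ℝ, G)) q q), ← sub_eq_zero]
  refine Eq.trans ?_ h1
  simp only [dualD, fderiv_fun_sub hd hd', sub_apply, Finset.sum_sub_distrib]

/-- `ωᵛ` is the part with two vertical legs of `-d` of the tautological form: the operator `(i_Φ²
- i_Φ) / 2` is multiplication by `a(a - 1) / 2` on multivectors with `a` vertical factors. -/
theorem omegaV_model (hΦ : IsVerticalProjection b₀ Φ)
    (hθV : ∀ q u, (θV.model q).pairing u = altPairing n (ρ (s q.2)) (ExteriorAlgebra.map
      (LinearMap.fst ℝ B G) (insertionDerivation (endModel Φ q : B × G →ₗ[ℝ] B × G) u)))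
    (q : Bundle.TotalSpace G Z'.Fiber) (u : ExteriorAlgebra ℝ (B × G)) :
    ((-vertD Φ θV).model q).pairing u = 1 / 2 * tautOmega (ρ ∘ₗ (s : G →ₗ[ℝ] F))
      (insertionDerivation (endModel Φ q : B × G →ₗ[ℝ] B × G)
        (insertionDerivation (endModel Φ q : B × G →ₗ[ℝ] B × G) u) -
          insertionDerivation (endModel Φ q : B × G →ₗ[ℝ] B × G) u) := by
  obtain ⟨c, hc⟩ := hΦ.exists_isSplitting h.surj q
  have e : ∀ α β : Form (𝓘(ℝ, B).prod 𝓘(ℝ, G)) (Bundle.TotalSpace G Z'.Fiber),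
      (-((1 / 2 : ℝ) • (α - β))).model q = -((1 / 2 : ℝ) • (α.model q - β.model q)) :=
    fun _ _ => rfl
  rw [vertD_of_insertField_eq_self (h.insertField_thetaV hΦ hθV), e, Covector.pairing_neg,
    Covector.pairing_smul, Covector.pairing_sub, LinearMap.neg_apply, LinearMap.smul_apply,
    LinearMap.sub_apply, insertField_model, insertField_model, insertField_model, ← map_sub,
    h.extD_thetaV hΦ hθV q (insertionDerivation_twice_sub_mem hc u), smul_eq_mul]
  ring

/-- Horizontal forms vanish on multivectors with a vertical factor, in all charts. -/
theorem dual_eq_zero (hf : ∀ q, ∀ u ∈ vertPow (LinearMap.ker (baseMap G b₀)) 1,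
      (f.model q).pairing u = 0) {p₀ : Bundle.TotalSpace G Z'.Fiber} {y : B × G}
    (hy : y ∈ (extChartAt (𝓘(ℝ, B).prod 𝓘(ℝ, G)) p₀).target) {u : ExteriorAlgebra ℝ (B × G)}
    (hu : u ∈ vertPow (LinearMap.ker (baseMap G b₀)) 1) : f.dual p₀ y u = 0 := by
  obtain ⟨q, hq, rfl⟩ : ∃ q ∈ (extChartAt (𝓘(ℝ, B).prod 𝓘(ℝ, G)) p₀).source,
      extChartAt (𝓘(ℝ, B).prod 𝓘(ℝ, G)) p₀ q = y :=
    ⟨_, (extChartAt _ p₀).map_target hy, (extChartAt _ p₀).right_inv hy⟩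
  have hqq := mem_extChartAt_source (I := 𝓘(ℝ, B).prod 𝓘(ℝ, G)) q
  rw [Form.dual_source _ hq]
  exact hf q _ (map_mem_vertPow (fun w hw => h.tangentCoordChange_mem hq hqq hw) hu)

/-- The exterior derivative of a horizontal form has at most one vertical leg. -/
theorem extD_eq_zero (hfs : f.Smooth) (hf : ∀ q, ∀ u ∈ vertPow (LinearMap.ker (baseMap G b₀)) 1,
      (f.model q).pairing u = 0) (q : Bundle.TotalSpace G Z'.Fiber) {u : ExteriorAlgebra ℝ (B × G)}
    (hu : u ∈ vertPow (LinearMap.ker (baseMap G b₀)) 2) : ((extD f).model q).pairing u = 0 := by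
  have ht := mem_extChartAt_target (I := 𝓘(ℝ, B).prod 𝓘(ℝ, G)) q
  rw [← Form.dual_self, Form.dual_extD hfs ht]
  refine dualD_eq_zero_of_mem_vertPow (hfs.differentiableAt ht) ?_ hu
  filter_upwards [(isOpen_extChartAt_target q).mem_nhds ht] with y hy u hu
  exact h.dual_eq_zero hf hy hu

/-- On horizontal forms `dᵛ` is the part of `d` with one vertical leg. -/
theorem vertD_horizontal (hΦ : IsVerticalProjection b₀ Φ) (hfs : f.Smooth)
    (hf : ∀ q, ∀ u ∈ vertPow (LinearMap.ker (baseMap G b₀)) 1, (f.model q).pairing u = 0) :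
    vertD Φ f = insertField Φ (extD f) := by
  refine vertD_of_insertField_eq_zero (form_ext_model fun q u => ?_) (form_ext_model fun q u => ?_)
  · rw [insertField_model, hf q _ (insertionDerivation_mem_vertPow (hΦ.apply_mem q) u)]
    exact (LinearMap.congr_fun Covector.pairing_zero u).symm
  · obtain ⟨c, hc⟩ := hΦ.exists_isSplitting h.surj q
    rw [insertField_model, insertField_model, insertField_model]
    exact apply_insertionDerivation_twice hc (fun u hu => h.extD_eq_zero hfs hf q hu) u

end IsPhaseBundle

end PhaseBundle

end Multisymplectic

end

noncomputable section

namespace Multisymplectic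

/-! ### Comparison of the brackets -/

theorem contDiff_insertionDerivation_clm {E : Type*} [NormedAddCommGroup E] [NormedSpace ℝ E]
    [FiniteDimensional ℝ E] : ContDiff ℝ ∞ fun Φ : E →L[ℝ] E =>
      LinearMap.toContinuousLinearMap (insertionDerivation (Φ : E →ₗ[ℝ] E)) :=
  contDiff_clm_apply_iff.2 fun u => contDiff_insertionDerivation u

section Compare

variable {A B F G : Type*} [NormedAddCommGroup A] [NormedSpace ℝ A] [FiniteDimensional ℝ A]
  [NormedAddCommGroup B] [NormedSpace ℝ B] [FiniteDimensional ℝ B]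
  [NormedAddCommGroup F] [NormedSpace ℝ F] [FiniteDimensional ℝ F]
  [NormedAddCommGroup G] [NormedSpace ℝ G] [FiniteDimensional ℝ G]
  {Y : Type*} [TopologicalSpace Y] [ChartedSpace B Y] [IsManifold 𝓘(ℝ, B) ∞ Y] {n : ℕ}
  {Z : VectorBundleCore ℝ Y F (atlas B Y)} {Z' : VectorBundleCore ℝ Y G (atlas B Y)}
  [Z.IsContMDiff 𝓘(ℝ, B) ∞] [Z'.IsContMDiff 𝓘(ℝ, B) ∞]
  {ρ : F →ₗ[ℝ] B [⋀^Fin n]→L[ℝ] ℝ}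
  {θ : Form (𝓘(ℝ, B).prod 𝓘(ℝ, F)) (Bundle.TotalSpace F Z.Fiber)}
  {P : F →L[ℝ] G} {s : G →L[ℝ] F} {b₀ : B →L[ℝ] A} {vol : ExteriorAlgebra ℝ A →ₗ[ℝ] ℝ} {ε : F}

/-- `θV` is the vertical tautological form of the quotient of a phase bundle, with respect to the
connection `Φ`. -/
structure IsVerticalForm (ρ : F →ₗ[ℝ] B [⋀^Fin n]→L[ℝ] ℝ) (s : G →L[ℝ] F) (b₀ : B →L[ℝ] A)
    (Φ : ∀ p : Bundle.TotalSpace G Z'.Fiber, TangentSpace (𝓘(ℝ, B).prod 𝓘(ℝ, G)) p →L[ℝ]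
      TangentSpace (𝓘(ℝ, B).prod 𝓘(ℝ, G)) p)
    (θV : Form (𝓘(ℝ, B).prod 𝓘(ℝ, G)) (Bundle.TotalSpace G Z'.Fiber)) : Prop where
  projection : IsVerticalProjection b₀ Φ
  model_eq : ∀ q u, (θV.model q).pairing u = altPairing n (ρ (s q.2)) (ExteriorAlgebra.map
      (LinearMap.fst ℝ B G) (insertionDerivation (endModel Φ q : B × G →ₗ[ℝ] B × G) u))

/-- Horizontal forms `f` of degree `n - r` with an `r`-vector field `X` such that `i(X)ωᵛ = dᵛf`. -/
structure IsVerticalHamiltonian (n : ℕ) (b₀ : B →L[ℝ] A)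
    (Φ : ∀ p : Bundle.TotalSpace G Z'.Fiber, TangentSpace (𝓘(ℝ, B).prod 𝓘(ℝ, G)) p →L[ℝ]
      TangentSpace (𝓘(ℝ, B).prod 𝓘(ℝ, G)) p)
    (θV : Form (𝓘(ℝ, B).prod 𝓘(ℝ, G)) (Bundle.TotalSpace G Z'.Fiber)) (r : ℕ)
    (X : MVField (𝓘(ℝ, B).prod 𝓘(ℝ, G)) (Bundle.TotalSpace G Z'.Fiber))
    (f : Form (𝓘(ℝ, B).prod 𝓘(ℝ, G)) (Bundle.TotalSpace G Z'.Fiber)) : Prop where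
  smooth_field : X.Smooth
  degree_field : X.HasDegree r
  smooth_form : f.Smooth
  degree_form : f.HasDegree ((n : ℤ) - r)
  horizontal : ∀ q, ∀ u ∈ vertPow (LinearMap.ker (baseMap G b₀)) 1, (f.model q).pairing u = 0
  eq : contract X (-vertD Φ θV) = vertD Φ f

variable {Φ : ∀ p : Bundle.TotalSpace G Z'.Fiber, TangentSpace (𝓘(ℝ, B).prod 𝓘(ℝ, G)) p →L[ℝ]
      TangentSpace (𝓘(ℝ, B).prod 𝓘(ℝ, G)) p}
  {θV f g : Form (𝓘(ℝ, B).prod 𝓘(ℝ, G)) (Bundle.TotalSpace G Z'.Fiber)}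
  {Xf Xg : MVField (𝓘(ℝ, B).prod 𝓘(ℝ, G)) (Bundle.TotalSpace G Z'.Fiber)} {r t : ℕ}

theorem IsVerticalHamiltonian.isHomogeneous (hX : IsVerticalHamiltonian n b₀ Φ θV r Xf f) {j : ℕ}
    (hj : r + j = n) (q : Bundle.TotalSpace G Z'.Fiber) :
    IsHomogeneous (f.model q).pairing j := fun _ _ hi hu =>
  Covector.pairing_eq_zero (α := f.model q) (hX.degree_form q) (by omega) hu

theorem IsVerticalHamiltonian.isHomogeneous_extD (hX : IsVerticalHamiltonian n b₀ Φ θV r Xf f)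
    {j : ℕ} (hj : r + j = n) (q : Bundle.TotalSpace G Z'.Fiber) :
    IsHomogeneous ((extD f).model q).pairing (j + 1) := fun _ _ hi hu =>
  Covector.pairing_eq_zero (α := (extD f).model q) (hX.degree_form.extD q) (by omega) hu

namespace IsPhaseBundle

variable (h : IsPhaseBundle Z Z' ρ θ P s b₀ vol ε) (hΦ : IsVerticalForm ρ s b₀ Φ θV)
include h hΦ

/-- `ωᵛ` has exactly two vertical legs. -/
theorem omegaV_insertionDerivation (q : Bundle.TotalSpace G Z'.Fiber)
    (u : ExteriorAlgebra ℝ (B × G)) : ((-vertD Φ θV).model q).pairing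
      (insertionDerivation (endModel Φ q : B × G →ₗ[ℝ] B × G) u) =
        2 * ((-vertD Φ θV).model q).pairing u := by
  obtain ⟨c, hc⟩ := hΦ.projection.exists_isSplitting h.surj q
  exact apply_insertionDerivation_eq_two_mul hc (fun u hu => h.tautOmega_section_eq_zero hu)
    (fun u => h.omegaV_model hΦ.projection hΦ.model_eq q u) u

/-- Tangent vectors of the ordinary phase space can be lifted to the extended one in such a way
that `ω` is pulled back to `ωᵛ`. -/
theorem exists_isPhaseLift (q : Bundle.TotalSpace G Z'.Fiber) :
    ∃ S, IsPhaseLift vol ((-vertD Φ θV).model q).pairing (tautOmega ρ) (baseMap G b₀)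
      (modelMap B P : B × F →ₗ[ℝ] B × G) S (0, ε) := by
  obtain ⟨c, hc⟩ := hΦ.projection.exists_isSplitting h.surj q
  obtain ⟨η, hη, hvη⟩ := h.vol_ne
  exact Multisymplectic.exists_isPhaseLift h.isPhaseLift_section hc h.finrank_eq h.vol_degree hη hvη
    (fun u hu => h.tautOmega_section_eq_zero hu) (isHomogeneous_tautOmega _)
    (fun u => h.omegaV_model hΦ.projection hΦ.model_eq q u)

/-- The equation `i(X)ωᵛ = dᵛf`, evaluated on multivectors. -/
theorem pairing_model (hX : IsVerticalHamiltonian n b₀ Φ θV r Xf f)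
    (q : Bundle.TotalSpace G Z'.Fiber) (u : ExteriorAlgebra ℝ (B × G)) :
    ((-vertD Φ θV).model q).pairing (Xf.model q * u) = ((extD f).model q).pairing
      (insertionDerivation (endModel Φ q : B × G →ₗ[ℝ] B × G) u) := by
  have e := hX.eq.trans (h.vertD_horizontal hΦ.projection hX.smooth_form hX.horizontal)
  have e2 : ((contract Xf (-vertD Φ θV)).model q).pairing u =
      ((insertField Φ (extD f)).model q).pairing u := by rw [e]
  rw [insertField_model] at e2
  exact (Covector.pairing_contract _ _ _).symm.trans e2

/-- The pull-back of `f` has Hamiltonian multivectors with a vertical factor. -/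
theorem exists_vertical_field (hX : IsVerticalHamiltonian n b₀ Φ θV r Xf f) (hr : 1 ≤ r)
    (hrn : r ≤ n) : ∃ X₀ : MVField (𝓘(ℝ, B).prod 𝓘(ℝ, F)) (Bundle.TotalSpace F Z.Fiber),
      X₀.HasDegree r ∧ contract X₀ (omega θ) = extD (f.bundlePullback P) ∧ ∀ q,
        X₀.model q ∈ vertPow (LinearMap.ker (baseMap F b₀)) 1 ∧
        mvMap (modelMap B P) (X₀.model q) = insertionDerivation
          (endModel Φ (bundleMap Z Z' P q) : B × G →ₗ[ℝ] B × G)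
          (Xf.model (bundleMap Z Z' P q)) := by
  have hpt : ∀ q, ∃ X ∈ ⋀[ℝ]^r (B × F), X ∈ vertPow (LinearMap.ker (baseMap F b₀)) 1 ∧
      mvMap (modelMap B P) X = insertionDerivation
          (endModel Φ (bundleMap Z Z' P q) : B × G →ₗ[ℝ] B × G)
          (Xf.model (bundleMap Z Z' P q)) ∧
      ∀ u, tautOmega ρ (X * u) = ((extD (f.bundlePullback (Z := Z) P)).model q).pairing u := by
    intro q
    obtain ⟨c, hc⟩ := hΦ.projection.exists_isSplitting h.surj (bundleMap Z Z' P q)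
    obtain ⟨S, hS⟩ := h.exists_isPhaseLift hΦ (bundleMap Z Z' P q)
    obtain ⟨η, hη, hvη⟩ := h.vol_ne
    obtain ⟨l, rfl⟩ := Nat.exists_eq_add_of_le' hr
    obtain ⟨j, hj⟩ := Nat.exists_eq_add_of_le hrn
    obtain ⟨X₀, hX₀, hv, hq, hu⟩ := hS.exists_hamiltonian hc h.finrank_eq h.vol_degree hη hvη
      (h.omegaV_insertionDerivation hΦ _)
      (fun u hu => h.extD_eq_zero hX.smooth_form hX.horizontal _ hu)
      (hX.isHomogeneous_extD hj.symm _) (by omega) (hX.degree_field _) (h.pairing_model hΦ hX _)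
    refine ⟨X₀, hX₀, hv, hq, fun u => ?_⟩
    rw [extD_bundlePullback h.hom hX.smooth_form, h.hom.pullback_model]
    exact hu u
  choose X₀ hX₀ hv hq hu using hpt
  refine ⟨X₀, hX₀, form_ext_model fun q u => ?_, fun q => ⟨hv q, hq q⟩⟩
  refine (Covector.pairing_contract _ _ _).trans ?_
  exact (h.taut.omega_model q _).trans (hu q u)

/-- Fields that annihilate `ω` annihilate the pull-backs of horizontal forms. -/
theorem contract_pullback_eq_zero (hX : IsVerticalHamiltonian n b₀ Φ θV r Xf f)
    (hrn : r ≤ n) {k : ℕ} {W : MVField (𝓘(ℝ, B).prod 𝓘(ℝ, F)) (Bundle.TotalSpace F Z.Fiber)}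
    (hW : W.HasDegree k) (hW0 : contract W (omega θ) = 0) :
    contract W (f.bundlePullback P) = 0 := by
  obtain ⟨j, hj⟩ := Nat.exists_eq_add_of_le hrn
  refine form_ext_model fun q u => ?_
  obtain ⟨c, hc⟩ := hΦ.projection.exists_isSplitting h.surj (bundleMap Z Z' P q)
  obtain ⟨S, hS⟩ := h.exists_isPhaseLift hΦ (bundleMap Z Z' P q)
  obtain ⟨η, hη, hvη⟩ := h.vol_ne
  have h0 : ∀ u, tautOmega ρ (W.model q * u) = 0 := fun u => by
    rw [← h.taut.omega_model q]
    exact (Covector.contract_eq_zero_iff _ _).1 (congrFun hW0 q) u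
  have e := hS.apply_mul_eq_zero hc h.finrank_eq h.vol_degree hη hvη (hX.horizontal (bundleMap Z Z' P q))
    (hX.isHomogeneous hj.symm (bundleMap Z Z' P q)) hj.symm (hW q) h0 u
  refine (Covector.pairing_contract _ _ _).trans
    ((h.hom.pullback_model f q (W.model q * u)).trans (e.trans ?_))
  exact (LinearMap.congr_fun Covector.pairing_zero u).symm

/-- Smooth Hamiltonian fields of the pull-back exist because pointwise ones do and `ω` has
constant coefficients in charts. -/
theorem isPoisson_pullback [T2Space Y] [SigmaCompactSpace Y]
    (hX : IsVerticalHamiltonian n b₀ Φ θV r Xf f) (hr : 1 ≤ r) (hrn : r ≤ n) :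
    IsPoisson n θ r (f.bundlePullback (Z := Z) P) where
  hamiltonian := by
    obtain ⟨X₀, hX₀, hω, -⟩ := h.exists_vertical_field hΦ hX hr hrn
    refine h.taut.exists_isHamiltonian (Form.Smooth.bundlePullback h.hom hX.smooth_form)
      hX.degree_form.bundlePullback fun q => ⟨X₀ q, hX₀ q, fun u => ?_⟩
    rw [← hω, ← h.taut.omega_model q]
    exact (Covector.pairing_contract _ _ _).symm
  kernel _ _ _ hWk hW := h.contract_pullback_eq_zero hΦ hX hrn hWk hW

end IsPhaseBundle

end Compare

end Multisymplectic

end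

noncomputable section

namespace Multisymplectic

theorem pairing_contract_model {E : Type*} [NormedAddCommGroup E] [NormedSpace ℝ E]
    [FiniteDimensional ℝ E] {H : Type*} [TopologicalSpace H] {I : ModelWithCorners ℝ E H}
    {N : Type*} [TopologicalSpace N] [ChartedSpace H N] (X : MVField I N) (α : Form I N) (q : N)
    (u : ExteriorAlgebra ℝ E) :
    ((contract X α).model q).pairing u = (α.model q).pairing (X.model q * u) :=
  Covector.pairing_contract _ _ _

theorem pairing_zero_model {E : Type*} [NormedAddCommGroup E] [NormedSpace ℝ E]
    {H : Type*} [TopologicalSpace H] {I : ModelWithCorners ℝ E H}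
    {N : Type*} [TopologicalSpace N] [ChartedSpace H N] (q : N) (u : ExteriorAlgebra ℝ E) :
    ((0 : Form I N).model q).pairing u = 0 :=
  LinearMap.congr_fun Covector.pairing_zero u

section Compare

variable {A B F G : Type*} [NormedAddCommGroup A] [NormedSpace ℝ A] [FiniteDimensional ℝ A]
  [NormedAddCommGroup B] [NormedSpace ℝ B] [FiniteDimensional ℝ B]
  [NormedAddCommGroup F] [NormedSpace ℝ F] [FiniteDimensional ℝ F]
  [NormedAddCommGroup G] [NormedSpace ℝ G] [FiniteDimensional ℝ G]
  {Y : Type*} [TopologicalSpace Y] [ChartedSpace B Y] [IsManifold 𝓘(ℝ, B) ∞ Y] {n : ℕ}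
  {Z : VectorBundleCore ℝ Y F (atlas B Y)} {Z' : VectorBundleCore ℝ Y G (atlas B Y)}
  [Z.IsContMDiff 𝓘(ℝ, B) ∞] [Z'.IsContMDiff 𝓘(ℝ, B) ∞]
  {ρ : F →ₗ[ℝ] B [⋀^Fin n]→L[ℝ] ℝ}
  {θ : Form (𝓘(ℝ, B).prod 𝓘(ℝ, F)) (Bundle.TotalSpace F Z.Fiber)}
  {P : F →L[ℝ] G} {s : G →L[ℝ] F} {b₀ : B →L[ℝ] A} {vol : ExteriorAlgebra ℝ A →ₗ[ℝ] ℝ} {ε : F}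

variable {Φ : ∀ p : Bundle.TotalSpace G Z'.Fiber, TangentSpace (𝓘(ℝ, B).prod 𝓘(ℝ, G)) p →L[ℝ]
      TangentSpace (𝓘(ℝ, B).prod 𝓘(ℝ, G)) p}
  {θV f g : Form (𝓘(ℝ, B).prod 𝓘(ℝ, G)) (Bundle.TotalSpace G Z'.Fiber)}
  {Xf Xg : MVField (𝓘(ℝ, B).prod 𝓘(ℝ, G)) (Bundle.TotalSpace G Z'.Fiber)} {r t : ℕ}

namespace IsPhaseBundle

variable (h : IsPhaseBundle Z Z' ρ θ P s b₀ vol ε) (hΦ : IsVerticalForm ρ s b₀ Φ θV)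
include h

theorem theta_eq_zero (q : Bundle.TotalSpace F Z.Fiber) {u : ExteriorAlgebra ℝ (B × F)}
    (hu : u ∈ vertPow (LinearMap.ker (baseMap F b₀)) 2) : (θ.model q).pairing u = 0 := by
  rw [h.taut.model_eq]
  refine (altPairing_comp (ρ q.2) (ContinuousLinearMap.fst ℝ B F) u).trans ?_
  exact h.two _ _ (map_mem_vertPow (fun w hw => hw) hu)

theorem pullback_eq_zero
    (hf : ∀ q, ∀ u ∈ vertPow (LinearMap.ker (baseMap G b₀)) 1, (f.model q).pairing u = 0)
    (q : Bundle.TotalSpace F Z.Fiber) {u : ExteriorAlgebra ℝ (B × F)}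
    (hu : u ∈ vertPow (LinearMap.ker (baseMap F b₀)) 1) :
    ((f.bundlePullback (Z := Z) P).model q).pairing u = 0 := by
  rw [h.hom.pullback_model]
  exact hf _ _ (map_mem_vertPow (fun w hw => hw) hu)

include hΦ

/-- Hamiltonian multivector fields of the pull-back of a horizontal form annihilate the pull-backs of
horizontal forms. -/
theorem contract_pullback_of_isHamiltonian (hX : IsVerticalHamiltonian n b₀ Φ θV r Xf f)
    (hr : 1 ≤ r) (hrn : r ≤ n) (hY : IsVerticalHamiltonian n b₀ Φ θV t Xg g) (htn : t ≤ n)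
    {X : MVField (𝓘(ℝ, B).prod 𝓘(ℝ, F)) (Bundle.TotalSpace F Z.Fiber)}
    (hXH : IsHamiltonian n θ r X (f.bundlePullback P)) :
    contract X (g.bundlePullback P) = 0 := by
  obtain ⟨X₀, hX₀, hω, hX₀q⟩ := h.exists_vertical_field hΦ hX hr hrn
  have e := h.contract_pullback_eq_zero hΦ hY htn (hXH.degree_field.sub hX₀)
    (by rw [contract_sub_left, hXH.eq, hω, sub_self])
  rw [contract_sub_left, sub_eq_zero] at e
  refine e.trans (form_ext_model fun q u => ?_)
  rw [pairing_contract_model, pairing_zero_model]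
  exact h.pullback_eq_zero hY.horizontal q
    (mul_mem_vertPow_one (hX₀q q).1 (j := 0) (Submodule.mem_top))

/-- On pull-backs of horizontal forms, only one term of the bracket is different from zero. -/
theorem bracket_eq_contract (hX : IsVerticalHamiltonian n b₀ Φ θV r Xf f) (hr : 1 ≤ r)
    (hrn : r ≤ n) (hY : IsVerticalHamiltonian n b₀ Φ θV t Xg g) (ht : 1 ≤ t) (htn : t ≤ n)
    {σ : ∀ p : Bundle.TotalSpace F Z.Fiber, TangentSpace (𝓘(ℝ, B).prod 𝓘(ℝ, F)) p}
    (hσ : IsExactMultisymplectic n θ σ)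
    {X X' : MVField (𝓘(ℝ, B).prod 𝓘(ℝ, F)) (Bundle.TotalSpace F Z.Fiber)}
    (hXH : IsHamiltonian n θ r X (f.bundlePullback P))
    (hX'H : IsHamiltonian n θ t X' (g.bundlePullback P)) :
    bracket θ r t X (f.bundlePullback P) X' (g.bundlePullback P) =
      (-1 : ℝ) ^ r • contract X (extD (g.bundlePullback P)) := by
  have e1 := h.contract_pullback_of_isHamiltonian hΦ hX hr hrn hY htn hXH
  have e2 := h.contract_pullback_of_isHamiltonian hΦ hY ht htn hX hrn hX'H
  -- Both fields may be replaced by fields with a vertical factor, and `θ` has at most one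
  -- vertical leg.
  have e3 : contract X' (contract X θ) = 0 := by
    obtain ⟨X₀, hX₀, hω, hX₀q⟩ := h.exists_vertical_field hΦ hX hr hrn
    obtain ⟨Y₀, hY₀, hω', hY₀q⟩ := h.exists_vertical_field hΦ hY ht htn
    rw [hσ.contract_congr hXH.degree_field hX₀ (hXH.eq.trans hω.symm),
      contract_comm hX'H.degree_field hX₀,
      hσ.contract_congr hX'H.degree_field hY₀ (hX'H.eq.trans hω'.symm)]
    have : contract X₀ (contract Y₀ θ) = 0 := form_ext_model fun q u => by
      rw [pairing_contract_model, pairing_contract_model, pairing_zero_model]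
      exact h.theta_eq_zero q (mul_mem_vertPow_one (hY₀q q).1
        (mul_mem_vertPow_one (hX₀q q).1 (j := 0) Submodule.mem_top))
    rw [this, smul_zero]
  have e4 := hXH.contract_extD
  obtain ⟨a, rfl⟩ := Nat.exists_eq_add_of_le' hr
  obtain ⟨b, rfl⟩ := Nat.exists_eq_add_of_le' ht
  simp only [bracket, lieDeriv, contract_wedge, e1, e2, e3, e4, extD_zero, contract_neg,
    Nat.add_sub_cancel, zero_sub, smul_neg, neg_neg, smul_smul]
  have e5 : (-1 : ℝ) ^ (a * b) * (-1) ^ (b + 1) = -((-1) ^ (a * (b + 1)) * (-1) ^ (a + 1 + (b + 1))) := by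
    have ha : (-1 : ℝ) ^ a * (-1) ^ a = 1 := by rw [← pow_add, Even.neg_one_pow ⟨a, rfl⟩]
    simp only [pow_add, mul_add, mul_one, pow_one]
    linear_combination (-1 : ℝ) ^ (a * b) * (-1) ^ b * ha
  rw [e5]
  module

/-- The bracket of the pull-backs is the pull-back of the contraction of `ωᵛ`. -/
theorem pullback_contract_eq_bracket (hX : IsVerticalHamiltonian n b₀ Φ θV r Xf f) (hr : 1 ≤ r)
    (hrn : r ≤ n) (hY : IsVerticalHamiltonian n b₀ Φ θV t Xg g) (ht : 1 ≤ t) (htn : t ≤ n)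
    {σ : ∀ p : Bundle.TotalSpace F Z.Fiber, TangentSpace (𝓘(ℝ, B).prod 𝓘(ℝ, F)) p}
    (hσ : IsExactMultisymplectic n θ σ)
    {X X' : MVField (𝓘(ℝ, B).prod 𝓘(ℝ, F)) (Bundle.TotalSpace F Z.Fiber)}
    (hXH : IsHamiltonian n θ r X (f.bundlePullback P))
    (hX'H : IsHamiltonian n θ t X' (g.bundlePullback P)) :
    ((-1 : ℝ) ^ r • contract Xf (contract Xg (-vertD Φ θV))).bundlePullback P =
      bracket θ r t X (f.bundlePullback P) X' (g.bundlePullback P) := by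
  rw [h.bracket_eq_contract hΦ hX hr hrn hY ht htn hσ hXH hX'H]
  obtain ⟨X₀, hX₀, hω, hX₀q⟩ := h.exists_vertical_field hΦ hX hr hrn
  have e : contract X (extD (g.bundlePullback (Z := Z) P)) =
      contract X₀ (extD (g.bundlePullback P)) := by
    rw [← hX'H.eq, contract_comm hXH.degree_field hX'H.degree_field, hXH.eq,
      contract_comm hX₀ hX'H.degree_field, hω]
  rw [e]
  refine form_ext_model fun q u => ?_
  obtain ⟨c, hc⟩ := hΦ.projection.exists_isSplitting h.surj (bundleMap Z Z' P q)
  have e1 := apply_insertionDerivation_mul_eq hc (h.omegaV_insertionDerivation hΦ _)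
    (fun u hu => h.extD_eq_zero hX.smooth_form hX.horizontal _ hu)
    (fun u hu => h.extD_eq_zero hY.smooth_form hY.horizontal _ hu)
    (hX.degree_field _) (hY.degree_field _) (h.pairing_model hΦ hX _) (h.pairing_model hΦ hY _)
    (mvMap (modelMap B P) u)
  have e2 : ∀ (c : ℝ) (α : Form (𝓘(ℝ, B).prod 𝓘(ℝ, F)) (Bundle.TotalSpace F Z.Fiber)),
      ((c • α).model q).pairing u = c * (α.model q).pairing u := fun c α =>
    LinearMap.congr_fun (Covector.pairing_smul c (α.model q)) u
  have e3 : ∀ (c : ℝ) (α : Form (𝓘(ℝ, B).prod 𝓘(ℝ, G)) (Bundle.TotalSpace G Z'.Fiber)),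
      (c • α).bundlePullback (Z := Z) P = c • α.bundlePullback P := fun c α => rfl
  rw [e3, e2, e2, h.hom.pullback_model, pairing_contract_model, pairing_contract_model,
    pairing_contract_model, extD_bundlePullback h.hom hY.smooth_form, h.hom.pullback_model,
    mvMap_mul, (hX₀q q).2]
  exact congrArg _ e1.symm

end IsPhaseBundle

end Compare

end Multisymplectic

end

noncomputable section

namespace Multisymplectic

section Compare

variable {A B F G : Type*} [NormedAddCommGroup A] [NormedSpace ℝ A] [FiniteDimensional ℝ A]
  [NormedAddCommGroup B] [NormedSpace ℝ B] [FiniteDimensional ℝ B]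
  [NormedAddCommGroup F] [NormedSpace ℝ F] [FiniteDimensional ℝ F]
  [NormedAddCommGroup G] [NormedSpace ℝ G] [FiniteDimensional ℝ G]
  {Y : Type*} [TopologicalSpace Y] [ChartedSpace B Y] [IsManifold 𝓘(ℝ, B) ∞ Y] {n : ℕ}
  {Z : VectorBundleCore ℝ Y F (atlas B Y)} {Z' : VectorBundleCore ℝ Y G (atlas B Y)}
  [Z.IsContMDiff 𝓘(ℝ, B) ∞] [Z'.IsContMDiff 𝓘(ℝ, B) ∞]
  {ρ : F →ₗ[ℝ] B [⋀^Fin n]→L[ℝ] ℝ}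
  {θ : Form (𝓘(ℝ, B).prod 𝓘(ℝ, F)) (Bundle.TotalSpace F Z.Fiber)}
  {P : F →L[ℝ] G} {s : G →L[ℝ] F} {b₀ : B →L[ℝ] A} {vol : ExteriorAlgebra ℝ A →ₗ[ℝ] ℝ} {ε : F}

variable {Φ : ∀ p : Bundle.TotalSpace G Z'.Fiber, TangentSpace (𝓘(ℝ, B).prod 𝓘(ℝ, G)) p →L[ℝ]
      TangentSpace (𝓘(ℝ, B).prod 𝓘(ℝ, G)) p}
  {θV f g : Form (𝓘(ℝ, B).prod 𝓘(ℝ, G)) (Bundle.TotalSpace G Z'.Fiber)}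
  {Xf Xg : MVField (𝓘(ℝ, B).prod 𝓘(ℝ, G)) (Bundle.TotalSpace G Z'.Fiber)} {r t : ℕ}

namespace IsPhaseBundle

variable (h : IsPhaseBundle Z Z' ρ θ P s b₀ vol ε) (hΦ : IsVerticalForm ρ s b₀ Φ θV)
include h hΦ

theorem omegaV_smooth : (-vertD Φ θV).Smooth := by
  have e : ∀ {α : Form (𝓘(ℝ, B).prod 𝓘(ℝ, G)) (Bundle.TotalSpace G Z'.Fiber)}, α.Smooth →
      (insertField Φ α).Smooth := fun hα => hα.insertField hΦ.projection.smooth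
  have hθ := h.thetaV_smooth hΦ.projection hΦ.model_eq
  rw [vertD_of_insertField_eq_self (h.insertField_thetaV hΦ.projection hΦ.model_eq)]
  exact (((e (e hθ.extD)).sub (e hθ.extD)).smul _).neg

theorem omegaV_degree : (-vertD Φ θV).HasDegree ((n : ℤ) + 1) := fun q j hj => by
  refine Covector.eq_zero_of_pairing (α := (-vertD Φ θV).model q) fun u hu => ?_
  have hu' := insertionDerivation_mem (endModel Φ q : B × G →ₗ[ℝ] B × G) hu
  rw [h.omegaV_model hΦ.projection hΦ.model_eq, isHomogeneous_tautOmega _ j _ (by omega)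
    (sub_mem (insertionDerivation_mem _ hu') hu'), mul_zero]

/-- The twofold contraction of `ωᵛ` with Hamiltonian multivector fields is horizontal. -/
theorem contract_contract_horizontal (hX : IsVerticalHamiltonian n b₀ Φ θV r Xf f)
    (hY : IsVerticalHamiltonian n b₀ Φ θV t Xg g) (a : ℝ) (q : Bundle.TotalSpace G Z'.Fiber)
    {u : ExteriorAlgebra ℝ (B × G)} (hu : u ∈ vertPow (LinearMap.ker (baseMap G b₀)) 1) :
    ((a • contract Xf (contract Xg (-vertD Φ θV))).model q).pairing u = 0 := by
  obtain ⟨c, hc⟩ := hΦ.projection.exists_isSplitting h.surj q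
  have e : ∀ (c : ℝ) (α : Form (𝓘(ℝ, B).prod 𝓘(ℝ, G)) (Bundle.TotalSpace G Z'.Fiber)),
      ((c • α).model q).pairing u = c * (α.model q).pairing u := fun c α =>
    LinearMap.congr_fun (Covector.pairing_smul c (α.model q)) u
  rw [e, pairing_contract_model, pairing_contract_model]
  exact mul_eq_zero_of_right a (apply_mul_mul_eq_zero hc (h.omegaV_insertionDerivation hΦ q)
    (fun u hu => h.extD_eq_zero hX.smooth_form hX.horizontal q hu)
    (fun u hu => h.extD_eq_zero hY.smooth_form hY.horizontal q hu)
    (hX.degree_field q) (hY.degree_field q) (h.pairing_model hΦ hX q) (h.pairing_model hΦ hY q) hu)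

/-- A horizontal form whose pull-back has a Hamiltonian multivector field `W` has one itself: it is
obtained from the push-forwards of the restrictions of `W` to local sections of the projection. -/
theorem exists_isVerticalHamiltonian [T2Space Y] [SigmaCompactSpace Y]
    (hfs : f.Smooth) (hfd : f.HasDegree ((n : ℤ) - r))
    (hf : ∀ q, ∀ u ∈ vertPow (LinearMap.ker (baseMap G b₀)) 1, (f.model q).pairing u = 0)
    {W : MVField (𝓘(ℝ, B).prod 𝓘(ℝ, F)) (Bundle.TotalSpace F Z.Fiber)}
    (hW : IsHamiltonian n θ r W (f.bundlePullback P)) :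
    ∃ X, IsVerticalHamiltonian n b₀ Φ θV r X f := by
  -- the local sections in the charts
  have hlift : ∀ p : Bundle.TotalSpace G Z'.Fiber, ∃ p' : Bundle.TotalSpace F Z.Fiber,
      bundleMap Z Z' P p' = p := fun p => ⟨⟨p.1, s p.2⟩, by
    have := h.proj_section p.2
    exact congrArg (fun x => (⟨p.1, x⟩ : Bundle.TotalSpace G Z'.Fiber)) this⟩
  choose σ hσ using hlift
  have hmaps : ∀ (p : Bundle.TotalSpace G Z'.Fiber) {y : B × G},
      y ∈ (extChartAt (𝓘(ℝ, B).prod 𝓘(ℝ, G)) p).target →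
      modelMap B s y ∈ (extChartAt (𝓘(ℝ, B).prod 𝓘(ℝ, F)) (σ p)).target := fun p y hy => by
    have e : (σ p).1 = p.1 := congrArg Bundle.TotalSpace.proj (hσ p)
    rw [h.hom.core'.target] at hy
    rw [h.hom.core.target, e]
    exact ⟨hy.1, mem_univ _⟩
  have hPs : ∀ y : B × G, modelMap B P (modelMap B s y) = y := fun y =>
    Prod.ext rfl (h.proj_section y.2)
  let X₁ : Bundle.TotalSpace G Z'.Fiber → B × G → ExteriorAlgebra ℝ (B × G) := fun p y =>
    mvMap (modelMap B P) (W.inChart (σ p) (modelMap B s y))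
  have hX₁ : ∀ p, ContDiffOn ℝ ∞ (X₁ p) (extChartAt (𝓘(ℝ, B).prod 𝓘(ℝ, G)) p).target := fun p =>
    (mvMap (modelMap B P)).contDiff.comp_contDiffOn
      ((MVField.smooth_iff.1 hW.smooth_field (σ p)).comp (modelMap B s).contDiff.contDiffOn
        fun y hy => hmaps p hy)
  have hX₁q : ∀ p q, q ∈ (extChartAt (𝓘(ℝ, B).prod 𝓘(ℝ, G)) p).source →
      ∃ q', bundleMap Z Z' P q' = q ∧ mvMap (tangentCoordChange (𝓘(ℝ, B).prod 𝓘(ℝ, G)) p q q)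
        (X₁ p (extChartAt (𝓘(ℝ, B).prod 𝓘(ℝ, G)) p q)) = mvMap (modelMap B P) (W.model q') := by
    intro p q hq
    set y := extChartAt (𝓘(ℝ, B).prod 𝓘(ℝ, G)) p q with hy
    have hyt : modelMap B s y ∈ (extChartAt (𝓘(ℝ, B).prod 𝓘(ℝ, F)) (σ p)).target :=
      hmaps p ((extChartAt (𝓘(ℝ, B).prod 𝓘(ℝ, G)) p).map_source hq)
    set q' := (extChartAt (𝓘(ℝ, B).prod 𝓘(ℝ, F)) (σ p)).symm (modelMap B s y) with hq'
    have e1 : bundleMap Z Z' P q' = q := by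
      rw [hq', h.hom.map_symm hyt, hσ, hPs, hy, (extChartAt _ p).left_inv hq]
    have hq's : q' ∈ (extChartAt (𝓘(ℝ, B).prod 𝓘(ℝ, F)) (σ p)).source :=
      (extChartAt _ (σ p)).map_target hyt
    have hq'q := mem_extChartAt_source (I := 𝓘(ℝ, B).prod 𝓘(ℝ, F)) q'
    refine ⟨q', e1, ?_⟩
    have e2 : modelMap B s y = extChartAt (𝓘(ℝ, B).prod 𝓘(ℝ, F)) (σ p) q' :=
      ((extChartAt _ (σ p)).right_inv hyt).symm
    have e3 := h.hom.tangentCoordChange_comp hq's hq'q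
    rw [hσ, e1] at e3
    change mvMap _ (mvMap (modelMap B P) (W.inChart (σ p) (modelMap B s y))) = _
    rw [e2, MVField.inChart_source _ hq's, mvMap_comp (modelMap B P), mvMap_comp,
      ← ContinuousLinearMap.comp_assoc, ← e3, ← mvMap_comp, ← mvMap_comp,
      mvMap_tangentCoordChange_symm hq's hq'q]
  -- the smooth field, up to the correction by the vertical projection
  obtain ⟨X, hXs, hXq⟩ := h.hom.core'.exists_smooth
    (C := fun q => {X | X ∈ ⋀[ℝ]^r (B × G) ∧ ∀ u, ((-vertD Φ θV).model q).pairing (X * u) =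
      ((extD f).model q).pairing (insertionDerivation (endModel Φ q : B × G →ₗ[ℝ] B × G) u)})
    (fun q x hx y hy a b _ _ hab => ⟨add_mem (Submodule.smul_mem _ _ hx.1)
      (Submodule.smul_mem _ _ hy.1), fun u => by
        rw [add_mul, smul_mul_assoc, smul_mul_assoc, map_add, map_smul, map_smul, hx.2, hy.2,
          ← add_smul, hab, one_smul]⟩)
    (fun p y => (2 : ℝ) • X₁ p y -
      insertionDerivation (endInChart Φ p y : B × G →ₗ[ℝ] B × G) (X₁ p y))
    (fun p => ((contDiffOn_const (c := (2 : ℝ))).smul (hX₁ p)).sub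
      ((contDiff_insertionDerivation_clm.comp_contDiffOn (hΦ.projection.smooth p)).clm_apply
        (hX₁ p))) (fun p q hq => by
      obtain ⟨q', rfl, e⟩ := hX₁q p q hq
      obtain ⟨c, hc⟩ := hΦ.projection.exists_isSplitting h.surj (bundleMap Z Z' P q')
      obtain ⟨S, hS⟩ := h.exists_isPhaseLift hΦ (bundleMap Z Z' P q')
      rw [map_sub, map_smul, mvMap_insertionDerivation_endInChart hq, e]
      have hm : mvMap (modelMap B P) (W.model q') ∈ ⋀[ℝ]^r (B × G) :=
        mvMap_mem _ (hW.degree_field q')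
      refine ⟨sub_mem (Submodule.smul_mem _ _ hm) (insertionDerivation_mem _ hm), fun u => ?_⟩
      refine hS.apply_mul_eq hc (h.omegaV_insertionDerivation hΦ _)
        (χ := ((extD f).model (bundleMap Z Z' P q')).pairing) (fun u => ?_) u
      rw [← h.taut.omega_model q', ← pairing_contract_model, hW.eq,
        extD_bundlePullback h.hom hfs, h.hom.pullback_model]
      rfl)
  refine ⟨X, hXs, fun q => (hXq q).1, hfs, hfd, hf, ?_⟩
  rw [h.vertD_horizontal hΦ.projection hfs hf]
  refine form_ext_model fun q u => ?_
  rw [pairing_contract_model, insertField_model]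
  exact (hXq q).2 u

/-- The contraction of `ωᵛ` with two Hamiltonian multivector fields is a Hamiltonian form. -/
theorem exists_isVerticalHamiltonian_contract [T2Space Y] [SigmaCompactSpace Y]
    (hX : IsVerticalHamiltonian n b₀ Φ θV r Xf f) (hr : 1 ≤ r)
    (hrn : r ≤ n) (hY : IsVerticalHamiltonian n b₀ Φ θV t Xg g) (ht : 1 ≤ t) (htn : t ≤ n)
    {σ : ∀ p : Bundle.TotalSpace F Z.Fiber, TangentSpace (𝓘(ℝ, B).prod 𝓘(ℝ, F)) p}
    (hσ : IsExactMultisymplectic n θ σ) :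
    ∃ W, IsVerticalHamiltonian n b₀ Φ θV (r + t - 1) W
      ((-1 : ℝ) ^ r • contract Xf (contract Xg (-vertD Φ θV))) := by
  obtain ⟨X, hXH⟩ := (h.isPoisson_pullback hΦ hX hr hrn).hamiltonian
  obtain ⟨X', hX'H⟩ := (h.isPoisson_pullback hΦ hY ht htn).hamiltonian
  have hb := hXH.bracket hr ht hσ.smooth hσ.degree hX'H
  rw [← h.pullback_contract_eq_bracket hΦ hX hr hrn hY ht htn hσ hXH hX'H] at hb
  refine h.exists_isVerticalHamiltonian hΦ ?_ ?_
    (fun q u hu => h.contract_contract_horizontal hΦ hX hY _ q hu) hb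
  · exact (Form.Smooth.contract hX.smooth_field (Form.Smooth.contract hY.smooth_field
      (h.omegaV_smooth hΦ))).smul _
  · have := (Form.HasDegree.contract hX.degree_field (Form.HasDegree.contract hY.degree_field
      (h.omegaV_degree hΦ))).smul ((-1 : ℝ) ^ r)
    rwa [show (n : ℤ) + 1 - t - r = (n : ℤ) - ((r + t - 1 : ℕ) : ℤ) by omega] at this

end IsPhaseBundle

end Compare

end Multisymplectic

end

noncomputable section

namespace Multisymplectic

/-! ### The multiphase spaces as phase bundles -/

section Derivation

variable {V : Type*} [AddCommGroup V] [Module ℝ V] [FiniteDimensional ℝ V]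

theorem insertionDerivation_ιMulti (Φ : V →ₗ[ℝ] V) (k : ℕ) (v : Fin k → V) :
    insertionDerivation Φ (ExteriorAlgebra.ιMulti ℝ k v) =
      ∑ i, ExteriorAlgebra.ιMulti ℝ k (Function.update v i (Φ (v i))) := by
  induction k with
  | zero => simp [insertionDerivation_one]
  | succ k ih =>
    rw [ExteriorAlgebra.ιMulti_succ_apply, insertionDerivation_ι_mul, Fin.sum_univ_succ]
    congr 1
    · rw [ExteriorAlgebra.ιMulti_succ_apply]
      congr 2
    · have e := ih (Matrix.vecTail v)
      rw [e, Finset.mul_sum]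
      refine Finset.sum_congr rfl fun i _ => ?_
      rw [ExteriorAlgebra.ιMulti_succ_apply]
      congr 2
      funext j
      simp [Matrix.vecTail, Function.update_apply]

end Derivation

section Fibres

variable {EM EQ : Type*} [NormedAddCommGroup EM] [NormedSpace ℝ EM] [FiniteDimensional ℝ EM]
  [NormedAddCommGroup EQ] [NormedSpace ℝ EQ] [FiniteDimensional ℝ EQ] {m : ℕ}

/-- Once one argument is vertical, the form only sees the base components of the others. -/
theorem extFibre_apply_vecCons (α : extFibre EM EQ (m + 1)) (w : EQ) (v : Fin m → EM × EQ) :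
    α.1 (Matrix.vecCons (0, w) v) = α.1 (Matrix.vecCons (0, w) fun j => ((v j).1, 0)) := by
  have hP : ∀ v : EM × EQ, v - ((LinearMap.inl ℝ EM EQ) ∘ₗ LinearMap.fst ℝ EM EQ) v ∈
      LinearMap.ker (LinearMap.fst ℝ EM EQ) := fun v => by simp
  have hw : ((0, w) : EM × EQ) ∈ LinearMap.ker (LinearMap.fst ℝ EM EQ) := by simp
  have h1 := altPairing_eq_zero_of_mem_vertPow α (ι_mul_mem_vertPow_succ hw
    (sub_map_mem_vertPow_one hP (ExteriorAlgebra.ιMulti ℝ m v)))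
  rw [mul_sub, map_sub, sub_eq_zero, ExteriorAlgebra.map_apply_ιMulti, altPairing_ι_mul,
    altPairing_ι_mul, altPairing_ιMulti, altPairing_ιMulti] at h1
  exact h1

/-- The projection to the mixed part commutes with the changes of coordinates. -/
theorem ordChange_fibreProj {L : EM × EQ →L[ℝ] EM × EQ} (hL : ∀ w : EQ, (L (0, w)).1 = 0)
    (α : extFibre EM EQ (m + 1)) :
    ordChange m L (fibreProj m α) = fibreProj m (extChange (m + 1) L α) := by
  refine ContinuousLinearMap.ext fun w => ContinuousAlternatingMap.ext fun v => ?_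
  rw [ordChange_apply, fibreProj_apply, fibreProj_apply, extChange_apply, triangular_eq hL]
  have e : (fun i => L ((Matrix.vecCons ((0, w) : EM × EQ) fun j => (v j, 0)) i)) =
      Matrix.vecCons ((0, (L (0, w)).2) : EM × EQ) fun j => L (v j, 0) := by
    funext i
    refine Fin.cases (Prod.ext (hL w) rfl) (fun i => rfl) i
  rw [e]
  exact (extFibre_apply_vecCons α _ fun j => L (v j, 0)).symm

/-- The alternation of `β(T Φ v₀)(T v₁, …, T vₘ)` is the form with mixed part `β`, evaluated after
insertion of `Φ`. -/
theorem altPairing_alternatize {W : Type*} [NormedAddCommGroup W] [NormedSpace ℝ W]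
    [FiniteDimensional ℝ W] (β : OrdFibre EM EQ m) (a : W →L[ℝ] EM × EQ) (Ψ : W →L[ℝ] W)
    (hΨ : ∀ v, (a (Ψ v)).1 = 0) (u : ExteriorAlgebra ℝ W) :
    altPairing (m + 1) (ContinuousAlternatingMap.alternatizeUncurryFin
      ((ContinuousAlternatingMap.compContinuousLinearMapCLM
        ((ContinuousLinearMap.fst ℝ EM EQ).comp a)).comp
        (β.comp ((ContinuousLinearMap.snd ℝ EM EQ).comp (a.comp Ψ))))) u =
      altPairing (m + 1) (fibreSectionForm β)
        (ExteriorAlgebra.map (a : W →ₗ[ℝ] EM × EQ) (insertionDerivation (Ψ : W →ₗ[ℝ] W) u)) := by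
  refine LinearMap.congr_fun (g := altPairing (m + 1) (fibreSectionForm β) ∘ₗ
    (ExteriorAlgebra.map (a : W →ₗ[ℝ] EM × EQ)).toLinearMap ∘ₗ
      insertionDerivation (Ψ : W →ₗ[ℝ] W)) (lhom_ext_ιMulti fun k v => ?_) u
  rw [LinearMap.comp_apply, LinearMap.comp_apply, insertionDerivation_ιMulti, map_sum, map_sum]
  simp only [AlgHom.toLinearMap_apply, ExteriorAlgebra.map_apply_ιMulti]
  by_cases hk : k = m + 1
  · subst hk
    rw [altPairing_ιMulti, ContinuousAlternatingMap.alternatizeUncurryFin_apply]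
    refine Finset.sum_congr rfl fun i _ => ?_
    rw [altPairing_ιMulti, fibreSectionForm_apply, Finset.sum_eq_single i]
    · rw [zsmul_eq_mul]
      push_cast
      congr 1
      change _ = β (a (Function.update v i (Ψ (v i)) i)).2
        fun j => (a (i.removeNth (Function.update v i (Ψ (v i))) j)).1
      rw [Function.update_self, Fin.removeNth_update]
      rfl
    · intro j _ hj
      obtain ⟨l, hl⟩ := Fin.exists_succAbove_eq hj.symm
      have e2 : β (((⇑(a : W →ₗ[ℝ] EM × EQ)) ∘ Function.update v i ((Ψ : W →ₗ[ℝ] W) (v i))) j).2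
          (fun k => (j.removeNth ((⇑(a : W →ₗ[ℝ] EM × EQ)) ∘ Function.update v i
            ((Ψ : W →ₗ[ℝ] W) (v i))) k).1) = 0 := by
        refine ContinuousAlternatingMap.map_coord_zero _ l ?_
        simp only [Fin.removeNth, hl, Function.comp_apply, Function.update_self]
        exact hΨ _
      rw [e2, mul_zero]
    · simp
  · rw [altPairing_ιMulti_of_ne hk]
    exact (Finset.sum_eq_zero fun i _ => altPairing_ιMulti_of_ne hk _ _).symm

end Fibres

section Phase

variable {EM EQ : Type*} [NormedAddCommGroup EM] [NormedSpace ℝ EM] [FiniteDimensional ℝ EM]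
  [NormedAddCommGroup EQ] [NormedSpace ℝ EQ] [FiniteDimensional ℝ EQ] {m : ℕ}
  {M : Type*} [TopologicalSpace M] [ChartedSpace EM M]
  {Y : Type*} [TopologicalSpace Y] [ChartedSpace (EM × EQ) Y]
  [IsManifold 𝓘(ℝ, EM × EQ) ∞ Y] {π : Y → M} {hπ : IsFibered (EM := EM) (EQ := EQ) π}

variable (EM EQ m) in
/-- The projection `fibreProj` as a continuous linear map. -/
def fibreProjL : extFibre EM EQ (m + 1) →L[ℝ] OrdFibre EM EQ m :=
  LinearMap.toContinuousLinearMap (fibreProjₗ EM EQ m)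

variable (EM EQ m) in
/-- The section `fibreSection` as a continuous linear map. -/
def fibreSectionL : OrdFibre EM EQ m →L[ℝ] extFibre EM EQ (m + 1) :=
  LinearMap.toContinuousLinearMap (fibreSection EM EQ m)

theorem isCoreHom_fibreProj :
    IsCoreHom (extCore m hπ) (ordCore m hπ) (fibreProjL EM EQ m) where
  core := isChartCore_extCore
  core' := isChartCore_ordCore
  coordChange i j _ hi hj α := ordChange_fibreProj (tangentChange_vertical hπ j i hj hi) α

/-- The extended multiphase space over the ordinary one satisfies the hypotheses of the
comparison. -/
theorem isPhaseBundle_extCore (h : Module.finrank ℝ EM = m + 1) :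
    IsPhaseBundle (extCore m hπ) (ordCore m hπ) (extFibre EM EQ (m + 1)).subtype
      (canonicalForm m hπ) (fibreProjL EM EQ m) (fibreSectionL EM EQ m)
      (ContinuousLinearMap.fst ℝ EM EQ) (altPairing (m + 1) (volForm h)) (fibreUnit EQ h) where
  taut := isTautological_canonicalForm
  hom := isCoreHom_fibreProj
  proj_section := fibreProj_fibreSection
  two x u hu := altPairing_eq_zero_of_mem_vertPow x hu
  one _ hx _ hu := altPairing_eq_zero_of_fibreProj hx hu
  proj_unit := fibreProj_fibreUnit h
  unit u := altPairing_comp (volForm h) (ContinuousLinearMap.fst ℝ EM EQ) u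
  decomp := exists_fibre_decomp h
  surj := ⟨LinearMap.inl ℝ EM EQ, fun _ => rfl⟩
  vertical i j y hi hj v hv := by
    have hv' : v = (0, v.2) := Prod.ext hv rfl
    rw [hv']
    exact tangentChange_vertical hπ i j hi hj v.2
  finrank_eq := h
  vol_degree := isHomogeneous_altPairing _
  vol_ne := ⟨volVector h, volVector_mem h, altPairing_volForm_volVector h⟩

end Phase

end Multisymplectic

end

noncomputable section

namespace Multisymplectic

/-! ### Connections of the ordinary multiphase space -/

section Base

variable {E : Type*} [NormedAddCommGroup E] [NormedSpace ℝ E] {M : Type*} [TopologicalSpace M]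
  [ChartedSpace E M] [IsManifold 𝓘(ℝ, E) ∞ M]

theorem hasFDerivAt_transition {φ ψ : OpenPartialHomeomorph M E}
    (hφ : φ ∈ IsManifold.maximalAtlas 𝓘(ℝ, E) ∞ M) (hψ : ψ ∈ IsManifold.maximalAtlas 𝓘(ℝ, E) ∞ M)
    {x : M} (hx : x ∈ φ.source) (hx' : x ∈ ψ.source) :
    HasFDerivAt (ψ ∘ φ.symm) (fderiv ℝ (ψ ∘ φ.symm) (φ x)) (φ x) := by
  have h := 𝓘(ℝ, E).contDiffWithinAt_extendCoordChange' (n := ∞) hφ hψ hx hx'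
  have h' := h.differentiableWithinAt (by simp)
  refine DifferentiableAt.hasFDerivAt ?_
  simpa [differentiableWithinAt_univ] using h'

/-- Transition maps have injective derivatives, the inverse being given by the opposite
transition. -/
theorem fderiv_transition_injective {φ ψ : OpenPartialHomeomorph M E}
    (hφ : φ ∈ IsManifold.maximalAtlas 𝓘(ℝ, E) ∞ M) (hψ : ψ ∈ IsManifold.maximalAtlas 𝓘(ℝ, E) ∞ M)
    {x : M} (hx : x ∈ φ.source) (hx' : x ∈ ψ.source) :
    Function.Injective (fderiv ℝ (ψ ∘ φ.symm) (φ x)) := by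
  have h1 := hasFDerivAt_transition hφ hψ hx hx'
  have h2 := hasFDerivAt_transition hψ hφ hx' hx
  have e : (ψ ∘ φ.symm) (φ x) = ψ x := by rw [Function.comp_apply, φ.left_inv hx]
  rw [← e] at h2
  have h3 := (h2.comp (φ x) h1).congr_of_eventuallyEq (f₁ := id) (by
    filter_upwards [(φ.symm ≫ₕ ψ).open_source.mem_nhds (x := φ x) (by simp [hx, hx'])] with y hy
    have hy' : y ∈ φ.target ∧ φ.symm y ∈ ψ.source := by simpa using hy
    simp [hy'.1, hy'.2])
  have h4 := h3.unique (hasFDerivAt_id _)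
  exact Function.LeftInverse.injective (g := fderiv ℝ (φ ∘ ψ.symm) ((ψ ∘ φ.symm) (φ x)))
    fun v => DFunLike.congr_fun h4 v

end Base

section Projection

variable {EM EQ G : Type*} [NormedAddCommGroup EM] [NormedSpace ℝ EM]
  [NormedAddCommGroup EQ] [NormedSpace ℝ EQ] [NormedAddCommGroup G] [NormedSpace ℝ G]
  {M : Type*} [TopologicalSpace M] [ChartedSpace EM M] [IsManifold 𝓘(ℝ, EM) ∞ M]
  {Y : Type*} [TopologicalSpace Y] [ChartedSpace (EM × EQ) Y]
  [IsManifold 𝓘(ℝ, EM × EQ) ∞ Y] {π : Y → M}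
  {Z : VectorBundleCore ℝ Y G (atlas (EM × EQ) Y)} [Z.IsContMDiff 𝓘(ℝ, EM × EQ) ∞]

/-- The differential of the projection to the base of a fibred manifold, from the total space of a
bundle over the latter. -/
theorem IsChartCore.exists_hasMFDerivAt_base (h : IsChartCore Z)
    (hπ : IsFibered (EM := EM) (EQ := EQ) π) (p : Bundle.TotalSpace G Z.Fiber) :
    ∃ L : EM →L[ℝ] EM, Function.Injective L ∧
      HasMFDerivAt (𝓘(ℝ, EM × EQ).prod 𝓘(ℝ, G)) 𝓘(ℝ, EM)
        (fun q : Bundle.TotalSpace G Z.Fiber => π q.1) p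
        (L.comp ((ContinuousLinearMap.fst ℝ EM EQ).comp (ContinuousLinearMap.fst ℝ (EM × EQ) G)) :
          (EM × EQ) × G →L[ℝ] EM) := by
  obtain ⟨ψ, hψ, hπψ⟩ := hπ (chartAt (EM × EQ) p.1) (chart_mem_atlas _ _)
  obtain ⟨hp, hpψ⟩ := hπψ p.1 (mem_chart_source _ _)
  have hχ := IsManifold.chart_mem_maximalAtlas (I := 𝓘(ℝ, EM)) (n := ∞) (π p.1)
  have hpχ := mem_chart_source EM (π p.1)
  set x := extChartAt (𝓘(ℝ, EM × EQ).prod 𝓘(ℝ, G)) p p with hx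
  have hx1 : x.1.1 = ψ (π p.1) := by
    rw [hpψ, hx, extChartAt_core]
    rfl
  have ht := mem_extChartAt_target (I := 𝓘(ℝ, EM × EQ).prod 𝓘(ℝ, G)) p
  have hs := mem_extChartAt_source (I := 𝓘(ℝ, EM × EQ).prod 𝓘(ℝ, G)) p
  have hd := hasFDerivAt_transition hψ hχ hp hpχ
  refine ⟨_, fderiv_transition_injective hψ hχ hp hpχ, ?_⟩
  set L := fderiv ℝ (chartAt EM (π p.1) ∘ ψ.symm) (ψ (π p.1)) with hL
  have hG : HasFDerivAt (fun z : (EM × EQ) × G => extChartAt 𝓘(ℝ, EM) (π p.1) (ψ.symm z.1.1))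
      (L.comp ((ContinuousLinearMap.fst ℝ EM EQ).comp (ContinuousLinearMap.fst ℝ (EM × EQ) G))) x :=
    HasFDerivAt.comp (g := chartAt EM (π p.1) ∘ ψ.symm) x (by rw [← hx1] at hd; exact hd)
      ((ContinuousLinearMap.fst ℝ EM EQ).comp
        (ContinuousLinearMap.fst ℝ (EM × EQ) G)).hasFDerivAt
  have hx2 : ψ.symm x.1.1 = π p.1 := by rw [hx1, ψ.left_inv hp]
  have := hasMFDerivAt_of_charts (I := 𝓘(ℝ, EM × EQ).prod 𝓘(ℝ, G)) (I' := 𝓘(ℝ, EM))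
    (F := fun q : Bundle.TotalSpace G Z.Fiber => π q.1) (p := p) (p' := π p.1) hs hG
    (by rw [← hx, hx2]; exact mem_extChartAt_target (I := 𝓘(ℝ, EM)) (π p.1)) (by
      have hc : ContinuousAt (fun z : (EM × EQ) × G => ψ.symm z.1.1) x := by
        refine ContinuousAt.comp (g := ψ.symm) ?_ (by fun_prop)
        rw [hx1]
        exact ψ.symm.continuousAt (ψ.map_source hp)
      have hc' := hc.preimage_mem_nhds ((chartAt EM (π p.1)).open_source.mem_nhds (by
        rw [hx2]; exact hpχ))
      filter_upwards [(isOpen_extChartAt_target p).mem_nhds ht, hc'] with y hy hy'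
      rw [h.target] at hy
      rw [h.symm_apply p hy.1]
      have hys : (chartAt (EM × EQ) p.1).symm y.1 ∈ (chartAt (EM × EQ) p.1).source := by
        simpa using (extChartAt 𝓘(ℝ, EM × EQ) p.1).map_target hy.1
      obtain ⟨h1, h2⟩ := hπψ _ hys
      have h3 : (chartAt (EM × EQ) p.1) ((chartAt (EM × EQ) p.1).symm y.1) = y.1 :=
        (extChartAt 𝓘(ℝ, EM × EQ) p.1).right_inv hy.1
      rw [h3] at h2
      have h4 : π ((chartAt (EM × EQ) p.1).symm y.1) = ψ.symm y.1.1 := by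
        rw [← h2, ψ.left_inv h1]
      exact h4.trans ((extChartAt 𝓘(ℝ, EM) (π p.1)).left_inv (by simpa using hy')).symm)
  rw [tangentCoordChange_self_eq hs] at this
  have h2 : tangentCoordChange 𝓘(ℝ, EM) (π p.1) (π p.1) (π p.1) = ContinuousLinearMap.id ℝ EM :=
    tangentCoordChange_self_eq (mem_extChartAt_source (I := 𝓘(ℝ, EM)) (π p.1))
  have h3 : ∀ (K : EM →L[ℝ] EM) (N : (EM × EQ) × G →L[ℝ] EM), K = ContinuousLinearMap.id ℝ EM →
      K.comp (N.comp (ContinuousLinearMap.id ℝ ((EM × EQ) × G))) = N := by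
    rintro K N rfl
    rfl
  exact h3 _ (L.comp ((ContinuousLinearMap.fst ℝ EM EQ).comp
    (ContinuousLinearMap.fst ℝ (EM × EQ) G))) h2 ▸ this

end Projection

section Phase

variable {EM EQ : Type*} [NormedAddCommGroup EM] [NormedSpace ℝ EM] [FiniteDimensional ℝ EM]
  [NormedAddCommGroup EQ] [NormedSpace ℝ EQ] [FiniteDimensional ℝ EQ] {m : ℕ}
  {M : Type*} [TopologicalSpace M] [ChartedSpace EM M] [IsManifold 𝓘(ℝ, EM) ∞ M]
  {Y : Type*} [TopologicalSpace Y] [ChartedSpace (EM × EQ) Y]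
  [IsManifold 𝓘(ℝ, EM × EQ) ∞ Y] {π : Y → M} {hπ : IsFibered (EM := EM) (EQ := EQ) π}

/-- In the charts of the phase space the vertical vectors are those without base component. -/
theorem toBaseDeriv_eq_zero_iff (p : OrdPhase m hπ) (v : (EM × EQ) × OrdFibre EM EQ m) :
    toBaseDeriv m hπ p v = 0 ↔ v.1.1 = 0 := by
  obtain ⟨L, hL, hd⟩ := isChartCore_ordCore.exists_hasMFDerivAt_base hπ p
  have e : toBaseDeriv m hπ p v = L v.1.1 := DFunLike.congr_fun hd.mfderiv v
  refine ⟨fun h => hL ((e.symm.trans h).trans (map_zero L).symm), fun h => e.trans ?_⟩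
  rw [h]
  exact map_zero L

variable {Φ : ∀ p : OrdPhase m hπ,
    TangentSpace (ordModel EM EQ m) p →L[ℝ] TangentSpace (ordModel EM EQ m) p}

theorem IsConnection.isVerticalProjection (hΦ : IsConnection m hπ Φ) :
    IsVerticalProjection (Z' := ordCore m hπ) (ContinuousLinearMap.fst ℝ EM EQ) Φ where
  idempotent := hΦ.idempotent
  vertical p v := (hΦ.vertical p v).trans (toBaseDeriv_eq_zero_iff p v)
  smooth := hΦ.smooth

theorem IsConnection.isVerticalForm (hΦ : IsConnection m hπ Φ) :
    IsVerticalForm (Z' := ordCore m hπ) (extFibre EM EQ (m + 1)).subtype (fibreSectionL EM EQ m)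
      (ContinuousLinearMap.fst ℝ EM EQ) Φ (thetaV m hπ Φ) where
  projection := hΦ.isVerticalProjection
  model_eq q u := by
    have hq : ∀ v, (ContinuousLinearMap.fst ℝ (EM × EQ) (OrdFibre EM EQ m) (endModel Φ q v)).1 = 0 :=
      fun v => (hΦ.isVerticalProjection.vertical q _).1 ⟨v, rfl⟩
    refine Eq.trans ?_ (altPairing_alternatize (q.2 : OrdFibre EM EQ m)
      (ContinuousLinearMap.fst ℝ (EM × EQ) (OrdFibre EM EQ m)) (endModel Φ q) hq u)
    rw [← ordProjDeriv_eq q]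
    rfl

/-- Vanishing on single vertical vectors is the same as vanishing on all multivectors with a
vertical factor. -/
theorem isKanatchikovHamiltonian_iff {r : ℕ} {X : MVField (ordModel EM EQ m) (OrdPhase m hπ)}
    {f : Form (ordModel EM EQ m) (OrdPhase m hπ)} :
    IsKanatchikovHamiltonian m hπ Φ r X f ↔ IsVerticalHamiltonian (Z' := ordCore m hπ) (m + 1)
      (ContinuousLinearMap.fst ℝ EM EQ) Φ (thetaV m hπ Φ) r X f where
  mp h := ⟨h.smooth_field, h.degree_field, h.smooth_form, h.degree_form,
    fun q _ hu => apply_eq_zero_of_contract (fun w hw =>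
      (Covector.contract_eq_zero_iff _ (f.model q)).1
        (h.horizontal q w ((toBaseDeriv_eq_zero_iff q w).2 hw))) hu, h.eq⟩
  mpr h := ⟨h.smooth_field, h.degree_field, h.smooth_form, h.degree_form,
    fun q w hw => (Covector.contract_eq_zero_iff _ (f.model q)).2 fun _ =>
      h.horizontal q _ (ι_mul_mem_vertPow_succ ((toBaseDeriv_eq_zero_iff q w).1 hw)
        Submodule.mem_top), h.eq⟩

end Phase

end Multisymplectic

end

theorem mainTheorem1
    {E : Type*} [NormedAddCommGroup E] [NormedSpace ℝ E] [FiniteDimensional ℝ E]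
    {H : Type*} [TopologicalSpace H] (I : ModelWithCorners ℝ E H) [I.Boundaryless]
    {Z : Type*} [TopologicalSpace Z] [ChartedSpace H Z] [IsManifold I ∞ Z]
    {EM EQ : Type*} [NormedAddCommGroup EM] [NormedSpace ℝ EM] [FiniteDimensional ℝ EM]
    [NormedAddCommGroup EQ] [NormedSpace ℝ EQ] [FiniteDimensional ℝ EQ]
    {M : Type*} [TopologicalSpace M] [T2Space M] [SigmaCompactSpace M] [ChartedSpace EM M]
    [IsManifold 𝓘(ℝ, EM) ∞ M]
    {Y : Type*} [TopologicalSpace Y] [T2Space Y] [SigmaCompactSpace Y]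
    [ChartedSpace (EM × EQ) Y] [IsManifold 𝓘(ℝ, EM × EQ) ∞ Y] :
    -- on every exact multisymplectic manifold
    (∀ (n : ℕ) (θ : Form I Z) (S : ∀ p : Z, TangentSpace I p),
      IsExactMultisymplectic n θ S →
      -- independence of the choice of the Hamiltonian multivector fields
      (∀ (r s : ℕ) (f g : Form I Z) (Xf Xf' Xg Xg' : MVField I Z), 1 ≤ r → 1 ≤ s →
        IsPoisson n θ r f → IsPoisson n θ s g →
        IsHamiltonian n θ r Xf f → IsHamiltonian n θ r Xf' f →
        IsHamiltonian n θ s Xg g → IsHamiltonian n θ s Xg' g →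
        bracket θ r s Xf f Xg g = bracket θ r s Xf' f Xg' g) ∧
      -- the Hamiltonian multivector field of the bracket, the bracket is a Poisson form,
      -- graded antisymmetry
      (∀ (r s : ℕ) (f g : Form I Z) (Xf Xg : MVField I Z), 1 ≤ r → 1 ≤ s →
        IsPoisson n θ r f → IsPoisson n θ s g →
        IsHamiltonian n θ r Xf f → IsHamiltonian n θ s Xg g →
        IsHamiltonian n θ (r + s - 1) (schouten Xg Xf) (bracket θ r s Xf f Xg g) ∧
        IsPoisson n θ (r + s - 1) (bracket θ r s Xf f Xg g) ∧
        bracket θ r s Xf f Xg g =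
          -((-1 : ℝ) ^ ((r - 1) * (s - 1)) • bracket θ s r Xg g Xf f)) ∧
      -- graded Jacobi identity
      (∀ (r s t : ℕ) (f g h : Form I Z) (Xf Xg Xh Xfg Xgh Xhf : MVField I Z),
        1 ≤ r → 1 ≤ s → 1 ≤ t →
        IsPoisson n θ r f → IsPoisson n θ s g → IsPoisson n θ t h →
        IsHamiltonian n θ r Xf f → IsHamiltonian n θ s Xg g → IsHamiltonian n θ t Xh h →
        IsHamiltonian n θ (r + s - 1) Xfg (bracket θ r s Xf f Xg g) →
        IsHamiltonian n θ (s + t - 1) Xgh (bracket θ s t Xg g Xh h) →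
        IsHamiltonian n θ (t + r - 1) Xhf (bracket θ t r Xh h Xf f) →
        (-1 : ℝ) ^ ((r - 1) * (t - 1)) •
            bracket θ r (s + t - 1) Xf f Xgh (bracket θ s t Xg g Xh h) +
          (-1 : ℝ) ^ ((s - 1) * (r - 1)) •
            bracket θ s (t + r - 1) Xg g Xhf (bracket θ t r Xh h Xf f) +
          (-1 : ℝ) ^ ((t - 1) * (s - 1)) •
            bracket θ t (r + s - 1) Xh h Xfg (bracket θ r s Xf f Xg g) = 0) ∧
      -- exact Hamiltonian multivector fields
      (∀ (r s : ℕ) (X X' : MVField I Z), 1 ≤ r → 1 ≤ s →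
        IsExactHamiltonian θ r X → IsExactHamiltonian θ s X' →
        IsPoisson n θ r (momentum θ r X) ∧ IsHamiltonian n θ r X (momentum θ r X) ∧
        IsPoisson n θ s (momentum θ s X') ∧ IsHamiltonian n θ s X' (momentum θ s X') ∧
        IsExactHamiltonian θ (s + r - 1) (schouten X' X) ∧
        bracket θ r s X (momentum θ r X) X' (momentum θ s X') =
          momentum θ (s + r - 1) (schouten X' X))) ∧
    -- multiphase spaces of a fibred manifold over a manifold of dimension `m + 1`
    (∀ (m : ℕ), Module.finrank ℝ EM = m + 1 →
      ∀ (π : Y → M) (hπ : IsFibered (EM := EM) (EQ := EQ) π),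
      -- the extended multiphase space is an exact multisymplectic manifold
      IsExactMultisymplectic (m + 1) (canonicalForm m hπ) (eulerField m hπ) ∧
      -- comparison with the bracket on the ordinary multiphase space
      (∀ (Φ : ∀ p : OrdPhase m hπ,
          TangentSpace (ordModel EM EQ m) p →L[ℝ] TangentSpace (ordModel EM EQ m) p),
        IsConnection m hπ Φ →
        ∀ (r s : ℕ) (f g : Form (ordModel EM EQ m) (OrdPhase m hπ))
          (Xf Xg : MVField (ordModel EM EQ m) (OrdPhase m hπ)),
          1 ≤ r → r ≤ m + 1 → 1 ≤ s → s ≤ m + 1 →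
          IsKanatchikovHamiltonian m hπ Φ r Xf f → IsKanatchikovHamiltonian m hπ Φ s Xg g →
          (∃ W, IsKanatchikovHamiltonian m hπ Φ (r + s - 1) W
            (kanatchikovBracket m hπ Φ r Xf Xg)) ∧
          IsPoisson (m + 1) (canonicalForm m hπ) r (pullback m hπ f) ∧
          IsPoisson (m + 1) (canonicalForm m hπ) s (pullback m hπ g) ∧
          ∀ (X X' : MVField (extModel EM EQ m) (ExtPhase m hπ)),
            IsHamiltonian (m + 1) (canonicalForm m hπ) r X (pullback m hπ f) →
            IsHamiltonian (m + 1) (canonicalForm m hπ) s X' (pullback m hπ g) →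
            pullback m hπ (kanatchikovBracket m hπ Φ r Xf Xg) =
              bracket (canonicalForm m hπ) r s X (pullback m hπ f) X' (pullback m hπ g))) := by
  constructor
  · intro n θ S hθ
    refine ⟨fun r s f g Xf Xf' Xg Xg' hr hs hf hg hX hX' hY hY' => ?_,
      fun r s f g Xf Xg hr hs hf hg hX hY => ?_,
      fun r s t f g h Xf Xg Xh Xfg Xgh Xhf hr hs ht hf hg hh hX hY hZ hXY hYZ hZX => ?_,
      fun r s X X' hr hs hX hX' => ?_⟩
    · exact (bracket_congr_left hθ hg hX hX' hY).trans
        (bracket_congr_right hr hs hθ hf hX' hY hY')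
    · exact ⟨hX.bracket hr hs hθ.smooth hθ.degree hY, hf.bracket hr hs hθ hg hX hY,
        bracket_antisymm hr hs hθ.smooth hX.smooth_field hX.degree_field hY.smooth_field
          hY.degree_field⟩
    · exact bracket_jacobi hr hs ht hθ hf hg hh hX hY hZ hXY hYZ hZX
    · exact ⟨hX.isPoisson hr hθ, hX.isHamiltonian hr hθ.smooth hθ.degree, hX'.isPoisson hs hθ,
        hX'.isHamiltonian hs hθ.smooth hθ.degree,
        hX.schouten hr hs hθ.smooth hθ.degree hX', bracket_momentum hr hs hθ.smooth hX hX'⟩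
  · intro m hm π hπ
    have hσ := isExactMultisymplectic_canonicalForm (hπ := hπ) hm
    refine ⟨hσ, fun Φ hΦ r s f g Xf Xg hr hrm hs hsm hX hY => ?_⟩
    have h := isPhaseBundle_extCore (hπ := hπ) hm
    have hV := hΦ.isVerticalForm
    have hX' := isKanatchikovHamiltonian_iff.1 hX
    have hY' := isKanatchikovHamiltonian_iff.1 hY
    obtain ⟨W, hW⟩ := h.exists_isVerticalHamiltonian_contract hV hX' hr hrm hY' hs hsm hσ
    exact ⟨⟨W, isKanatchikovHamiltonian_iff.2 hW⟩, h.isPoisson_pullback hV hX' hr hrm,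
      h.isPoisson_pullback hV hY' hs hsm, fun X X' hXf hXg =>
        h.pullback_contract_eq_bracket hV hX' hr hrm hY' hs hsm hσ hXf hXg⟩
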